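/- Let $d,N\ge 0$ and let $g=(g_{\mu\nu})$ be a constant Riemannian metric on $\mathbb T^d=(\mathbb R/2\pi\mathbb Z)^d$, $\sqrt g:=\sqrt{\det(g_{\mu\nu})}$, $(g^{\mu\nu})=(g_{\mu\nu})^{-1}$, $k^\mu=g^{\mu\nu}k_\nu$, $k^2=g^{\mu\nu}k_\mu k_\nu$, $\partial^2=g^{\mu\nu}\partial_\mu\partial_\nu$. Let $E,\omega_1,\dots,\omega_d\in C^\infty(\mathbb T^d;M_N(\mathbb C))$ be arbitrary, $\nabla_\mu=\partial_\mu+\omega_\mu$, $L=-(g^{\mu\nu}\nabla_\mu\nabla_\nu+E)$ on sections of $\mathbb T^d\times\mathbb C^N$, and $\Omega_{\mu\nu}=\partial_\mu\omega_\nu-\partial_\nu\omega_\mu$. Fourier coefficients are normalised by $\phi(x)=(2\pi)^{-d/2}\sum_{k\in\mathbb Z^d}\hat\phi(k)e^{ikx}$. (i) There is exactly one $C_0$-semigroup $e^{-tL}$ on $L^2(\mathbb T^d;\mathbb C^N)$ whose generator is the closure of $-L$ on $C^\infty$, and $e^{-tL}$ is of trace class for $t>0$; put $K(L,t)=\mathrm{Tr}\,e^{-tL}$.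 (ii) Put $$v_1(k,t)=\delta_{k,0}\,t(2\pi)^{-d/2}\sum_{q\in\mathbb Z^d}e^{-tq^2},\qquad v_2(k,t)=\frac{t^2}{2(2\pi)^d}\int_0^1d\xi\sum_{q\in\mathbb Z^d}e^{-t(\xi(q+k)^2+(1-\xi)q^2)},$$ $$v_3^{\mu\nu}(k,t)=\frac{t^2}{2(2\pi)^d}\int_0^1d\xi\sum_{q\in\mathbb Z^d}\Bigl[(k^\mu k^\nu-4q^\mu q^\nu)e^{-t(\xi(q+k)^2+(1-\xi)q^2)}+\tfrac2t g^{\mu\nu}e^{-tq^2}\Bigr],$$ $$K^{(2)}_{E,\omega}(t)=\mathrm{tr}\sum_{k\in\mathbb Z^d}\bigl(\hat E(k)v_1(k,t)+\hat E(-k)\hat E(k)v_2(k,t)+\hat\omega_\mu(-k)\hat\omega_\nu(k)v_3^{\mu\nu}(k,t)\bigr).$$ All these series and integrals converge for $t>0$. If $L_\varepsilon$ denotes $L$ with $(E,\omega)$ replaced by $(\varepsilon E,\varepsilon\omega)$, then for every fixed $t>0$ $$K(L_\varepsilon,t)=N\sum_{q\in\mathbb Z^d}e^{-tq^2}+K^{(2)}_{\varepsilon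 E,\varepsilon\omega}(t)+O(\varepsilon^3)\qquad(\varepsilon\to0).$$ (iii) Let $h(z)=\int_0^1e^{-\alpha(1-\alpha)z}\,d\alpha$ and $q(z)=-\frac12\frac{h(z)-1}{z}$ (with $q(0)=\frac1{12}$). There is $c>0$, depending only on $g$, such that as $t\to0^+$ $$K^{(2)}_{E,\omega}(t)=(4\pi t)^{-d/2}\int_{\mathbb T^d}\sqrt g\,dx\,\mathrm{tr}\bigl[tE+t^2E\tfrac12h(-t\partial^2)E+t^2\Omega_{\mu\nu}\,q(-t\partial^2)\Omega^{\mu\nu}\bigr]+O(e^{-c/t}).$$ (iv) Let $(-\partial^2)^{-1}$ be the inverse of $-\partial^2$ on the nonzero Fourier modes, extended by $0$ to constants. There is $c>0$, depending only on $g$, such that as $t\to\infty$ $$K^{(2)}_{E,\omega}(t)=\frac t{(2\pi)^d}\,\mathrm{tr}\int_{\mathbb T^d}dx\bigl[E+E(-\partial^2)^{-1}E+\tfrac12\Omega_{\mu\nu}(-\partial^2)^{-1}\Omega^{\mu\nu}\bigr]+Z_{E,\omega}(t)+O(e^{-ct}),$$ where $Z_{E,\omega}(t)=\frac{t^2}{2(2\pi)^d}\,\mathrm{tr}\,\hat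 E(0)^2+\frac t{(2\pi)^d}\,g^{\mu\nu}\,\mathrm{tr}\,\hat\omega_\mu(0)\hat\omega_\nu(0)$ is the quadratic contribution of the constant modes; it vanishes when $\hat E(0)=0$ and $\hat\omega_\mu(0)=0$. (v) Replacing $\Omega_{\mu\nu}$ by $\partial_\mu\omega_\nu-\partial_\nu\omega_\mu+\omega_\mu\omega_\nu-\omega_\nu\omega_\mu$ in the displayed integrals of (iii) and (iv) changes them, for every fixed $t>0$, only by $O(\varepsilon^3)$ when $(E,\omega)$ is scaled to $(\varepsilon E,\varepsilon\omega)$. -/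

import Mathlib

open MeasureTheory Filter Topology Asymptotics
open scoped NNReal

noncomputable section

namespace TorusHeat

instance factTwoPiPos : Fact (0 < 2 * Real.pi) := ⟨Real.two_pi_pos⟩

/-- The torus `T^d` with `2π`-periodic coordinates; its `volume` is `dx`, of total mass `(2π)^d`. -/
abbrev Torus (d : ℕ) : Type := Fin d → AddCircle (2 * Real.pi)

/-- The Hilbert space `L²(T^d; ℂ^N)` of square-integrable sections. -/
abbrev L2 (d N : ℕ) : Type := Lp (EuclideanSpace ℂ (Fin N)) 2 (volume : Measure (Torus d))

/-- Matrix-valued functions on the torus. -/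
abbrev MatField (d N : ℕ) : Type := Torus d → Matrix (Fin N) (Fin N) ℂ

/-- A function on the torus is smooth if its periodic lift to `ℝ^d` is. -/
def IsSmooth {d : ℕ} {V : Type*} [NormedAddCommGroup V] [NormedSpace ℝ V] (u : Torus d → V) :
    Prop :=
  ContDiff ℝ ((⊤ : ℕ∞) : WithTop ℕ∞) (fun y : Fin d → ℝ => u (fun i => (y i : AddCircle (2 * Real.pi))))

/-- A matrix-valued function is smooth if all its entries are. -/
def IsSmoothMat {d N : ℕ} (u : MatField d N) : Prop :=
  ∀ a b, IsSmooth (fun x => u x a b)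

/-- The partial derivative `∂_μ u`. -/
def pd {d : ℕ} {V : Type*} [NormedAddCommGroup V] [NormedSpace ℝ V] (μ : Fin d)
    (u : Torus d → V) : Torus d → V :=
  fun x => deriv (fun s : ℝ => u (x + Pi.single μ (s : AddCircle (2 * Real.pi)))) 0

/-- The partial derivative of a matrix-valued function, entry by entry. -/
def pdMat {d N : ℕ} (μ : Fin d) (u : MatField d N) : MatField d N :=
  fun x => Matrix.of fun a b => pd μ (fun y => u y a b) x

/-- The covariant derivative `∇_μ u = ∂_μ u + ω_μ u` of a section `u`. -/
def covDeriv {d N : ℕ} (ω : Fin d → MatField d N) (μ : Fin d) (u : Torus d → Fin N → ℂ) :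
    Torus d → Fin N → ℂ :=
  fun x => pd μ u x + (ω μ x).mulVec (u x)

/-- The Laplace-type operator `L u = -(g^{μν} ∇_μ ∇_ν u + E u)`, where `g = (g_{μν})` is the
constant metric and `g⁻¹ = (g^{μν})`. -/
def laplaceType {d N : ℕ} (g : Matrix (Fin d) (Fin d) ℝ) (E : MatField d N)
    (ω : Fin d → MatField d N) (u : Torus d → Fin N → ℂ) : Torus d → Fin N → ℂ :=
  fun x => -((∑ μ, ∑ ν, (g⁻¹ μ ν : ℂ) • covDeriv ω μ (covDeriv ω ν u) x) + (E x).mulVec (u x))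

/-- The graph in `L² × L²` of `-L` acting on smooth sections. -/
def negGraph {d N : ℕ} (g : Matrix (Fin d) (Fin d) ℝ) (E : MatField d N)
    (ω : Fin d → MatField d N) : Set (L2 d N × L2 d N) :=
  {p | ∃ u : Torus d → Fin N → ℂ, IsSmooth u ∧
    (p.1 =ᵐ[volume] fun x => WithLp.toLp 2 (u x)) ∧
    (p.2 =ᵐ[volume] fun x => WithLp.toLp 2 (-(laplaceType g E ω u x)))}

/-- Strongly continuous one-parameter semigroups of bounded operators. -/
structure IsC0Semigroup {H : Type*} [NormedAddCommGroup H] [NormedSpace ℂ H]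
    (G : ℝ≥0 → H →L[ℂ] H) : Prop where
  zero : G 0 = 1
  add : ∀ s t, G (s + t) = G s * G t
  cont : ∀ ψ, Continuous fun t => G t ψ

/-- The graph of the generator `T ψ = lim_{h → 0+} h⁻¹ (G(h) ψ - ψ)`. -/
def generatorGraph {H : Type*} [NormedAddCommGroup H] [NormedSpace ℂ H]
    (G : ℝ≥0 → H →L[ℂ] H) : Set (H × H) :=
  {p | Tendsto (fun h : ℝ≥0 => (((h : ℝ) : ℂ)⁻¹) • (G h p.1 - p.1)) (𝓝[>] 0) (𝓝 p.2)}

/-- `G` is the heat semigroup `e^{-tL}`: the `C₀`-semigroup on `L²` whose generator is the closure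
of `-L` on smooth sections. -/
def IsHeatSemigroup {d N : ℕ} (g : Matrix (Fin d) (Fin d) ℝ) (E : MatField d N)
    (ω : Fin d → MatField d N) (G : ℝ≥0 → L2 d N →L[ℂ] L2 d N) : Prop :=
  IsC0Semigroup G ∧ generatorGraph G = closure (negGraph g E ω)

/-- `A` is of trace class with trace `τ`: in every orthonormal basis the diagonal matrix elements
are (absolutely) summable, with sum `τ`. -/
def HasTrace {H : Type} [NormedAddCommGroup H] [InnerProductSpace ℂ H] (A : H →L[ℂ] H) (τ : ℂ) :
    Prop :=
  ∀ (ι : Type) (b : HilbertBasis ι ℂ H), HasSum (fun i => inner ℂ (b i) (A (b i))) τ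

/-- The heat semigroup `e^{-tL}` (the unique one, when there is one). -/
def heatSemigroup {d N : ℕ} (g : Matrix (Fin d) (Fin d) ℝ) (E : MatField d N)
    (ω : Fin d → MatField d N) : ℝ≥0 → L2 d N →L[ℂ] L2 d N :=
  Classical.epsilon (IsHeatSemigroup g E ω)

/-- The heat trace `K(L, t) = Tr e^{-tL}` (meaningful when `e^{-tL}` is of trace class). -/
def heatTrace {d N : ℕ} (g : Matrix (Fin d) (Fin d) ℝ) (E : MatField d N)
    (ω : Fin d → MatField d N) (t : ℝ≥0) : ℂ :=
  Classical.epsilon (HasTrace (heatSemigroup g E ω t))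

/-- The plane wave `e^{ikx}`. -/
def planeWave {d : ℕ} (k : Fin d → ℤ) (x : Torus d) : ℂ := ∏ i, fourier (k i) (x i)

/-- The Fourier coefficient `û(k) = (2π)^{-d/2} ∫ u(x) e^{-ikx} dx` of a matrix-valued function,
so that `u(x) = (2π)^{-d/2} ∑_k û(k) e^{ikx}`. -/
def fCoeff {d N : ℕ} (u : MatField d N) (k : Fin d → ℤ) : Matrix (Fin N) (Fin N) ℂ :=
  Matrix.of fun a b =>
    (((2 * Real.pi) ^ (-(d : ℝ) / 2) : ℝ) : ℂ) * ∫ x, u x a b * planeWave (-k) x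

/-- `k^μ = g^{μν} k_ν`. -/
def raise {d : ℕ} (g : Matrix (Fin d) (Fin d) ℝ) (k : Fin d → ℤ) (μ : Fin d) : ℝ :=
  ∑ ν, g⁻¹ μ ν * (k ν : ℝ)

/-- `k² = g^{μν} k_μ k_ν`. -/
def normSq {d : ℕ} (g : Matrix (Fin d) (Fin d) ℝ) (k : Fin d → ℤ) : ℝ :=
  ∑ μ, ∑ ν, g⁻¹ μ ν * (k μ : ℝ) * (k ν : ℝ)

/-- The weight `e^{-t(ξ(q+k)² + (1-ξ)q²)}`. -/
def expWeight {d : ℕ} (g : Matrix (Fin d) (Fin d) ℝ) (k : Fin d → ℤ) (t ξ : ℝ) (q : Fin d → ℤ) :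
    ℝ :=
  Real.exp (-t * (ξ * normSq g (q + k) + (1 - ξ) * normSq g q))

/-- The lattice sum `∑_q e^{-tq²}`. -/
def theta {d : ℕ} (g : Matrix (Fin d) (Fin d) ℝ) (t : ℝ) : ℝ :=
  ∑' q : Fin d → ℤ, Real.exp (-t * normSq g q)

/-- The form factor `v₁(k,t)`. -/
def v1 {d : ℕ} (g : Matrix (Fin d) (Fin d) ℝ) (k : Fin d → ℤ) (t : ℝ) : ℝ :=
  if k = 0 then t * (2 * Real.pi) ^ (-(d : ℝ) / 2) * theta g t else 0

/-- The form factor `v₂(k,t)`. -/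
def v2 {d : ℕ} (g : Matrix (Fin d) (Fin d) ℝ) (k : Fin d → ℤ) (t : ℝ) : ℝ :=
  t ^ 2 / (2 * (2 * Real.pi) ^ d) *
    ∫ ξ in (0 : ℝ)..1, ∑' q : Fin d → ℤ, expWeight g k t ξ q

/-- The summand in the form factor `v₃^{μν}(k,t)`. -/
def v3Term {d : ℕ} (g : Matrix (Fin d) (Fin d) ℝ) (μ ν : Fin d) (k : Fin d → ℤ) (t ξ : ℝ)
    (q : Fin d → ℤ) : ℝ :=
  (raise g k μ * raise g k ν - 4 * raise g q μ * raise g q ν) * expWeight g k t ξ q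
    + 2 / t * g⁻¹ μ ν * Real.exp (-t * normSq g q)

/-- The form factor `v₃^{μν}(k,t)`. -/
def v3 {d : ℕ} (g : Matrix (Fin d) (Fin d) ℝ) (μ ν : Fin d) (k : Fin d → ℤ) (t : ℝ) : ℝ :=
  t ^ 2 / (2 * (2 * Real.pi) ^ d) *
    ∫ ξ in (0 : ℝ)..1, ∑' q : Fin d → ℤ, v3Term g μ ν k t ξ q

/-- The contribution of the mode `k` to the heat trace up to second order in `E` and `ω`. -/
def modeTerm {d N : ℕ} (g : Matrix (Fin d) (Fin d) ℝ) (E : MatField d N)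
    (ω : Fin d → MatField d N) (t : ℝ) (k : Fin d → ℤ) : ℂ :=
  Matrix.trace ((v1 g k t : ℂ) • fCoeff E k + (v2 g k t : ℂ) • (fCoeff E (-k) * fCoeff E k)
    + ∑ μ, ∑ ν, (v3 g μ ν k t : ℂ) • (fCoeff (ω μ) (-k) * fCoeff (ω ν) k))

/-- The first and second order terms in `E` and `ω` of the heat trace. -/
def secondOrder {d N : ℕ} (g : Matrix (Fin d) (Fin d) ℝ) (E : MatField d N)
    (ω : Fin d → MatField d N) (t : ℝ) : ℂ :=
  ∑' k : Fin d → ℤ, modeTerm g E ω t k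

/-- The Barvinsky--Vilkovisky function `h(z) = ∫₀¹ e^{-α(1-α)z} dα`. -/
def bvH (z : ℝ) : ℝ := ∫ α in (0 : ℝ)..1, Real.exp (-(α * (1 - α)) * z)

/-- The Barvinsky--Vilkovisky function `q(z) = -(h(z) - 1) / (2z)`, continued to `q(0) = 1/12`. -/
def bvQ (z : ℝ) : ℝ := if z = 0 then 1 / 12 else -(1 / 2) * ((bvH z - 1) / z)

/-- The function `m(-∂²)` of `-∂² = -g^{μν}∂_μ∂_ν`, i.e. the Fourier multiplier `m(k²)`, applied to
a matrix-valued function. -/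
def funcLap {d N : ℕ} (g : Matrix (Fin d) (Fin d) ℝ) (m : ℝ → ℝ) (u : MatField d N) :
    MatField d N :=
  fun x => (((2 * Real.pi) ^ (-(d : ℝ) / 2) : ℝ) : ℂ) •
    ∑' k : Fin d → ℤ, ((m (normSq g k) : ℂ) * planeWave k x) • fCoeff u k

/-- `(-∂²)^{-1}` on the nonzero modes, extended by zero to the constants (in Lean `0⁻¹ = 0`, and
`k² = 0` only for `k = 0`). -/
def invLap {d N : ℕ} (g : Matrix (Fin d) (Fin d) ℝ) (u : MatField d N) : MatField d N :=
  funcLap g (fun z => z⁻¹) u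

/-- `Ω_{μν} = ∂_μ ω_ν - ∂_ν ω_μ`. -/
def linCurv {d N : ℕ} (ω : Fin d → MatField d N) (μ ν : Fin d) : MatField d N :=
  fun x => pdMat μ (ω ν) x - pdMat ν (ω μ) x

/-- `Ω_{μν} = ∂_μ ω_ν - ∂_ν ω_μ + ω_μ ω_ν - ω_ν ω_μ`. -/
def fullCurv {d N : ℕ} (ω : Fin d → MatField d N) (μ ν : Fin d) : MatField d N :=
  fun x => pdMat μ (ω ν) x - pdMat ν (ω μ) x + (ω μ x * ω ν x - ω ν x * ω μ x)

/-- `Ω^{μν} = g^{μρ} g^{νσ} Ω_{ρσ}`. -/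
def raiseCurv {d N : ℕ} (g : Matrix (Fin d) (Fin d) ℝ) (Om : Fin d → Fin d → MatField d N)
    (μ ν : Fin d) : MatField d N :=
  fun x => ∑ ρ, ∑ σ, ((g⁻¹ μ ρ * g⁻¹ ν σ : ℝ) : ℂ) • Om ρ σ x

/-- `(4πt)^{-d/2} ∫ √g tr[tE + t² E ½h(-t∂²) E + t² Ω_{μν} q(-t∂²) Ω^{μν}] dx`. -/
def smallT {d N : ℕ} (g : Matrix (Fin d) (Fin d) ℝ) (E : MatField d N)
    (Om : Fin d → Fin d → MatField d N) (t : ℝ) : ℂ :=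
  (((4 * Real.pi * t) ^ (-(d : ℝ) / 2) : ℝ) : ℂ) *
    ∫ x : Torus d, (Real.sqrt g.det : ℂ) * Matrix.trace ((t : ℂ) • E x
      + (t ^ 2 : ℂ) • (E x * funcLap g (fun z => 1 / 2 * bvH (t * z)) E x)
      + (t ^ 2 : ℂ) •
        ∑ μ, ∑ ν, Om μ ν x * funcLap g (fun z => bvQ (t * z)) (raiseCurv g Om μ ν) x)

/-- `t (2π)^{-d} tr ∫ [E + E (-∂²)^{-1} E + ½ Ω_{μν} (-∂²)^{-1} Ω^{μν}] dx`. -/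
def largeT {d N : ℕ} (g : Matrix (Fin d) (Fin d) ℝ) (E : MatField d N)
    (Om : Fin d → Fin d → MatField d N) (t : ℝ) : ℂ :=
  ((t / (2 * Real.pi) ^ d : ℝ) : ℂ) *
    ∫ x : Torus d, Matrix.trace (E x + E x * invLap g E x
      + (1 / 2 : ℂ) • ∑ μ, ∑ ν, Om μ ν x * invLap g (raiseCurv g Om μ ν) x)

/-- The contribution at large `t` of the constant modes to the second order terms:
`t² / (2 (2π)^d) tr Ê(0)² + t / (2π)^d g^{μν} tr ω̂_μ(0) ω̂_ν(0)`. -/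
def zeroModeT {d N : ℕ} (g : Matrix (Fin d) (Fin d) ℝ) (E : MatField d N)
    (ω : Fin d → MatField d N) (t : ℝ) : ℂ :=
  ((t ^ 2 / (2 * (2 * Real.pi) ^ d) : ℝ) : ℂ) * Matrix.trace (fCoeff E 0 * fCoeff E 0)
    + ((t / (2 * Real.pi) ^ d : ℝ) : ℂ) *
      ∑ μ, ∑ ν, (g⁻¹ μ ν : ℂ) * Matrix.trace (fCoeff (ω μ) 0 * fCoeff (ω ν) 0)

end TorusHeat

end

open TorusHeat

/-!
The whole argument takes place in the orthonormal basis of plane waves of `L²(T^d; ℂ^N)`. There `-L`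
becomes the matrix `-q² + B` (`sc_neg_laplaceType`), where `B = pert` is the sum of a part `pert1` of
first and a part `pert2` of second order in `(E, ω)`. Since the coefficients are smooth, `B` decays
rapidly off the diagonal and grows only linearly along it (`IsPert`), so it is a small perturbation
of `q²`.

**The semigroup.** The heat kernel is the matrix `heatKernel` summing the Dyson series, that is, the
iterates of the Volterra equation `K(t) = e^{-tq²} + ∫₀ᵗ K(s) B e^{-(t-s)q²} ds`. The series converges
in norms that combine rapid decay off the diagonal with a smoothing weight `(1 + s q²)^{-m}`
(`RowBound.volterra`, `rowBound_dyson`): the loss of one power of `q` in `B` is regained by the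
integral over time. Uniqueness for the Volterra equation gives the semigroup law (`heatKernel_add`),
and Schur's test (`exists_matrixOp`) turns the matrix into bounded operators on `L²`. They are
smoothing for `t > 0`, hence the smooth sections are a core and the generator is the closure of
`-L` (`generatorGraph_subset_closure`); a semigroup is determined by its generator
(`IsC0Semigroup.eq_of_generatorGraph_eq`). For `t > 0` the matrix is absolutely summable, so the
operators are nuclear and the trace is the sum of the diagonal (`hasTrace_of_summable`).

**The expansion.** To third order in `ε` only the first Dyson terms of `pert1` and `pert2` and the
second one of `pert1` contribute (`heatKernel_expansion`). In the trace of the latter the integral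
over the two-simplex may be symmetrised in the two energies, and becomes
`∫₀¹ e^{-t(ξ(q+k)² + (1-ξ)q²)} dξ` (`simplexTwo_add_swap`). The mixed terms in `E` and `ω`, like
the difference between the tensor structure obtained and the one in `v₃`, are odd under the
exchange `q ↔ -(q + k)` of the two momenta and drop out (`hasSum_quadTerm`).

**The two limits.** By Parseval all quadratic functionals are sums over the modes `k`
(`smallT_eq`, `largeT_eq`), and the square of the linearised curvature is twice the quadratic form of
the transversal tensor `k² g^{μν} - k^μ k^ν` in `ω` (`curvPair_linCurv`). It is therefore enough to
compare the form factors mode by mode, with an error of at most polynomial growth in `k`, which the rapidly decaying Fourier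
coefficients absorb (`norm_secondOrder_sub_le`).

* As `t → ∞`, the sum over `q` is exhausted by `q = 0` and `q = -k` up to an exponentially small
  error, because the other momenta have a positive minimal energy
  (`exists_hasSum_pairWeight_largeT`).
* As `t → 0`, completing the square makes the sums over `q` moments of Gaussians on a shifted lattice,
  which by Poisson summation (`hasSum_poisson`) and its derivatives in the shift equal the
  corresponding integrals up to `O(e^{-c/t})` (`exists_moments_sub_le`). The resulting integral over
  `ξ` is `h` for `v₂`; for `v₃` an integration by parts (`mul_integral_exp_eq`) shows that it is the
  form factor `q(tk²)` times the transversal tensor (`integral_v3Main_eq`).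

The commutator in the full curvature is quadratic in `ω`, so that it enters the square of the
curvature only at third and fourth order (`smallT_fullCurv_sub`).
-/

noncomputable section

namespace TorusHeat

/-! ### The lattice of Fourier modes and its quadratic form -/

section Lattice

variable {d : ℕ}

/-- The weight `1 + ∑ |kᵢ|` on the lattice. It is submultiplicative, which is what makes
polynomially decaying kernels a convolution algebra. -/
def jb (k : Fin d → ℤ) : ℝ := 1 + ∑ i, |(k i : ℝ)|

lemma one_le_jb (k : Fin d → ℤ) : 1 ≤ jb k := by
  have : 0 ≤ ∑ i, |(k i : ℝ)| := Finset.sum_nonneg fun i _ => abs_nonneg _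
  unfold jb; linarith

lemma jb_pos (k : Fin d → ℤ) : 0 < jb k := lt_of_lt_of_le one_pos (one_le_jb k)

@[simp] lemma jb_neg (k : Fin d → ℤ) : jb (-k) = jb k := by simp [jb]

lemma jb_sub_comm (k l : Fin d → ℤ) : jb (k - l) = jb (l - k) := by
  rw [← neg_sub, jb_neg]

lemma jb_add_le (k l : Fin d → ℤ) : jb (k + l) ≤ jb k + jb l - 1 := by
  have : ∑ i, |((k + l) i : ℝ)| ≤ ∑ i, |(k i : ℝ)| + ∑ i, |(l i : ℝ)| := by
    rw [← Finset.sum_add_distrib]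
    refine Finset.sum_le_sum fun i _ => ?_
    simpa using abs_add_le (k i : ℝ) (l i)
  unfold jb; linarith

lemma jb_add_le_mul (k l : Fin d → ℤ) : jb (k + l) ≤ jb k * jb l := by
  have h := jb_add_le k l
  nlinarith [one_le_jb k, one_le_jb l]

lemma abs_le_jb (k : Fin d → ℤ) (i : Fin d) : |(k i : ℝ)| ≤ jb k := by
  have : |(k i : ℝ)| ≤ ∑ i, |(k i : ℝ)| :=
    Finset.single_le_sum (f := fun i => |(k i : ℝ)|) (fun i _ => abs_nonneg _) (Finset.mem_univ i)
  unfold jb; linarith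

lemma summable_pi_prod {f : ℤ → ℝ} (hf : Summable f) (h0 : ∀ n, 0 ≤ f n) :
    Summable fun k : Fin d → ℤ => ∏ i, f (k i) := by
  classical
  refine summable_of_sum_le (c := ∏ _i : Fin d, ∑' n, f n)
    (fun k => Finset.prod_nonneg fun i _ => h0 _) fun s => ?_
  calc ∑ k ∈ s, ∏ i, f (k i)
      ≤ ∑ k ∈ Fintype.piFinset fun i => s.image fun k => k i, ∏ i, f (k i) := by
        refine Finset.sum_le_sum_of_subset_of_nonneg (fun k hk => ?_)
          fun k _ _ => Finset.prod_nonneg fun i _ => h0 _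
        simp only [Fintype.mem_piFinset, Finset.mem_image]
        exact fun i => ⟨k, hk, rfl⟩
    _ = ∏ i : Fin d, ∑ n ∈ s.image fun k => k i, f n := (Finset.prod_univ_sum _ _).symm
    _ ≤ ∏ _i : Fin d, ∑' n, f n :=
        Finset.prod_le_prod (fun i _ => Finset.sum_nonneg fun n _ => h0 n)
          fun i _ => hf.sum_le_tsum _ fun n _ => h0 n

lemma summable_jb_two_mul : Summable fun k : Fin d → ℤ => (jb k ^ (2 * d))⁻¹ := by
  have h1 : Summable fun n : ℤ => ((1 + |(n : ℝ)|) ^ 2)⁻¹ := by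
    have h2 : Summable fun n : ℤ => 1 / (n : ℝ) ^ 2 := Real.summable_one_div_int_pow.2 one_lt_two
    have h3 : Summable fun n : ℤ => (if n = 0 then (1 : ℝ) else 0) :=
      summable_of_ne_finset_zero (s := {0}) (by intro b hb; simp at hb; simp [hb])
    refine Summable.of_nonneg_of_le (fun n => by positivity) (fun n => ?_) (h2.add h3)
    rcases eq_or_ne n 0 with rfl | hn
    · simp
    · simp only [hn, if_false, add_zero, one_div]
      have : (0 : ℝ) < (n : ℝ) ^ 2 := by positivity
      refine inv_anti₀ this ?_
      rw [← sq_abs (n : ℝ)]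
      gcongr; linarith
  refine Summable.of_nonneg_of_le (fun k => by have := jb_pos k; positivity) (fun k => ?_)
    (summable_pi_prod (d := d) h1 fun n => by positivity)
  rw [Finset.prod_inv_distrib]
  refine inv_anti₀ (Finset.prod_pos fun i _ => by positivity) ?_
  calc ∏ i, (1 + |(k i : ℝ)|) ^ 2 ≤ ∏ _i : Fin d, jb k ^ 2 := by
        refine Finset.prod_le_prod (fun i _ => by positivity) fun i _ => ?_
        have : |(k i : ℝ)| ≤ ∑ i, |(k i : ℝ)| := Finset.single_le_sum
          (f := fun i => |(k i : ℝ)|) (fun i _ => abs_nonneg _) (Finset.mem_univ i)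
        unfold jb; gcongr
    _ = jb k ^ (2 * d) := by simp [pow_mul]

lemma inv_jb_pow_anti (k : Fin d → ℤ) {m n : ℕ} (h : m ≤ n) : (jb k ^ n)⁻¹ ≤ (jb k ^ m)⁻¹ :=
  inv_anti₀ (pow_pos (jb_pos k) m) (pow_le_pow_right₀ (one_le_jb k) h)

lemma inv_jb_pow_nonneg (k : Fin d → ℤ) (n : ℕ) : 0 ≤ (jb k ^ n)⁻¹ := by
  have := jb_pos k; positivity

lemma inv_jb_pow_pos (k : Fin d → ℤ) (n : ℕ) : 0 < (jb k ^ n)⁻¹ := by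
  have := jb_pos k; positivity

lemma summable_jb {n : ℕ} (hn : 2 * d ≤ n) : Summable fun k : Fin d → ℤ => (jb k ^ n)⁻¹ :=
  Summable.of_nonneg_of_le (fun k => inv_jb_pow_nonneg k n) (fun k => inv_jb_pow_anti k hn)
    summable_jb_two_mul

/-- Kernels decaying like `jb (p - q) ^ (-n)`, `n ≥ 2d`, are closed under composition. -/
lemma jb_conv {n : ℕ} (hn : 2 * d ≤ n) : ∃ K : ℝ, 0 < K ∧ ∀ p q : Fin d → ℤ,
    (Summable fun r => (jb (p - r) ^ n)⁻¹ * (jb (r - q) ^ n)⁻¹) ∧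
    ∑' r, (jb (p - r) ^ n)⁻¹ * (jb (r - q) ^ n)⁻¹ ≤ K * (jb (p - q) ^ n)⁻¹ := by
  set S := ∑' k : Fin d → ℤ, (jb k ^ n)⁻¹ with hS
  have hS0 : 0 < S := (summable_jb hn).tsum_pos (fun k => inv_jb_pow_nonneg k n) 0
    (inv_jb_pow_pos 0 n)
  have key : ∀ p q r : Fin d → ℤ, (jb (p - r) ^ n)⁻¹ * (jb (r - q) ^ n)⁻¹ ≤
      (2 ^ n * (jb (p - q) ^ n)⁻¹) * ((jb (p - r) ^ n)⁻¹ + (jb (r - q) ^ n)⁻¹) := by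
    intro p q r
    have ha := jb_pos (p - r); have hb := jb_pos (r - q); have hc := jb_pos (p - q)
    have hadd : jb (p - q) ≤ jb (p - r) + jb (r - q) := by
      have := jb_add_le (p - r) (r - q)
      rw [sub_add_sub_cancel] at this; linarith
    have hx := inv_jb_pow_nonneg (p - r) n
    have hy := inv_jb_pow_nonneg (r - q) n
    have aux : ∀ a c : ℝ, 0 < a → 0 < c → c ≤ 2 * a → (a ^ n)⁻¹ ≤ 2 ^ n * (c ^ n)⁻¹ := by
      intro a c ha hc h
      rw [← div_eq_mul_inv, inv_le_iff_one_le_mul₀ (by positivity), div_mul_eq_mul_div,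
        le_div_iff₀ (by positivity), one_mul, ← mul_pow]
      gcongr
    rcases le_total (jb (p - r)) (jb (r - q)) with h | h
    · have := aux _ _ hb hc (by linarith)
      have h0 := hy.trans this
      nlinarith [mul_le_mul_of_nonneg_left this hx, mul_nonneg h0 hy]
    · have := aux _ _ ha hc (by linarith)
      have h0 := hx.trans this
      nlinarith [mul_le_mul_of_nonneg_right this hy, mul_nonneg h0 hx]
  refine ⟨2 ^ n * (S + S), by positivity, fun p q => ?_⟩
  have e1 : HasSum (fun r => (jb (p - r) ^ n)⁻¹) S :=
    (Equiv.subLeft p).hasSum_iff (f := fun k => (jb k ^ n)⁻¹) |>.2 (summable_jb hn).hasSum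
  have e2 : HasSum (fun r => (jb (r - q) ^ n)⁻¹) S :=
    (Equiv.subRight q).hasSum_iff (f := fun k => (jb k ^ n)⁻¹) |>.2 (summable_jb hn).hasSum
  have e3 := (e1.add e2).mul_left (2 ^ n * (jb (p - q) ^ n)⁻¹)
  have hs := Summable.of_nonneg_of_le (fun r => mul_nonneg (inv_jb_pow_nonneg (p - r) n)
    (inv_jb_pow_nonneg (r - q) n)) (key p q) e3.summable
  refine ⟨hs, (hs.tsum_le_tsum (key p q) e3.summable).trans ?_⟩
  rw [e3.tsum_eq]
  exact le_of_eq (by ring)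

end Lattice

section Metric

variable {d : ℕ} (g : Matrix (Fin d) (Fin d) ℝ)

/-- The bilinear form `g^{μν} y_μ z_ν`. -/
def bform (y z : Fin d → ℝ) : ℝ := ∑ μ, ∑ ν, g⁻¹ μ ν * y μ * z ν

lemma normSq_eq_bform (k : Fin d → ℤ) : normSq g k = bform g (fun i => k i) (fun i => k i) := rfl

lemma bform_add_left (x y z : Fin d → ℝ) : bform g (x + y) z = bform g x z + bform g y z := by
  simp only [bform, ← Finset.sum_add_distrib]
  exact Finset.sum_congr rfl fun μ _ => Finset.sum_congr rfl fun ν _ => by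
    simp only [Pi.add_apply]; ring

lemma bform_add_right (x y z : Fin d → ℝ) : bform g x (y + z) = bform g x y + bform g x z := by
  simp only [bform, ← Finset.sum_add_distrib]
  exact Finset.sum_congr rfl fun μ _ => Finset.sum_congr rfl fun ν _ => by
    simp only [Pi.add_apply]; ring

lemma bform_smul_left (a : ℝ) (y z : Fin d → ℝ) : bform g (a • y) z = a * bform g y z := by
  simp only [bform, Finset.mul_sum]
  exact Finset.sum_congr rfl fun μ _ => Finset.sum_congr rfl fun ν _ => by
    simp only [Pi.smul_apply, smul_eq_mul]; ring

lemma bform_smul_right (a : ℝ) (y z : Fin d → ℝ) : bform g y (a • z) = a * bform g y z := by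
  simp only [bform, Finset.mul_sum]
  exact Finset.sum_congr rfl fun μ _ => Finset.sum_congr rfl fun ν _ => by
    simp only [Pi.smul_apply, smul_eq_mul]; ring

variable {g}

lemma inv_symm (hg : g.PosDef) (μ ν : Fin d) : g⁻¹ μ ν = g⁻¹ ν μ := by
  have := congrFun (congrFun hg.inv.isHermitian.eq ν) μ
  simpa using this

lemma bform_comm (hg : g.PosDef) (y z : Fin d → ℝ) : bform g y z = bform g z y := by
  unfold bform
  rw [Finset.sum_comm]
  exact Finset.sum_congr rfl fun μ _ => Finset.sum_congr rfl fun ν _ => by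
    rw [inv_symm hg]; ring

lemma bform_eq_dotProduct (y z : Fin d → ℝ) : bform g y z = y ⬝ᵥ (g⁻¹.mulVec z) := by
  simp only [bform, dotProduct, Matrix.mulVec, Finset.mul_sum]
  exact Finset.sum_congr rfl fun μ _ => Finset.sum_congr rfl fun ν _ => by ring

lemma bform_pos (hg : g.PosDef) {y : Fin d → ℝ} (hy : y ≠ 0) : 0 < bform g y y := by
  rw [bform_eq_dotProduct]
  simpa using hg.inv.dotProduct_mulVec_pos hy

lemma bform_self_nonneg (hg : g.PosDef) (y : Fin d → ℝ) : 0 ≤ bform g y y := by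
  rcases eq_or_ne y 0 with rfl | h
  · simp [bform]
  · exact (bform_pos hg h).le

lemma continuous_bform : Continuous fun p : (Fin d → ℝ) × (Fin d → ℝ) => bform g p.1 p.2 := by
  unfold bform; fun_prop

lemma exists_lower_bform (hg : g.PosDef) :
    ∃ c : ℝ, 0 < c ∧ ∀ y : Fin d → ℝ, c * ‖y‖ ^ 2 ≤ bform g y y := by
  have hc : IsCompact (Metric.sphere (0 : Fin d → ℝ) 1) := isCompact_sphere _ _
  have hcont : Continuous fun y : Fin d → ℝ => bform g y y :=
    continuous_bform.comp (continuous_id.prodMk continuous_id)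
  rcases (Metric.sphere (0 : Fin d → ℝ) 1).eq_empty_or_nonempty with he | hne
  · refine ⟨1, one_pos, fun y => ?_⟩
    rcases eq_or_ne y 0 with rfl | h
    · simp [bform]
    · have : (‖y‖⁻¹ • y) ∈ Metric.sphere (0 : Fin d → ℝ) 1 := by
        simp [norm_smul, norm_ne_zero_iff.2 h]
      rw [he] at this; exact this.elim
  · obtain ⟨y₀, hy₀, hmin⟩ := hc.exists_isMinOn hne hcont.continuousOn
    have hy0 : y₀ ≠ 0 := by rintro rfl; simp at hy₀
    refine ⟨bform g y₀ y₀, bform_pos hg hy0, fun y => ?_⟩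
    rcases eq_or_ne y 0 with rfl | h
    · simp [bform]
    · have hn : ‖y‖ ≠ 0 := norm_ne_zero_iff.2 h
      have hm : (‖y‖⁻¹ • y) ∈ Metric.sphere (0 : Fin d → ℝ) 1 := by
        simp [norm_smul, hn]
      have := hmin hm
      simp only [Set.mem_ofPred_eq, bform_smul_left, bform_smul_right] at this
      have h2 : 0 < ‖y‖ ^ 2 := by positivity
      calc bform g y₀ y₀ * ‖y‖ ^ 2 ≤ (‖y‖⁻¹ * (‖y‖⁻¹ * bform g y y)) * ‖y‖ ^ 2 := by gcongr
        _ = bform g y y := by field_simp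

lemma bform_add_self_le (hg : g.PosDef) (y z : Fin d → ℝ) :
    bform g (y + z) (y + z) ≤ 2 * bform g y y + 2 * bform g z z := by
  have h := bform_self_nonneg hg (y + (-1 : ℝ) • z)
  simp only [bform_add_left, bform_add_right, bform_smul_left, bform_smul_right] at h ⊢
  linarith

lemma normSq_nonneg (hg : g.PosDef) (k : Fin d → ℤ) : 0 ≤ normSq g k := bform_self_nonneg hg _

lemma normSq_add_le (hg : g.PosDef) (k l : Fin d → ℤ) :
    normSq g (k + l) ≤ 2 * normSq g k + 2 * normSq g l := by
  have := bform_add_self_le hg (fun i => (k i : ℝ)) (fun i => (l i : ℝ))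
  simp only [normSq_eq_bform]
  convert this using 2 <;> (ext i; simp)

@[simp] lemma normSq_zero : normSq g (0 : Fin d → ℤ) = 0 := by simp [normSq]

@[simp] lemma normSq_neg (k : Fin d → ℤ) : normSq g (-k) = normSq g k := by simp [normSq]

lemma exists_normSq_le (g : Matrix (Fin d) (Fin d) ℝ) :
    ∃ C : ℝ, 0 < C ∧ ∀ k : Fin d → ℤ, normSq g k ≤ C * jb k ^ 2 := by
  refine ⟨∑ μ, ∑ ν, |g⁻¹ μ ν| + 1, by positivity, fun k => ?_⟩
  have h1 : normSq g k ≤ (∑ μ, ∑ ν, |g⁻¹ μ ν|) * jb k ^ 2 := by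
    simp only [normSq, Finset.sum_mul]
    refine Finset.sum_le_sum fun μ _ => Finset.sum_le_sum fun ν _ => ?_
    calc g⁻¹ μ ν * (k μ : ℝ) * (k ν : ℝ) ≤ |g⁻¹ μ ν * (k μ : ℝ) * (k ν : ℝ)| := le_abs_self _
      _ = |g⁻¹ μ ν| * (|(k μ : ℝ)| * |(k ν : ℝ)|) := by rw [abs_mul, abs_mul, mul_assoc]
      _ ≤ |g⁻¹ μ ν| * jb k ^ 2 := by
          rw [pow_two]
          have := jb_pos k
          gcongr <;> exact abs_le_jb _ _
  nlinarith [sq_nonneg (jb k)]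

/-- The quadratic form controls the weight, and is bounded below off the origin. -/
lemma exists_lower_normSq (hg : g.PosDef) : ∃ c : ℝ, 0 < c ∧ c ≤ 1 ∧
    (∀ k : Fin d → ℤ, c * jb k ^ 2 ≤ 1 + normSq g k) ∧
    ∀ k : Fin d → ℤ, k ≠ 0 → c * jb k ^ 2 ≤ normSq g k := by
  obtain ⟨c, hc, h⟩ := exists_lower_bform hg
  have hlow : ∀ k : Fin d → ℤ, k ≠ 0 → c / (1 + d) ^ 2 * jb k ^ 2 ≤ normSq g k := by
    intro k hk
    refine le_trans ?_ (h fun i => (k i : ℝ))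
    set y : Fin d → ℝ := fun i => (k i : ℝ) with hy
    have h1 : (1 : ℝ) ≤ ‖y‖ := by
      obtain ⟨i, hi⟩ := Function.ne_iff.mp hk
      refine le_trans ?_ (norm_le_pi_norm y i)
      rw [Real.norm_eq_abs]
      have h0 : (1 : ℤ) ≤ |k i| := Int.one_le_abs hi
      change (1 : ℝ) ≤ |(k i : ℝ)|
      exact_mod_cast h0
    have h2 : ∑ i, |(k i : ℝ)| ≤ d * ‖y‖ := by
      calc ∑ i, |(k i : ℝ)| ≤ ∑ _i : Fin d, ‖y‖ :=
            Finset.sum_le_sum fun i _ => norm_le_pi_norm y i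
        _ = d * ‖y‖ := by simp
    have h3 : jb k ≤ (1 + d) * ‖y‖ := by unfold jb; linarith
    have h4 : jb k ^ 2 ≤ ((1 + d) * ‖y‖) ^ 2 := by have := jb_pos k; gcongr
    calc c / (1 + d) ^ 2 * jb k ^ 2 ≤ c / (1 + d) ^ 2 * ((1 + d) * ‖y‖) ^ 2 := by gcongr
      _ = c * ‖y‖ ^ 2 := by field_simp
  refine ⟨min 1 (c / (1 + d) ^ 2), by positivity, min_le_left _ _, fun k => ?_, fun k hk => ?_⟩
  · rcases eq_or_ne k 0 with rfl | hk
    · simp [jb]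
    · have := hlow k hk
      have h5 : min 1 (c / (1 + d) ^ 2) * jb k ^ 2 ≤ c / (1 + d) ^ 2 * jb k ^ 2 := by
        gcongr; exact min_le_right _ _
      linarith
  · refine le_trans ?_ (hlow k hk)
    gcongr; exact min_le_right _ _

lemma abs_raise_le (g : Matrix (Fin d) (Fin d) ℝ) : ∃ C : ℝ, 0 < C ∧ ∀ (k : Fin d → ℤ) μ,
    |raise g k μ| ≤ C * jb k := by
  refine ⟨∑ μ, ∑ ν, |g⁻¹ μ ν| + 1, by positivity, fun k μ => ?_⟩
  have h1 : |raise g k μ| ≤ (∑ ν, |g⁻¹ μ ν|) * jb k := by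
    unfold raise
    refine (Finset.abs_sum_le_sum_abs _ _).trans ?_
    rw [Finset.sum_mul]
    refine Finset.sum_le_sum fun ν _ => ?_
    rw [abs_mul]
    gcongr; exact abs_le_jb _ _
  have h2 : ∑ ν, |g⁻¹ μ ν| ≤ ∑ μ, ∑ ν, |g⁻¹ μ ν| :=
    Finset.single_le_sum (f := fun μ => ∑ ν, |g⁻¹ μ ν|)
      (fun μ _ => Finset.sum_nonneg fun ν _ => abs_nonneg _) (Finset.mem_univ μ)
  refine h1.trans ?_
  have := jb_pos k
  gcongr; linarith

end Metric

/-! ### The Volterra equation for the rows of a heat kernel -/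

section Volterra

open Set

variable {ι : Type*}

/-- The smoothing weight `(1 + s x)^{-m}`. -/
def wt (m : ℕ) (s x : ℝ) : ℝ := ((1 + s * x) ^ m)⁻¹

lemma wt_pos {m : ℕ} {s x : ℝ} (hs : 0 ≤ s) (hx : 0 ≤ x) : 0 < wt m s x := by
  unfold wt; positivity

lemma wt_le_one {m : ℕ} {s x : ℝ} (hs : 0 ≤ s) (hx : 0 ≤ x) : wt m s x ≤ 1 := by
  unfold wt
  exact inv_le_one_of_one_le₀ (one_le_pow₀ (by nlinarith [mul_nonneg hs hx]))

@[simp] lemma wt_zero_left (m : ℕ) (x : ℝ) : wt m 0 x = 1 := by simp [wt]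

/-- A constant with `(1 + x)^m ≤ wtC m * e^{x/2}` for `x ≥ 0`. -/
def wtC (m : ℕ) : ℝ := 2 ^ m * m.factorial * Real.exp (1 / 2)

lemma wtC_pos (m : ℕ) : 0 < wtC m := by unfold wtC; positivity

lemma one_add_pow_le (m : ℕ) {x : ℝ} (hx : 0 ≤ x) : (1 + x) ^ m ≤ wtC m * Real.exp (x / 2) := by
  have h := Real.pow_div_factorial_le_exp ((1 + x) / 2) (by positivity) m
  rw [div_le_iff₀ (by positivity), div_pow, div_le_iff₀ (by positivity)] at h
  calc (1 + x) ^ m ≤ Real.exp ((1 + x) / 2) * m.factorial * 2 ^ m := h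
    _ = wtC m * Real.exp (x / 2) := by
        rw [wtC, add_div, Real.exp_add]; ring

/-- Free propagation from time `s` to time `t` turns the weight at `s` into the one at `t`, at the
cost of half of the exponential decay. -/
lemma wt_mul_exp_le (m : ℕ) {s t x : ℝ} (hs : 0 ≤ s) (hst : s ≤ t) (hx : 0 ≤ x) :
    wt m s x * Real.exp (-(t - s) * x) ≤ wtC m * Real.exp (-(t - s) * (x / 2)) * wt m t x := by
  have hy : 0 ≤ (t - s) * x := mul_nonneg (by linarith) hx
  have h1 := one_add_pow_le m hy
  have hsx : 0 ≤ s * x := mul_nonneg hs hx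
  have htx : 0 ≤ t * x := mul_nonneg (hs.trans hst) hx
  have h2 : (1 + t * x) ^ m ≤ (1 + s * x) ^ m * (1 + (t - s) * x) ^ m := by
    rw [← mul_pow]
    refine pow_le_pow_left₀ (by positivity) ?_ m
    nlinarith [mul_nonneg hsx hy]
  have e : Real.exp (-(t - s) * x) =
      Real.exp (-(t - s) * (x / 2)) * (Real.exp ((t - s) * x / 2))⁻¹ := by
    rw [← Real.exp_neg, ← Real.exp_add]; congr 1; ring
  have h3 : (1 + t * x) ^ m ≤ (1 + s * x) ^ m * (wtC m * Real.exp ((t - s) * x / 2)) :=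
    h2.trans (by gcongr)
  have h4 : ((1 + s * x) ^ m)⁻¹ * (Real.exp ((t - s) * x / 2))⁻¹ ≤
      wtC m * ((1 + t * x) ^ m)⁻¹ := by
    rw [← mul_inv, ← div_eq_mul_inv, inv_eq_one_div,
      div_le_div_iff₀ (by positivity) (by positivity), one_mul]
    linarith
  unfold wt
  rw [e]
  calc _ = Real.exp (-(t - s) * (x / 2)) *
        (((1 + s * x) ^ m)⁻¹ * (Real.exp ((t - s) * x / 2))⁻¹) := by ring
    _ ≤ Real.exp (-(t - s) * (x / 2)) * (wtC m * ((1 + t * x) ^ m)⁻¹) := by gcongr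
    _ = _ := by ring

/-- The product of a row `F s` with the matrix `B`. -/
def rowMul (B : ι → ι → ℂ) (F : ℝ → ι → ℂ) (s : ℝ) (q : ι) : ℂ := ∑' r, F s r * B r q

/-- The Volterra operator `F ↦ ∫₀ᵗ F(s) B e^{-(t-s)Q} ds` on time-dependent rows. -/
def volterra (Q : ι → ℝ) (B : ι → ι → ℂ) (F : ℝ → ι → ℂ) (t : ℝ) (q : ι) : ℂ :=
  ∫ s in (0 : ℝ)..t, rowMul B F s q * (Real.exp (-(t - s) * Q q) : ℂ)

/-- A continuous row with `|F(s)_q| ≤ A e^{ls} γ_q (1 + s Q_q)^{-m}` on `[0, T]`. -/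
structure RowBound (Q : ι → ℝ) (m : ℕ) (T : ℝ) (γ : ι → ℝ) (l A : ℝ) (F : ℝ → ι → ℂ) : Prop where
  cont : ∀ q, ContinuousOn (fun s => F s q) (Icc 0 T)
  le : ∀ s ∈ Icc 0 T, ∀ q, ‖F s q‖ ≤ A * Real.exp (l * s) * γ q * wt m s (Q q)

/-- The matrix `B` maps rows of size `γ_q (1 + s Q_q)^{-m}` to rows of size
`b v_q γ_q (1 + s Q_q)^{-m}`, uniformly for `s ∈ [0, T]`. -/
structure Admissible (Q : ι → ℝ) (m : ℕ) (T : ℝ) (γ v : ι → ℝ) (b : ℝ) (B : ι → ι → ℂ) : Prop where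
  nonneg : ∀ q, 0 ≤ γ q
  summable : ∀ s ∈ Icc 0 T, ∀ q, Summable fun r => γ r * wt m s (Q r) * ‖B r q‖
  le : ∀ s ∈ Icc 0 T, ∀ q, ∑' r, γ r * wt m s (Q r) * ‖B r q‖ ≤ b * v q * γ q * wt m s (Q q)

variable {Q : ι → ℝ} {m : ℕ} {T : ℝ} {γ v : ι → ℝ} {l A b δ : ℝ} {B : ι → ι → ℂ} {F : ℝ → ι → ℂ}

lemma norm_rowMul_term_le (hF : RowBound Q m T γ l A F) {s : ℝ} (hs : s ∈ Icc 0 T) (q r : ι) :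
    ‖F s r * B r q‖ ≤ A * Real.exp (l * s) * (γ r * wt m s (Q r) * ‖B r q‖) := by
  rw [norm_mul]
  calc ‖F s r‖ * ‖B r q‖ ≤ A * Real.exp (l * s) * γ r * wt m s (Q r) * ‖B r q‖ := by
        gcongr; exact hF.le s hs r
    _ = _ := by ring

lemma summable_rowMul (hF : RowBound Q m T γ l A F) (hB : Admissible Q m T γ v b B)
    {s : ℝ} (hs : s ∈ Icc 0 T) (q : ι) : Summable fun r => ‖F s r * B r q‖ :=
  Summable.of_nonneg_of_le (fun _ => norm_nonneg _) (norm_rowMul_term_le hF hs q)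
    ((hB.summable s hs q).mul_left _)

lemma norm_rowMul_le (hA : 0 ≤ A) (hF : RowBound Q m T γ l A F) (hB : Admissible Q m T γ v b B)
    {s : ℝ} (hs : s ∈ Icc 0 T) (q : ι) :
    ‖rowMul B F s q‖ ≤ A * Real.exp (l * s) * (b * v q * γ q * wt m s (Q q)) := by
  refine (norm_tsum_le_tsum_norm (summable_rowMul hF hB hs q)).trans ?_
  refine ((summable_rowMul hF hB hs q).tsum_le_tsum (norm_rowMul_term_le hF hs q)
    ((hB.summable s hs q).mul_left _)).trans ?_
  rw [tsum_mul_left]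
  gcongr
  exact hB.le s hs q

lemma RowBound.norm_le (hQ : ∀ q, 0 ≤ Q q) (hl : 0 ≤ l) (hA : 0 ≤ A) (hγ : ∀ q, 0 ≤ γ q)
    (hF : RowBound Q m T γ l A F)
    {s : ℝ} (hs : s ∈ Icc 0 T) (q : ι) : ‖F s q‖ ≤ A * Real.exp (l * T) * γ q := by
  refine (hF.le s hs q).trans ?_
  have h1 := wt_le_one (m := m) hs.1 (hQ q)
  have h2 := (wt_pos (m := m) hs.1 (hQ q)).le
  have h3 : Real.exp (l * s) ≤ Real.exp (l * T) := by
    gcongr; exact hs.2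
  have := hγ q
  calc A * Real.exp (l * s) * γ q * wt m s (Q q) ≤ A * Real.exp (l * T) * γ q * 1 := by gcongr
    _ = _ := mul_one _

lemma continuousOn_rowMul (hQ : ∀ q, 0 ≤ Q q) (hl : 0 ≤ l) (hT : 0 ≤ T) (hA : 0 ≤ A)
    (hF : RowBound Q m T γ l A F) (hB : Admissible Q m T γ v b B) (q : ι) :
    ContinuousOn (fun s => rowMul B F s q) (Icc 0 T) := by
  have h0 := (hB.summable 0 ⟨le_rfl, hT⟩ q).mul_left (A * Real.exp (l * T))
  refine continuousOn_tsum (fun r => (hF.cont r).mul continuousOn_const) h0 fun r s hs => ?_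
  rw [norm_mul, wt_zero_left, mul_one, ← mul_assoc]
  gcongr
  exact hF.norm_le hQ hl hA hB.nonneg hs r

lemma intervalIntegrable_rowMul_exp (hQ : ∀ q, 0 ≤ Q q) (hl : 0 ≤ l) (hA : 0 ≤ A)
    (hF : RowBound Q m T γ l A F) (hB : Admissible Q m T γ v b B) (q : ι) {t : ℝ}
    (ht : t ∈ Icc 0 T) (a : ℝ) :
    IntervalIntegrable (fun s => rowMul B F s q * (Real.exp (-(a - s) * Q q) : ℂ)) volume 0 t := by
  refine ContinuousOn.intervalIntegrable ?_
  rw [uIcc_of_le ht.1]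
  refine ContinuousOn.mul ((continuousOn_rowMul hQ hl (ht.1.trans ht.2) hA hF hB q).mono
    (Icc_subset_Icc_right ht.2)) ?_
  exact Continuous.continuousOn (by fun_prop)

/-- Factoring out `e^{-tQ}` exhibits `volterra` as a multiple of a primitive, whence its continuity
in time. -/
lemma volterra_eq (Q : ι → ℝ) (B : ι → ι → ℂ) (F : ℝ → ι → ℂ) (t : ℝ) (q : ι) :
    volterra Q B F t q = (Real.exp (-t * Q q) : ℂ) *
      ∫ s in (0 : ℝ)..t, rowMul B F s q * (Real.exp (-(0 - s) * Q q) : ℂ) := by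
  rw [volterra, ← intervalIntegral.integral_const_mul]
  refine intervalIntegral.integral_congr fun s _ => ?_
  rw [mul_left_comm, ← Complex.ofReal_mul, ← Real.exp_add]
  congr 4; ring

/-- The Volterra operator is bounded on weighted rows, with a bound that is small once `l` is
large: the time integral is absorbed by the exponential weight mode by mode. -/
lemma RowBound.volterra (hQ : ∀ q, 0 ≤ Q q) (hl : 0 < l) (hT : 0 ≤ T) (hA : 0 ≤ A) (hb : 0 ≤ b)
    (hv0 : ∀ q, 0 ≤ v q) (hv : ∀ q, v q * wtC m ≤ δ * (l + Q q / 2))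
    (hF : RowBound Q m T γ l A F) (hB : Admissible Q m T γ v b B) :
    RowBound Q m T γ l (A * (b * δ)) (volterra Q B F) := by
  constructor
  · intro q
    simp only [volterra_eq Q B F]
    refine ContinuousOn.mul (Continuous.continuousOn (by fun_prop)) ?_
    have := intervalIntegral.continuousOn_primitive_interval (μ := volume) (a := 0) (b := T)
      (f := fun s => rowMul B F s q * (Real.exp (-(0 - s) * Q q) : ℂ)) ?_
    · rwa [uIcc_of_le hT] at this
    · have h := intervalIntegrable_rowMul_exp hQ hl.le hA hF hB q ⟨hT, le_rfl⟩ 0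
      rw [uIcc_of_le hT]
      exact (intervalIntegrable_iff_integrableOn_Icc_of_le hT).1 h
  · intro t ht q
    have hμ : 0 < l + Q q / 2 := by have := hQ q; linarith
    have hw := wt_pos (m := m) ht.1 (hQ q)
    have hγ := hB.nonneg q
    set μ := l + Q q / 2 with hμd
    set D := A * b * v q * γ q * wtC m * wt m t (Q q) * Real.exp (l * t) with hD
    have hD0 : 0 ≤ D := by
      have := wtC_pos m; have := hv0 q; positivity
    have hb1 : ∀ s ∈ Icc 0 t, ‖rowMul B F s q * (Real.exp (-(t - s) * Q q) : ℂ)‖ ≤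
        D * Real.exp (-(t - s) * μ) := by
      intro s hs
      have hs' : s ∈ Icc 0 T := ⟨hs.1, hs.2.trans ht.2⟩
      have h1 := norm_rowMul_le hA hF hB hs' q
      have h2 := wt_mul_exp_le m hs.1 hs.2 (hQ q)
      rw [norm_mul, Complex.norm_real, Real.norm_of_nonneg (Real.exp_pos _).le]
      have hv' := hv0 q
      calc ‖rowMul B F s q‖ * Real.exp (-(t - s) * Q q)
          ≤ A * Real.exp (l * s) * (b * v q * γ q * wt m s (Q q)) * Real.exp (-(t - s) * Q q) := by
            gcongr
        _ = A * Real.exp (l * s) * (b * v q * γ q) *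
            (wt m s (Q q) * Real.exp (-(t - s) * Q q)) := by ring
        _ ≤ A * Real.exp (l * s) * (b * v q * γ q) *
            (wtC m * Real.exp (-(t - s) * (Q q / 2)) * wt m t (Q q)) := by gcongr
        _ = D * Real.exp (-(t - s) * μ) := by
            have : Real.exp (l * s) * Real.exp (-(t - s) * (Q q / 2)) =
              Real.exp (l * t) * Real.exp (-(t - s) * μ) := by
              rw [← Real.exp_add, ← Real.exp_add, hμd]; congr 1; ring
            calc _ = A * (b * v q * γ q) * wtC m * wt m t (Q q) *
                  (Real.exp (l * s) * Real.exp (-(t - s) * (Q q / 2))) := by ring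
              _ = _ := by rw [this, hD]; ring
    have hint : ∫ s in (0 : ℝ)..t, D * Real.exp (-(t - s) * μ) ≤ D * (1 / μ) := by
      rw [intervalIntegral.integral_const_mul]
      refine mul_le_mul_of_nonneg_left ?_ hD0
      have hder : ∀ s ∈ uIcc 0 t, HasDerivAt (fun s => Real.exp (-(t - s) * μ) / μ)
          (Real.exp (-(t - s) * μ)) s := by
        intro s _
        have h1 : HasDerivAt (fun s : ℝ => -(t - s) * μ) μ s := by
          have := (((hasDerivAt_id s).const_sub t).neg).mul_const μ
          simpa using this
        have := h1.exp.div_const μ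
        rwa [mul_div_assoc, div_self hμ.ne', mul_one] at this
      rw [intervalIntegral.integral_eq_sub_of_hasDerivAt hder
        (Continuous.intervalIntegrable (by fun_prop) _ _)]
      have : 0 < Real.exp (-(t - 0) * μ) / μ := by positivity
      simp only [sub_self, neg_zero, zero_mul, Real.exp_zero]
      linarith
    have hvδ : v q * wtC m * (1 / μ) ≤ δ := by
      rw [mul_one_div, div_le_iff₀ hμ]; exact hv q
    unfold TorusHeat.volterra
    calc _ ≤ ∫ s in (0 : ℝ)..t, D * Real.exp (-(t - s) * μ) :=
          intervalIntegral.norm_integral_le_of_norm_le ht.1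
            (Eventually.of_forall fun s hs => hb1 s ⟨hs.1.le, hs.2⟩)
            (Continuous.intervalIntegrable (by fun_prop) _ _)
      _ ≤ D * (1 / μ) := hint
      _ = A * b * Real.exp (l * t) * γ q * wt m t (Q q) * (v q * wtC m * (1 / μ)) := by
          rw [hD]; ring
      _ ≤ A * b * Real.exp (l * t) * γ q * wt m t (Q q) * δ := by gcongr
      _ = _ := by ring

lemma volterra_sub (hQ : ∀ q, 0 ≤ Q q) (hl : 0 ≤ l) (hA : 0 ≤ A)
    {F' : ℝ → ι → ℂ}
    (hF : RowBound Q m T γ l A F) (hF' : RowBound Q m T γ l A F') (hB : Admissible Q m T γ v b B)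
    {t : ℝ} (ht : t ∈ Icc 0 T) (q : ι) :
    volterra Q B (fun s r => F s r - F' s r) t q = volterra Q B F t q - volterra Q B F' t q := by
  unfold volterra
  rw [← intervalIntegral.integral_sub (intervalIntegrable_rowMul_exp hQ hl hA hF hB q ht t)
    (intervalIntegrable_rowMul_exp hQ hl hA hF' hB q ht t)]
  refine intervalIntegral.integral_congr fun s hs => ?_
  rw [uIcc_of_le ht.1] at hs
  have hs' : s ∈ Icc 0 T := ⟨hs.1, hs.2.trans ht.2⟩
  simp only [rowMul]
  rw [← sub_mul, ← (summable_rowMul hF hB hs' q).of_norm.tsum_sub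
    (summable_rowMul hF' hB hs' q).of_norm]
  simp only [sub_mul]

/-- The Volterra operator may be applied term by term to an absolutely convergent superposition of
rows. -/
lemma volterra_tsum {κ : Type*} (hQ : ∀ q, 0 ≤ Q q) (hl : 0 ≤ l)
    {γ : κ → ι → ℝ} {A : κ → ℝ} {F : κ → ℝ → ι → ℂ} [Countable κ] (hb : 0 ≤ b) (hv0 : ∀ q, 0 ≤ v q)
    (hA : ∀ i, 0 ≤ A i) (hF : ∀ i, RowBound Q m T (γ i) l (A i) (F i))
    (hB : ∀ i, Admissible Q m T (γ i) v b B) (hs : ∀ q, Summable fun i => A i * γ i q)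
    {t : ℝ} (ht : t ∈ Icc 0 T) (q : ι) :
    HasSum (fun i => volterra Q B (F i) t q) (volterra Q B (fun s r => ∑' i, F i s r) t q) := by
  have hbd : ∀ i, ∀ s ∈ Icc 0 t, ‖rowMul B (F i) s q * (Real.exp (-(t - s) * Q q) : ℂ)‖ ≤
      A i * γ i q * (Real.exp (l * T) * b * v q) := by
    intro i s hs
    have hs' : s ∈ Icc 0 T := ⟨hs.1, hs.2.trans ht.2⟩
    have h1 := norm_rowMul_le (hA i) (hF i) (hB i) hs' q
    rw [norm_mul, Complex.norm_real, Real.norm_of_nonneg (Real.exp_pos _).le]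
    have h2 : Real.exp (-(t - s) * Q q) ≤ 1 := by
      rw [Real.exp_le_one_iff]
      have := mul_nonneg (sub_nonneg.2 hs.2) (hQ q)
      linarith
    have h3 := wt_le_one (m := m) hs.1 (hQ q)
    have h4 := (wt_pos (m := m) hs.1 (hQ q)).le
    have h5 : Real.exp (l * s) ≤ Real.exp (l * T) := by gcongr; exact hs'.2
    have := hA i; have := (hB i).nonneg q; have := hv0 q
    calc ‖rowMul B (F i) s q‖ * Real.exp (-(t - s) * Q q)
        ≤ (A i * Real.exp (l * T) * (b * v q * γ i q * 1)) * 1 := by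
          refine mul_le_mul (h1.trans ?_) h2 (Real.exp_pos _).le (by positivity)
          gcongr
      _ = _ := by ring
  unfold volterra
  refine intervalIntegral.hasSum_integral_of_dominated_convergence
    (fun i _ => A i * γ i q * (Real.exp (l * T) * b * v q))
    (fun i => ?_) (fun i => Eventually.of_forall fun s hs' => ?_) ?_ ?_ ?_
  · exact (intervalIntegrable_rowMul_exp hQ hl (hA i) (hF i) (hB i) q ht t).def'.aestronglyMeasurable
  · rw [uIoc_of_le ht.1] at hs'
    exact hbd i s ⟨hs'.1.le, hs'.2⟩
  · exact Eventually.of_forall fun s _ => (hs q).mul_right _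
  · exact intervalIntegrable_const
  · refine Eventually.of_forall fun s hs' => ?_
    rw [uIoc_of_le ht.1] at hs'
    have hsT : s ∈ Icc 0 T := ⟨hs'.1.le, hs'.2.trans ht.2⟩
    refine HasSum.mul_right _ ?_
    have hsum : Summable (Function.uncurry fun (i : κ) (r : ι) => F i s r * B r q) := by
      refine Summable.of_norm ?_
      refine (summable_prod_of_nonneg fun _ => norm_nonneg _).2 ⟨fun i => ?_, ?_⟩
      · exact summable_rowMul (hF i) (hB i) hsT q
      · refine Summable.of_nonneg_of_le (fun i => tsum_nonneg fun r => norm_nonneg _) (fun i => ?_)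
          ((hs q).mul_right (Real.exp (l * s) * (b * v q * wt m s (Q q))))
        refine ((summable_rowMul (hF i) (hB i) hsT q).tsum_le_tsum
          (norm_rowMul_term_le (hF i) hsT q) (((hB i).summable s hsT q).mul_left _)).trans ?_
        rw [tsum_mul_left]
        have := hA i
        calc _ ≤ A i * Real.exp (l * s) * (b * v q * γ i q * wt m s (Q q)) := by
              gcongr; exact (hB i).le s hsT q
          _ = _ := by ring
    have h1 : rowMul B (fun s r => ∑' i, F i s r) s q = ∑' i, rowMul B (F i) s q := by
      unfold rowMul
      simp only [← tsum_mul_right]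
      exact hsum.tsum_comm
    rw [h1]
    exact hsum.prod.hasSum

/-- A bounded row that solves the homogeneous Volterra equation vanishes. -/
lemma eq_zero_of_eq_volterra (hQ : ∀ q, 0 ≤ Q q) (hl : 0 < l) (hT : 0 ≤ T) (hA : 0 ≤ A)
    (hb : 0 ≤ b) (hδ : 0 ≤ δ) (hbδ : b * δ ≤ 1 / 2)
    (hv0 : ∀ q, 0 ≤ v q) (hv : ∀ q, v q * wtC m ≤ δ * (l + Q q / 2))
    (hF : RowBound Q m T γ l A F) (hB : Admissible Q m T γ v b B)
    (heq : ∀ t ∈ Icc 0 T, ∀ q, F t q = volterra Q B F t q) {t : ℝ} (ht : t ∈ Icc 0 T) (q : ι) :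
    F t q = 0 := by
  have hn : ∀ n : ℕ, RowBound Q m T γ l (A * (b * δ) ^ n) F := by
    intro n
    induction n with
    | zero => simpa using hF
    | succ n ih =>
      have h := RowBound.volterra hQ hl hT (by positivity) hb hv0 hv ih hB
      refine ⟨hF.cont, fun s hs r => ?_⟩
      rw [heq s hs r, pow_succ, ← mul_assoc]
      exact h.le s hs r
  have hlim : Tendsto (fun n : ℕ => A * (b * δ) ^ n * Real.exp (l * t) * γ q * wt m t (Q q)) atTop
      (𝓝 (A * 0 * Real.exp (l * t) * γ q * wt m t (Q q))) := by
    have := tendsto_pow_atTop_nhds_zero_of_lt_one (r := b * δ) (by positivity) (by linarith)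
    exact (((this.const_mul A).mul_const _).mul_const _).mul_const _
  have h0 : ‖F t q‖ ≤ A * 0 * Real.exp (l * t) * γ q * wt m t (Q q) :=
    ge_of_tendsto' hlim fun n => (hn n).le t ht q
  simpa using h0

end Volterra

/-! ### The Dyson series of the heat kernel in Fourier space -/

section Dyson

open Set

variable {d N : ℕ}

/-- Indices of the Fourier basis of `L²(T^d; ℂ^N)`: a mode and a component. -/
abbrev Idx (d N : ℕ) : Type := (Fin d → ℤ) × Fin N

/-- The free energy `q²` of a basis vector. -/
def energy (g : Matrix (Fin d) (Fin d) ℝ) (q : Idx d N) : ℝ := normSq g q.1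

/-- The decay `jb (p - q) ^ (-M)` of a matrix off the diagonal. -/
def gam (M : ℕ) (p q : Idx d N) : ℝ := (jb (p.1 - q.1) ^ M)⁻¹

/-- The growth of a first order operator in Fourier space. -/
def vel (q : Idx d N) : ℝ := jb q.1

lemma energy_nonneg {g : Matrix (Fin d) (Fin d) ℝ} (hg : g.PosDef) (q : Idx d N) :
    0 ≤ energy g q := normSq_nonneg hg _

lemma gam_nonneg (M : ℕ) (p q : Idx d N) : 0 ≤ gam M p q := inv_jb_pow_nonneg _ _

@[simp] lemma gam_self (M : ℕ) (p : Idx d N) : gam M p p = 1 := by simp [gam, jb]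

lemma gam_le_one (M : ℕ) (p q : Idx d N) : gam M p q ≤ 1 :=
  inv_le_one_of_one_le₀ (one_le_pow₀ (one_le_jb _))

lemma vel_nonneg (q : Idx d N) : 0 ≤ vel q := (jb_pos _).le

lemma hasSum_fst {f : (Fin d → ℤ) → ℝ} (hf : Summable f) :
    HasSum (fun r : Idx d N => f r.1) (N * ∑' k, f k) := by
  have h1 : HasSum (fun a : Fin N => (1 : ℝ)) N := by
    have := hasSum_fintype (fun _ : Fin N => (1 : ℝ))
    simpa using this
  have h2 : Summable fun x : Idx d N => f x.1 * 1 := by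
    refine Summable.of_norm ?_
    have := Summable.mul_of_nonneg hf.norm h1.summable (fun _ => norm_nonneg _)
      (fun _ => zero_le_one)
    simpa using this
  have := hf.hasSum.mul h1 h2
  simpa [mul_comm] using this

/-- A first order perturbation with smooth coefficients: its matrix decays rapidly off the diagonal
and grows linearly along it. -/
def IsPert (B : Idx d N → Idx d N → ℂ) : Prop :=
  ∀ L : ℕ, ∃ C : ℝ, 0 < C ∧ ∀ r q, ‖B r q‖ ≤ C * gam L r q * vel q

lemma gam_conv {M : ℕ} (hM : 2 * d ≤ M) : ∃ K : ℝ, 0 < K ∧ ∀ p q : Idx d N,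
    (Summable fun r : Idx d N => gam M p r * gam M r q) ∧
    ∑' r : Idx d N, gam M p r * gam M r q ≤ K * gam M p q := by
  obtain ⟨K, hK, h⟩ := jb_conv hM
  refine ⟨N * K + 1, by positivity, fun p q => ?_⟩
  obtain ⟨h1, h2⟩ := h p.1 q.1
  have h3 := hasSum_fst (N := N) h1
  refine ⟨h3.summable, ?_⟩
  have h4 : ∑' r : Idx d N, gam M p r * gam M r q = _ := h3.tsum_eq
  rw [h4]
  have h5 := gam_nonneg M p q
  have h6 : (N : ℝ) * ∑' r, (jb (p.1 - r) ^ M)⁻¹ * (jb (r - q.1) ^ M)⁻¹ ≤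
      N * (K * gam M p q) := by gcongr; exact h2
  nlinarith

lemma summable_gam_left {M : ℕ} (hM : 2 * d ≤ M) (q : Idx d N) :
    Summable fun r : Idx d N => gam M r q :=
  (hasSum_fst (f := fun k => (jb (k - q.1) ^ M)⁻¹)
    ((Equiv.subRight q.1).summable_iff (f := fun k => (jb k ^ M)⁻¹) |>.2 (summable_jb hM))).summable

lemma tsum_gam_left {M : ℕ} (q : Idx d N) :
    ∑' r : Idx d N, gam M r q = ∑' r : Idx d N, (jb r.1 ^ M)⁻¹ :=
  ((Equiv.prodCongr (Equiv.subRight q.1) (Equiv.refl (Fin N))).tsum_eq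
    (fun r : Idx d N => (jb r.1 ^ M)⁻¹))

lemma gam_comm (M : ℕ) (p q : Idx d N) : gam M p q = gam M q p := by
  rw [gam, gam, jb_sub_comm]

lemma summable_gam_right {M : ℕ} (hM : 2 * d ≤ M) (p : Idx d N) :
    Summable fun r : Idx d N => gam M p r := by
  simpa only [gam_comm M p] using summable_gam_left hM p

/-- A Peetre-type inequality: passing from one mode to another costs the smoothing weight at most
a power of their distance, uniformly in time. -/
lemma wt_peetre {g : Matrix (Fin d) (Fin d) ℝ} (hg : g.PosDef) (m : ℕ) {T : ℝ} (hT : 0 ≤ T) :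
    ∃ C : ℝ, 0 < C ∧ ∀ s ∈ Icc 0 T, ∀ r q : Idx d N,
      wt m s (energy g r) ≤ C * jb (r.1 - q.1) ^ (2 * m) * wt m s (energy g q) := by
  obtain ⟨CQ, hCQ, h⟩ := exists_normSq_le g
  refine ⟨(2 + 2 * T * CQ) ^ m, by positivity, fun s hs r q => ?_⟩
  have hr := energy_nonneg hg r
  have hq := energy_nonneg hg q
  have hj := one_le_jb (r.1 - q.1)
  have h1 : energy g q ≤ 2 * energy g r + 2 * (CQ * jb (r.1 - q.1) ^ 2) := by
    have h2 := normSq_add_le hg r.1 (q.1 - r.1)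
    rw [add_sub_cancel] at h2
    have h3 := h (q.1 - r.1)
    rw [jb_sub_comm] at h3
    unfold energy; linarith
  have hs0 := hs.1
  have h4 : 1 + s * energy g q ≤ (2 + 2 * T * CQ) * jb (r.1 - q.1) ^ 2 * (1 + s * energy g r) := by
    have h5 : s * energy g q ≤ s * (2 * energy g r + 2 * (CQ * jb (r.1 - q.1) ^ 2)) := by gcongr
    have h6 : s * (CQ * jb (r.1 - q.1) ^ 2) ≤ T * (CQ * jb (r.1 - q.1) ^ 2) := by
      gcongr; exact hs.2
    have h7 : (1 : ℝ) ≤ jb (r.1 - q.1) ^ 2 := one_le_pow₀ hj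
    have h8 : 0 ≤ s * energy g r := by positivity
    have h9 : 0 ≤ T * CQ * jb (r.1 - q.1) ^ 2 * (s * energy g r) := by positivity
    nlinarith [mul_le_mul_of_nonneg_right h7 h8]
  unfold wt
  have hp1 : 0 < 1 + s * energy g r := by positivity
  have hp2 : 0 < 1 + s * energy g q := by positivity
  rw [← div_eq_mul_inv, le_div_iff₀ (by positivity), inv_mul_le_iff₀ (by positivity), pow_mul,
    ← mul_pow, ← mul_pow, mul_comm (1 + s * energy g r)]
  gcongr

/-- Matrices of first order operators are admissible for all weights, with a bound proportional to
their size. -/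
lemma admissible_gam {g : Matrix (Fin d) (Fin d) ℝ} (hg : g.PosDef) {M : ℕ} (hM : 2 * d ≤ M)
    (m : ℕ) {T : ℝ} (hT : 0 ≤ T) : ∃ K : ℝ, 0 < K ∧ ∀ (B : Idx d N → Idx d N → ℂ) (C : ℝ), 0 ≤ C →
      (∀ r q, ‖B r q‖ ≤ C * gam (M + 2 * m) r q * vel q) →
      ∀ p, Admissible (energy g) m T (gam M p) vel (C * K) B := by
  obtain ⟨K, hK, h⟩ := gam_conv (N := N) hM
  obtain ⟨W, hW, hw⟩ := wt_peetre (N := N) hg m hT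
  refine ⟨K * W, by positivity, fun B C hC hB p => ?_⟩
  have key : ∀ s ∈ Icc 0 T, ∀ q r, gam M p r * wt m s (energy g r) * ‖B r q‖ ≤
      C * W * vel q * wt m s (energy g q) * (gam M p r * gam M r q) := by
    intro s hs q r
    have h1 := hw s hs r q
    have h2 := hB r q
    have hj := jb_pos (r.1 - q.1)
    have h3 := gam_nonneg M p r
    have h4 := (wt_pos (m := m) hs.1 (energy_nonneg hg r)).le
    have h5 := (wt_pos (m := m) hs.1 (energy_nonneg hg q)).le
    have e : jb (r.1 - q.1) ^ (2 * m) * gam (M + 2 * m) r q = gam M r q := by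
      unfold gam; rw [pow_add]; field_simp
    calc _ ≤ gam M p r * (W * jb (r.1 - q.1) ^ (2 * m) * wt m s (energy g q)) *
          (C * gam (M + 2 * m) r q * vel q) := by gcongr
      _ = C * W * vel q * wt m s (energy g q) *
          (gam M p r * (jb (r.1 - q.1) ^ (2 * m) * gam (M + 2 * m) r q)) := by ring
      _ = _ := by rw [e]
  have hsm : ∀ s ∈ Icc 0 T, ∀ q, Summable fun r => gam M p r * wt m s (energy g r) * ‖B r q‖ := by
    intro s hs q
    refine Summable.of_nonneg_of_le (fun r => ?_) (key s hs q) ((h p q).1.mul_left _)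
    have h3 := gam_nonneg M p r
    have h4 := (wt_pos (m := m) hs.1 (energy_nonneg hg r)).le
    positivity
  refine ⟨gam_nonneg M p, hsm, fun s hs q => ?_⟩
  refine ((hsm s hs q).tsum_le_tsum (key s hs q) ((h p q).1.mul_left _)).trans ?_
  rw [tsum_mul_left]
  have h5 := (wt_pos (m := m) hs.1 (energy_nonneg hg q)).le
  have h6 := vel_nonneg q
  calc _ ≤ C * W * vel q * wt m s (energy g q) * (K * gam M p q) := by
        gcongr; exact (h p q).2
    _ = _ := by ring

/-- On rows without any off-diagonal decay or smoothing a perturbation still acts boundedly; this is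
the setting of the uniqueness arguments. -/
lemma admissible_one {g : Matrix (Fin d) (Fin d) ℝ} (T : ℝ) {B : Idx d N → Idx d N → ℂ}
    (hB : IsPert B) : ∃ b : ℝ, 0 < b ∧ Admissible (energy g) 0 T (fun _ => 1) vel b B := by
  obtain ⟨C, hC, h⟩ := hB (2 * d)
  have hS : 0 ≤ ∑' r : Idx d N, (jb r.1 ^ (2 * d))⁻¹ := tsum_nonneg fun r => inv_jb_pow_nonneg _ _
  have hle : ∀ q r, ‖B r q‖ ≤ C * vel q * gam (2 * d) r q := fun q r => (h r q).trans (by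
    apply le_of_eq; ring)
  have hs : ∀ q, Summable fun r => ‖B r q‖ := fun q =>
    Summable.of_nonneg_of_le (fun _ => norm_nonneg _) (hle q) ((summable_gam_left le_rfl q).mul_left _)
  refine ⟨C * (∑' r : Idx d N, (jb r.1 ^ (2 * d))⁻¹) + 1, by positivity, fun _ => zero_le_one,
    fun s _ q => by simpa [wt] using hs q, fun s _ q => ?_⟩
  simp only [wt, pow_zero, inv_one, mul_one, one_mul]
  refine ((hs q).tsum_le_tsum (hle q) ((summable_gam_left le_rfl q).mul_left _)).trans ?_
  rw [tsum_mul_left, tsum_gam_left]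
  have := vel_nonneg q
  nlinarith

/-- Linear growth in the mode is small compared with `l + q²/2` once `l` is large. -/
lemma exists_rate {g : Matrix (Fin d) (Fin d) ℝ} (hg : g.PosDef) (m : ℕ) {δ : ℝ} (hδ : 0 < δ) :
    ∃ l : ℝ, 0 < l ∧ ∀ q : Idx d N, vel q * wtC m ≤ δ * (l + energy g q / 2) := by
  obtain ⟨c, hc, -, h, -⟩ := exists_lower_normSq hg
  have hW := wtC_pos m
  refine ⟨1 / 2 + wtC m ^ 2 / (2 * c * δ ^ 2), by positivity, fun q => ?_⟩
  have h1 := h q.1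
  have h2 : wtC m / δ * jb q.1 ≤ wtC m ^ 2 / (2 * c * δ ^ 2) + c * jb q.1 ^ 2 / 2 := by
    have h3 : wtC m ^ 2 / (2 * c * δ ^ 2) = (wtC m / δ) ^ 2 / (2 * c) := by field_simp
    rw [h3, ← sub_nonneg]
    have h4 : (wtC m / δ) ^ 2 / (2 * c) + c * jb q.1 ^ 2 / 2 - wtC m / δ * jb q.1 =
        (wtC m / δ - c * jb q.1) ^ 2 / (2 * c) := by field_simp; ring
    rw [h4]; positivity
  have h5 : wtC m / δ * jb q.1 ≤ 1 / 2 + wtC m ^ 2 / (2 * c * δ ^ 2) + energy g q / 2 := by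
    unfold energy; linarith
  calc vel q * wtC m = δ * (wtC m / δ * jb q.1) := by unfold vel; field_simp
    _ ≤ _ := by gcongr

/-- The matrix of the free heat semigroup. -/
def freeKernel (g : Matrix (Fin d) (Fin d) ℝ) (t : ℝ) (p q : Idx d N) : ℂ :=
  if p = q then (Real.exp (-t * energy g q) : ℂ) else 0

/-- The `n`-th term of the Dyson series of `e^{t(-q² + B)}`. -/
def dyson (g : Matrix (Fin d) (Fin d) ℝ) (B : Idx d N → Idx d N → ℂ) :
    ℕ → ℝ → Idx d N → Idx d N → ℂ
  | 0 => freeKernel g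
  | n + 1 => fun t p q => volterra (energy g) B (fun s r => dyson g B n s p r) t q

/-- The matrix of the heat semigroup `e^{t(-q² + B)}`. -/
def heatKernel (g : Matrix (Fin d) (Fin d) ℝ) (B : Idx d N → Idx d N → ℂ) (t : ℝ)
    (p q : Idx d N) : ℂ := ∑' n, dyson g B n t p q

variable {g : Matrix (Fin d) (Fin d) ℝ}

lemma rowBound_freeKernel (hg : g.PosDef) (M m : ℕ) (T : ℝ) {l : ℝ} (hl : 0 ≤ l) (p : Idx d N) :
    RowBound (energy g) m T (gam M p) l (wtC m) (fun t r => freeKernel g t p r) := by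
  refine ⟨fun q => ?_, fun t ht q => ?_⟩
  · unfold freeKernel
    split_ifs
    · exact Continuous.continuousOn (by fun_prop)
    · exact continuousOn_const
  · have hC := wtC_pos m
    have hw := wt_pos (m := m) ht.1 (energy_nonneg hg q)
    unfold freeKernel
    split_ifs with h
    · subst h
      rw [Complex.norm_real, Real.norm_of_nonneg (Real.exp_pos _).le, gam_self, mul_one]
      have h1 := wt_mul_exp_le m le_rfl ht.1 (energy_nonneg hg p)
      simp only [wt_zero_left, one_mul, sub_zero] at h1
      have h2 : Real.exp (-t * (energy g p / 2)) ≤ 1 := by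
        rw [Real.exp_le_one_iff]
        have := mul_nonneg ht.1 (energy_nonneg hg p)
        linarith
      have h3 : 1 ≤ Real.exp (l * t) := Real.one_le_exp (mul_nonneg hl ht.1)
      exact h1.trans (mul_le_mul_of_nonneg_right
        (mul_le_mul_of_nonneg_left (h2.trans h3) hC.le) hw.le)
    · rw [norm_zero]
      have := gam_nonneg M p q
      positivity

/-- Bounds for the Dyson series, uniform in the size `θ ≤ 1` of the perturbation: the `n`-th term is
of order `θ^n`, decays off the diagonal and is smoothing for positive times. -/
lemma rowBound_dyson (hg : g.PosDef) {M : ℕ} (hM : 2 * d ≤ M) (m : ℕ) {T : ℝ} (hT : 0 ≤ T)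
    {C : ℝ} (hC : 0 < C) : ∃ l A : ℝ, 0 < l ∧ 0 < A ∧ ∀ (B : Idx d N → Idx d N → ℂ) (θ : ℝ), 0 ≤ θ →
      (∀ r q, ‖B r q‖ ≤ θ * C * gam (M + 2 * m) r q * vel q) → ∀ p : Idx d N,
      (∀ n, RowBound (energy g) m T (gam M p) l (A * (θ / 2) ^ n)
        (fun t r => dyson g B n t p r)) ∧
      ∀ F A', 0 ≤ A' → RowBound (energy g) m T (gam M p) l A' F →
        RowBound (energy g) m T (gam M p) l (A' * (θ / 2)) (volterra (energy g) B F) := by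
  obtain ⟨K, hK, hadm⟩ := admissible_gam (N := N) hg hM m hT
  obtain ⟨l, hl, hrate⟩ := exists_rate (N := N) hg m (δ := 1 / (2 * C * K)) (by positivity)
  refine ⟨l, wtC m, hl, wtC_pos m, fun B θ hθ hB p => ?_⟩
  have hv : ∀ F A', 0 ≤ A' → RowBound (energy g) m T (gam M p) l A' F →
        RowBound (energy g) m T (gam M p) l (A' * (θ / 2)) (volterra (energy g) B F) := by
    intro F A' hA' hF
    have := RowBound.volterra (energy_nonneg hg) hl hT hA' (b := θ * C * K) (by positivity)
      vel_nonneg hrate hF (hadm B (θ * C) (by positivity) hB p)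
    convert this using 1
    field_simp
  refine ⟨fun n => ?_, hv⟩
  induction n with
  | zero => simpa [dyson] using rowBound_freeKernel hg M m T hl.le p
  | succ n ih =>
    have := hv _ _ (by have := wtC_pos m; positivity) ih
    rw [pow_succ, ← mul_assoc]
    exact this

end Dyson

/-! ### Duhamel's formula and the semigroup law for the heat kernel -/

section HeatKernel

open Set

variable {d N : ℕ} {g : Matrix (Fin d) (Fin d) ℝ} {B : Idx d N → Idx d N → ℂ}

lemma rowBound_heatKernel (hg : g.PosDef) (hB : IsPert B) {M : ℕ} (hM : 2 * d ≤ M) (m : ℕ) {T : ℝ}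
    (hT : 0 ≤ T) : ∃ l A : ℝ, 0 < l ∧ 0 < A ∧ ∀ p : Idx d N,
      RowBound (energy g) m T (gam M p) l A (fun t r => heatKernel g B t p r) ∧
      (∀ n, RowBound (energy g) m T (gam M p) l (A * (1 / 2) ^ n) (fun t r => dyson g B n t p r)) := by
  obtain ⟨C, hC, hBC⟩ := hB (M + 2 * m)
  obtain ⟨l, A, hl, hA, h⟩ := rowBound_dyson (N := N) hg hM m hT hC
  refine ⟨l, A * 2, hl, by positivity, fun p => ?_⟩
  have hn := (h B 1 zero_le_one (by simpa using hBC) p).1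
  have hgeo : HasSum (fun n : ℕ => A * (1 / 2 : ℝ) ^ n) (A * 2) := hasSum_geometric_two.mul_left A
  refine ⟨⟨fun q => ?_, fun t ht q => ?_⟩, fun n => ⟨(hn n).cont, fun t ht q => ?_⟩⟩
  · refine continuousOn_tsum (fun n => (hn n).cont q)
      (hgeo.summable.mul_right (Real.exp (l * T) * gam M p q)) fun n t ht => ?_
    rw [← mul_assoc]
    exact (hn n).norm_le (energy_nonneg hg) hl.le (by positivity) (gam_nonneg M p) ht q
  · have hs := hgeo.mul_right (Real.exp (l * t) * gam M p q * wt m t (energy g q))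
    have := tsum_of_norm_bounded hs (f := fun n => dyson g B n t p q) fun n => by
      have := (hn n).le t ht q
      refine this.trans (le_of_eq (by ring))
    unfold heatKernel
    refine this.trans (le_of_eq (by ring))
  · refine ((hn n).le t ht q).trans ?_
    have := gam_nonneg M p q
    have := wt_pos (m := m) ht.1 (energy_nonneg hg q)
    gcongr
    linarith

/-- The heat kernel is smoothing: for positive times it decays rapidly in all directions. -/
lemma norm_heatKernel_le (hg : g.PosDef) (hB : IsPert B) {M : ℕ} (hM : 2 * d ≤ M) (m : ℕ) {T : ℝ}
    (hT : 0 ≤ T) : ∃ A : ℝ, 0 < A ∧ ∀ t ∈ Icc 0 T, ∀ p q : Idx d N,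
      ‖heatKernel g B t p q‖ ≤ A * gam M p q * wt m t (energy g q) := by
  obtain ⟨l, A, hl, hA, h⟩ := rowBound_heatKernel (B := B) hg hB hM m hT
  refine ⟨A * Real.exp (l * T), by positivity, fun t ht p q => ((h p).1.le t ht q).trans ?_⟩
  have := gam_nonneg M p q
  have := wt_pos (m := m) ht.1 (energy_nonneg hg q)
  gcongr
  exact ht.2

lemma exists_admissible (hg : g.PosDef) (hB : IsPert B) {T : ℝ} (hT : 0 ≤ T) :
    ∃ b : ℝ, 0 < b ∧ ∀ p : Idx d N,
      Admissible (energy g) 0 T (gam (2 * d) p) vel b B := by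
  obtain ⟨C, hC, hBC⟩ := hB (2 * d)
  obtain ⟨K, hK, h⟩ := admissible_gam (N := N) hg (le_refl (2 * d)) 0 hT
  exact ⟨C * K, by positivity, h B C hC.le (by simpa using hBC)⟩

/-- Duhamel's formula. -/
lemma heatKernel_eq (hg : g.PosDef) (hB : IsPert B) {t : ℝ} (ht : 0 ≤ t) (p q : Idx d N) :
    heatKernel g B t p q = freeKernel g t p q +
      volterra (energy g) B (fun s r => heatKernel g B s p r) t q := by
  obtain ⟨l, A, hl, hA, h⟩ := rowBound_heatKernel (B := B) hg hB (le_refl (2 * d)) 0 ht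
  obtain ⟨b, hb, hadm⟩ := exists_admissible hg hB ht
  have hgeo : Summable (fun n : ℕ => A * (1 / 2 : ℝ) ^ n) := summable_geometric_two.mul_left A
  have h1 := volterra_tsum (energy_nonneg hg) hl.le (γ := fun _ : ℕ => gam (2 * d) p)
    (A := fun n => A * (1 / 2) ^ n) (F := fun n t r => dyson g B n t p r) hb.le vel_nonneg
    (fun n => by positivity) (h p).2 (fun _ => hadm p) (fun q => hgeo.mul_right _)
    (t := t) ⟨ht, le_rfl⟩ q
  have h2 : HasSum (fun n => dyson g B n t p q) (freeKernel g t p q +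
      volterra (energy g) B (fun s r => heatKernel g B s p r) t q) := by
    rw [← hasSum_nat_add_iff' 1]
    simpa [dyson, heatKernel] using h1
  exact h2.tsum_eq

lemma heatKernel_zero (hg : g.PosDef) (hB : IsPert B) (p q : Idx d N) :
    heatKernel g B 0 p q = if p = q then 1 else 0 := by
  rw [heatKernel_eq hg hB le_rfl]
  simp [volterra, freeKernel]

lemma continuousOn_heatKernel (hg : g.PosDef) (hB : IsPert B) (p q : Idx d N) (T : ℝ) :
    ContinuousOn (fun t => heatKernel g B t p q) (Icc 0 T) := by
  rcases le_total 0 T with hT | hT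
  · obtain ⟨l, A, hl, hA, h⟩ := rowBound_heatKernel (B := B) hg hB (le_refl (2 * d)) 0 hT
    exact (h p).1.cont q
  · refine (Set.subsingleton_Icc_of_ge hT).continuousOn _

lemma continuousOn_rowMul_heatKernel (hg : g.PosDef) (hB : IsPert B) (p q : Idx d N) {T : ℝ}
    (hT : 0 ≤ T) :
    ContinuousOn (fun s => rowMul B (fun s r => heatKernel g B s p r) s q) (Icc 0 T) := by
  obtain ⟨l, A, hl, hA, h⟩ := rowBound_heatKernel (B := B) hg hB (le_refl (2 * d)) 0 hT
  obtain ⟨b, hb, hadm⟩ := exists_admissible hg hB hT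
  exact continuousOn_rowMul (energy_nonneg hg) hl.le hT hA.le (h p).1 (hadm p) q

/-- The forward equation `∂ₜ T = T (-q² + B)` in integrated form. -/
lemma heatKernel_sub (hg : g.PosDef) (hB : IsPert B) {t : ℝ} (ht : 0 ≤ t) (p q : Idx d N) :
    heatKernel g B t p q - (if p = q then 1 else 0) = ∫ s in (0 : ℝ)..t,
      (-(energy g q : ℂ) * heatKernel g B s p q +
        rowMul B (fun s r => heatKernel g B s p r) s q) := by
  set h := fun s => rowMul B (fun s r => heatKernel g B s p r) s q with hh
  have hc : ContinuousOn h (Icc 0 t) := continuousOn_rowMul_heatKernel hg hB p q ht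
  set k := fun s => h s * (Real.exp (-(0 - s) * energy g q) : ℂ) with hk
  have hkc : ContinuousOn k (Icc 0 t) :=
    hc.mul (Continuous.continuousOn (by fun_prop))
  set a : ℂ := if p = q then 1 else 0 with ha
  have hT : ∀ s, 0 ≤ s → heatKernel g B s p q =
      (Real.exp (-s * energy g q) : ℂ) * (a + ∫ u in (0 : ℝ)..s, k u) := by
    intro s hs
    rw [heatKernel_eq hg hB hs, volterra_eq, mul_add, freeKernel, ha]
    split_ifs <;> simp [hk, hh]
  have hcont := continuousOn_heatKernel hg hB p q t
  have hder : ∀ s ∈ Ioo 0 t, HasDerivAt (fun s => heatKernel g B s p q)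
      (-(energy g q : ℂ) * heatKernel g B s p q + h s) s := by
    intro s hs
    have hki : IntervalIntegrable k volume 0 s := by
      refine ContinuousOn.intervalIntegrable ?_
      rw [uIcc_of_le hs.1.le]
      exact hkc.mono (Icc_subset_Icc_right hs.2.le)
    have h1 : HasDerivAt (fun s => ∫ u in (0 : ℝ)..s, k u) (k s) s := by
      refine intervalIntegral.integral_hasDerivAt_right hki ?_ ?_
      · exact (hkc.mono Ioo_subset_Icc_self).stronglyMeasurableAtFilter isOpen_Ioo s hs
      · exact hkc.continuousAt (Icc_mem_nhds hs.1 hs.2)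
    have h2 : HasDerivAt (fun s : ℝ => (Real.exp (-s * energy g q) : ℂ))
        ((Real.exp (-s * energy g q) * (-energy g q) : ℝ) : ℂ) s := by
      have h3 : HasDerivAt (fun s : ℝ => -s * energy g q) (-energy g q) s := by
        simpa using (hasDerivAt_id s).neg.mul_const (energy g q)
      exact h3.exp.ofReal_comp
    have h4 := h2.mul (h1.const_add a)
    have h5 : (fun s => heatKernel g B s p q) =ᶠ[𝓝 s] fun s =>
        (Real.exp (-s * energy g q) : ℂ) * (a + ∫ u in (0 : ℝ)..s, k u) := by
      filter_upwards [lt_mem_nhds hs.1] with u hu using hT u hu.le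
    refine (h4.congr_of_eventuallyEq h5).congr_deriv ?_
    rw [hT s hs.1.le, hk]
    have h6 : (Real.exp (-s * energy g q) : ℂ) * (Real.exp (-(0 - s) * energy g q) : ℂ) = 1 := by
      rw [← Complex.ofReal_mul, ← Real.exp_add]; simp
    push_cast at h6 ⊢
    linear_combination h s * h6
  have h7 := intervalIntegral.integral_eq_sub_of_hasDerivAt_of_le ht hcont hder (by
    refine ContinuousOn.intervalIntegrable ?_
    rw [uIcc_of_le ht]
    exact (continuousOn_const.mul hcont).add hc)
  rw [h7, heatKernel_zero hg hB]

lemma volterra_const_mul (Q : Idx d N → ℝ) (c : ℂ) (F : ℝ → Idx d N → ℂ) (t : ℝ) (q : Idx d N) :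
    volterra Q B (fun s r => c * F s r) t q = c * volterra Q B F t q := by
  unfold volterra rowMul
  rw [← intervalIntegral.integral_const_mul]
  refine intervalIntegral.integral_congr fun s _ => ?_
  simp only [mul_assoc, tsum_mul_left]

lemma summable_heatKernel_mul (hg : g.PosDef) (hB : IsPert B) {s t : ℝ} (hs : 0 ≤ s) (ht : 0 ≤ t)
    (p q : Idx d N) :
    Summable fun r => ‖heatKernel g B s p r * heatKernel g B t r q‖ := by
  obtain ⟨A, hA, h⟩ := norm_heatKernel_le hg hB (le_refl (2 * d)) 0 (add_nonneg hs ht)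
  obtain ⟨K, hK, hconv⟩ := gam_conv (d := d) (N := N) (le_refl (2 * d))
  refine Summable.of_nonneg_of_le (fun r => norm_nonneg _) (fun r => ?_)
    ((hconv p q).1.mul_left (A * A))
  rw [norm_mul]
  have h1 := h s ⟨hs, by linarith⟩ p r
  have h2 := h t ⟨ht, by linarith⟩ r q
  simp only [wt, pow_zero, inv_one, mul_one] at h1 h2
  calc _ ≤ (A * gam (2 * d) p r) * (A * gam (2 * d) r q) := by
        have := gam_nonneg (2 * d) p r
        gcongr
    _ = _ := by ring

/-- The semigroup law: both sides solve the same Volterra equation in the second time. -/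
lemma heatKernel_add (hg : g.PosDef) (hB : IsPert B) {s t : ℝ} (hs : 0 ≤ s) (ht : 0 ≤ t)
    (p q : Idx d N) :
    HasSum (fun r => heatKernel g B s p r * heatKernel g B t r q) (heatKernel g B (s + t) p q) := by
  have hst : 0 ≤ s + t := add_nonneg hs ht
  obtain ⟨b, hb, hone⟩ := admissible_one (g := g) t hB
  obtain ⟨b', hb', hadm⟩ := exists_admissible hg hB ht
  obtain ⟨b₂, hb₂, hadm₂⟩ := exists_admissible hg hB hst
  obtain ⟨l, hl, hrate⟩ := exists_rate (N := N) hg 0 (δ := 1 / (2 * b)) (by positivity)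
  obtain ⟨l', A, hl', hA, hrow⟩ := rowBound_heatKernel (B := B) hg hB (le_refl (2 * d)) 0 hst
  obtain ⟨K, hK, hconv⟩ := gam_conv (d := d) (N := N) (le_refl (2 * d))
  have hQ := energy_nonneg (N := N) hg
  have hnorm : ∀ u ∈ Icc 0 (s + t), ∀ p q, ‖heatKernel g B u p q‖ ≤
      A * Real.exp (l' * (s + t)) * gam (2 * d) p q := fun u hu p q =>
    (hrow p).1.norm_le hQ hl'.le hA.le (gam_nonneg _ p) hu q
  set A₁ := A * Real.exp (l' * (s + t)) with hA₁
  have hA₁0 : 0 < A₁ := by positivity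
  -- the two sides as functions of the second time `τ`
  set F₁ : ℝ → Idx d N → ℂ := fun τ q => heatKernel g B (s + τ) p q with hF₁
  set F₂ : ℝ → Idx d N → ℂ := fun τ q => ∑' r, heatKernel g B s p r * heatKernel g B τ r q with hF₂
  have hone' : ∀ r : Idx d N, ∀ τ ∈ Icc (0 : ℝ) t, 1 ≤ Real.exp (l * τ) := fun r τ hτ =>
    Real.one_le_exp (mul_nonneg hl.le hτ.1)
  have hterm : ∀ τ ∈ Icc 0 t, ∀ q r, ‖heatKernel g B s p r * heatKernel g B τ r q‖ ≤
      A₁ * A₁ * (gam (2 * d) p r * gam (2 * d) r q) := by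
    intro τ hτ q r
    rw [norm_mul]
    have h1 := hnorm s ⟨hs, by linarith⟩ p r
    have h2 := hnorm τ ⟨hτ.1, by linarith [hτ.2]⟩ r q
    calc _ ≤ (A₁ * gam (2 * d) p r) * (A₁ * gam (2 * d) r q) := by
          have := gam_nonneg (2 * d) p r
          gcongr
      _ = _ := by ring
  set A₂ := A₁ + A₁ * A₁ * K with hA₂
  have hb₁ : RowBound (energy g) 0 t (fun _ => 1) l A₂ F₁ := by
    refine ⟨fun q => ?_, fun τ hτ q => ?_⟩
    · refine (continuousOn_heatKernel hg hB p q (s + t)).comp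
        (Continuous.continuousOn (by fun_prop)) fun τ hτ => ⟨by linarith [hτ.1], by linarith [hτ.2]⟩
    · have h1 := hnorm (s + τ) ⟨by linarith [hτ.1], by linarith [hτ.2]⟩ p q
      have h2 := gam_le_one (2 * d) p q
      simp only [wt, pow_zero, inv_one, mul_one]
      calc _ ≤ A₁ * 1 := h1.trans (by gcongr)
        _ ≤ A₂ * Real.exp (l * τ) := by
          have := hone' p τ hτ
          have h3 : A₁ ≤ A₂ := by rw [hA₂]; nlinarith [mul_pos (mul_pos hA₁0 hA₁0) hK]
          gcongr
  have hb₂' : RowBound (energy g) 0 t (fun _ => 1) l A₂ F₂ := by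
    refine ⟨fun q => ?_, fun τ hτ q => ?_⟩
    · exact continuousOn_tsum (fun r => continuousOn_const.mul (continuousOn_heatKernel hg hB r q t))
        ((hconv p q).1.mul_left (A₁ * A₁)) fun r τ hτ => hterm τ hτ q r
    · have h1 := tsum_of_norm_bounded ((hconv p q).1.mul_left (A₁ * A₁)).hasSum (hterm τ hτ q)
      rw [tsum_mul_left] at h1
      have h2 := gam_le_one (2 * d) p q
      simp only [wt, pow_zero, inv_one, mul_one]
      calc _ ≤ A₁ * A₁ * (K * 1) := h1.trans (by
            have := (hconv p q).2.trans (mul_le_mul_of_nonneg_left h2 hK.le)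
            gcongr)
        _ ≤ A₂ * Real.exp (l * τ) := by
          have := hone' p τ hτ
          have h3 : A₁ * A₁ * (K * 1) ≤ A₂ := by rw [hA₂]; linarith
          have h4 : 0 < A₂ := by positivity
          nlinarith
  have hF₁c : ∀ q, ContinuousOn (fun u => rowMul B (fun s r => heatKernel g B s p r) u q)
      (Icc 0 (s + t)) := fun q => continuousOn_rowMul_heatKernel hg hB p q hst
  -- the integral in Duhamel's formula up to time `s + τ`, split at time `s`
  have he₁ : ∀ τ ∈ Icc 0 t, ∀ q, F₁ τ q = heatKernel g B s p q * (Real.exp (-τ * energy g q) : ℂ) +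
      volterra (energy g) B F₁ τ q := by
    intro τ hτ q
    have hi : ∀ a b, a ∈ Icc 0 (s + t) → b ∈ Icc 0 (s + t) →
        IntervalIntegrable (fun u => rowMul B (fun s r => heatKernel g B s p r) u q *
        (Real.exp (-(s + τ - u) * energy g q) : ℂ)) volume a b := by
      intro a b ha hb
      refine ContinuousOn.intervalIntegrable ?_
      refine ContinuousOn.mul ((hF₁c q).mono (uIcc_subset_Icc ha hb)) ?_
      exact Continuous.continuousOn (by fun_prop)
    have h0m : (0 : ℝ) ∈ Icc 0 (s + t) := ⟨le_rfl, hst⟩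
    have hsm : s ∈ Icc 0 (s + t) := ⟨hs, by linarith⟩
    have hτm : s + τ ∈ Icc 0 (s + t) := ⟨by linarith [hτ.1], by linarith [hτ.2]⟩
    have h1 : volterra (energy g) B (fun s r => heatKernel g B s p r) (s + τ) q =
        (Real.exp (-τ * energy g q) : ℂ) * volterra (energy g) B (fun s r => heatKernel g B s p r) s q
        + volterra (energy g) B F₁ τ q := by
      unfold volterra
      rw [← intervalIntegral.integral_add_adjacent_intervals (hi 0 s h0m hsm) (hi s (s + τ) hsm hτm),
        ← intervalIntegral.integral_const_mul]
      congr 1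
      · refine intervalIntegral.integral_congr fun u _ => ?_
        rw [mul_left_comm, ← Complex.ofReal_mul, ← Real.exp_add]
        congr 4; ring
      · have := intervalIntegral.integral_comp_add_left (a := 0) (b := τ)
          (fun u => rowMul B (fun s r => heatKernel g B s p r) u q *
            (Real.exp (-(s + τ - u) * energy g q) : ℂ)) s
        rw [add_zero] at this
        rw [← this]
        refine intervalIntegral.integral_congr fun u _ => ?_
        simp only [rowMul, hF₁]
        congr 4; ring
    have h2 : freeKernel g (s + τ) p q = (Real.exp (-τ * energy g q) : ℂ) * freeKernel g s p q := by
      unfold freeKernel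
      split_ifs
      · rw [← Complex.ofReal_mul, ← Real.exp_add]; congr 2; ring
      · simp
    rw [hF₁]
    simp only
    rw [heatKernel_eq hg hB hτm.1, h1, h2, heatKernel_eq hg hB hs]
    ring
  -- Duhamel's formula at time `τ`, superposed over the intermediate modes `r`
  have he₂ : ∀ τ ∈ Icc 0 t, ∀ q, F₂ τ q = heatKernel g B s p q * (Real.exp (-τ * energy g q) : ℂ) +
      volterra (energy g) B F₂ τ q := by
    intro τ hτ q
    have hrow' : ∀ r, RowBound (energy g) 0 t (gam (2 * d) r) l' (‖heatKernel g B s p r‖ * A)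
        (fun τ q => heatKernel g B s p r * heatKernel g B τ r q) := by
      intro r
      refine ⟨fun q => continuousOn_const.mul (continuousOn_heatKernel hg hB r q t),
        fun u hu q => ?_⟩
      rw [norm_mul]
      have := (hrow r).1.le u ⟨hu.1, by linarith [hu.2]⟩ q
      calc _ ≤ ‖heatKernel g B s p r‖ *
            (A * Real.exp (l' * u) * gam (2 * d) r q * wt 0 u (energy g q)) := by gcongr
        _ = _ := by ring
    have h1 := volterra_tsum hQ hl'.le hb'.le vel_nonneg (fun r => by positivity) hrow' hadm
      (fun q => by
        refine Summable.of_nonneg_of_le (fun r => ?_) (fun r => ?_)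
          ((hconv p q).1.mul_left (A₁ * A))
        · have := gam_nonneg (2 * d) r q
          positivity
        · have h1 := hnorm s ⟨hs, by linarith⟩ p r
          have := gam_nonneg (2 * d) r q
          calc _ ≤ A₁ * gam (2 * d) p r * A * gam (2 * d) r q := by gcongr
            _ = _ := by ring) hτ q
    have h2 : HasSum (fun r => heatKernel g B s p r * freeKernel g τ r q)
        (heatKernel g B s p q * (Real.exp (-τ * energy g q) : ℂ)) := by
      have := hasSum_single (f := fun r => heatKernel g B s p r * freeKernel g τ r q) q
        (fun r hr => by simp [freeKernel, hr])
      simpa [freeKernel] using this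
    have h3 := h2.add h1
    rw [← h3.tsum_eq]
    refine tsum_congr fun r => ?_
    rw [volterra_const_mul, ← mul_add, ← heatKernel_eq hg hB hτ.1]
  have hsum : Summable fun r => heatKernel g B s p r * heatKernel g B t r q :=
    (summable_heatKernel_mul hg hB hs ht p q).of_norm
  have hA₂0 : 0 < A₂ := by positivity
  -- the difference solves the homogeneous Volterra equation
  have hdiff : RowBound (energy g) 0 t (fun _ => 1) l (2 * A₂) (fun τ q => F₁ τ q - F₂ τ q) := by
    refine ⟨fun q => (hb₁.cont q).sub (hb₂'.cont q), fun τ hτ q => ?_⟩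
    refine (norm_sub_le _ _).trans ((add_le_add (hb₁.le τ hτ q) (hb₂'.le τ hτ q)).trans ?_)
    apply le_of_eq; ring
  have hz := eq_zero_of_eq_volterra hQ hl ht (by positivity) hb.le (by positivity)
    (le_of_eq (by field_simp)) vel_nonneg hrate hdiff hone (fun τ hτ q => by
      rw [volterra_sub hQ hl.le hA₂0.le hb₁ hb₂' hone hτ q, he₁ τ hτ q, he₂ τ hτ q]
      ring) (⟨ht, le_rfl⟩ : t ∈ Icc 0 t) q
  have : heatKernel g B (s + t) p q = ∑' r, heatKernel g B s p r * heatKernel g B t r q :=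
    sub_eq_zero.1 hz
  rw [this]
  exact hsum.hasSum

end HeatKernel

/-! ### Strongly continuous semigroups and their generators -/

section Semigroup

open Set

variable {H : Type*} [NormedAddCommGroup H] [NormedSpace ℂ H]
  {G G' : ℝ≥0 → H →L[ℂ] H}

lemma IsC0Semigroup.exists_norm_le [CompleteSpace H] (hG : IsC0Semigroup G) (T : ℝ≥0) :
    ∃ M : ℝ, 0 < M ∧ ∀ s ≤ T, ‖G s‖ ≤ M := by
  obtain ⟨M, hM⟩ := banach_steinhaus (g := fun s : Icc (0 : ℝ≥0) T => G s) fun x => by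
    obtain ⟨C, hC⟩ := (isCompact_Icc (a := (0 : ℝ≥0)) (b := T)).exists_bound_of_continuousOn
      (hG.cont x).continuousOn
    exact ⟨C, fun i => hC i i.2⟩
  exact ⟨max M 1, by positivity, fun s hs => (hM ⟨s, zero_le, hs⟩).trans (le_max_left _ _)⟩

/-- Joint continuity of `(t, u) ↦ G(t) u`. -/
lemma IsC0Semigroup.tendsto_apply [CompleteSpace H] (hG : IsC0Semigroup G) {α : Type*} {f : Filter α}
    {r : α → ℝ≥0} {u : α → H} {r₀ : ℝ≥0} {u₀ : H} (hr : Tendsto r f (𝓝 r₀))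
    (hu : Tendsto u f (𝓝 u₀)) : Tendsto (fun a => G (r a) (u a)) f (𝓝 (G r₀ u₀)) := by
  obtain ⟨M, hM, h⟩ := hG.exists_norm_le (r₀ + 1)
  have h1 : Tendsto (fun a => G (r a) u₀) f (𝓝 (G r₀ u₀)) := ((hG.cont u₀).tendsto r₀).comp hr
  have h2 : Tendsto (fun a => G (r a) (u a - u₀)) f (𝓝 0) := by
    have h3 : Tendsto (fun a => M * ‖u a - u₀‖) f (𝓝 0) := by
      have := (tendsto_sub_nhds_zero_iff.2 hu).norm.const_mul M
      simpa using this
    refine squeeze_zero_norm' ?_ h3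
    have h4 : ∀ᶠ a in f, r a < r₀ + 1 := hr.eventually_lt_const (by simp)
    filter_upwards [h4] with a ha
    exact (G (r a)).le_of_opNorm_le (h _ ha.le) _
  have := h2.add h1
  simpa using this

lemma IsC0Semigroup.add_apply (hG : IsC0Semigroup G) (s t : ℝ≥0) (x : H) :
    G (s + t) x = G s (G t x) := by rw [hG.add]; rfl

lemma generatorGraph_unique {x y z : H} (h : (x, y) ∈ generatorGraph G)
    (h' : (x, z) ∈ generatorGraph G) : y = z := tendsto_nhds_unique h h'

lemma generatorGraph_zero : ((0 : H), (0 : H)) ∈ generatorGraph G := by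
  simp [generatorGraph]

lemma generatorGraph_add {x y x' y' : H} (h : (x, y) ∈ generatorGraph G)
    (h' : (x', y') ∈ generatorGraph G) : (x + x', y + y') ∈ generatorGraph G := by
  have := Tendsto.add h h'
  refine this.congr fun s => ?_
  simp only [map_add]
  rw [← smul_add]; congr 1; abel

lemma generatorGraph_smul (c : ℂ) {x y : H} (h : (x, y) ∈ generatorGraph G) :
    (c • x, c • y) ∈ generatorGraph G := by
  have := Tendsto.const_smul h c
  refine this.congr fun s => ?_
  simp only [map_smul]
  rw [smul_comm, smul_sub]

lemma generatorGraph_sum {κ : Type*} (s : Finset κ) {x y : κ → H}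
    (h : ∀ i ∈ s, (x i, y i) ∈ generatorGraph G) :
    (∑ i ∈ s, x i, ∑ i ∈ s, y i) ∈ generatorGraph G := by
  classical
  induction s using Finset.induction_on with
  | empty => simpa using generatorGraph_zero
  | insert a s ha ih =>
    rw [Finset.sum_insert ha, Finset.sum_insert ha]
    exact generatorGraph_add (h a (Finset.mem_insert_self a s))
      (ih fun i hi => h i (Finset.mem_insert_of_mem hi))

/-- The generator commutes with the semigroup. -/
lemma IsC0Semigroup.generatorGraph_apply (hG : IsC0Semigroup G) {x y : H}
    (h : (x, y) ∈ generatorGraph G) (t : ℝ≥0) : (G t x, G t y) ∈ generatorGraph G := by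
  have h1 := ((G t).continuous.tendsto y).comp h
  refine h1.congr fun s => ?_
  simp only [Function.comp, map_smul, map_sub]
  rw [← hG.add_apply, ← hG.add_apply, add_comm]

lemma tendsto_toNNReal_sub (t : ℝ) :
    Tendsto (fun u : ℝ => (u - t).toNNReal) (𝓝[>] t) (𝓝[>] 0) := by
  refine tendsto_nhdsWithin_iff.2 ⟨?_, ?_⟩
  · have : Continuous fun u : ℝ => (u - t).toNNReal := by fun_prop
    have h := (this.tendsto t).mono_left (nhdsWithin_le_nhds (s := Ioi t))
    simpa using h
  · filter_upwards [self_mem_nhdsWithin] with u hu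
    simpa using hu

lemma IsC0Semigroup.continuous_real (hG : IsC0Semigroup G) (y : H) :
    Continuous fun s : ℝ => G s.toNNReal y := (hG.cont y).comp (by fun_prop)

/-- The generator in integrated form. -/
lemma IsC0Semigroup.mem_generatorGraph_iff [CompleteSpace H] (hG : IsC0Semigroup G) {x y : H} :
    (x, y) ∈ generatorGraph G ↔
      ∀ t : ℝ≥0, G t x - x = ∫ s in (0 : ℝ)..t, G s.toNNReal y := by
  constructor
  · intro h t
    have hder : ∀ s ∈ Ioo (min 0 (t : ℝ)) (max 0 (t : ℝ)),
        HasDerivWithinAt (fun s : ℝ => G s.toNNReal x) (G s.toNNReal y) (Ioi s) s := by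
      intro s hs
      rw [min_eq_left t.coe_nonneg, max_eq_right t.coe_nonneg] at hs
      have h1 := hG.generatorGraph_apply h s.toNNReal
      rw [hasDerivWithinAt_iff_tendsto_slope' (by simp)]
      refine (Tendsto.comp h1 (tendsto_toNNReal_sub s)).congr' ?_
      filter_upwards [self_mem_nhdsWithin] with u hu
      have hu' : 0 ≤ u - s := (sub_pos.2 hu).le
      simp only [Function.comp, slope, vsub_eq_sub]
      rw [← hG.add_apply, ← Real.toNNReal_add hu' hs.1.le, sub_add_cancel, Real.coe_toNNReal _ hu',
        ← Complex.ofReal_inv, Complex.coe_smul]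
    have := intervalIntegral.integral_eq_sub_of_hasDeriv_right
      (hG.continuous_real x).continuousOn hder ((hG.continuous_real y).intervalIntegrable _ _)
    rw [this]
    simp [hG.zero]
  · intro h
    have hd := intervalIntegral.integral_hasDerivAt_right
      ((hG.continuous_real y).intervalIntegrable 0 0)
      ((hG.continuous_real y).stronglyMeasurableAtFilter _ _) (hG.continuous_real y).continuousAt
    have h1 := (hasDerivAt_iff_tendsto_slope.1 hd).mono_left
      (nhdsWithin_mono _ (fun u (hu : u ∈ Ioi (0 : ℝ)) => ne_of_gt hu))
    have h2 : Tendsto (fun r : ℝ≥0 => (r : ℝ)) (𝓝[>] 0) (𝓝[>] 0) := by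
      refine tendsto_nhdsWithin_iff.2 ⟨?_, ?_⟩
      · exact (NNReal.continuous_coe.tendsto 0).mono_left nhdsWithin_le_nhds
      · filter_upwards [self_mem_nhdsWithin] with u hu
        exact_mod_cast hu
    have h3 := h1.comp h2
    simp only [Real.toNNReal_zero, hG.zero] at h3
    refine h3.congr fun r => ?_
    simp only [Function.comp, slope, vsub_eq_sub, sub_zero, intervalIntegral.integral_same]
    rw [← h r, ← Complex.ofReal_inv, Complex.coe_smul]

lemma IsC0Semigroup.isClosed_generatorGraph [CompleteSpace H] (hG : IsC0Semigroup G) :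
    IsClosed (generatorGraph G) := by
  rw [← isSeqClosed_iff_isClosed]
  rintro p ⟨x, y⟩ hp hlim
  rw [hG.mem_generatorGraph_iff]
  intro t
  have hx : Tendsto (fun n => (p n).1) atTop (𝓝 x) := (continuous_fst.tendsto _).comp hlim
  have hy : Tendsto (fun n => (p n).2) atTop (𝓝 y) := (continuous_snd.tendsto _).comp hlim
  obtain ⟨M, hM, hb⟩ := hG.exists_norm_le t
  have h1 : Tendsto (fun n => G t (p n).1 - (p n).1) atTop (𝓝 (G t x - x)) :=
    (((G t).continuous.tendsto x).comp hx).sub hx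
  have h2 : Tendsto (fun n => ∫ s in (0 : ℝ)..t, G s.toNNReal (p n).2) atTop
      (𝓝 (∫ s in (0 : ℝ)..t, G s.toNNReal y)) := by
    rw [← tendsto_sub_nhds_zero_iff]
    have h3 : Tendsto (fun n => M * ‖(p n).2 - y‖ * |(t : ℝ) - 0|) atTop (𝓝 0) := by
      have := ((tendsto_sub_nhds_zero_iff.2 hy).norm.const_mul M).mul_const |(t : ℝ) - 0|
      simpa using this
    refine squeeze_zero_norm (fun n => ?_) h3
    rw [← intervalIntegral.integral_sub ((hG.continuous_real _).intervalIntegrable _ _)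
      ((hG.continuous_real _).intervalIntegrable _ _)]
    refine intervalIntegral.norm_integral_le_of_norm_le_const fun s hs => ?_
    rw [uIoc_of_le t.coe_nonneg] at hs
    rw [← map_sub]
    refine (G s.toNNReal).le_of_opNorm_le (hb _ ?_) _
    rw [Real.toNNReal_le_iff_le_coe]; exact hs.2
  refine tendsto_nhds_unique h1 (h2.congr fun n => ?_)
  exact ((hG.mem_generatorGraph_iff (x := (p n).1) (y := (p n).2)).1 (hp n) t).symm

/-- A semigroup is determined by its generator: `s ↦ G(t - s) G'(s) x` is constant. -/
lemma IsC0Semigroup.eq_of_generatorGraph_eq [CompleteSpace H] (hG : IsC0Semigroup G)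
    (hG' : IsC0Semigroup G') (h : generatorGraph G' = generatorGraph G)
    (hd : Dense {x : H | ∃ y, (x, y) ∈ generatorGraph G}) : G' = G := by
  funext t
  refine ContinuousLinearMap.ext fun x => ?_
  refine congrFun (Continuous.ext_on hd (G' t).continuous (G t).continuous ?_) x
  rintro x ⟨y, hxy⟩
  set φ : ℝ → H := fun s => G ((t : ℝ) - s).toNNReal (G' s.toNNReal x) with hφ
  have hc : Continuous φ := by
    refine continuous_iff_continuousAt.2 fun s => hG.tendsto_apply ?_ ?_
    · exact Continuous.tendsto (by fun_prop : Continuous fun s : ℝ => ((t : ℝ) - s).toNNReal) s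
    · exact (hG'.continuous_real x).tendsto s
  have hz : ∀ s ∈ Ico (0 : ℝ) t, HasDerivWithinAt φ 0 (Ici s) s := by
    intro s hs
    rw [← hasDerivWithinAt_Ioi_iff_Ici, hasDerivWithinAt_iff_tendsto_slope' (by simp)]
    have h1 : (G' s.toNNReal x, G' s.toNNReal y) ∈ generatorGraph G' :=
      hG'.generatorGraph_apply (by rw [h]; exact hxy) _
    have h2 : (G' s.toNNReal x, G' s.toNNReal y) ∈ generatorGraph G := by rwa [← h]
    have h3 := (Tendsto.sub h1 h2).comp (tendsto_toNNReal_sub s)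
    have h4 : Tendsto (fun u : ℝ => ((t : ℝ) - u).toNNReal) (𝓝[>] s) (𝓝 ((t : ℝ) - s).toNNReal) :=
      (Continuous.tendsto (by fun_prop : Continuous fun s : ℝ => ((t : ℝ) - s).toNNReal) s).mono_left
        nhdsWithin_le_nhds
    have h5 := hG.tendsto_apply h4 h3
    simp only [sub_self, map_zero] at h5
    refine h5.congr' ?_
    filter_upwards [Ioo_mem_nhdsGT hs.2] with u hu
    have hu' : 0 ≤ u - s := (sub_pos.2 hu.1).le
    have e1 : G' u.toNNReal x = G' (u - s).toNNReal (G' s.toNNReal x) := by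
      rw [← hG'.add_apply, ← Real.toNNReal_add hu' hs.1, sub_add_cancel]
    have e2 : ∀ z, G ((t : ℝ) - s).toNNReal z = G ((t : ℝ) - u).toNNReal (G (u - s).toNNReal z) := by
      intro z
      rw [← hG.add_apply, ← Real.toNNReal_add (sub_pos.2 hu.2).le hu', sub_add_sub_cancel]
    simp only [hφ, Function.comp, slope, vsub_eq_sub]
    rw [e1, e2, Real.coe_toNNReal _ hu', ← smul_sub, map_smul, ← Complex.ofReal_inv,
      Complex.coe_smul, ← map_sub]
    congr 2; abel
  have := constant_of_has_deriv_right_zero hc.continuousOn hz t ⟨t.coe_nonneg, le_rfl⟩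
  simpa [hφ, hG.zero, hG'.zero] using this

end Semigroup

/-! ### Operators with given matrices -/

section MatrixOp

open Set

variable {ι : Type*}

/-- The hypothesis of Schur's test: rows and columns of `M` are bounded by `C` in `ℓ¹`. -/
structure SchurBound (M : ι → ι → ℂ) (C : ℝ) : Prop where
  row : ∀ p, Summable fun q => ‖M p q‖
  col : ∀ q, Summable fun p => ‖M p q‖
  row_le : ∀ p, ∑' q, ‖M p q‖ ≤ C
  col_le : ∀ q, ∑' p, ‖M p q‖ ≤ C

/-- The Cauchy-Schwarz inequality for series with weights. -/
lemma sq_tsum_le {a x : ι → ℝ} (ha : ∀ i, 0 ≤ a i) (h1 : Summable a)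
    (h2 : Summable fun i => a i * x i) (h3 : Summable fun i => a i * x i ^ 2) :
    (∑' i, a i * x i) ^ 2 ≤ (∑' i, a i) * ∑' i, a i * x i ^ 2 := by
  have h : ∀ l : ℝ, 0 ≤ (∑' i, a i) * (l * l) + (-2 * ∑' i, a i * x i) * l + ∑' i, a i * x i ^ 2 := by
    intro l
    have hs := ((h1.hasSum.mul_right (l * l)).add ((h2.hasSum.mul_left (-2)).mul_right l)).add
      h3.hasSum
    refine hs.nonneg fun i => ?_
    have := mul_nonneg (ha i) (sq_nonneg (l - x i))
    nlinarith
  have := discrim_le_zero h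
  unfold discrim at this
  nlinarith

variable {H : Type*} [NormedAddCommGroup H] [InnerProductSpace ℂ H]

lemma norm_repr_le (b : HilbertBasis ι ℂ H) (ψ : H) (q : ι) : ‖b.repr ψ q‖ ≤ ‖ψ‖ := by
  have := lp.norm_apply_le_norm (by norm_num : (2 : ENNReal) ≠ 0) (b.repr ψ) q
  rwa [b.repr.norm_map] at this

lemma hasSum_norm_sq_repr (b : HilbertBasis ι ℂ H) (ψ : H) :
    HasSum (fun q => ‖b.repr ψ q‖ ^ 2) (‖ψ‖ ^ 2) := by
  have := lp.hasSum_norm (p := 2) (by norm_num) (b.repr ψ)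
  rw [b.repr.norm_map] at this
  simpa using this

lemma summable_matrix_mul {M : ι → ι → ℂ} {C : ℝ} (hM : SchurBound M C) (b : HilbertBasis ι ℂ H)
    (ψ : H) (p : ι) : Summable fun q => ‖M p q * b.repr ψ q‖ := by
  refine Summable.of_nonneg_of_le (fun _ => norm_nonneg _) (fun q => ?_) ((hM.row p).mul_right ‖ψ‖)
  rw [norm_mul]
  gcongr; exact norm_repr_le b ψ q

lemma SchurBound.summable_sq {M : ι → ι → ℂ} {C : ℝ} (hM : SchurBound M C) {x : ι → ℝ} {s : ℝ}
    (hx : HasSum (fun q => x q ^ 2) s) :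
    Summable (fun y : ι × ι => ‖M y.1 y.2‖ * x y.2 ^ 2) ∧
      ∑' y : ι × ι, ‖M y.1 y.2‖ * x y.2 ^ 2 ≤ C * s := by
  have hle : ∀ q, ∑' p, ‖M p q‖ * x q ^ 2 ≤ C * x q ^ 2 := fun q => by
    rw [tsum_mul_right]
    exact mul_le_mul_of_nonneg_right (hM.col_le q) (sq_nonneg _)
  have hxs : Summable fun q => C * x q ^ 2 := hx.summable.mul_left C
  have h1 : Summable (fun y : ι × ι => ‖M y.2 y.1‖ * x y.1 ^ 2) := by
    refine (summable_prod_of_nonneg fun _ => by positivity).2 ⟨fun q => (hM.col q).mul_right (x q ^ 2), ?_⟩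
    change Summable fun q => ∑' p, ‖M p q‖ * x q ^ 2
    have hn : ∀ q, 0 ≤ ∑' p, ‖M p q‖ * x q ^ 2 := fun q =>
      tsum_nonneg fun p => mul_nonneg (norm_nonneg _) (sq_nonneg _)
    exact Summable.of_nonneg_of_le hn hle hxs
  have h2 : ∑' y : ι × ι, ‖M y.2 y.1‖ * x y.1 ^ 2 ≤ C * s := by
    rw [h1.tsum_prod, ← hx.tsum_eq, ← tsum_mul_left]
    exact h1.prod.tsum_le_tsum hle hxs
  refine ⟨h1.prod_symm, ?_⟩
  rw [← (Equiv.prodComm ι ι).tsum_eq]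
  exact h2

lemma SchurBound.norm_sq_le {M : ι → ι → ℂ} {C : ℝ} (hM : SchurBound M C) {x : ι → ℂ} {s : ℝ}
    (hx : HasSum (fun q => ‖x q‖ ^ 2) s) {p : ι} (h1 : Summable fun q => ‖M p q * x q‖) :
    ‖∑' q, M p q * x q‖ ^ 2 ≤ C * ∑' q, ‖M p q‖ * ‖x q‖ ^ 2 := by
  have h2 : ‖∑' q, M p q * x q‖ ≤ ∑' q, ‖M p q‖ * ‖x q‖ := by
    simpa only [norm_mul] using norm_tsum_le_tsum_norm h1
  have h3 : Summable fun q => ‖M p q‖ * ‖x q‖ ^ 2 := (hM.summable_sq hx).1.prod_factor p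
  have h4 := sq_tsum_le (fun q => norm_nonneg (M p q)) (hM.row p)
    (by simpa only [norm_mul] using h1) h3
  have h5 : 0 ≤ ∑' q, ‖M p q‖ * ‖x q‖ ^ 2 := tsum_nonneg fun q => by positivity
  calc _ ≤ (∑' q, ‖M p q‖ * ‖x q‖) ^ 2 := pow_le_pow_left₀ (norm_nonneg _) h2 2
    _ ≤ _ := h4
    _ ≤ _ := mul_le_mul_of_nonneg_right (hM.row_le p) h5

/-- **Schur's test**: a matrix with bounded rows and columns defines a bounded operator. -/
lemma exists_matrixOp {M : ι → ι → ℂ} {C : ℝ} (hC : 0 ≤ C) (hM : SchurBound M C)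
    (b : HilbertBasis ι ℂ H) :
    ∃ A : H →L[ℂ] H, ‖A‖ ≤ C ∧ ∀ ψ p, b.repr (A ψ) p = ∑' q, M p q * b.repr ψ q := by
  have hsq := fun ψ : H => hM.summable_sq (hasSum_norm_sq_repr b ψ)
  have hrow := fun (ψ : H) (p : ι) =>
    hM.norm_sq_le (hasSum_norm_sq_repr b ψ) (summable_matrix_mul hM b ψ p)
  have hsum : ∀ ψ : H, Summable fun p => C * ∑' q, ‖M p q‖ * ‖b.repr ψ q‖ ^ 2 := fun ψ =>
    (hsq ψ).1.prod.mul_left C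
  have hsum' : ∀ ψ : H, Summable fun p => ‖∑' q, M p q * b.repr ψ q‖ ^ 2 := fun ψ =>
    Summable.of_nonneg_of_le (fun _ => by positivity) (hrow ψ) (hsum ψ)
  have hmem : ∀ ψ : H, Memℓp (fun p => ∑' q, M p q * b.repr ψ q) 2 := by
    intro ψ
    refine memℓp_gen ?_
    simp only [ENNReal.toReal_ofNat, Real.rpow_ofNat]
    exact hsum' ψ
  let A₀ : H →ₗ[ℂ] H :=
    { toFun := fun ψ => b.repr.symm ⟨fun p => ∑' q, M p q * b.repr ψ q, hmem ψ⟩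
      map_add' := fun ψ φ => by
        rw [← map_add]
        congr 1
        ext p
        simp only [map_add, lp.coeFn_add, Pi.add_apply, mul_add]
        exact (summable_matrix_mul hM b ψ p).of_norm.tsum_add (summable_matrix_mul hM b φ p).of_norm
      map_smul' := fun c ψ => by
        rw [RingHom.id_apply, ← map_smul]
        congr 1
        ext p
        simp only [map_smul, lp.coeFn_smul, Pi.smul_apply, smul_eq_mul, ← tsum_mul_left]
        exact tsum_congr fun q => by ring }
  have hrepr : ∀ ψ p, b.repr (A₀ ψ) p = ∑' q, M p q * b.repr ψ q := by
    intro ψ p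
    simp only [A₀, LinearMap.coe_mk, AddHom.coe_mk, LinearIsometryEquiv.apply_symm_apply]
  have hbound : ∀ ψ, ‖A₀ ψ‖ ≤ C * ‖ψ‖ := by
    intro ψ
    refine le_of_sq_le_sq ?_ (by positivity)
    rw [← (hasSum_norm_sq_repr b (A₀ ψ)).tsum_eq]
    simp only [hrepr]
    calc ∑' p, ‖∑' q, M p q * b.repr ψ q‖ ^ 2
        ≤ ∑' p, C * ∑' q, ‖M p q‖ * ‖b.repr ψ q‖ ^ 2 :=
          (hsum' ψ).tsum_le_tsum (hrow ψ) (hsum ψ)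
      _ = C * ∑' x : ι × ι, ‖M x.1 x.2‖ * ‖b.repr ψ x.2‖ ^ 2 := by
          rw [tsum_mul_left, (hsq ψ).1.tsum_prod]
      _ ≤ C * (C * ‖ψ‖ ^ 2) := by gcongr; exact (hsq ψ).2
      _ = (C * ‖ψ‖) ^ 2 := by ring
  exact ⟨A₀.mkContinuous C hbound, A₀.mkContinuous_norm_le hC hbound, hrepr⟩

lemma repr_ext (b : HilbertBasis ι ℂ H) {x y : H} (h : ∀ p, b.repr x p = b.repr y p) : x = y :=
  b.repr.injective (by ext p; exact h p)

lemma repr_self_apply (b : HilbertBasis ι ℂ H) [DecidableEq ι] (p q : ι) :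
    b.repr (b q) p = if p = q then 1 else 0 := by
  rw [b.repr_self, lp.single_apply, Pi.single_apply]

/-- The coordinate of a vector, as a continuous linear functional. -/
def coord (b : HilbertBasis ι ℂ H) (p : ι) : H →L[ℂ] ℂ := innerSL ℂ (b p)

lemma coord_apply (b : HilbertBasis ι ℂ H) (p : ι) (x : H) : coord b p x = b.repr x p := by
  rw [b.repr_apply_apply]; rfl

lemma exists_repr_eq [CompleteSpace H] (b : HilbertBasis ι ℂ H) {c : ι → ℂ}
    (hc : Summable fun q => ‖c q‖) :
    ∃ x : H, HasSum (fun q => c q • b q) x ∧ ∀ p, b.repr x p = c p := by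
  classical
  have hs : Summable fun q => c q • b q := by
    refine Summable.of_norm ?_
    simpa [norm_smul, b.orthonormal.1] using hc
  refine ⟨_, hs.hasSum, fun p => ?_⟩
  have h1 := hs.hasSum.mapL (coord b p)
  simp only [map_smul, coord_apply, repr_self_apply] at h1
  have h2 : HasSum (fun q => c q • (if p = q then (1 : ℂ) else 0)) (c p) := by
    have := hasSum_single (f := fun q => c q • (if p = q then (1 : ℂ) else 0)) p
      (fun q hq => by simp [hq.symm])
    simpa using this
  exact h1.unique h2

/-- A nuclear operator has a trace, the sum of its diagonal matrix elements in the basis in which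
its matrix is absolutely summable. -/
lemma hasTrace_of_summable {ι H : Type} [NormedAddCommGroup H] [InnerProductSpace ℂ H]
    [CompleteSpace H] (b : HilbertBasis ι ℂ H)
    {M : ι → ι → ℂ} (hM : Summable fun x : ι × ι => ‖M x.1 x.2‖) {A : H →L[ℂ] H}
    (hA : ∀ p q, b.repr (A (b q)) p = M p q) : HasTrace A (∑' p, M p p) := by
  classical
  intro κ e
  -- Bessel's inequality bounds the contribution of each matrix unit.
  have hpair : ∀ p q : ι, (Summable fun i => ‖inner ℂ (e i) (b p) * inner ℂ (b q) (e i)‖) ∧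
      ∑' i, ‖inner ℂ (e i) (b p) * inner ℂ (b q) (e i)‖ ≤ 1 := by
    intro p q
    have h1 : HasSum (fun i => ‖inner ℂ (e i) (b p)‖ ^ 2) 1 := by
      have := hasSum_norm_sq_repr e (b p)
      simpa [e.repr_apply_apply, b.orthonormal.1] using this
    have h2 : HasSum (fun i => ‖inner ℂ (b q) (e i)‖ ^ 2) 1 := by
      have := hasSum_norm_sq_repr e (b q)
      simpa [e.repr_apply_apply, b.orthonormal.1, norm_inner_symm] using this
    have h3 := (h1.add h2).mul_left (1 / 2)
    have hle : ∀ i, ‖inner ℂ (e i) (b p) * inner ℂ (b q) (e i)‖ ≤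
        1 / 2 * (‖inner ℂ (e i) (b p)‖ ^ 2 + ‖inner ℂ (b q) (e i)‖ ^ 2) := by
      intro i
      rw [norm_mul]
      nlinarith [sq_nonneg (‖inner ℂ (e i) (b p)‖ - ‖inner ℂ (b q) (e i)‖)]
    have h4 := Summable.of_nonneg_of_le (fun _ => norm_nonneg _) hle h3.summable
    refine ⟨h4, (h4.tsum_le_tsum hle h3.summable).trans ?_⟩
    rw [h3.tsum_eq]; norm_num
  have hbig : Summable fun x : (ι × ι) × κ =>
      M x.1.1 x.1.2 * (inner ℂ (e x.2) (b x.1.1) * inner ℂ (b x.1.2) (e x.2)) := by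
    refine Summable.of_norm ((summable_prod_of_nonneg fun _ => norm_nonneg _).2 ⟨fun x => ?_, ?_⟩)
    · simp only [norm_mul (M x.1 x.2)]
      exact (hpair x.1 x.2).1.mul_left _
    · refine Summable.of_nonneg_of_le (fun _ => tsum_nonneg fun _ => norm_nonneg _) (fun x => ?_) hM
      simp only [norm_mul (M x.1 x.2)]
      rw [tsum_mul_left]
      exact mul_le_of_le_one_right (norm_nonneg _) (hpair x.1 x.2).2
  have hcol : ∀ q, HasSum (fun p => M p q • b p) (A (b q)) := by
    intro q
    have := b.hasSum_repr (A (b q))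
    simpa only [hA] using this
  -- both vectors of `⟨e i, A (e i)⟩` expanded in the basis `b`
  have hdiag : ∀ i, HasSum (fun x : ι × ι =>
      M x.1 x.2 * (inner ℂ (e i) (b x.1) * inner ℂ (b x.2) (e i))) (inner ℂ (e i) (A (e i))) := by
    intro i
    have hs : Summable fun x : ι × ι =>
        M x.1 x.2 * (inner ℂ (e i) (b x.1) * inner ℂ (b x.2) (e i)) :=
      hbig.comp_injective (i := fun x : ι × ι => (x, i)) fun x y h => (Prod.ext_iff.1 h).1
    have h1 : HasSum (fun q => inner ℂ (b q) (e i) * inner ℂ (e i) (A (b q)))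
        (inner ℂ (e i) (A (e i))) := by
      have h2 := ((b.hasSum_repr (e i)).mapL A).mapL (innerSL ℂ (e i))
      simpa [b.repr_apply_apply, inner_smul_right] using h2
    have h3 : ∀ q, HasSum (fun p => M p q * (inner ℂ (e i) (b p) * inner ℂ (b q) (e i)))
        (inner ℂ (b q) (e i) * inner ℂ (e i) (A (b q))) := by
      intro q
      have h4 := ((hcol q).mapL (innerSL ℂ (e i))).mul_left (inner ℂ (b q) (e i))
      refine h4.congr_fun fun p => ?_
      simp only [innerSL_apply_apply, inner_smul_right]
      ring
    have h5 := hs.prod_symm.hasSum.prod_fiberwise h3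
    have h6 : ∑' x : ι × ι, M x.1 x.2 * (inner ℂ (e i) (b x.1) * inner ℂ (b x.2) (e i)) =
        inner ℂ (e i) (A (e i)) := by
      rw [← (Equiv.prodComm ι ι).tsum_eq]
      exact h5.unique h1
    rw [← h6]; exact hs.hasSum
  have h7 := hbig.prod_symm.hasSum.prod_fiberwise hdiag
  -- summing over `i` first, Parseval in the basis `e` leaves the diagonal of `M`
  have h8 : ∑' x : κ × (ι × ι), M x.2.1 x.2.2 * (inner ℂ (e x.1) (b x.2.1) *
      inner ℂ (b x.2.2) (e x.1)) = ∑' p, M p p := by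
    have h9 : ∀ x : ι × ι, HasSum (fun i => M x.1 x.2 * (inner ℂ (e i) (b x.1) *
        inner ℂ (b x.2) (e i))) (M x.1 x.2 * if x.1 = x.2 then 1 else 0) := by
      intro x
      refine HasSum.mul_left _ ?_
      have h := e.hasSum_inner_mul_inner (b x.2) (b x.1)
      have h' : inner ℂ (b x.2) (b x.1) = if x.1 = x.2 then (1 : ℂ) else 0 := by
        rw [orthonormal_iff_ite.1 b.orthonormal x.2 x.1]
        simp only [eq_comm]
      rw [h'] at h
      exact h.congr_fun fun i => mul_comm _ _
    have h10 := hbig.hasSum.prod_fiberwise h9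
    have h11 : ∑' x : κ × (ι × ι), M x.2.1 x.2.2 * (inner ℂ (e x.1) (b x.2.1) *
        inner ℂ (b x.2.2) (e x.1)) = ∑' x : (ι × ι) × κ, M x.1.1 x.1.2 *
        (inner ℂ (e x.2) (b x.1.1) * inner ℂ (b x.1.2) (e x.2)) := by
      rw [← (Equiv.prodComm (ι × ι) κ).tsum_eq]; rfl
    rw [h11, ← h10.tsum_eq, h10.summable.tsum_prod]
    refine tsum_congr fun p => ?_
    rw [tsum_eq_single p fun q hq => by simp [hq.symm]]
    simp
  rw [← h8]
  exact h7

lemma hasTrace_unique {H : Type} [NormedAddCommGroup H] [InnerProductSpace ℂ H] [CompleteSpace H]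
    {A : H →L[ℂ] H} {τ τ' : ℂ} (h : HasTrace A τ) (h' : HasTrace A τ') : τ = τ' := by
  obtain ⟨w, b, -⟩ := exists_hilbertBasis ℂ H
  exact (h w b).unique (h' w b)

end MatrixOp

/-! ### The heat semigroup in a Fourier basis -/

section HeatSemigroup

open Set

variable {d N : ℕ} {g : Matrix (Fin d) (Fin d) ℝ} {B : Idx d N → Idx d N → ℂ}

/-- Rapidly decreasing sequences of Fourier coefficients. -/
def RapidDecay (c : Idx d N → ℂ) : Prop :=
  ∀ L : ℕ, ∃ C : ℝ, 0 < C ∧ ∀ q, ‖c q‖ ≤ C * (jb q.1 ^ L)⁻¹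

lemma summable_jb_idx {n : ℕ} (hn : 2 * d ≤ n) :
    Summable fun q : Idx d N => (jb q.1 ^ n)⁻¹ := (hasSum_fst (summable_jb hn)).summable

lemma wt_le_jb (hg : g.PosDef) (m : ℕ) {t : ℝ} (ht : 0 < t) :
    ∃ C : ℝ, 0 < C ∧ ∀ q : Idx d N, wt m t (energy g q) ≤ C * (jb q.1 ^ (2 * m))⁻¹ := by
  obtain ⟨c, hc, -, h, -⟩ := exists_lower_normSq hg
  set a := min 1 t with ha
  have ha0 : 0 < a := lt_min one_pos ht
  refine ⟨((a * c) ^ m)⁻¹, by positivity, fun q => ?_⟩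
  have hj := jb_pos q.1
  have hE := energy_nonneg hg q
  have h1 : a * c * jb q.1 ^ 2 ≤ 1 + t * energy g q := by
    have h2 : a * (c * jb q.1 ^ 2) ≤ a * (1 + energy g q) := by
      gcongr; exact h q.1
    have h3 : a ≤ 1 := min_le_left _ _
    have h4 : a * energy g q ≤ t * energy g q := by gcongr; exact min_le_right _ _
    nlinarith
  rw [wt, pow_mul, ← mul_inv, ← mul_pow]
  exact inv_anti₀ (by positivity) (by gcongr)

lemma exists_schurBound_heatKernel (hg : g.PosDef) (hB : IsPert B) {T : ℝ} (hT : 0 ≤ T) :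
    ∃ C : ℝ, 0 < C ∧ ∀ t ∈ Icc 0 T, SchurBound (heatKernel g B t) C := by
  obtain ⟨A, hA, h⟩ := norm_heatKernel_le hg hB (le_refl (2 * d)) 0 hT
  have hS : 0 ≤ ∑' r : Idx d N, (jb r.1 ^ (2 * d))⁻¹ := tsum_nonneg fun r => inv_jb_pow_nonneg _ _
  refine ⟨A * (∑' r : Idx d N, (jb r.1 ^ (2 * d))⁻¹) + 1, by positivity, fun t ht => ?_⟩
  have h1 : ∀ p q, ‖heatKernel g B t p q‖ ≤ A * gam (2 * d) p q := fun p q => by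
    simpa [wt] using h t ht p q
  have hr : ∀ p, Summable fun q => ‖heatKernel g B t p q‖ := fun p =>
    Summable.of_nonneg_of_le (fun _ => norm_nonneg _) (h1 p)
      ((summable_gam_right le_rfl p).mul_left A)
  have hc : ∀ q, Summable fun p => ‖heatKernel g B t p q‖ := fun q =>
    Summable.of_nonneg_of_le (fun _ => norm_nonneg _) (fun p => h1 p q)
      ((summable_gam_left le_rfl q).mul_left A)
  refine ⟨hr, hc, fun p => ?_, fun q => ?_⟩
  · refine ((hr p).tsum_le_tsum (h1 p) ((summable_gam_right le_rfl p).mul_left A)).trans ?_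
    simp only [gam_comm _ p]
    rw [tsum_mul_left, tsum_gam_left]
    linarith
  · refine ((hc q).tsum_le_tsum (fun p => h1 p q) ((summable_gam_left le_rfl q).mul_left A)).trans ?_
    rw [tsum_mul_left, tsum_gam_left]
    linarith

/-- The matrix of `-q² + B`. -/
def genMatrix (g : Matrix (Fin d) (Fin d) ℝ) (B : Idx d N → Idx d N → ℂ) (p q : Idx d N) : ℂ :=
  (if p = q then -(energy g q : ℂ) else 0) + B p q

lemma exists_genMatrix_col (hB : IsPert B) : ∃ C : ℝ, 0 < C ∧ ∀ q : Idx d N,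
    (Summable fun p => ‖genMatrix g B p q‖) ∧
      ∑' p, ‖genMatrix g B p q‖ ≤ C * jb q.1 ^ 2 + |energy g q| := by
  obtain ⟨C, hC, h⟩ := hB (2 * d)
  have hS : 0 ≤ ∑' r : Idx d N, (jb r.1 ^ (2 * d))⁻¹ := tsum_nonneg fun r => inv_jb_pow_nonneg _ _
  refine ⟨C * (∑' r : Idx d N, (jb r.1 ^ (2 * d))⁻¹) + 1, by positivity, fun q => ?_⟩
  have h1 : HasSum (fun p : Idx d N => if p = q then |energy g q| else 0) |energy g q| :=
    hasSum_ite_eq q _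
  have h2 := ((summable_gam_left (M := 2 * d) le_rfl q).mul_left (C * vel q)).hasSum
  have h3 : ∀ p, ‖genMatrix g B p q‖ ≤ (if p = q then |energy g q| else 0) +
      C * vel q * gam (2 * d) p q := by
    intro p
    refine (norm_add_le _ _).trans (add_le_add ?_ ((h p q).trans (le_of_eq (by ring))))
    split_ifs <;> simp
  have h4 := h1.add h2
  have h5 := Summable.of_nonneg_of_le (fun _ => norm_nonneg _) h3 h4.summable
  refine ⟨h5, (h5.tsum_le_tsum h3 h4.summable).trans ?_⟩
  rw [h4.tsum_eq, tsum_mul_left, tsum_gam_left]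
  have h6 := one_le_jb q.1
  have h7 : jb q.1 ≤ jb q.1 ^ 2 := by nlinarith
  unfold vel
  nlinarith [mul_le_mul_of_nonneg_left h7 (mul_nonneg hC.le hS), sq_nonneg (jb q.1)]

variable {H : Type*} [NormedAddCommGroup H] [InnerProductSpace ℂ H] {b : HilbertBasis (Idx d N) ℂ H}

/-- The operators `G t` have the heat kernel as their matrix. -/
def HasHeatMatrix (g : Matrix (Fin d) (Fin d) ℝ) (B : Idx d N → Idx d N → ℂ)
    (b : HilbertBasis (Idx d N) ℂ H) (G : ℝ≥0 → H →L[ℂ] H) : Prop :=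
  ∀ (t : ℝ≥0) ψ p, b.repr (G t ψ) p = ∑' q, heatKernel g B t p q * b.repr ψ q

lemma exists_hasHeatMatrix (hg : g.PosDef) (hB : IsPert B) (b : HilbertBasis (Idx d N) ℂ H) :
    ∃ G : ℝ≥0 → H →L[ℂ] H, HasHeatMatrix g B b G := by
  have : ∀ t : ℝ≥0, ∃ A : H →L[ℂ] H, ∀ ψ p, b.repr (A ψ) p =
      ∑' q, heatKernel g B t p q * b.repr ψ q := by
    intro t
    obtain ⟨C, hC, h⟩ := exists_schurBound_heatKernel hg hB t.coe_nonneg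
    obtain ⟨A, -, hA⟩ := exists_matrixOp hC.le (h t ⟨t.coe_nonneg, le_rfl⟩) b
    exact ⟨A, hA⟩
  choose G hG using this
  exact ⟨G, hG⟩

variable {G : ℝ≥0 → H →L[ℂ] H}

lemma HasHeatMatrix.exists_norm_le (hG : HasHeatMatrix g B b G) (hg : g.PosDef) (hB : IsPert B)
    (T : ℝ≥0) : ∃ C : ℝ, 0 < C ∧ ∀ t ≤ T, ‖G t‖ ≤ C := by
  obtain ⟨C, hC, h⟩ := exists_schurBound_heatKernel hg hB T.coe_nonneg
  refine ⟨C, hC, fun t ht => ?_⟩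
  obtain ⟨A, hA, hA'⟩ := exists_matrixOp hC.le (h t ⟨t.coe_nonneg, ht⟩) b
  have : G t = A := by
    refine ContinuousLinearMap.ext fun ψ => repr_ext b fun p => ?_
    rw [hG, hA']
  rwa [this]

lemma HasHeatMatrix.apply_basis (hG : HasHeatMatrix g B b G) (t : ℝ≥0) (p q : Idx d N) :
    b.repr (G t (b q)) p = heatKernel g B t p q := by
  rw [hG, tsum_eq_single q]
  · simp [repr_self_apply]
  · intro r hr
    simp [repr_self_apply, hr]

lemma HasHeatMatrix.continuous_basis [CompleteSpace H] (hG : HasHeatMatrix g B b G) (hg : g.PosDef)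
    (hB : IsPert B) (T : ℝ≥0) (q : Idx d N) : ContinuousOn (fun t => G t (b q)) (Iic T) := by
  obtain ⟨A, hA, h⟩ := norm_heatKernel_le hg hB (le_refl (2 * d)) 0 T.coe_nonneg
  have h1 : ∀ t, G t (b q) = ∑' p, heatKernel g B t p q • b p := by
    intro t
    have := b.hasSum_repr (G t (b q))
    simp only [hG.apply_basis] at this
    exact this.tsum_eq.symm
  simp only [h1]
  refine continuousOn_tsum (fun p => ?_) ((summable_gam_left (le_refl (2 * d)) q).mul_left A)
    fun p t ht => ?_
  · refine ContinuousOn.smul ?_ continuousOn_const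
    exact (continuousOn_heatKernel hg hB p q T).comp NNReal.continuous_coe.continuousOn
      fun t ht => ⟨t.coe_nonneg, ht⟩
  · rw [norm_smul, b.orthonormal.1, mul_one]
    simpa [wt] using h t ⟨t.coe_nonneg, ht⟩ p q

lemma HasHeatMatrix.isC0Semigroup [CompleteSpace H] (hG : HasHeatMatrix g B b G) (hg : g.PosDef)
    (hB : IsPert B) : IsC0Semigroup G := by
  have hext : ∀ A A' : H →L[ℂ] H, (∀ q p, b.repr (A (b q)) p = b.repr (A' (b q)) p) → A = A' := by
    intro A A' h
    refine ContinuousLinearMap.ext_on (s := range b) ?_ ?_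
    · exact Submodule.dense_iff_topologicalClosure_eq_top.2 b.dense_span
    · rintro _ ⟨q, rfl⟩
      exact repr_ext b (h q)
  refine ⟨hext _ _ fun q p => ?_, fun s t => hext _ _ fun q p => ?_, fun ψ => ?_⟩
  · rw [hG.apply_basis, NNReal.coe_zero, heatKernel_zero hg hB]
    simp [repr_self_apply]
  · rw [hG.apply_basis, NNReal.coe_add]
    change _ = b.repr (G s (G t (b q))) p
    rw [hG s]
    simp only [hG.apply_basis]
    exact (heatKernel_add hg hB s.coe_nonneg t.coe_nonneg p q).tsum_eq.symm
  · have hT : ∀ T : ℝ≥0, ContinuousOn (fun t => G t ψ) (Iic T) := by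
      intro T
      obtain ⟨C, hC, h⟩ := hG.exists_norm_le hg hB T
      have hψ := b.hasSum_repr ψ
      have hu : TendstoUniformlyOn (fun (s : Finset (Idx d N)) (t : ℝ≥0) =>
          G t (∑ i ∈ s, b.repr ψ i • b i)) (fun t => G t ψ) atTop (Iic T) := by
        rw [Metric.tendstoUniformlyOn_iff]
        intro ε hε
        have h1 := (Metric.tendsto_nhds.1 hψ) (ε / C) (by positivity)
        filter_upwards [h1] with s hs t ht
        rw [dist_eq_norm, ← map_sub]
        calc _ ≤ C * ‖ψ - ∑ i ∈ s, b.repr ψ i • b i‖ := (G t).le_of_opNorm_le (h t ht) _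
          _ < C * (ε / C) := by
            rw [dist_comm, dist_eq_norm] at hs
            gcongr
          _ = ε := by field_simp
      refine hu.continuousOn (Frequently.of_forall fun s => ?_)
      simp only [map_sum, map_smul]
      exact continuousOn_finsetSum _ fun i _ => continuousOn_const.smul
        (hG.continuous_basis hg hB T i)
    refine continuous_iff_continuousAt.2 fun t => (hT (t + 1)).continuousAt ?_
    exact Iic_mem_nhds (by simp)

/-- Basis vectors are in the domain of the generator. -/
lemma HasHeatMatrix.basis_mem_generatorGraph [CompleteSpace H] (hG : HasHeatMatrix g B b G)
    (hg : g.PosDef) (hB : IsPert B) {q : Idx d N} {y : H}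
    (hy : ∀ p, b.repr y p = genMatrix g B p q) : (b q, y) ∈ generatorGraph G := by
  have hs := hG.isC0Semigroup hg hB
  rw [hs.mem_generatorGraph_iff]
  intro t
  refine repr_ext b fun p => ?_
  have h1 : b.repr (G t (b q) - b q) p = heatKernel g B t p q - if p = q then 1 else 0 := by
    rw [map_sub, lp.coeFn_sub, Pi.sub_apply, hG.apply_basis, repr_self_apply]
  have h2 : b.repr (∫ s in (0 : ℝ)..t, G s.toNNReal y) p =
      ∫ s in (0 : ℝ)..t, b.repr (G s.toNNReal y) p := by
    simp only [← coord_apply]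
    exact ((coord b p).intervalIntegral_comp_comm
      ((hs.continuous_real y).intervalIntegrable _ _)).symm
  rw [h1, h2, heatKernel_sub hg hB t.coe_nonneg]
  refine intervalIntegral.integral_congr fun s hs' => ?_
  rw [uIcc_of_le t.coe_nonneg] at hs'
  obtain ⟨l, A, hl, hA, hrow⟩ := rowBound_heatKernel (B := B) hg hB (le_refl (2 * d)) 0 hs'.1
  obtain ⟨b', hb', hadm⟩ := exists_admissible hg hB hs'.1
  have h3 := (summable_rowMul (hrow p).1 (hadm p) (s := s) ⟨hs'.1, le_rfl⟩ q).of_norm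
  have h4 : HasSum (fun r => heatKernel g B s p r * if r = q then -(energy g q : ℂ) else 0)
      (-(energy g q : ℂ) * heatKernel g B s p q) := by
    have := hasSum_single (f := fun r => heatKernel g B s p r *
      if r = q then -(energy g q : ℂ) else 0) q (fun r hr => by simp [hr])
    simpa [mul_comm] using this
  have h5 := h4.add h3.hasSum
  simp only
  rw [hG, Real.coe_toNNReal _ hs'.1]
  refine h5.tsum_eq.symm.trans (tsum_congr fun r => ?_)
  rw [hy, genMatrix, mul_add]

/-- Vectors with rapidly decreasing coefficients are in the domain of the generator. -/
lemma HasHeatMatrix.mem_generatorGraph [CompleteSpace H] (hG : HasHeatMatrix g B b G)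
    (hg : g.PosDef) (hB : IsPert B) {x y : H} (hx : RapidDecay (b.repr x))
    (hy : ∀ p, b.repr y p = ∑' q, genMatrix g B p q * b.repr x q) :
    (x, y) ∈ generatorGraph G := by
  obtain ⟨C, hC, hcol⟩ := exists_genMatrix_col (g := g) hB
  obtain ⟨C', hC', hQ⟩ := exists_normSq_le g
  choose z hz hz' using fun q => exists_repr_eq b (hcol q).1
  have hzn : ∀ q, ‖z q‖ ≤ (C + C') * jb q.1 ^ 2 := by
    intro q
    have h1 : ‖z q‖ ≤ ∑' p, ‖genMatrix g B p q‖ := by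
      rw [← (hz q).tsum_eq]
      refine (norm_tsum_le_tsum_norm ?_).trans (le_of_eq ?_)
      · simpa [norm_smul, b.orthonormal.1] using (hcol q).1
      · simp [norm_smul, b.orthonormal.1]
    have h2 : |energy g q| ≤ C' * jb q.1 ^ 2 := by
      rw [abs_of_nonneg (energy_nonneg hg q)]; exact hQ q.1
    linarith [(hcol q).2]
  obtain ⟨D, hD, hxD⟩ := hx (2 * d + 2)
  have hsum : Summable fun q => b.repr x q • z q := by
    refine Summable.of_norm_bounded
      ((summable_jb_idx (N := N) (le_refl (2 * d))).mul_left (D * (C + C'))) fun q => ?_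
    have hj := jb_pos q.1
    rw [norm_smul]
    calc _ ≤ (D * (jb q.1 ^ (2 * d + 2))⁻¹) * ((C + C') * jb q.1 ^ 2) := by
          gcongr
          · exact hxD q
          · exact hzn q
      _ = _ := by rw [pow_add]; field_simp
  have hyz : HasSum (fun q => b.repr x q • z q) y := by
    have h1 : ∑' q, b.repr x q • z q = y := by
      refine repr_ext b fun p => ?_
      have h2 := hsum.hasSum.mapL (coord b p)
      simp only [map_smul, coord_apply, hz', smul_eq_mul] at h2
      rw [← h2.tsum_eq, hy]
      exact tsum_congr fun q => mul_comm _ _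
    rw [← h1]; exact hsum.hasSum
  have hmem : ∀ s : Finset (Idx d N), (∑ q ∈ s, b.repr x q • b q, ∑ q ∈ s, b.repr x q • z q) ∈
      generatorGraph G := fun s => generatorGraph_sum s fun q _ =>
    generatorGraph_smul _ (hG.basis_mem_generatorGraph hg hB (hz' q))
  exact (hG.isC0Semigroup hg hB).isClosed_generatorGraph.mem_of_tendsto
    (Tendsto.prodMk_nhds (b.hasSum_repr x) hyz) (Eventually.of_forall hmem)

/-- The semigroup is smoothing. -/
lemma HasHeatMatrix.rapidDecay (hG : HasHeatMatrix g B b G) (hg : g.PosDef) (hB : IsPert B)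
    {t : ℝ≥0} (ht : 0 < t) (ψ : H) : RapidDecay (b.repr (G t ψ)) := by
  intro L
  set M := max L (2 * d) with hM
  have hMd : 2 * d ≤ M := le_max_right _ _
  obtain ⟨A, hA, h⟩ := norm_heatKernel_le hg hB hMd M t.coe_nonneg
  obtain ⟨W, hW, hw⟩ := wt_le_jb (N := N) hg M (NNReal.coe_pos.2 ht)
  obtain ⟨K, hK, hconv⟩ := gam_conv (N := N) hMd
  refine ⟨A * W * ‖ψ‖ * K + 1, by positivity, fun p => ?_⟩
  -- `gam M q o` is the decay of the mode `q` itself, so that the decay of the sum over `q` is a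
  -- convolution estimate
  set o : Idx d N := (0, p.2) with ho
  have hgo : ∀ q, gam M q o = (jb q.1 ^ M)⁻¹ := fun q => by simp [gam, ho]
  have h1 : ∀ q, ‖heatKernel g B t p q * b.repr ψ q‖ ≤
      A * W * ‖ψ‖ * (gam M p q * gam M q o) := by
    intro q
    have h2 := h t ⟨t.coe_nonneg, le_rfl⟩ p q
    have h3 : wt M t (energy g q) ≤ W * gam M q o := by
      rw [hgo]
      exact (hw q).trans (mul_le_mul_of_nonneg_left (inv_jb_pow_anti _ (by omega)) hW.le)
    have h4 := norm_repr_le b ψ q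
    have h5 := gam_nonneg M p q
    have h6 := gam_nonneg M q o
    rw [norm_mul]
    calc _ ≤ (A * gam M p q * (W * gam M q o)) * ‖ψ‖ := by
          gcongr
          exact h2.trans (by gcongr)
      _ = _ := by ring
  have h2 := tsum_of_norm_bounded ((hconv p o).1.mul_left (A * W * ‖ψ‖)).hasSum h1
  rw [hG]
  refine h2.trans ?_
  rw [tsum_mul_left]
  have h3 := (hconv p o).2
  rw [hgo] at h3
  have h4 : (jb p.1 ^ M)⁻¹ ≤ (jb p.1 ^ L)⁻¹ := inv_jb_pow_anti _ (le_max_left _ _)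
  have h5 := inv_jb_pow_nonneg p.1 L
  calc A * W * ‖ψ‖ * ∑' q, gam M p q * gam M q o ≤ A * W * ‖ψ‖ * (K * (jb p.1 ^ L)⁻¹) := by
        gcongr
        exact h3.trans (by gcongr)
    _ ≤ _ := by nlinarith

/-- At positive times the heat matrix is absolutely summable, so that the semigroup consists of
nuclear operators. -/
lemma summable_heatKernel (hg : g.PosDef) (hB : IsPert B) {t : ℝ} (ht : 0 < t) :
    Summable fun x : Idx d N × Idx d N => ‖heatKernel g B t x.1 x.2‖ := by
  obtain ⟨A, hA, h⟩ := norm_heatKernel_le hg hB (le_refl (2 * d)) d ht.le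
  obtain ⟨W, hW, hw⟩ := wt_le_jb (N := N) hg d ht
  have h1 : Summable fun x : Idx d N × Idx d N => ‖heatKernel g B t x.2 x.1‖ := by
    have hle : ∀ q p : Idx d N, ‖heatKernel g B t p q‖ ≤
        A * W * (jb q.1 ^ (2 * d))⁻¹ * gam (2 * d) p q := by
      intro q p
      have := gam_nonneg (2 * d) p q
      calc _ ≤ A * gam (2 * d) p q * (W * (jb q.1 ^ (2 * d))⁻¹) :=
            (h t ⟨ht.le, le_rfl⟩ p q).trans (by gcongr; exact hw q)
        _ = _ := by ring
    have hs : ∀ q : Idx d N, Summable fun p => ‖heatKernel g B t p q‖ := fun q =>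
      Summable.of_nonneg_of_le (fun _ => norm_nonneg _) (hle q)
        ((summable_gam_left le_rfl q).mul_left _)
    refine (summable_prod_of_nonneg fun _ => norm_nonneg _).2 ⟨hs, ?_⟩
    have hle' : ∀ q : Idx d N, ∑' p, ‖heatKernel g B t p q‖ ≤
        A * W * (jb q.1 ^ (2 * d))⁻¹ * ∑' r : Idx d N, (jb r.1 ^ (2 * d))⁻¹ := by
      intro q
      refine ((hs q).tsum_le_tsum (hle q) ((summable_gam_left le_rfl q).mul_left _)).trans ?_
      rw [tsum_mul_left, tsum_gam_left]
    have hs' : Summable fun q : Idx d N =>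
        A * W * (jb q.1 ^ (2 * d))⁻¹ * ∑' r : Idx d N, (jb r.1 ^ (2 * d))⁻¹ :=
      ((summable_jb_idx le_rfl).mul_left (A * W)).mul_right _
    exact Summable.of_nonneg_of_le (fun q => tsum_nonneg fun p => norm_nonneg _) hle' hs'
  exact h1.prod_symm

end HeatSemigroup

/-! ### Fourier analysis on the torus -/

section Fourier

open Set

variable {d : ℕ}

/-- The covering map `ℝ^d → T^d`. -/
def cover (y : Fin d → ℝ) : Torus d := fun i => (y i : AddCircle (2 * Real.pi))

lemma isOpenQuotientMap_cover : IsOpenQuotientMap (cover (d := d)) :=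
  IsOpenQuotientMap.piMap fun _ => QuotientAddGroup.isOpenQuotientMap_mk

lemma cover_add_single (y : Fin d → ℝ) (μ : Fin d) (s : ℝ) :
    cover y + Pi.single μ (s : AddCircle (2 * Real.pi)) = cover (y + Pi.single μ s) := by
  ext i
  rcases eq_or_ne i μ with rfl | h
  · simp [cover]
  · simp [cover, h]

lemma continuous_of_cover {V : Type*} [TopologicalSpace V] {u : Torus d → V}
    (h : Continuous fun y => u (cover y)) : Continuous u :=
  isOpenQuotientMap_cover.isQuotientMap.continuous_iff.2 h

lemma IsSmooth.continuous {V : Type*} [NormedAddCommGroup V] [NormedSpace ℝ V] {u : Torus d → V}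
    (hu : IsSmooth u) : Continuous u := continuous_of_cover (ContDiff.continuous hu)

lemma continuous_planeWave (k : Fin d → ℤ) : Continuous (planeWave k) := by
  unfold planeWave; fun_prop

lemma planeWave_add (k l : Fin d → ℤ) (x : Torus d) :
    planeWave (k + l) x = planeWave k x * planeWave l x := by
  simp only [planeWave, Pi.add_apply, fourier_add, ← Finset.prod_mul_distrib]

@[simp] lemma planeWave_zero (x : Torus d) : planeWave 0 x = 1 := by simp [planeWave]

lemma planeWave_neg (k : Fin d → ℤ) (x : Torus d) :
    planeWave (-k) x = starRingEnd ℂ (planeWave k x) := by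
  simp only [planeWave, Pi.neg_apply, fourier_neg, map_prod]

@[simp] lemma norm_planeWave (k : Fin d → ℤ) (x : Torus d) : ‖planeWave k x‖ = 1 := by
  simp only [planeWave, norm_prod, fourier_apply]
  exact Finset.prod_eq_one fun i _ => Circle.norm_coe _

/-- The linear form `y ↦ k · y`. -/
def phase (k : Fin d → ℤ) : (Fin d → ℝ) →L[ℝ] ℝ := ∑ i, (k i : ℝ) • ContinuousLinearMap.proj i

lemma phase_apply (k : Fin d → ℤ) (y : Fin d → ℝ) : phase k y = ∑ i, (k i : ℝ) * y i := by
  simp [phase]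

lemma norm_phase_le (k : Fin d → ℤ) : ‖phase k‖ ≤ jb k := by
  refine ContinuousLinearMap.opNorm_le_bound _ (jb_pos k).le fun y => ?_
  rw [phase_apply]
  calc ‖∑ i, (k i : ℝ) * y i‖ ≤ ∑ i, ‖(k i : ℝ) * y i‖ := norm_sum_le _ _
    _ ≤ ∑ i, |(k i : ℝ)| * ‖y‖ := by
        refine Finset.sum_le_sum fun i _ => ?_
        rw [norm_mul, Real.norm_eq_abs]
        gcongr; exact norm_le_pi_norm y i
    _ = (∑ i, |(k i : ℝ)|) * ‖y‖ := by rw [Finset.sum_mul]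
    _ ≤ jb k * ‖y‖ := by gcongr; unfold jb; linarith

lemma planeWave_cover (k : Fin d → ℤ) (y : Fin d → ℝ) :
    planeWave k (cover y) = Complex.exp (Complex.I * (phase k y : ℝ)) := by
  have hpi : (Real.pi : ℂ) ≠ 0 := Complex.ofReal_ne_zero.2 Real.pi_ne_zero
  rw [phase_apply, planeWave]
  push_cast
  rw [Finset.mul_sum, Complex.exp_sum]
  refine Finset.prod_congr rfl fun i _ => ?_
  rw [cover, fourier_coe_apply]
  congr 1
  push_cast
  field_simp

/-- The normalisation `(2π)^{-d/2}` of Fourier coefficients. -/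
def fnorm (d : ℕ) : ℝ := (2 * Real.pi) ^ (-(d : ℝ) / 2)

lemma fnorm_pos : 0 < fnorm d := by unfold fnorm; positivity

lemma fnorm_sq : fnorm d ^ 2 = ((2 * Real.pi) ^ d)⁻¹ := by
  have h : (0 : ℝ) ≤ 2 * Real.pi := by positivity
  rw [fnorm, ← Real.rpow_natCast, ← Real.rpow_mul h, ← Real.rpow_natCast (2 * Real.pi) d,
    ← Real.rpow_neg h]
  congr 1; push_cast; ring

lemma integral_fourier (n : ℤ) :
    ∫ x : AddCircle (2 * Real.pi), (fourier n x : ℂ) = if n = 0 then ((2 * Real.pi : ℝ) : ℂ) else 0 := by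
  split_ifs with h
  · subst h
    have : (volume : Measure (AddCircle (2 * Real.pi))).real univ = 2 * Real.pi := by
      rw [Measure.real, AddCircle.measure_univ, ENNReal.toReal_ofReal Real.two_pi_pos.le]
    simp [this]
  · exact integral_eq_zero_of_add_right_eq_neg (μ := volume)
      (fourier_add_half_inv_index h Real.two_pi_pos)

lemma integral_planeWave (k : Fin d → ℤ) :
    ∫ x : Torus d, planeWave k x = if k = 0 then (((2 * Real.pi) ^ d : ℝ) : ℂ) else 0 := by
  unfold planeWave
  rw [integral_fintype_prod_volume_eq_prod (fun (i : Fin d) (x : AddCircle (2 * Real.pi)) =>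
    (fourier (k i) x : ℂ))]
  simp only [integral_fourier]
  split_ifs with h
  · subst h; simp
  · obtain ⟨i, hi⟩ := Function.ne_iff.mp h
    exact Finset.prod_eq_zero (Finset.mem_univ i) (if_neg hi)

/-- The Fourier coefficient of a scalar function. -/
def sc (u : Torus d → ℂ) (k : Fin d → ℤ) : ℂ := (fnorm d : ℂ) * ∫ x, u x * planeWave (-k) x

lemma fCoeff_apply {N : ℕ} (u : MatField d N) (k : Fin d → ℤ) (a b : Fin N) :
    fCoeff u k a b = sc (fun x => u x a b) k := rfl

lemma integrable_of_continuous {u : Torus d → ℂ} (hu : Continuous u) : Integrable u :=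
  hu.integrable_of_hasCompactSupport (HasCompactSupport.of_compactSpace u)

lemma exists_bound_of_continuous {u : Torus d → ℂ} (hu : Continuous u) :
    ∃ C : ℝ, 0 < C ∧ ∀ x, ‖u x‖ ≤ C := by
  obtain ⟨C, hC⟩ := isCompact_univ.exists_bound_of_continuousOn hu.continuousOn
  exact ⟨max C 1, by positivity, fun x => (hC x (mem_univ x)).trans (le_max_left _ _)⟩

/-! #### Completeness of the plane waves -/

/-- The plane wave as a continuous map. -/
def planeWaveC (k : Fin d → ℤ) : C(Torus d, ℂ) := ⟨planeWave k, continuous_planeWave k⟩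

lemma span_planeWaveC_closure : (Submodule.span ℂ (range (planeWaveC (d := d)))).topologicalClosure
    = ⊤ := by
  let S : StarSubalgebra ℂ C(Torus d, ℂ) :=
    { toSubalgebra := Algebra.adjoin ℂ (range planeWaveC)
      star_mem' := by
        change Algebra.adjoin ℂ (range planeWaveC) ≤ star (Algebra.adjoin ℂ (range planeWaveC))
        refine Algebra.adjoin_le ?_
        rintro _ ⟨n, rfl⟩
        refine Algebra.subset_adjoin ⟨-n, ?_⟩
        ext1 x
        simp [planeWaveC, planeWave_neg] }
  have hS : Subalgebra.toSubmodule S.toSubalgebra = Submodule.span ℂ (range planeWaveC) := by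
    apply Algebra.adjoin_eq_span_of_subset
    refine .trans (fun x => Submonoid.closure_induction (fun _ => id) ⟨0, ?_⟩ ?_)
      Submodule.subset_span
    · ext z; simp [planeWaveC]
    · rintro _ _ _ _ ⟨m, rfl⟩ ⟨n, rfl⟩
      refine ⟨m + n, ?_⟩
      ext z; simp [planeWaveC, planeWave_add]
  have hsep : S.SeparatesPoints := by
    intro x y hxy
    obtain ⟨i, hi⟩ := Function.ne_iff.mp hxy
    refine ⟨_, ⟨planeWaveC (Pi.single i 1), Algebra.subset_adjoin ⟨Pi.single i 1, rfl⟩, rfl⟩, ?_⟩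
    have h1 : ∀ z : Torus d, planeWaveC (Pi.single i 1) z = fourier 1 (z i) := by
      intro z
      change planeWave (Pi.single i 1) z = _
      rw [planeWave, Finset.prod_eq_single i]
      · simp
      · intro j _ hj; simp [hj]
      · simp
    change planeWaveC (Pi.single i 1) x ≠ planeWaveC (Pi.single i 1) y
    rw [h1, h1, fourier_one, fourier_one]
    exact fun h => hi (AddCircle.injective_toCircle Real.two_pi_pos.ne' (Circle.ext h))
  rw [← hS]
  exact congr_arg (Subalgebra.toSubmodule <| StarSubalgebra.toSubalgebra ·)
    (ContinuousMap.starSubalgebra_topologicalClosure_eq_top_of_separatesPoints S hsep)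

/-- A square-integrable function without Fourier coefficients vanishes. -/
lemma ae_eq_zero_of_sc {f : Torus d → ℂ} (hf : MemLp f 2 volume)
    (h : ∀ k, ∫ x, f x * planeWave (-k) x = 0) : f =ᵐ[volume] 0 := by
  set F : Lp ℂ 2 (volume : Measure (Torus d)) := hf.toLp f with hF
  have hden : (Submodule.span ℂ (range fun k : Fin d → ℤ =>
      ContinuousMap.toLp (E := ℂ) 2 (volume : Measure (Torus d)) ℂ (planeWaveC k))).topologicalClosure
      = ⊤ := by
    simpa only [Submodule.map_span, ContinuousLinearMap.coe_coe, ← range_comp, Function.comp_def]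
      using (ContinuousMap.toLp_denseRange ℂ (volume : Measure (Torus d)) ℂ
        (by norm_num : (2 : ENNReal) ≠ ⊤)).topologicalClosure_map_submodule
        span_planeWaveC_closure
  have hort : F ∈ (Submodule.span ℂ (range fun k : Fin d → ℤ =>
      ContinuousMap.toLp (E := ℂ) 2 (volume : Measure (Torus d)) ℂ (planeWaveC k)))ᗮ := by
    rw [Submodule.mem_orthogonal]
    intro u hu
    induction hu using Submodule.span_induction with
    | mem u hu =>
      obtain ⟨k, rfl⟩ := hu
      rw [MeasureTheory.L2.inner_def, ← h k]
      refine integral_congr_ae ?_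
      filter_upwards [ContinuousMap.coeFn_toLp (p := 2) (𝕜 := ℂ) volume (planeWaveC k),
        hf.coeFn_toLp] with x h1 h2
      rw [h1, h2, planeWave_neg]
      simp [planeWaveC]
    | zero => simp
    | add u v _ _ hu hv => rw [inner_add_left, hu, hv, add_zero]
    | smul c u _ hu => rw [inner_smul_left, hu, mul_zero]
  rw [← Submodule.orthogonal_closure, hden, Submodule.top_orthogonal_eq_bot, Submodule.mem_bot] at hort
  have h1 := hf.coeFn_toLp
  rw [← hF, hort] at h1
  exact h1.symm.trans (Lp.coeFn_zero _ _ _)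

lemma eq_zero_of_sc {f : Torus d → ℂ} (hf : Continuous f)
    (h : ∀ k, ∫ x, f x * planeWave (-k) x = 0) : f = 0 := by
  have h1 : MemLp f 2 volume := by
    obtain ⟨C, -, hC⟩ := exists_bound_of_continuous hf
    exact MemLp.of_bound hf.aestronglyMeasurable C (Eventually.of_forall hC)
  exact (Continuous.ae_eq_iff_eq volume hf continuous_zero).1 (ae_eq_zero_of_sc h1 h)

/-! #### Fourier series -/

/-- The function with Fourier coefficients `c`. -/
def fseries (c : (Fin d → ℤ) → ℂ) (x : Torus d) : ℂ :=
  (fnorm d : ℂ) * ∑' k, c k * planeWave k x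

lemma summable_mul_planeWave {c : (Fin d → ℤ) → ℂ} (hc : Summable fun k => ‖c k‖) (x : Torus d) :
    Summable fun k => c k * planeWave k x := by
  refine Summable.of_norm ?_
  simpa using hc

lemma continuous_fseries {c : (Fin d → ℤ) → ℂ} (hc : Summable fun k => ‖c k‖) :
    Continuous (fseries c) := by
  refine continuous_const.mul (continuous_tsum (fun k => ?_) hc fun k x => ?_)
  · exact continuous_const.mul (continuous_planeWave k)
  · simp

/-- Pairing with an absolutely convergent Fourier series. -/
lemma hasSum_integral_mul_fseries {c : (Fin d → ℤ) → ℂ} (hc : Summable fun k => ‖c k‖)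
    {φ : Torus d → ℂ} (hφ : Continuous φ) :
    HasSum (fun k => sc φ (-k) * c k) (∫ x, φ x * fseries c x) := by
  obtain ⟨C, hC, hb⟩ := exists_bound_of_continuous hφ
  have h1 : HasSum (fun k => ∫ x, φ x * (c k * planeWave k x))
      (∫ x, φ x * ∑' k, c k * planeWave k x) := by
    refine hasSum_integral_of_dominated_convergence (fun k _ => C * ‖c k‖) (fun k => ?_)
      (fun k => Eventually.of_forall fun x => ?_) (Eventually.of_forall fun x => hc.mul_left C)
      (integrable_const _) (Eventually.of_forall fun x => ?_)
    · exact (hφ.mul (continuous_const.mul (continuous_planeWave k))).aestronglyMeasurable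
    · rw [norm_mul, norm_mul, norm_planeWave, mul_one]
      gcongr; exact hb x
    · exact (summable_mul_planeWave hc x).hasSum.mul_left _
  have h2 := h1.mul_left (fnorm d : ℂ)
  have e1 : ∫ x, φ x * fseries c x = (fnorm d : ℂ) * ∫ x, φ x * ∑' k, c k * planeWave k x := by
    rw [← integral_const_mul]
    exact integral_congr_ae (Eventually.of_forall fun x => by simp only [fseries]; ring)
  rw [e1]
  refine h2.congr_fun fun k => ?_
  rw [sc, neg_neg, mul_assoc, ← integral_mul_const]
  congr 1
  exact integral_congr_ae (Eventually.of_forall fun x => by simp only; ring)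

lemma sc_planeWave (k l : Fin d → ℤ) :
    (fnorm d : ℂ) * ∫ x, planeWave (-k) x * planeWave l x = if l = k then (fnorm d : ℂ)⁻¹ else 0 := by
  have h1 : ∀ x : Torus d, planeWave (-k) x * planeWave l x = planeWave (l - k) x := fun x => by
    rw [← planeWave_add]; congr 1; abel
  simp only [h1]
  rw [integral_planeWave]
  simp only [sub_eq_zero]
  split_ifs with h
  · have h2 : (fnorm d : ℂ) ≠ 0 := Complex.ofReal_ne_zero.2 fnorm_pos.ne'
    have h3 : ((2 * Real.pi) ^ d : ℝ) = (fnorm d ^ 2)⁻¹ := by rw [fnorm_sq, inv_inv]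
    rw [h3]
    push_cast
    field_simp
  · simp

lemma sc_fseries {c : (Fin d → ℤ) → ℂ} (hc : Summable fun k => ‖c k‖) (k : Fin d → ℤ) :
    sc (fseries c) k = c k := by
  have h := (hasSum_integral_mul_fseries hc (continuous_planeWave (-k))).mul_left (fnorm d : ℂ)
  have h2 : (fnorm d : ℂ) ≠ 0 := Complex.ofReal_ne_zero.2 fnorm_pos.ne'
  have h1 : HasSum (fun l => (fnorm d : ℂ) * (sc (planeWave (-k)) (-l) * c l)) (c k) := by
    have h3 := hasSum_single (f := fun l => (fnorm d : ℂ) * (sc (planeWave (-k)) (-l) * c l)) k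
      (fun l hl => by simp [sc, sc_planeWave, hl])
    have h4 : (fnorm d : ℂ) * (sc (planeWave (-k)) (-k) * c k) = c k := by
      simp only [sc, neg_neg, sc_planeWave, if_true]
      field_simp
    rwa [h4] at h3
  rw [← h.unique h1, sc]
  congr 1
  exact integral_congr_ae (Eventually.of_forall fun x => mul_comm _ _)

/-- Fourier inversion. -/
lemma fseries_sc {u : Torus d → ℂ} (hu : Continuous u) (hs : Summable fun k => ‖sc u k‖) :
    fseries (sc u) = u := by
  have hc := continuous_fseries hs
  have h2 : (fnorm d : ℂ) ≠ 0 := Complex.ofReal_ne_zero.2 fnorm_pos.ne'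
  have : fseries (sc u) - u = 0 := by
    refine eq_zero_of_sc (hc.sub hu) fun k => ?_
    have h1 : sc (fseries (sc u)) k - sc u k = 0 := by rw [sc_fseries hs, sub_self]
    simp only [sc, ← mul_sub] at h1
    have h3 := (mul_eq_zero.1 h1).resolve_left h2
    rw [← integral_sub] at h3
    · rw [← h3]
      exact integral_congr_ae (Eventually.of_forall fun x => by
        simp only [Pi.sub_apply, sub_mul])
    · exact integrable_of_continuous (hc.mul (continuous_planeWave _))
    · exact integrable_of_continuous (hu.mul (continuous_planeWave _))
  exact sub_eq_zero.1 this

lemma hasSum_integral_mul {φ u : Torus d → ℂ} (hφ : Continuous φ) (hu : Continuous u)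
    (hs : Summable fun k => ‖sc u k‖) : HasSum (fun k => sc φ (-k) * sc u k) (∫ x, φ x * u x) := by
  have := hasSum_integral_mul_fseries hs hφ
  rwa [fseries_sc hu hs] at this

lemma sc_mul_planeWave (φ : Torus d → ℂ) (k l : Fin d → ℤ) :
    sc (fun x => φ x * planeWave (-k) x) (-l) = sc φ (k - l) := by
  unfold sc
  congr 1
  refine integral_congr_ae (Eventually.of_forall fun x => ?_)
  simp only
  rw [mul_assoc, ← planeWave_add]
  congr 2; abel

/-- The Fourier coefficients of a product are a convolution. -/
lemma hasSum_sc_mul {φ u : Torus d → ℂ} (hφ : Continuous φ) (hu : Continuous u)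
    (hs : Summable fun k => ‖sc u k‖) (p : Fin d → ℤ) :
    HasSum (fun q => (fnorm d : ℂ) * sc φ (p - q) * sc u q) (sc (fun x => φ x * u x) p) := by
  have h := (hasSum_integral_mul (hφ.mul (continuous_planeWave (-p))) hu hs).mul_left (fnorm d : ℂ)
  have e : sc (fun x => φ x * u x) p =
      (fnorm d : ℂ) * ∫ x, φ x * planeWave (-p) x * u x := by
    unfold sc
    congr 1
    exact integral_congr_ae (Eventually.of_forall fun x => by simp only; ring)
  rw [e]
  refine h.congr_fun fun q => ?_
  rw [← sc_mul_planeWave, mul_assoc]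
  rfl

end Fourier

/-! ### Smooth functions on the torus -/

section Smooth

open Set

variable {d : ℕ} {V : Type*} [NormedAddCommGroup V] [NormedSpace ℝ V]

lemma IsSmooth.differentiable {u : Torus d → V} (hu : IsSmooth u) :
    Differentiable ℝ fun y => u (cover y) :=
  ContDiff.differentiable hu (by simp)

lemma IsSmooth.hasDerivAt {u : Torus d → V} (hu : IsSmooth u) (y : Fin d → ℝ) (μ : Fin d) (s : ℝ) :
    HasDerivAt (fun s : ℝ => u (cover y + Pi.single μ (s : AddCircle (2 * Real.pi))))
      (fderiv ℝ (fun y => u (cover y)) (y + Pi.single μ s) (Pi.single μ 1)) s := by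
  simp only [cover_add_single]
  have h1 : HasDerivAt (fun s : ℝ => y + Pi.single μ s) (Pi.single μ (1 : ℝ)) s :=
    (hasDerivAt_single μ s).const_add y
  exact (hu.differentiable _).hasFDerivAt.comp_hasDerivAt s h1

lemma pd_cover {u : Torus d → V} (hu : IsSmooth u) (μ : Fin d) (y : Fin d → ℝ) :
    pd μ u (cover y) = fderiv ℝ (fun y => u (cover y)) y (Pi.single μ 1) := by
  have := (hu.hasDerivAt y μ 0).deriv
  simpa [pd] using this

lemma IsSmooth.hasDerivAt_pd {u : Torus d → V} (hu : IsSmooth u) (x : Torus d) (μ : Fin d) (s : ℝ) :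
    HasDerivAt (fun s : ℝ => u (x + Pi.single μ (s : AddCircle (2 * Real.pi))))
      (pd μ u (x + Pi.single μ (s : AddCircle (2 * Real.pi)))) s := by
  obtain ⟨y, rfl⟩ := isOpenQuotientMap_cover.surjective x
  rw [cover_add_single, pd_cover hu]
  exact hu.hasDerivAt y μ s

lemma IsSmooth.hasDerivAt_zero {u : Torus d → V} (hu : IsSmooth u) (x : Torus d) (μ : Fin d) :
    HasDerivAt (fun s : ℝ => u (x + Pi.single μ (s : AddCircle (2 * Real.pi)))) (pd μ u x) 0 := by
  simpa using hu.hasDerivAt_pd x μ 0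

lemma IsSmooth.pd {u : Torus d → V} (hu : IsSmooth u) (μ : Fin d) : IsSmooth (pd μ u) := by
  have h1 : (fun y : Fin d → ℝ => TorusHeat.pd μ u (cover y)) =
      fun y => fderiv ℝ (fun y => u (cover y)) y (Pi.single μ 1) := funext fun y => pd_cover hu μ y
  have h2 : ContDiff ℝ ((⊤ : ℕ∞) : WithTop ℕ∞) (fderiv ℝ fun y => u (cover y)) :=
    ContDiff.fderiv_right (n := ((⊤ : ℕ∞) : WithTop ℕ∞)) hu (by simp)
  change ContDiff ℝ _ fun y => TorusHeat.pd μ u (cover y)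
  rw [h1]
  exact h2.clm_apply contDiff_const

lemma isSmooth_const (c : V) : IsSmooth (fun _ : Torus d => c) :=
  contDiff_const (c := c)

lemma IsSmooth.add {u v : Torus d → V} (hu : IsSmooth u) (hv : IsSmooth v) :
    IsSmooth fun x => u x + v x := ContDiff.add hu hv

lemma IsSmooth.sub {u v : Torus d → V} (hu : IsSmooth u) (hv : IsSmooth v) :
    IsSmooth fun x => u x - v x := ContDiff.sub hu hv

lemma IsSmooth.mul {u v : Torus d → ℂ} (hu : IsSmooth u) (hv : IsSmooth v) :
    IsSmooth fun x => u x * v x := ContDiff.mul hu hv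

lemma IsSmooth.const_mul {u : Torus d → ℂ} (hu : IsSmooth u) (c : ℂ) :
    IsSmooth fun x => c * u x := (isSmooth_const c).mul hu

lemma IsSmooth.sum {κ : Type*} {s : Finset κ} {u : κ → Torus d → V} (hu : ∀ i ∈ s, IsSmooth (u i)) :
    IsSmooth fun x => ∑ i ∈ s, u i x := ContDiff.sum hu

lemma isSmooth_pi {κ : Type*} [Fintype κ] {u : Torus d → κ → ℂ} :
    IsSmooth u ↔ ∀ a, IsSmooth fun x => u x a := contDiff_pi

lemma isSmooth_planeWave (k : Fin d → ℤ) : IsSmooth (planeWave k) := by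
  change ContDiff ℝ _ fun y => planeWave k (cover y)
  simp only [planeWave_cover]
  exact (contDiff_const.mul (Complex.ofRealCLM.contDiff.comp (phase k).contDiff)).cexp

lemma pd_apply {κ : Type*} [Fintype κ] {u : Torus d → κ → ℂ} (hu : IsSmooth u) (μ : Fin d)
    (x : Torus d) (a : κ) : pd μ u x a = pd μ (fun x => u x a) x := by
  have h := hasDerivAt_pi.1 (hu.hasDerivAt_zero x μ) a
  exact h.unique ((isSmooth_pi.1 hu a).hasDerivAt_zero x μ)

lemma pd_mul {u v : Torus d → ℂ} (hu : IsSmooth u) (hv : IsSmooth v) (μ : Fin d) :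
    pd μ (fun x => u x * v x) = fun x => pd μ u x * v x + u x * pd μ v x := by
  funext x
  have h := (hu.hasDerivAt_zero x μ).mul (hv.hasDerivAt_zero x μ)
  simp only [QuotientAddGroup.mk_zero, Pi.single_zero, add_zero] at h
  exact ((hu.mul hv).hasDerivAt_zero x μ).unique h

lemma pd_planeWave (k : Fin d → ℤ) (μ : Fin d) :
    pd μ (planeWave k) = fun x => Complex.I * (k μ : ℂ) * planeWave k x := by
  funext x
  obtain ⟨y, rfl⟩ := isOpenQuotientMap_cover.surjective x
  refine ((isSmooth_planeWave k).hasDerivAt_zero _ μ).unique ?_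
  simp only [cover_add_single, planeWave_cover]
  have h1 : HasDerivAt (fun s : ℝ => phase k (y + Pi.single μ s)) (phase k (Pi.single μ 1)) 0 :=
    (phase k).hasFDerivAt.comp_hasDerivAt 0 ((hasDerivAt_single μ 0).const_add y)
  have h2 : phase k (Pi.single μ 1) = k μ := by
    rw [phase_apply, Finset.sum_eq_single μ] <;> simp +contextual
  have h3 := ((h1.ofReal_comp).const_mul Complex.I).cexp
  rw [h2, Pi.single_zero, add_zero] at h3
  refine h3.congr_deriv ?_
  push_cast
  ring

instance : (volume : Measure (Torus d)).IsAddRightInvariant :=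
  inferInstanceAs (Measure.pi fun _ => volume).IsAddRightInvariant

lemma integral_translate (u : Torus d → ℂ) (z : Torus d) : ∫ x, u (x + z) = ∫ x, u x :=
  integral_add_right_eq_self u z

/-- The integral of a derivative vanishes. -/
lemma integral_pd {u : Torus d → ℂ} (hu : IsSmooth u) (μ : Fin d) : ∫ x, pd μ u x = 0 := by
  obtain ⟨C, hC, hb⟩ := exists_bound_of_continuous (hu.pd μ).continuous
  set z : ℝ → Torus d := fun s => Pi.single μ (s : AddCircle (2 * Real.pi)) with hz
  have hz0 : z 0 = 0 := by simp [hz]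
  have hcont : ∀ s : ℝ, Continuous fun x : Torus d => u (x + z s) := fun s =>
    hu.continuous.comp (continuous_id.add continuous_const)
  have hcont' : Continuous fun x : Torus d => pd μ u (x + z 0) :=
    (hu.pd μ).continuous.comp (continuous_id.add continuous_const)
  have hd : ∀ (x : Torus d) (s : ℝ), HasDerivAt (fun s => u (x + z s)) (pd μ u (x + z s)) s :=
    fun x s => hu.hasDerivAt_pd x μ s
  clear_value z
  have h2 : HasDerivAt (fun s : ℝ => ∫ x, u (x + z s)) (∫ x, pd μ u (x + z 0)) 0 :=
    (hasDerivAt_integral_of_dominated_loc_of_deriv_le (μ := (volume : Measure (Torus d)))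
      (𝕜 := ℝ) (F := fun s x => u (x + z s)) (F' := fun s x => pd μ u (x + z s))
      (s := univ) (bound := fun _ => C) univ_mem
      (Eventually.of_forall fun s => (hcont s).aestronglyMeasurable)
      (integrable_of_continuous (hcont 0)) hcont'.aestronglyMeasurable
      (Eventually.of_forall fun x s _ => hb _) (integrable_const C)
      (Eventually.of_forall fun x s _ => hd x s)).2
  simp only [integral_translate] at h2
  exact h2.unique (hasDerivAt_const (0 : ℝ) _)

lemma sc_pd {u : Torus d → ℂ} (hu : IsSmooth u) (μ : Fin d) (k : Fin d → ℤ) :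
    sc (pd μ u) k = Complex.I * (k μ : ℂ) * sc u k := by
  have h := integral_pd (hu.mul (isSmooth_planeWave (-k))) μ
  rw [pd_mul hu (isSmooth_planeWave (-k)), integral_add, pd_planeWave] at h
  · have e : ∫ x, u x * (Complex.I * ((-k) μ : ℂ) * planeWave (-k) x) =
        -(Complex.I * (k μ : ℂ)) * ∫ x, u x * planeWave (-k) x := by
      rw [← integral_const_mul]
      refine integral_congr_ae (Eventually.of_forall fun x => ?_)
      simp only [Pi.neg_apply, Int.cast_neg]
      ring
    rw [e] at h
    unfold sc
    linear_combination (fnorm d : ℂ) * h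
  · exact integrable_of_continuous
      ((hu.pd μ).continuous.mul (continuous_planeWave _))
  · exact integrable_of_continuous
      (hu.continuous.mul ((isSmooth_planeWave _).pd μ).continuous)

/-- The Fourier coefficients of a smooth function decay rapidly. -/
lemma IsSmooth.sc_decay {u : Torus d → ℂ} (hu : IsSmooth u) (L : ℕ) :
    ∃ C : ℝ, 0 < C ∧ ∀ k, ‖sc u k‖ ≤ C * (jb k ^ L)⁻¹ := by
  induction L generalizing u with
  | zero =>
    obtain ⟨C, hC, hb⟩ := exists_bound_of_continuous hu.continuous
    have hf := fnorm_pos (d := d)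
    refine ⟨fnorm d * (C * (volume : Measure (Torus d)).real univ) + 1, by positivity, fun k => ?_⟩
    have h1 : ‖∫ x, u x * planeWave (-k) x‖ ≤ C * (volume : Measure (Torus d)).real univ :=
      norm_integral_le_of_norm_le_const (Eventually.of_forall fun x => by simpa using hb x)
    rw [sc, norm_mul, Complex.norm_real, Real.norm_of_nonneg hf.le]
    simp only [pow_zero, inv_one, mul_one]
    nlinarith
  | succ L ih =>
    obtain ⟨C, hC, h⟩ := ih hu
    choose D hD hD' using fun i => ih (hu.pd i)
    refine ⟨C + ∑ i, D i, by have := Finset.sum_nonneg fun i (_ : i ∈ Finset.univ) => (hD i).le; linarith,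
      fun k => ?_⟩
    have hj := jb_pos k
    have h1 : ‖sc u k‖ * jb k ≤ (C + ∑ i, D i) * (jb k ^ L)⁻¹ := by
      rw [jb, mul_add, mul_one, add_mul, Finset.mul_sum, Finset.sum_mul]
      refine add_le_add (h k) (Finset.sum_le_sum fun i _ => ?_)
      refine le_trans (le_of_eq ?_) (hD' i k)
      rw [sc_pd hu]
      simp [mul_comm]
    rw [pow_succ, mul_inv, ← mul_assoc, ← div_eq_mul_inv _ (jb k), le_div_iff₀ hj]
    exact h1

lemma summable_of_decay {c : (Fin d → ℤ) → ℂ} {C : ℝ}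
    (h : ∀ k, ‖c k‖ ≤ C * (jb k ^ (2 * d))⁻¹) : Summable fun k => ‖c k‖ :=
  Summable.of_nonneg_of_le (fun _ => norm_nonneg _) h (summable_jb_two_mul.mul_left C)

lemma IsSmooth.summable_sc {u : Torus d → ℂ} (hu : IsSmooth u) : Summable fun k => ‖sc u k‖ := by
  obtain ⟨C, -, h⟩ := hu.sc_decay (2 * d)
  exact summable_of_decay h

lemma iteratedDeriv_cexp_I (n : ℕ) : iteratedDeriv n (fun s : ℝ => Complex.exp (Complex.I * s)) =
    fun s : ℝ => Complex.I ^ n * Complex.exp (Complex.I * s) := by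
  induction n with
  | zero => simp
  | succ n ih =>
    rw [iteratedDeriv_succ, ih]
    funext s
    have h1 : HasDerivAt (fun s : ℝ => Complex.I * (s : ℂ)) Complex.I s := by
      simpa using (Complex.ofRealCLM.hasDerivAt (x := s)).const_mul Complex.I
    rw [(h1.cexp.const_mul (Complex.I ^ n)).deriv]
    ring

lemma norm_iteratedFDeriv_planeWave_le (k : Fin d → ℤ) (n : ℕ) (y : Fin d → ℝ) :
    ‖iteratedFDeriv ℝ n (fun y => planeWave k (cover y)) y‖ ≤ jb k ^ n := by
  have e : (fun y => planeWave k (cover y)) =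
      (fun s : ℝ => Complex.exp (Complex.I * s)) ∘ phase k := by
    funext y; rw [planeWave_cover]; rfl
  have hc : ContDiff ℝ n fun s : ℝ => Complex.exp (Complex.I * s) :=
    (contDiff_const.mul Complex.ofRealCLM.contDiff).cexp
  rw [e, ContinuousLinearMap.iteratedFDeriv_comp_right _ hc _ le_rfl]
  refine (ContinuousMultilinearMap.norm_compContinuousLinearMap_le _ _).trans ?_
  rw [norm_iteratedFDeriv_eq_norm_iteratedDeriv, iteratedDeriv_cexp_I]
  simp only [norm_mul, norm_pow, Complex.norm_I, one_pow, one_mul, Finset.prod_const,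
    Finset.card_univ, Fintype.card_fin]
  rw [mul_comm Complex.I, Complex.norm_exp_ofReal_mul_I, one_mul]
  exact pow_le_pow_left₀ (norm_nonneg _) (norm_phase_le k) n

/-- A Fourier series with rapidly decreasing coefficients is smooth. -/
lemma isSmooth_fseries {c : (Fin d → ℤ) → ℂ}
    (hc : ∀ L : ℕ, ∃ C : ℝ, 0 < C ∧ ∀ k, ‖c k‖ ≤ C * (jb k ^ L)⁻¹) : IsSmooth (fseries c) := by
  refine (isSmooth_const (fnorm d : ℂ)).mul ?_
  change ContDiff ℝ _ fun y => ∑' k, c k * planeWave k (cover y)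
  refine contDiff_tsum (v := fun n k => ‖c k‖ * jb k ^ n) (fun k => ?_) (fun n _ => ?_)
    fun n k y _ => ?_
  · exact contDiff_const.mul (isSmooth_planeWave k)
  · obtain ⟨C, hC, h⟩ := hc (2 * d + n)
    refine Summable.of_nonneg_of_le (fun k => ?_) (fun k => ?_)
      ((summable_jb_two_mul (d := d)).mul_left C)
    · have := jb_pos k; positivity
    · have := jb_pos k
      calc ‖c k‖ * jb k ^ n ≤ C * (jb k ^ (2 * d + n))⁻¹ * jb k ^ n := by gcongr; exact h k
        _ = _ := by rw [pow_add]; field_simp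
  · have h1 : (fun y => c k * planeWave k (cover y)) = c k • fun y => planeWave k (cover y) := rfl
    have h2 : ContDiffAt ℝ n (fun y => planeWave k (cover y)) y :=
      (ContDiff.of_le (isSmooth_planeWave k) (by exact_mod_cast le_top)).contDiffAt
    rw [h1, iteratedFDeriv_const_smul_apply h2, norm_smul]
    gcongr
    exact norm_iteratedFDeriv_planeWave_le k n y

end Smooth

/-! ### The Fourier basis of `L²` -/

section Basis

open Set

variable {d N : ℕ}

lemma memLp_section {u : Torus d → Fin N → ℂ} (hu : Continuous u) :
    MemLp (fun x => WithLp.toLp 2 (u x)) 2 (volume : Measure (Torus d)) := by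
  have hc : Continuous fun x => WithLp.toLp 2 (u x) := (PiLp.continuous_toLp 2 _).comp hu
  obtain ⟨C, hC⟩ := isCompact_univ.exists_bound_of_continuousOn hc.continuousOn
  exact MemLp.of_bound hc.aestronglyMeasurable C (Eventually.of_forall fun x => hC x (mem_univ x))

/-- The class in `L²` of a continuous section. -/
def toL2 (u : Torus d → Fin N → ℂ) (hu : Continuous u) : L2 d N := (memLp_section hu).toLp _

lemma coeFn_toL2 {u : Torus d → Fin N → ℂ} (hu : Continuous u) :
    toL2 u hu =ᵐ[volume] fun x => WithLp.toLp 2 (u x) := (memLp_section hu).coeFn_toLp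

lemma continuous_basisSection (q : Idx d N) : Continuous fun x : Torus d =>
    (Pi.single q.2 ((fnorm d : ℂ) * planeWave q.1 x) : Fin N → ℂ) :=
  (continuous_single q.2).comp (continuous_const.mul (continuous_planeWave q.1))

/-- The normalised plane wave `(2π)^{-d/2} e^{ikx}` in the component `a`. -/
def basisVec (q : Idx d N) : L2 d N := toL2 _ (continuous_basisSection q)

lemma inner_basisVec (q : Idx d N) (f : L2 d N) :
    inner ℂ (basisVec q) f = sc (fun x => f x q.2) q.1 := by
  rw [MeasureTheory.L2.inner_def, sc, ← integral_const_mul]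
  refine integral_congr_ae ?_
  filter_upwards [coeFn_toL2 (continuous_basisSection q)] with x hx
  rw [basisVec, hx, PiLp.inner_apply, Finset.sum_eq_single q.2]
  · simp [planeWave_neg]; ring
  · intro a _ ha; simp [ha]
  · simp

lemma sc_congr_ae {u v : Torus d → ℂ} (h : u =ᵐ[volume] v) (k : Fin d → ℤ) : sc u k = sc v k := by
  unfold sc
  congr 1
  refine integral_congr_ae ?_
  filter_upwards [h] with x hx
  rw [hx]

lemma sc_component {f : L2 d N} {u : Torus d → Fin N → ℂ}
    (h : f =ᵐ[volume] fun x => WithLp.toLp 2 (u x)) (q : Idx d N) :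
    sc (fun x => f x q.2) q.1 = sc (fun x => u x q.2) q.1 := by
  refine sc_congr_ae ?_ _
  filter_upwards [h] with x hx
  rw [hx]

lemma orthonormal_basisVec : Orthonormal ℂ (basisVec (d := d) (N := N)) := by
  rw [orthonormal_iff_ite]
  intro p q
  rw [inner_basisVec, sc_component (f := basisVec q) (coeFn_toL2 (continuous_basisSection q)), sc]
  have h2 : (fnorm d : ℂ) ≠ 0 := Complex.ofReal_ne_zero.2 fnorm_pos.ne'
  rcases eq_or_ne p.2 q.2 with h | h
  · have e : ∀ x : Torus d, (Pi.single q.2 ((fnorm d : ℂ) * planeWave q.1 x) : Fin N → ℂ) p.2 *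
        planeWave (-p.1) x = (fnorm d : ℂ) * (planeWave (-p.1) x * planeWave q.1 x) := by
      intro x; rw [h, Pi.single_eq_same]; ring
    simp only [e]
    rw [integral_const_mul, sc_planeWave]
    by_cases h1 : p = q
    · subst h1; simp [h2]
    · rw [if_neg h1, if_neg, mul_zero]
      exact fun h3 => h1 (Prod.ext h3.symm h)
  · have h1 : p ≠ q := fun h3 => h (by rw [h3])
    simp [h, h1]

/-- The Hilbert basis of plane waves. -/
def fourierBasis (d N : ℕ) : HilbertBasis (Idx d N) ℂ (L2 d N) :=
  HilbertBasis.mkOfOrthogonalEqBot orthonormal_basisVec <| by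
    rw [Submodule.eq_bot_iff]
    intro f hf
    rw [Submodule.mem_orthogonal] at hf
    have h1 : ∀ a : Fin N, (fun x => f x a) =ᵐ[volume] 0 := by
      intro a
      refine ae_eq_zero_of_sc ?_ fun k => ?_
      · exact (EuclideanSpace.proj (𝕜 := ℂ) a).comp_memLp' (Lp.memLp f)
      · have h2 := hf _ (Submodule.subset_span ⟨(k, a), rfl⟩)
        rw [inner_basisVec, sc] at h2
        exact (mul_eq_zero.1 h2).resolve_left (Complex.ofReal_ne_zero.2 fnorm_pos.ne')
    refine (Lp.eq_zero_iff_ae_eq_zero).2 ?_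
    filter_upwards [ae_all_iff.2 h1] with x hx
    ext a
    exact hx a

lemma fourierBasis_repr (f : L2 d N) (q : Idx d N) :
    (fourierBasis d N).repr f q = sc (fun x => f x q.2) q.1 := by
  rw [HilbertBasis.repr_apply_apply, fourierBasis, HilbertBasis.coe_mkOfOrthogonalEqBot,
    inner_basisVec]

end Basis

/-! ### The Laplace-type operator in Fourier space -/

section Laplace

open Set

variable {d N : ℕ}

lemma sc_add {u v : Torus d → ℂ} (hu : Continuous u) (hv : Continuous v) (k : Fin d → ℤ) :
    sc (fun x => u x + v x) k = sc u k + sc v k := by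
  unfold sc
  rw [← mul_add, ← integral_add]
  · simp only [add_mul]
  · exact integrable_of_continuous (hu.mul (continuous_planeWave _))
  · exact integrable_of_continuous (hv.mul (continuous_planeWave _))

lemma sc_const_mul (c : ℂ) (u : Torus d → ℂ) (k : Fin d → ℤ) :
    sc (fun x => c * u x) k = c * sc u k := by
  unfold sc
  simp only [mul_assoc]
  rw [integral_const_mul]
  ring

lemma sc_sum {κ : Type*} {s : Finset κ} {u : κ → Torus d → ℂ} (hu : ∀ i ∈ s, Continuous (u i))
    (k : Fin d → ℤ) : sc (fun x => ∑ i ∈ s, u i x) k = ∑ i ∈ s, sc (u i) k := by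
  unfold sc
  rw [← Finset.mul_sum, ← integral_finsetSum]
  · simp only [Finset.sum_mul]
  · exact fun i hi => integrable_of_continuous ((hu i hi).mul (continuous_planeWave _))

/-- The part of `-L` of first order in `E` and `ω`, as a matrix in Fourier space. -/
def pert1 (g : Matrix (Fin d) (Fin d) ℝ) (E : MatField d N) (ω : Fin d → MatField d N)
    (p q : Idx d N) : ℂ :=
  (fnorm d : ℂ) * ((∑ μ, ∑ ν, (g⁻¹ μ ν : ℂ) *
    (Complex.I * (p.1 μ : ℂ) * fCoeff (ω ν) (p.1 - q.1) p.2 q.2 +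
      Complex.I * (q.1 ν : ℂ) * fCoeff (ω μ) (p.1 - q.1) p.2 q.2)) +
    fCoeff E (p.1 - q.1) p.2 q.2)

/-- The part of `-L` of second order in `ω`, as a matrix in Fourier space. -/
def pert2 (g : Matrix (Fin d) (Fin d) ℝ) (ω : Fin d → MatField d N) (p q : Idx d N) : ℂ :=
  (fnorm d : ℂ) * ∑ μ, ∑ ν, (g⁻¹ μ ν : ℂ) *
    fCoeff (fun x => ω μ x * ω ν x) (p.1 - q.1) p.2 q.2

/-- The difference between `-L` and `∂²`, as a matrix in Fourier space. -/
def pert (g : Matrix (Fin d) (Fin d) ℝ) (E : MatField d N) (ω : Fin d → MatField d N)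
    (p q : Idx d N) : ℂ := pert1 g E ω p q + pert2 g ω p q

lemma IsSmoothMat.mul {u v : MatField d N} (hu : IsSmoothMat u) (hv : IsSmoothMat v) :
    IsSmoothMat fun x => u x * v x := by
  intro a b
  simp only [Matrix.mul_apply]
  exact IsSmooth.sum fun c _ => (hu a c).mul (hv c b)

lemma IsSmoothMat.fCoeff_decay {u : MatField d N} (hu : IsSmoothMat u) (L : ℕ) :
    ∃ C : ℝ, 0 < C ∧ ∀ k a b, ‖fCoeff u k a b‖ ≤ C * (jb k ^ L)⁻¹ := by
  choose C hC h using fun a b => (hu a b).sc_decay L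
  have hsum : ∀ a b, C a b ≤ ∑ a, ∑ b, C a b := fun a b =>
    (Finset.single_le_sum (f := fun b => C a b) (fun b _ => (hC a b).le) (Finset.mem_univ b)).trans
      (Finset.single_le_sum (f := fun a => ∑ b, C a b)
        (fun a _ => Finset.sum_nonneg fun b _ => (hC a b).le) (Finset.mem_univ a))
  have h0 : 0 ≤ ∑ a, ∑ b, C a b :=
    Finset.sum_nonneg fun a _ => Finset.sum_nonneg fun b _ => (hC a b).le
  refine ⟨∑ a, ∑ b, C a b + 1, by linarith, fun k a b => ?_⟩
  rw [fCoeff_apply]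
  refine (h a b k).trans ?_
  have := inv_jb_pow_nonneg k L
  gcongr
  linarith [hsum a b]

lemma pert1_bound (g : Matrix (Fin d) (Fin d) ℝ) {E : MatField d N} {ω : Fin d → MatField d N}
    (hE : IsSmoothMat E) (hω : ∀ μ, IsSmoothMat (ω μ)) (L : ℕ) : ∃ C : ℝ, 0 < C ∧
      ∀ r q : Idx d N, ‖pert1 g E ω r q‖ ≤ C * gam L r q * vel q := by
  obtain ⟨C, hC, hCE⟩ := hE.fCoeff_decay L
  choose D hD hDω using fun μ => (hω μ).fCoeff_decay (L + 1)
  have hS : 0 ≤ ∑ μ, ∑ ν, |g⁻¹ μ ν| * (D ν + D μ) := Finset.sum_nonneg fun μ _ =>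
    Finset.sum_nonneg fun ν _ => mul_nonneg (abs_nonneg _) (add_nonneg (hD ν).le (hD μ).le)
  have hf := fnorm_pos (d := d)
  refine ⟨fnorm d * ((∑ μ, ∑ ν, |g⁻¹ μ ν| * (D ν + D μ)) + C), by positivity, fun r q => ?_⟩
  have hj := one_le_jb q.1
  have hj0 := jb_pos (r.1 - q.1)
  have hγ := gam_nonneg L r q
  have hr : jb r.1 ≤ jb (r.1 - q.1) * jb q.1 := by
    simpa using jb_add_le_mul (r.1 - q.1) q.1
  have hq : jb q.1 ≤ jb (r.1 - q.1) * jb q.1 := by nlinarith [one_le_jb (r.1 - q.1)]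
  have e : (jb (r.1 - q.1) ^ (L + 1))⁻¹ * (jb (r.1 - q.1) * jb q.1) = gam L r q * vel q := by
    unfold gam vel; rw [pow_succ]; field_simp
  have key : ∀ (μ ν : Fin d) (k : Fin d → ℤ), jb k ≤ jb (r.1 - q.1) * jb q.1 →
      ‖Complex.I * (k μ : ℂ) * fCoeff (ω ν) (r.1 - q.1) r.2 q.2‖ ≤ D ν * (gam L r q * vel q) := by
    intro μ ν k hk
    rw [norm_mul, norm_mul, Complex.norm_I, one_mul, Complex.norm_intCast, ← e]
    calc _ ≤ (jb (r.1 - q.1) * jb q.1) * (D ν * (jb (r.1 - q.1) ^ (L + 1))⁻¹) := by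
          gcongr
          · exact (abs_le_jb k μ).trans hk
          · exact hDω ν _ _ _
      _ = _ := by ring
  rw [pert1, norm_mul, Complex.norm_real, Real.norm_of_nonneg hf.le, mul_assoc, mul_assoc]
  refine mul_le_mul_of_nonneg_left ?_ hf.le
  rw [add_mul]
  refine (norm_add_le _ _).trans (add_le_add ?_ ?_)
  · rw [Finset.sum_mul]
    refine norm_sum_le_of_le _ fun μ _ => ?_
    rw [Finset.sum_mul]
    refine norm_sum_le_of_le _ fun ν _ => ?_
    rw [norm_mul, Complex.norm_real, Real.norm_eq_abs, mul_assoc |g⁻¹ μ ν|]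
    refine mul_le_mul_of_nonneg_left ?_ (abs_nonneg _)
    rw [add_mul]
    exact (norm_add_le _ _).trans (add_le_add (key μ ν r.1 hr) (key ν μ q.1 hq))
  · have h1 := hCE (r.1 - q.1) r.2 q.2
    refine h1.trans ?_
    have h2 : gam L r q * 1 ≤ gam L r q * vel q := mul_le_mul_of_nonneg_left hj hγ
    rw [mul_one] at h2
    exact mul_le_mul_of_nonneg_left h2 hC.le

lemma pert2_bound (g : Matrix (Fin d) (Fin d) ℝ) {ω : Fin d → MatField d N}
    (hω : ∀ μ, IsSmoothMat (ω μ)) (L : ℕ) : ∃ C : ℝ, 0 < C ∧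
      ∀ r q : Idx d N, ‖pert2 g ω r q‖ ≤ C * gam L r q * vel q := by
  choose D hD hDω using fun μ ν => ((hω μ).mul (hω ν)).fCoeff_decay L
  have hS : 0 ≤ ∑ μ, ∑ ν, |g⁻¹ μ ν| * D μ ν := Finset.sum_nonneg fun μ _ =>
    Finset.sum_nonneg fun ν _ => mul_nonneg (abs_nonneg _) (hD μ ν).le
  have hf := fnorm_pos (d := d)
  refine ⟨fnorm d * ((∑ μ, ∑ ν, |g⁻¹ μ ν| * D μ ν) + 1), by positivity, fun r q => ?_⟩
  have hj : 1 ≤ vel q := one_le_jb q.1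
  have hγ := gam_nonneg L r q
  rw [pert2, norm_mul, Complex.norm_real, Real.norm_of_nonneg hf.le, mul_assoc, mul_assoc]
  refine mul_le_mul_of_nonneg_left ?_ hf.le
  have h2 : gam L r q * 1 ≤ gam L r q * vel q := mul_le_mul_of_nonneg_left hj hγ
  have h3 : 0 ≤ gam L r q * vel q := mul_nonneg hγ (vel_nonneg q)
  have h1 : ‖∑ μ, ∑ ν, (g⁻¹ μ ν : ℂ) * fCoeff (fun x => ω μ x * ω ν x) (r.1 - q.1) r.2 q.2‖ ≤
      (∑ μ, ∑ ν, |g⁻¹ μ ν| * D μ ν) * (gam L r q * vel q) := by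
    rw [Finset.sum_mul]
    refine norm_sum_le_of_le _ fun μ _ => ?_
    rw [Finset.sum_mul]
    refine norm_sum_le_of_le _ fun ν _ => ?_
    rw [norm_mul, Complex.norm_real, Real.norm_eq_abs, mul_assoc]
    refine mul_le_mul_of_nonneg_left ((hDω μ ν _ _ _).trans ?_) (abs_nonneg _)
    refine mul_le_mul_of_nonneg_left ?_ (hD μ ν).le
    exact le_trans (le_of_eq (by rw [mul_one]; rfl)) h2
  refine h1.trans ?_
  nlinarith

lemma isPert_pert (g : Matrix (Fin d) (Fin d) ℝ) {E : MatField d N} {ω : Fin d → MatField d N}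
    (hE : IsSmoothMat E) (hω : ∀ μ, IsSmoothMat (ω μ)) : IsPert (pert g E ω) := by
  intro L
  obtain ⟨C, hC, h⟩ := pert1_bound g hE hω L
  obtain ⟨D, hD, h'⟩ := pert2_bound g hω L
  refine ⟨C + D, by positivity, fun r q => ?_⟩
  refine (norm_add_le _ _).trans ((add_le_add (h r q) (h' r q)).trans (le_of_eq (by ring)))

lemma hasSum_idx {f : Idx d N → ℂ} {s : Fin N → ℂ} (h : ∀ b, HasSum (fun k => f (k, b)) (s b)) :
    HasSum f (∑ b, s b) := by
  classical
  have h1 : ∀ b, HasSum (fun q : Idx d N => if q.2 = b then f q else 0) (s b) := by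
    intro b
    have hinj : Function.Injective fun k : Fin d → ℤ => ((k, b) : Idx d N) := fun k l hkl =>
      (Prod.ext_iff.1 hkl).1
    refine (hinj.hasSum_iff fun q hq => ?_).1 ?_
    · refine if_neg fun hb => hq ⟨q.1, ?_⟩
      exact Prod.ext rfl hb.symm
    · simpa [Function.comp_def] using h b
  have h2 := hasSum_sum (s := Finset.univ) fun b _ => h1 b
  simpa using h2

variable {g : Matrix (Fin d) (Fin d) ℝ} {E : MatField d N} {ω : Fin d → MatField d N}
  {u : Torus d → Fin N → ℂ}

lemma isSmooth_mulVec {A : MatField d N} (hA : IsSmoothMat A) (hu : IsSmooth u) :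
    IsSmooth fun x => (A x).mulVec (u x) := by
  refine isSmooth_pi.2 fun a => ?_
  simp only [Matrix.mulVec, dotProduct]
  exact IsSmooth.sum fun b _ => (hA a b).mul (isSmooth_pi.1 hu b)

lemma isSmooth_covDeriv (hω : ∀ μ, IsSmoothMat (ω μ)) (hu : IsSmooth u) (μ : Fin d) :
    IsSmooth (covDeriv ω μ u) := (hu.pd μ).add (isSmooth_mulVec (hω μ) hu)

lemma IsSmooth.const_smul_pi (hu : IsSmooth u) (c : ℂ) : IsSmooth fun x => c • u x :=
  isSmooth_pi.2 fun a => (isSmooth_pi.1 hu a).const_mul c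

lemma isSmooth_neg_laplaceType (hE : IsSmoothMat E) (hω : ∀ μ, IsSmoothMat (ω μ))
    (hu : IsSmooth u) : IsSmooth fun x => -laplaceType g E ω u x := by
  unfold laplaceType
  simp only [neg_neg]
  refine IsSmooth.add (IsSmooth.sum fun μ _ => IsSmooth.sum fun ν _ => ?_) (isSmooth_mulVec hE hu)
  exact (isSmooth_covDeriv hω (isSmooth_covDeriv hω hu ν) μ).const_smul_pi _

/-- Multiplication by a smooth matrix in Fourier space. -/
lemma hasSum_sc_mulVec {A : MatField d N} (hA : IsSmoothMat A) (hu : IsSmooth u) (p : Idx d N) :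
    HasSum (fun q : Idx d N => (fnorm d : ℂ) * fCoeff A (p.1 - q.1) p.2 q.2 *
      sc (fun x => u x q.2) q.1) (sc (fun x => (A x).mulVec (u x) p.2) p.1) := by
  have e : sc (fun x => (A x).mulVec (u x) p.2) p.1 = ∑ b, sc (fun x => A x p.2 b * u x b) p.1 := by
    simp only [Matrix.mulVec, dotProduct]
    exact sc_sum (fun b _ => ((hA p.2 b).mul (isSmooth_pi.1 hu b)).continuous) _
  rw [e]
  refine hasSum_idx fun b => ?_
  exact hasSum_sc_mul (hA p.2 b).continuous (isSmooth_pi.1 hu b).continuous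
    (isSmooth_pi.1 hu b).summable_sc p.1

lemma sc_pd_apply (hu : IsSmooth u) (μ : Fin d) (q : Idx d N) :
    sc (fun x => pd μ u x q.2) q.1 = Complex.I * (q.1 μ : ℂ) * sc (fun x => u x q.2) q.1 := by
  rw [← sc_pd (isSmooth_pi.1 hu q.2)]
  congr 1
  funext x
  exact pd_apply hu μ x q.2

lemma sc_covDeriv (hω : ∀ μ, IsSmoothMat (ω μ)) (hu : IsSmooth u) (μ : Fin d) (p : Idx d N) :
    sc (fun x => covDeriv ω μ u x p.2) p.1 = Complex.I * (p.1 μ : ℂ) * sc (fun x => u x p.2) p.1 +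
      sc (fun x => (ω μ x).mulVec (u x) p.2) p.1 := by
  rw [← sc_pd_apply hu]
  exact sc_add (isSmooth_pi.1 (hu.pd μ) p.2).continuous
    (isSmooth_pi.1 (isSmooth_mulVec (hω μ) hu) p.2).continuous _

lemma sc_mulVec_covDeriv (hω : ∀ μ, IsSmoothMat (ω μ)) (hu : IsSmooth u) (μ ν : Fin d)
    (p : Idx d N) : sc (fun x => (ω μ x).mulVec (covDeriv ω ν u x) p.2) p.1 =
      sc (fun x => (ω μ x).mulVec (pd ν u x) p.2) p.1 +
      sc (fun x => ((ω μ x * ω ν x).mulVec (u x)) p.2) p.1 := by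
  rw [← sc_add (isSmooth_pi.1 (isSmooth_mulVec (hω μ) (hu.pd ν)) p.2).continuous
    (isSmooth_pi.1 (isSmooth_mulVec ((hω μ).mul (hω ν)) hu) p.2).continuous]
  congr 1
  funext x
  simp only [covDeriv, Matrix.mulVec_add, Matrix.mulVec_mulVec, Pi.add_apply]

/-- In Fourier space `-L` is the matrix `-q² + B` with `B = pert g E ω`. -/
lemma sc_neg_laplaceType (hE : IsSmoothMat E) (hω : ∀ μ, IsSmoothMat (ω μ)) (hu : IsSmooth u)
    (p : Idx d N) : HasSum (fun q => genMatrix g (pert g E ω) p q * sc (fun x => u x q.2) q.1)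
      (sc (fun x => (-laplaceType g E ω u x) p.2) p.1) := by
  have hcc : ∀ μ ν, IsSmooth (covDeriv ω μ (covDeriv ω ν u)) := fun μ ν =>
    isSmooth_covDeriv hω (isSmooth_covDeriv hω hu ν) μ
  have e : sc (fun x => (-laplaceType g E ω u x) p.2) p.1 =
      (∑ μ, ∑ ν, (g⁻¹ μ ν : ℂ) * sc (fun x => covDeriv ω μ (covDeriv ω ν u) x p.2) p.1) +
      sc (fun x => (E x).mulVec (u x) p.2) p.1 := by
    have e1 : (fun x => (-laplaceType g E ω u x) p.2) = fun x =>
        (∑ μ, ∑ ν, (g⁻¹ μ ν : ℂ) * covDeriv ω μ (covDeriv ω ν u) x p.2) +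
          (E x).mulVec (u x) p.2 := by
      funext x
      simp [laplaceType, Finset.sum_apply]
    have hs : ∀ μ ν, Continuous fun x => (g⁻¹ μ ν : ℂ) * covDeriv ω μ (covDeriv ω ν u) x p.2 :=
      fun μ ν => ((isSmooth_pi.1 (hcc μ ν) p.2).const_mul _).continuous
    rw [e1, sc_add (continuous_finsetSum _ fun μ _ => continuous_finsetSum _ fun ν _ => hs μ ν)
      (isSmooth_pi.1 (isSmooth_mulVec hE hu) p.2).continuous,
      sc_sum (fun μ _ => continuous_finsetSum _ fun ν _ => hs μ ν)]
    congr 1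
    refine Finset.sum_congr rfl fun μ _ => ?_
    rw [sc_sum (fun ν _ => hs μ ν)]
    exact Finset.sum_congr rfl fun ν _ => sc_const_mul _ _ _
  have hterm : ∀ μ ν, HasSum (fun q : Idx d N => (Complex.I * (p.1 μ : ℂ)) *
      ((if p = q then Complex.I * (p.1 ν : ℂ) * sc (fun x => u x q.2) q.1 else 0) +
        (fnorm d : ℂ) * fCoeff (ω ν) (p.1 - q.1) p.2 q.2 * sc (fun x => u x q.2) q.1) +
      ((fnorm d : ℂ) * fCoeff (ω μ) (p.1 - q.1) p.2 q.2 *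
        (Complex.I * (q.1 ν : ℂ) * sc (fun x => u x q.2) q.1) +
        (fnorm d : ℂ) * fCoeff (fun x => ω μ x * ω ν x) (p.1 - q.1) p.2 q.2 *
          sc (fun x => u x q.2) q.1))
      (sc (fun x => covDeriv ω μ (covDeriv ω ν u) x p.2) p.1) := by
    intro μ ν
    rw [sc_covDeriv hω (isSmooth_covDeriv hω hu ν), sc_covDeriv hω hu, sc_mulVec_covDeriv hω hu]
    refine HasSum.add (HasSum.mul_left _ (HasSum.add ?_ (hasSum_sc_mulVec (hω ν) hu p)))
      (HasSum.add ?_ (hasSum_sc_mulVec ((hω μ).mul (hω ν)) hu p))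
    · have := hasSum_single (f := fun q : Idx d N => if p = q then
        Complex.I * (p.1 ν : ℂ) * sc (fun x => u x q.2) q.1 else 0) p
        (fun q hq => by simp [hq.symm])
      simpa using this
    · have := hasSum_sc_mulVec (hω μ) (hu.pd ν) p
      simpa only [sc_pd_apply hu] using this
  rw [e]
  have h1 := (hasSum_sum (s := Finset.univ) fun μ _ => hasSum_sum (s := Finset.univ) fun ν _ =>
    (hterm μ ν).mul_left (g⁻¹ μ ν : ℂ)).add (hasSum_sc_mulVec hE hu p)
  refine h1.congr_fun fun q => ?_
  have hI : Complex.I * Complex.I = -1 := Complex.I_mul_I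
  rw [genMatrix, pert, pert1, pert2, energy, normSq]
  generalize sc (fun x => u x q.2) q.1 = S
  have split : ∀ A B Z F f : ℂ, (A + (f * (B + F) + f * Z)) * S =
      (A * S + f * B * S + f * Z * S) + f * F * S := fun A B Z F f => by ring
  rw [split]
  congr 1
  by_cases hpq : p = q
  · subst hpq
    simp only [if_true]
    push_cast
    simp only [← Finset.sum_neg_distrib, Finset.mul_sum, Finset.sum_mul]
    simp only [← Finset.sum_add_distrib]
    refine Finset.sum_congr rfl fun μ _ => Finset.sum_congr rfl fun ν _ => ?_
    linear_combination ((g⁻¹ μ ν : ℂ) * p.1 μ * p.1 ν * S) * -hI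
  · simp only [if_neg hpq, zero_mul, zero_add]
    simp only [Finset.mul_sum, Finset.sum_mul]
    simp only [← Finset.sum_add_distrib]
    refine Finset.sum_congr rfl fun μ _ => Finset.sum_congr rfl fun ν _ => ?_
    ring

end Laplace

/-! ### Existence, uniqueness and trace of the heat semigroup -/

section Existence

open Set

variable {d N : ℕ} {g : Matrix (Fin d) (Fin d) ℝ} {E : MatField d N} {ω : Fin d → MatField d N}
  {G : ℝ≥0 → L2 d N →L[ℂ] L2 d N}

lemma rapidDecay_of_isSmooth {u : Torus d → Fin N → ℂ} (hu : IsSmooth u) :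
    RapidDecay fun q : Idx d N => sc (fun x => u x q.2) q.1 := by
  intro L
  choose C hC h using fun a => (isSmooth_pi.1 hu a).sc_decay L
  have h0 : 0 ≤ ∑ a, C a := Finset.sum_nonneg fun a _ => (hC a).le
  refine ⟨∑ a, C a + 1, by linarith, fun q => (h q.2 q.1).trans ?_⟩
  have := inv_jb_pow_nonneg q.1 L
  gcongr
  linarith [Finset.single_le_sum (f := C) (fun a _ => (hC a).le) (Finset.mem_univ q.2)]

lemma exists_isSmooth_of_rapidDecay {f : L2 d N} (hf : RapidDecay ((fourierBasis d N).repr f)) :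
    ∃ u : Torus d → Fin N → ℂ, IsSmooth u ∧ f =ᵐ[volume] fun x => WithLp.toLp 2 (u x) := by
  set c := (fourierBasis d N).repr f with hc
  have hdec : ∀ a : Fin N, ∀ L : ℕ, ∃ C : ℝ, 0 < C ∧ ∀ k, ‖c (k, a)‖ ≤ C * (jb k ^ L)⁻¹ := by
    intro a L
    obtain ⟨C, hC, h⟩ := hf L
    exact ⟨C, hC, fun k => h (k, a)⟩
  have hu : IsSmooth fun (x : Torus d) (a : Fin N) => fseries (fun k => c (k, a)) x :=
    isSmooth_pi.2 fun a => isSmooth_fseries (hdec a)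
  refine ⟨_, hu, ?_⟩
  have e : f = toL2 _ hu.continuous := by
    refine repr_ext (fourierBasis d N) fun p => ?_
    rw [fourierBasis_repr (toL2 _ _), sc_component (coeFn_toL2 hu.continuous), ← hc]
    obtain ⟨C, -, h⟩ := hdec p.2 (2 * d)
    exact (sc_fseries (summable_of_decay h) p.1).symm
  conv_lhs => rw [e]
  exact coeFn_toL2 hu.continuous

lemma negGraph_subset (hg : g.PosDef) (hE : IsSmoothMat E) (hω : ∀ μ, IsSmoothMat (ω μ))
    (hG : HasHeatMatrix g (pert g E ω) (fourierBasis d N) G) :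
    negGraph g E ω ⊆ generatorGraph G := by
  rintro ⟨x, y⟩ ⟨u, hu, hx, hy⟩
  have hxr : ∀ q, (fourierBasis d N).repr x q = sc (fun x => u x q.2) q.1 := fun q => by
    rw [fourierBasis_repr, sc_component hx]
  refine hG.mem_generatorGraph hg (isPert_pert g hE hω) ?_ fun p => ?_
  · intro L
    obtain ⟨C, hC, h⟩ := rapidDecay_of_isSmooth hu L
    exact ⟨C, hC, fun q => by rw [hxr]; exact h q⟩
  · rw [fourierBasis_repr, sc_component hy, ← (sc_neg_laplaceType hE hω hu p).tsum_eq]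
    exact tsum_congr fun q => by rw [hxr]

/-- The smoothing property of the semigroup makes the smooth sections a core of its generator. -/
lemma generatorGraph_subset_closure (hg : g.PosDef) (hE : IsSmoothMat E)
    (hω : ∀ μ, IsSmoothMat (ω μ)) (hG : HasHeatMatrix g (pert g E ω) (fourierBasis d N) G) :
    generatorGraph G ⊆ closure (negGraph g E ω) := by
  rintro ⟨ψ, χ⟩ hψ
  have hB := isPert_pert g hE hω
  have hS := hG.isC0Semigroup hg hB
  have hmem : ∀ t : ℝ≥0, 0 < t → (G t ψ, G t χ) ∈ negGraph g E ω := by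
    intro t ht
    obtain ⟨u, hu, hux⟩ := exists_isSmooth_of_rapidDecay (hG.rapidDecay hg hB ht ψ)
    have hL := isSmooth_neg_laplaceType (g := g) hE hω hu
    have h1 : (G t ψ, toL2 _ hL.continuous) ∈ generatorGraph G :=
      negGraph_subset hg hE hω hG ⟨u, hu, hux, coeFn_toL2 hL.continuous⟩
    have h2 : (G t ψ, G t χ) ∈ generatorGraph G := hS.generatorGraph_apply hψ t
    rw [generatorGraph_unique h2 h1]
    exact ⟨u, hu, hux, coeFn_toL2 hL.continuous⟩
  have hlim : Tendsto (fun t : ℝ≥0 => (G t ψ, G t χ)) (𝓝[>] 0) (𝓝 (ψ, χ)) := by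
    have h0 : ∀ φ, Tendsto (fun t : ℝ≥0 => G t φ) (𝓝[>] 0) (𝓝 φ) := fun φ => by
      have := (hS.cont φ).tendsto 0
      rw [hS.zero] at this
      exact this.mono_left nhdsWithin_le_nhds
    exact (h0 ψ).prodMk_nhds (h0 χ)
  exact mem_closure_of_tendsto hlim (eventually_nhdsWithin_of_forall fun t ht => hmem t ht)

lemma HasHeatMatrix.isHeatSemigroup (hG : HasHeatMatrix g (pert g E ω) (fourierBasis d N) G)
    (hg : g.PosDef) (hE : IsSmoothMat E) (hω : ∀ μ, IsSmoothMat (ω μ)) :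
    IsHeatSemigroup g E ω G := by
  have hS := hG.isC0Semigroup hg (isPert_pert g hE hω)
  exact ⟨hS, (generatorGraph_subset_closure hg hE hω hG).antisymm
    (closure_minimal (negGraph_subset hg hE hω hG) hS.isClosed_generatorGraph)⟩

lemma HasHeatMatrix.eq_of_isHeatSemigroup
    (hG : HasHeatMatrix g (pert g E ω) (fourierBasis d N) G)
    (hg : g.PosDef) (hE : IsSmoothMat E) (hω : ∀ μ, IsSmoothMat (ω μ))
    {G' : ℝ≥0 → L2 d N →L[ℂ] L2 d N} (hG' : IsHeatSemigroup g E ω G') : G' = G := by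
  have hB := isPert_pert g hE hω
  obtain ⟨hS, hgr⟩ := hG.isHeatSemigroup hg hE hω
  refine hS.eq_of_generatorGraph_eq hG'.1 (hG'.2.trans hgr.symm) fun ψ => ?_
  have h0 : Tendsto (fun t : ℝ≥0 => G t ψ) (𝓝[>] 0) (𝓝 ψ) := by
    have := (hS.cont ψ).tendsto 0
    rw [hS.zero] at this
    exact this.mono_left nhdsWithin_le_nhds
  refine mem_closure_of_tendsto h0 (eventually_nhdsWithin_of_forall fun t ht => ?_)
  obtain ⟨u, hu, hux⟩ := exists_isSmooth_of_rapidDecay (hG.rapidDecay hg hB ht ψ)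
  exact ⟨_, negGraph_subset hg hE hω hG
    ⟨u, hu, hux, coeFn_toL2 (isSmooth_neg_laplaceType (g := g) hE hω hu).continuous⟩⟩

theorem existsUnique_isHeatSemigroup (hg : g.PosDef) (hE : IsSmoothMat E)
    (hω : ∀ μ, IsSmoothMat (ω μ)) :
    ∃! G : ℝ≥0 → L2 d N →L[ℂ] L2 d N, IsHeatSemigroup g E ω G := by
  obtain ⟨G, hG⟩ := exists_hasHeatMatrix hg (isPert_pert g hE hω) (fourierBasis d N)
  exact ⟨G, hG.isHeatSemigroup hg hE hω, fun G' hG' => hG.eq_of_isHeatSemigroup hg hE hω hG'⟩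

lemma hasTrace_heatSemigroup_tsum (hg : g.PosDef) (hE : IsSmoothMat E)
    (hω : ∀ μ, IsSmoothMat (ω μ)) {t : ℝ≥0} (ht : 0 < t) :
    HasTrace (heatSemigroup g E ω t) (∑' p, heatKernel g (pert g E ω) t p p) := by
  have hB := isPert_pert g hE hω
  obtain ⟨G, hG⟩ := exists_hasHeatMatrix hg hB (fourierBasis d N)
  have hh : IsHeatSemigroup g E ω (heatSemigroup g E ω) :=
    Classical.epsilon_spec (existsUnique_isHeatSemigroup hg hE hω).exists
  rw [hG.eq_of_isHeatSemigroup hg hE hω hh]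
  exact hasTrace_of_summable (fourierBasis d N) (summable_heatKernel hg hB (NNReal.coe_pos.2 ht))
    (hG.apply_basis t)

theorem hasTrace_heatSemigroup (hg : g.PosDef) (hE : IsSmoothMat E)
    (hω : ∀ μ, IsSmoothMat (ω μ)) {t : ℝ≥0} (ht : 0 < t) :
    HasTrace (heatSemigroup g E ω t) (heatTrace g E ω t) :=
  Classical.epsilon_spec ⟨_, hasTrace_heatSemigroup_tsum hg hE hω ht⟩

theorem heatTrace_eq_tsum (hg : g.PosDef) (hE : IsSmoothMat E)
    (hω : ∀ μ, IsSmoothMat (ω μ)) {t : ℝ≥0} (ht : 0 < t) :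
    heatTrace g E ω t = ∑' p, heatKernel g (pert g E ω) t p p :=
  hasTrace_unique (hasTrace_heatSemigroup hg hE hω ht) (hasTrace_heatSemigroup_tsum hg hE hω ht)

end Existence

/-! ### Convergence of the form factors -/

section FormFactors

open Set

variable {d : ℕ} {g : Matrix (Fin d) (Fin d) ℝ}

lemma exp_normSq_le (hg : g.PosDef) {t : ℝ} (ht : 0 < t) (L : ℕ) :
    ∃ C : ℝ, 0 < C ∧ ∀ k, Real.exp (-t * normSq g k) ≤ C * (jb k ^ L)⁻¹ := by
  obtain ⟨C, hC, h⟩ := wt_le_jb (N := 1) hg L ht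
  refine ⟨wtC L * C, mul_pos (wtC_pos L) hC, fun k => ?_⟩
  have h1 := wt_mul_exp_le L le_rfl ht.le (normSq_nonneg hg k)
  simp only [wt_zero_left, one_mul, sub_zero] at h1
  have h2 : Real.exp (-t * (normSq g k / 2)) ≤ 1 := by
    rw [Real.exp_le_one_iff]
    have := mul_nonneg ht.le (normSq_nonneg hg k)
    linarith
  have h3 : wt L t (normSq g k) ≤ C * (jb k ^ L)⁻¹ :=
    (h (k, 0)).trans (mul_le_mul_of_nonneg_left (inv_jb_pow_anti _ (by omega)) hC.le)
  have h4 := wt_pos (m := L) ht.le (normSq_nonneg hg k)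
  have h5 := wtC_pos L
  calc _ ≤ wtC L * 1 * wt L t (normSq g k) := h1.trans (by gcongr)
    _ ≤ wtC L * 1 * (C * (jb k ^ L)⁻¹) := by gcongr
    _ = _ := by ring

lemma summable_jb_mul_exp (hg : g.PosDef) {t : ℝ} (ht : 0 < t) (n : ℕ) :
    Summable fun q => jb q ^ n * Real.exp (-t * normSq g q) := by
  obtain ⟨C, hC, h⟩ := exp_normSq_le hg ht (n + 2 * d)
  refine Summable.of_nonneg_of_le (fun q => ?_) (fun q => ?_)
    ((summable_jb (d := d) le_rfl).mul_left C)
  · have := jb_pos q; positivity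
  · have := jb_pos q
    calc _ ≤ jb q ^ n * (C * (jb q ^ (n + 2 * d))⁻¹) := by gcongr; exact h q
      _ = _ := by rw [pow_add]; field_simp

lemma summable_exp_normSq (hg : g.PosDef) {t : ℝ} (ht : 0 < t) :
    Summable fun q => Real.exp (-t * normSq g q) := by
  simpa using summable_jb_mul_exp hg ht 0

lemma summable_jb_mul_exp_shift (hg : g.PosDef) {t : ℝ} (ht : 0 < t) (n : ℕ) (k : Fin d → ℤ) :
    Summable fun q => jb q ^ n * Real.exp (-t * normSq g (q + k)) := by
  have h1 := ((summable_jb_mul_exp hg ht n).mul_left (jb (-k) ^ n)).comp_injective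
    (add_left_injective k)
  refine Summable.of_nonneg_of_le (fun q => ?_) (fun q => ?_) h1
  · have := jb_pos q; positivity
  · have h2 : jb q ≤ jb (-k) * jb (q + k) := by simpa using jb_add_le_mul (-k) (q + k)
    have := jb_pos q
    simp only [Function.comp_apply]
    rw [← mul_assoc, ← mul_pow]
    gcongr

/-- The sum over the lattice of the right-hand sides is controlled by Gaussian sums: the weight is
convex in `ξ`. -/
lemma expWeight_le (k : Fin d → ℤ) (t : ℝ) {ξ : ℝ} (hξ : ξ ∈ Icc (0 : ℝ) 1) (q : Fin d → ℤ) :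
    expWeight g k t ξ q ≤ ξ * Real.exp (-t * normSq g (q + k)) +
      (1 - ξ) * Real.exp (-t * normSq g q) := by
  have h := convexOn_exp.2 (mem_univ (-t * normSq g (q + k))) (mem_univ (-t * normSq g q)) hξ.1
    (sub_nonneg.2 hξ.2) (by ring)
  simp only [smul_eq_mul] at h
  refine le_trans (le_of_eq ?_) h
  rw [expWeight]; congr 1; ring

lemma expWeight_le_add (k : Fin d → ℤ) (t : ℝ) {ξ : ℝ} (hξ : ξ ∈ Icc (0 : ℝ) 1) (q : Fin d → ℤ) :
    expWeight g k t ξ q ≤ Real.exp (-t * normSq g (q + k)) + Real.exp (-t * normSq g q) := by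
  refine (expWeight_le k t hξ q).trans (add_le_add ?_ ?_)
  · exact mul_le_of_le_one_left (Real.exp_pos _).le hξ.2
  · exact mul_le_of_le_one_left (Real.exp_pos _).le (by linarith [hξ.1])

lemma expWeight_pos (k : Fin d → ℤ) (t ξ : ℝ) (q : Fin d → ℤ) : 0 < expWeight g k t ξ q :=
  Real.exp_pos _

lemma continuous_expWeight (k : Fin d → ℤ) (t : ℝ) (q : Fin d → ℤ) :
    Continuous fun ξ => expWeight g k t ξ q := by
  unfold expWeight; fun_prop

lemma intervalIntegrable_tsum {κ : Type*} {F : κ → ℝ → ℝ} {b : κ → ℝ}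
    (hF : ∀ q, Continuous (F q)) (hb : Summable b) (hle : ∀ q, ∀ ξ ∈ Icc (0 : ℝ) 1, |F q ξ| ≤ b q) :
    IntervalIntegrable (fun ξ => ∑' q, F q ξ) volume 0 1 := by
  refine ContinuousOn.intervalIntegrable ?_
  rw [uIcc_of_le zero_le_one]
  exact continuousOn_tsum (fun q => (hF q).continuousOn) hb hle

lemma hasSum_integral_of_le {κ : Type*} [Countable κ] {F : κ → ℝ → ℝ} {b : κ → ℝ}
    (hF : ∀ q, Continuous (F q)) (hb : Summable b) (hle : ∀ q, ∀ ξ ∈ Icc (0 : ℝ) 1, |F q ξ| ≤ b q) :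
    HasSum (fun q => ∫ ξ in (0 : ℝ)..1, F q ξ) (∫ ξ in (0 : ℝ)..1, ∑' q, F q ξ) := by
  have hm : ∀ ξ, ξ ∈ uIoc (0 : ℝ) 1 → ξ ∈ Icc (0 : ℝ) 1 := fun ξ h => by
    rw [uIoc_of_le zero_le_one] at h; exact Ioc_subset_Icc_self h
  refine intervalIntegral.hasSum_integral_of_dominated_convergence (fun q _ => b q)
    (fun q => (hF q).aestronglyMeasurable) (fun q => Eventually.of_forall fun ξ h => hle q ξ (hm ξ h))
    (Eventually.of_forall fun _ _ => hb) intervalIntegrable_const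
    (Eventually.of_forall fun ξ h => ?_)
  exact (Summable.of_norm_bounded hb fun q => hle q ξ (hm ξ h)).hasSum

/-- A majorant of the summands in the form factors with a polynomially bounded prefactor. -/
def majorant (g : Matrix (Fin d) (Fin d) ℝ) (n : ℕ) (C : ℝ) (k : Fin d → ℤ) (t : ℝ)
    (q : Fin d → ℤ) : ℝ :=
  C * (jb q ^ n * Real.exp (-t * normSq g (q + k)) + jb q ^ n * Real.exp (-t * normSq g q))

lemma summable_majorant (hg : g.PosDef) {t : ℝ} (ht : 0 < t) (n : ℕ) (C : ℝ) (k : Fin d → ℤ) :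
    Summable (majorant g n C k t) :=
  ((summable_jb_mul_exp_shift hg ht n k).add (summable_jb_mul_exp hg ht n)).mul_left C

lemma abs_mul_expWeight_le {f : (Fin d → ℤ) → ℝ} {n : ℕ} {C : ℝ} (hf : ∀ q, |f q| ≤ C * jb q ^ n)
    (k : Fin d → ℤ) (t : ℝ) (q : Fin d → ℤ) {ξ : ℝ} (hξ : ξ ∈ Icc (0 : ℝ) 1) :
    |f q * expWeight g k t ξ q| ≤ majorant g n C k t q := by
  have h0 := (abs_nonneg _).trans (hf q)
  rw [abs_mul, abs_of_pos (expWeight_pos k t ξ q), majorant]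
  calc _ ≤ C * jb q ^ n * (Real.exp (-t * normSq g (q + k)) + Real.exp (-t * normSq g q)) :=
        mul_le_mul (hf q) (expWeight_le_add k t hξ q) (expWeight_pos k t ξ q).le h0
    _ = _ := by ring

/-- `∫₀¹ e^{-t(ξ(q+k)² + (1-ξ)q²)} dξ`. -/
def pairWeight (g : Matrix (Fin d) (Fin d) ℝ) (t : ℝ) (k q : Fin d → ℤ) : ℝ :=
  ∫ ξ in (0 : ℝ)..1, expWeight g k t ξ q

lemma pairWeight_nonneg (t : ℝ) (k q : Fin d → ℤ) : 0 ≤ pairWeight g t k q :=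
  intervalIntegral.integral_nonneg zero_le_one fun _ _ => (expWeight_pos _ _ _ _).le

lemma pairWeight_le (t : ℝ) (k q : Fin d → ℤ) :
    pairWeight g t k q ≤ Real.exp (-t * normSq g (q + k)) + Real.exp (-t * normSq g q) := by
  have h := intervalIntegral.integral_mono_on (zero_le_one' ℝ)
    ((continuous_expWeight k t q).intervalIntegrable 0 1)
    (intervalIntegrable_const (μ := volume) (c := Real.exp (-t * normSq g (q + k)) + Real.exp (-t * normSq g q)))
    fun ξ hξ => expWeight_le_add (g := g) k t hξ q
  simpa [pairWeight] using h

/-- The weight is invariant under the exchange of the two momenta `q` and `q + k`. -/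
lemma pairWeight_swap (t : ℝ) (k q : Fin d → ℤ) :
    pairWeight g t k (-(q + k)) = pairWeight g t k q := by
  have h := intervalIntegral.integral_comp_sub_left (a := 0) (b := 1)
    (fun ξ => expWeight g k t ξ q) 1
  simp only [sub_self, sub_zero] at h
  rw [pairWeight, pairWeight, ← h]
  refine intervalIntegral.integral_congr fun ξ _ => ?_
  have e : -(q + k) + k = -q := by abel
  simp only [expWeight, e, normSq_neg]
  congr 1; ring

lemma exists_abs_prefactor_le (g : Matrix (Fin d) (Fin d) ℝ) (μ ν : Fin d) (k : Fin d → ℤ) :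
    ∃ C : ℝ, ∀ q, |raise g k μ * raise g k ν - 4 * raise g q μ * raise g q ν| ≤ C * jb q ^ 2 := by
  obtain ⟨C, hC, h⟩ := abs_raise_le g
  refine ⟨|raise g k μ * raise g k ν| + 4 * C ^ 2, fun q => ?_⟩
  have hj : 1 ≤ jb q ^ 2 := one_le_pow₀ (one_le_jb q)
  have h1 : |raise g q μ| * |raise g q ν| ≤ (C * jb q) * (C * jb q) :=
    mul_le_mul (h q μ) (h q ν) (abs_nonneg _) ((abs_nonneg _).trans (h q μ))
  have h2 := abs_nonneg (raise g k μ * raise g k ν)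
  calc _ ≤ |raise g k μ * raise g k ν| + |4 * raise g q μ * raise g q ν| := abs_sub _ _
    _ = |raise g k μ * raise g k ν| + 4 * (|raise g q μ| * |raise g q ν|) := by
        rw [abs_mul (4 * raise g q μ), abs_mul 4, abs_of_pos (by norm_num : (0 : ℝ) < 4)]; ring
    _ ≤ _ := by nlinarith

lemma exists_v3Term_majorant (hg : g.PosDef) {t : ℝ} (ht : 0 < t) (k : Fin d → ℤ) (μ ν : Fin d) :
    ∃ b : (Fin d → ℤ) → ℝ, Summable b ∧ ∀ q, ∀ ξ ∈ Icc (0 : ℝ) 1, |v3Term g μ ν k t ξ q| ≤ b q := by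
  obtain ⟨C, h⟩ := exists_abs_prefactor_le g μ ν k
  refine ⟨_, (summable_majorant hg ht 2 C k).add
    ((summable_exp_normSq hg ht).mul_left |2 / t * g⁻¹ μ ν|), fun q ξ hξ => ?_⟩
  refine (abs_add_le _ _).trans (add_le_add (abs_mul_expWeight_le h k t q hξ) ?_)
  rw [abs_mul, abs_of_pos (Real.exp_pos _)]

lemma expWeight_majorant (k : Fin d → ℤ) (t : ℝ) (q : Fin d → ℤ) {ξ : ℝ} (hξ : ξ ∈ Icc (0 : ℝ) 1) :
    |expWeight g k t ξ q| ≤ majorant g 0 1 k t q := by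
  simpa using abs_mul_expWeight_le (g := g) (f := fun _ => 1) (n := 0) (C := 1) (by simp) k t q hξ

lemma continuous_v3Term (k : Fin d → ℤ) (μ ν : Fin d) (t : ℝ) (q : Fin d → ℤ) :
    Continuous fun ξ => v3Term g μ ν k t ξ q :=
  (continuous_const.mul (continuous_expWeight k t q)).add continuous_const

theorem formFactors_converge (hg : g.PosDef) {t : ℝ} (ht : 0 < t) :
    (Summable fun q : Fin d → ℤ => Real.exp (-t * normSq g q)) ∧
      ∀ k : Fin d → ℤ,
        (∀ ξ ∈ Icc (0 : ℝ) 1, Summable fun q => expWeight g k t ξ q) ∧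
        IntervalIntegrable (fun ξ => ∑' q, expWeight g k t ξ q) volume 0 1 ∧
        ∀ μ ν : Fin d,
          (∀ ξ ∈ Icc (0 : ℝ) 1, Summable fun q => v3Term g μ ν k t ξ q) ∧
          IntervalIntegrable (fun ξ => ∑' q, v3Term g μ ν k t ξ q) volume 0 1 := by
  refine ⟨summable_exp_normSq hg ht, fun k => ⟨fun ξ hξ => ?_, ?_, fun μ ν => ?_⟩⟩
  · exact Summable.of_norm_bounded (summable_majorant hg ht 0 1 k)
      fun q => expWeight_majorant k t q hξ
  · exact intervalIntegrable_tsum (continuous_expWeight k t) (summable_majorant hg ht 0 1 k)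
      fun q ξ hξ => expWeight_majorant k t q hξ
  · obtain ⟨b, hb, h⟩ := exists_v3Term_majorant hg ht k μ ν
    exact ⟨fun ξ hξ => Summable.of_norm_bounded hb fun q => h q ξ hξ,
      intervalIntegrable_tsum (continuous_v3Term k μ ν t) hb h⟩

lemma hasSum_v2 (hg : g.PosDef) {t : ℝ} (ht : 0 < t) (k : Fin d → ℤ) :
    HasSum (fun q => t ^ 2 / (2 * (2 * Real.pi) ^ d) * pairWeight g t k q) (v2 g k t) :=
  (hasSum_integral_of_le (continuous_expWeight k t) (summable_majorant hg ht 0 1 k)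
    fun q _ hξ => expWeight_majorant k t q hξ).mul_left _

lemma integral_mul_expWeight_add (a b t : ℝ) (k q : Fin d → ℤ) :
    ∫ ξ in (0 : ℝ)..1, (a * expWeight g k t ξ q + b) = a * pairWeight g t k q + b := by
  have h : IntervalIntegrable (fun ξ => a * expWeight g k t ξ q) volume 0 1 :=
    (continuous_const.mul (continuous_expWeight k t q)).intervalIntegrable _ _
  rw [intervalIntegral.integral_add h intervalIntegrable_const, intervalIntegral.integral_const_mul]
  simp [pairWeight]

lemma hasSum_v3 (hg : g.PosDef) {t : ℝ} (ht : 0 < t) (k : Fin d → ℤ) (μ ν : Fin d) :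
    HasSum (fun q => t ^ 2 / (2 * (2 * Real.pi) ^ d) *
      ((raise g k μ * raise g k ν - 4 * raise g q μ * raise g q ν) * pairWeight g t k q +
        2 / t * g⁻¹ μ ν * Real.exp (-t * normSq g q))) (v3 g μ ν k t) := by
  obtain ⟨b, hb, h⟩ := exists_v3Term_majorant hg ht k μ ν
  refine HasSum.mul_left _ ?_
  refine (hasSum_integral_of_le (continuous_v3Term k μ ν t) hb h).congr_fun fun q => ?_
  exact (integral_mul_expWeight_add _ _ _ _ _).symm

end FormFactors

/-! ### The Dyson expansion of the heat trace -/

section Expansion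

open Set

variable {d N : ℕ} {g : Matrix (Fin d) (Fin d) ℝ} {B B₁ B₂ : Idx d N → Idx d N → ℂ}

/-- The Volterra operator is linear in the perturbation. -/
lemma volterra_add_matrix {ι : Type*} {Q : ι → ℝ} {m : ℕ} {T : ℝ} {γ v : ι → ℝ} {l A b₁ b₂ : ℝ}
    {B₁ B₂ : ι → ι → ℂ} {F : ℝ → ι → ℂ} (hQ : ∀ q, 0 ≤ Q q) (hl : 0 ≤ l) (hA : 0 ≤ A)
    (hF : RowBound Q m T γ l A F) (h₁ : Admissible Q m T γ v b₁ B₁)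
    (h₂ : Admissible Q m T γ v b₂ B₂) (x y : ℂ) {t : ℝ} (ht : t ∈ Icc 0 T) (q : ι) :
    volterra Q (fun r q => x * B₁ r q + y * B₂ r q) F t q =
      x * volterra Q B₁ F t q + y * volterra Q B₂ F t q := by
  unfold volterra
  rw [← intervalIntegral.integral_const_mul, ← intervalIntegral.integral_const_mul,
    ← intervalIntegral.integral_add
      ((intervalIntegrable_rowMul_exp hQ hl hA hF h₁ q ht t).const_mul x)
      ((intervalIntegrable_rowMul_exp hQ hl hA hF h₂ q ht t).const_mul y)]
  refine intervalIntegral.integral_congr fun s hs => ?_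
  rw [uIcc_of_le ht.1] at hs
  have hs' : s ∈ Icc 0 T := ⟨hs.1, hs.2.trans ht.2⟩
  have e : rowMul (fun r q => x * B₁ r q + y * B₂ r q) F s q =
      x * rowMul B₁ F s q + y * rowMul B₂ F s q := by
    simp only [rowMul]
    rw [← tsum_mul_left, ← tsum_mul_left,
      ← ((summable_rowMul hF h₁ hs' q).of_norm.mul_left x).tsum_add
        ((summable_rowMul hF h₂ hs' q).of_norm.mul_left y)]
    exact tsum_congr fun r => by ring
  simp only [e]
  ring

lemma volterra_congr {ι : Type*} {Q : ι → ℝ} {B : ι → ι → ℂ} {T : ℝ} {F F' : ℝ → ι → ℂ}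
    (h : ∀ s ∈ Icc 0 T, ∀ r, F s r = F' s r) {t : ℝ} (ht : t ∈ Icc 0 T) (q : ι) :
    volterra Q B F t q = volterra Q B F' t q := by
  unfold volterra
  refine intervalIntegral.integral_congr fun s hs => ?_
  rw [uIcc_of_le ht.1] at hs
  have e : rowMul B F s q = rowMul B F' s q :=
    tsum_congr fun r => by rw [h s ⟨hs.1, hs.2.trans ht.2⟩ r]
  simp only [e]

lemma RowBound.const_mul {ι : Type*} {Q : ι → ℝ} {m : ℕ} {T : ℝ} {γ : ι → ℝ} {l A : ℝ}
    {F : ℝ → ι → ℂ} (hF : RowBound Q m T γ l A F) (c : ℂ) :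
    RowBound Q m T γ l (‖c‖ * A) fun s r => c * F s r := by
  refine ⟨fun q => continuousOn_const.mul (hF.cont q), fun s hs q => ?_⟩
  rw [norm_mul]
  calc _ ≤ ‖c‖ * (A * Real.exp (l * s) * γ q * wt m s (Q q)) := by gcongr; exact hF.le s hs q
    _ = _ := by ring

/-- The remainder after three terms of a geometrically dominated series. -/
lemma norm_tsum_sub_three_le {f : ℕ → ℂ} {A x : ℝ} (hx : 0 ≤ x) (hx' : x ≤ 1 / 2)
    (h : ∀ n, ‖f n‖ ≤ A * x ^ n) : ‖∑' n, f n - (f 0 + f 1 + f 2)‖ ≤ 2 * A * x ^ 3 := by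
  have hA : 0 ≤ A := by simpa using (norm_nonneg _).trans (h 0)
  have hgeo : HasSum (fun n : ℕ => A * x ^ 3 * (1 / 2 : ℝ) ^ n) (A * x ^ 3 * 2) :=
    hasSum_geometric_two.mul_left _
  have hterm : ∀ n, ‖f (n + 3)‖ ≤ A * x ^ 3 * (1 / 2 : ℝ) ^ n := by
    intro n
    refine (h (n + 3)).trans ?_
    rw [pow_add]
    calc A * (x ^ n * x ^ 3) ≤ A * ((1 / 2) ^ n * x ^ 3) := by gcongr
      _ = A * x ^ 3 * (1 / 2) ^ n := by ring
  have hs : Summable f := (summable_nat_add_iff 3).1 (Summable.of_norm_bounded hgeo.summable hterm)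
  have e : ∑' n, f n - (f 0 + f 1 + f 2) = ∑' n, f (n + 3) := by
    rw [← hs.sum_add_tsum_nat_add 3]
    simp [Finset.sum_range_succ]
  rw [e]
  exact (tsum_of_norm_bounded hgeo hterm).trans (le_of_eq (by ring))

set_option maxHeartbeats 400000 in
/-- The heat kernel for `ε B₁ + ε² B₂` up to third order in `ε`: the free kernel, the first Dyson
terms of both perturbations and the second one of `B₁`. The smoothing weight makes the remainder
summable over the modes. -/
lemma heatKernel_expansion (hg : g.PosDef) (h₁ : IsPert B₁) (h₂ : IsPert B₂) (m : ℕ) {t : ℝ}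
    (ht : 0 ≤ t) : ∃ A : ℝ, 0 < A ∧ ∀ ε : ℝ, |ε| ≤ 1 / 2 → ∀ p q : Idx d N,
      ‖heatKernel g (fun r q => ε * B₁ r q + (ε : ℂ) ^ 2 * B₂ r q) t p q -
        (dyson g B₁ 0 t p q + (ε * dyson g B₁ 1 t p q + (ε : ℂ) ^ 2 * dyson g B₂ 1 t p q) +
          (ε : ℂ) ^ 2 * dyson g B₁ 2 t p q)‖ ≤ A * |ε| ^ 3 * wt m t (energy g q) := by
  set M := 2 * d with hM
  obtain ⟨C₁, hC₁, hb₁⟩ := h₁ (M + 2 * m)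
  obtain ⟨C₂, hC₂, hb₂⟩ := h₂ (M + 2 * m)
  set C := C₁ + C₂ with hC
  have hC0 : 0 < C := by positivity
  have hgv : ∀ r q : Idx d N, 0 ≤ gam (M + 2 * m) r q * vel q := fun r q =>
    mul_nonneg (gam_nonneg _ _ _) (vel_nonneg _)
  have hb₁' : ∀ r q, ‖B₁ r q‖ ≤ C * gam (M + 2 * m) r q * vel q := fun r q => by
    refine (hb₁ r q).trans ?_
    rw [mul_assoc, mul_assoc]
    exact mul_le_mul_of_nonneg_right (by linarith) (hgv r q)
  have hb₂' : ∀ r q, ‖B₂ r q‖ ≤ C * gam (M + 2 * m) r q * vel q := fun r q => by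
    refine (hb₂ r q).trans ?_
    rw [mul_assoc, mul_assoc]
    exact mul_le_mul_of_nonneg_right (by linarith) (hgv r q)
  obtain ⟨K, hK, hadm⟩ := admissible_gam (N := N) hg (le_refl M) m ht
  obtain ⟨l, A, hl, hA, hD⟩ := rowBound_dyson (N := N) hg (le_refl M) m ht hC0
  refine ⟨5 * A * Real.exp (l * t), by positivity, fun ε hε p q => ?_⟩
  set Bε : Idx d N → Idx d N → ℂ := fun r q => ε * B₁ r q + (ε : ℂ) ^ 2 * B₂ r q with hBε
  have hε0 := abs_nonneg ε
  -- the perturbation is of order `ε`, so its `n`-th Dyson term is of order `ε ^ n`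
  have hbε : ∀ r q, ‖Bε r q‖ ≤ (2 * |ε|) * C * gam (M + 2 * m) r q * vel q := by
    intro r q
    have h3 := hgv r q
    have h4 : ‖(ε : ℂ) * B₁ r q‖ ≤ |ε| * (C * (gam (M + 2 * m) r q * vel q)) := by
      rw [norm_mul, Complex.norm_real, Real.norm_eq_abs, ← mul_assoc C]
      gcongr
      exact hb₁' r q
    have h5 : ‖(ε : ℂ) ^ 2 * B₂ r q‖ ≤ |ε| * (C * (gam (M + 2 * m) r q * vel q)) := by
      rw [norm_mul, norm_pow, Complex.norm_real, Real.norm_eq_abs, ← mul_assoc C]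
      have : |ε| ^ 2 ≤ |ε| := by nlinarith
      gcongr
      exact hb₂' r q
    refine (norm_add_le _ _).trans ((add_le_add h4 h5).trans (le_of_eq (by ring)))
  obtain ⟨hn, hvε⟩ := hD Bε (2 * |ε|) (by positivity) hbε p
  obtain ⟨hn₁, hv₁⟩ := hD B₁ 1 zero_le_one (by simpa using hb₁') p
  obtain ⟨hn₂, hv₂⟩ := hD B₂ 1 zero_le_one (by simpa using hb₂') p
  have e2 : 2 * |ε| / 2 = |ε| := by ring
  rw [e2] at hn hvε
  have ha₁ := hadm B₁ C hC0.le hb₁' p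
  have ha₂ := hadm B₂ C hC0.le hb₂' p
  have hQ := energy_nonneg (N := N) hg
  have hmem : t ∈ Icc 0 t := ⟨ht, le_rfl⟩
  -- first order
  have hT1 : ∀ s ∈ Icc 0 t, ∀ q, dyson g Bε 1 s p q =
      ε * dyson g B₁ 1 s p q + (ε : ℂ) ^ 2 * dyson g B₂ 1 s p q := by
    intro s hs q
    have hF : RowBound (energy g) m t (gam M p) l A (fun t r => dyson g Bε 0 t p r) := by
      simpa using hn 0
    exact volterra_add_matrix hQ hl.le hA.le hF ha₁ ha₂ _ _ hs q
  -- second order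
  have hF1 : RowBound (energy g) m t (gam M p) l (A * |ε|) (fun t r => dyson g Bε 1 t p r) := by
    simpa using hn 1
  have hT2 : dyson g Bε 2 t p q = (ε : ℂ) ^ 2 * dyson g B₁ 2 t p q +
      ((ε : ℂ) * volterra (energy g) B₁ (fun s r => (ε : ℂ) ^ 2 * dyson g B₂ 1 s p r) t q +
        (ε : ℂ) ^ 2 * volterra (energy g) B₂ (fun s r => dyson g Bε 1 s p r) t q) := by
    have h6 : dyson g Bε 2 t p q = (ε : ℂ) * volterra (energy g) B₁
        (fun s r => dyson g Bε 1 s p r) t q +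
        (ε : ℂ) ^ 2 * volterra (energy g) B₂ (fun s r => dyson g Bε 1 s p r) t q :=
      volterra_add_matrix hQ hl.le (by positivity) hF1 ha₁ ha₂ _ _ hmem q
    have hF1' : RowBound (energy g) m t (gam M p) l (A * |ε|)
        (fun s r => (ε : ℂ) * dyson g B₁ 1 s p r) := by
      have h7 := (hn₁ 1).const_mul (ε : ℂ)
      refine ⟨h7.cont, fun s hs r => (h7.le s hs r).trans ?_⟩
      have h8 := wt_pos (m := m) hs.1 (hQ r)
      have h9 := gam_nonneg M p r
      rw [Complex.norm_real, Real.norm_eq_abs, pow_one]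
      gcongr ?_ * _ * _ * _
      nlinarith [mul_nonneg hε0 hA.le]
    have h7 : volterra (energy g) B₁ (fun s r => (ε : ℂ) ^ 2 * dyson g B₂ 1 s p r) t q =
        volterra (energy g) B₁ (fun s r => dyson g Bε 1 s p r) t q -
          volterra (energy g) B₁ (fun s r => (ε : ℂ) * dyson g B₁ 1 s p r) t q := by
      rw [← volterra_sub hQ hl.le (by positivity) hF1 hF1' ha₁ hmem]
      refine volterra_congr (fun s hs r => ?_) hmem q
      rw [hT1 s hs r]; ring
    have h8 : volterra (energy g) B₁ (fun s r => (ε : ℂ) * dyson g B₁ 1 s p r) t q =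
        ε * dyson g B₁ 2 t p q := volterra_const_mul _ _ _ _ _
    rw [h6, h7, h8]; ring
  have hw := wt_pos (m := m) ht (hQ q)
  have hγ1 : gam M p q ≤ 1 := gam_le_one M p q
  have hγ0 := gam_nonneg M p q
  have hfin : ∀ (F : ℝ → Idx d N → ℂ) (A' : ℝ), 0 ≤ A' → RowBound (energy g) m t (gam M p) l A' F →
      ‖F t q‖ ≤ A' * (Real.exp (l * t) * wt m t (energy g q)) := by
    intro F A' hA' hF
    refine (hF.le t hmem q).trans ?_
    calc _ = A' * Real.exp (l * t) * wt m t (energy g q) * gam M p q := by ring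
      _ ≤ A' * Real.exp (l * t) * wt m t (energy g q) * 1 := by gcongr
      _ = _ := by ring
  set W := Real.exp (l * t) * wt m t (energy g q) with hW
  have hW0 : 0 < W := by positivity
  have hr1 : ‖volterra (energy g) B₁ (fun s r => (ε : ℂ) ^ 2 * dyson g B₂ 1 s p r) t q‖ ≤
      |ε| ^ 2 * A * W := by
    have h7 := hv₁ _ _ (by positivity) ((hn₂ 1).const_mul ((ε : ℂ) ^ 2))
    refine (hfin _ _ (by positivity) h7).trans ?_
    rw [norm_pow, Complex.norm_real, Real.norm_eq_abs, pow_one]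
    gcongr ?_ * _
    nlinarith [mul_nonneg (sq_nonneg |ε|) hA.le]
  have hr2 : ‖volterra (energy g) B₂ (fun s r => dyson g Bε 1 s p r) t q‖ ≤ |ε| * A * W := by
    refine (hfin _ _ (by positivity) (hv₂ _ _ (by positivity) hF1)).trans ?_
    gcongr ?_ * _
    nlinarith [mul_nonneg hε0 hA.le]
  have hrem := norm_tsum_sub_three_le (f := fun n => dyson g Bε n t p q) (x := |ε|) (A := A * W)
    hε0 hε fun n => (hfin _ _ (by positivity) (hn n)).trans (le_of_eq (by ring))
  have hid : heatKernel g Bε t p q - (dyson g B₁ 0 t p q +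
        (ε * dyson g B₁ 1 t p q + (ε : ℂ) ^ 2 * dyson g B₂ 1 t p q) +
          (ε : ℂ) ^ 2 * dyson g B₁ 2 t p q) =
      ((ε : ℂ) * volterra (energy g) B₁ (fun s r => (ε : ℂ) ^ 2 * dyson g B₂ 1 s p r) t q +
        (ε : ℂ) ^ 2 * volterra (energy g) B₂ (fun s r => dyson g Bε 1 s p r) t q) +
        (heatKernel g Bε t p q -
          (dyson g Bε 0 t p q + dyson g Bε 1 t p q + dyson g Bε 2 t p q)) := by
    have h0 : dyson g Bε 0 t p q = dyson g B₁ 0 t p q := rfl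
    rw [hT1 t hmem q, hT2, h0]; ring
  rw [hid]
  have h9 : ‖(ε : ℂ) * volterra (energy g) B₁ (fun s r => (ε : ℂ) ^ 2 * dyson g B₂ 1 s p r) t q‖ ≤
      |ε| * (|ε| ^ 2 * A * W) := by
    rw [norm_mul, Complex.norm_real, Real.norm_eq_abs]
    exact mul_le_mul_of_nonneg_left hr1 hε0
  have h10 : ‖(ε : ℂ) ^ 2 * volterra (energy g) B₂ (fun s r => dyson g Bε 1 s p r) t q‖ ≤
      |ε| ^ 2 * (|ε| * A * W) := by
    rw [norm_mul, norm_pow, Complex.norm_real, Real.norm_eq_abs]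
    exact mul_le_mul_of_nonneg_left hr2 (sq_nonneg _)
  have h11 : 0 ≤ A * |ε| ^ 3 * W := by positivity
  calc _ ≤ |ε| * (|ε| ^ 2 * A * W) + |ε| ^ 2 * (|ε| * A * W) + 2 * (A * W) * |ε| ^ 3 :=
        (norm_add_le _ _).trans (add_le_add ((norm_add_le _ _).trans (add_le_add h9 h10)) hrem)
    _ = 4 * (A * |ε| ^ 3 * W) := by ring
    _ ≤ 5 * (A * |ε| ^ 3 * W) := by linarith
    _ = _ := by rw [hW]; ring

end Expansion

/-! ### Traces of the first two terms of the Dyson series -/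

section DysonTrace

open Set

variable {d N : ℕ} {g : Matrix (Fin d) (Fin d) ℝ} {B : Idx d N → Idx d N → ℂ}

lemma rowMul_freeKernel (s : ℝ) (p q : Idx d N) :
    rowMul B (fun s r => freeKernel g s p r) s q = (Real.exp (-s * energy g p) : ℂ) * B p q := by
  rw [rowMul, tsum_eq_single p fun r hr => by simp [freeKernel, hr.symm]]
  simp [freeKernel]

/-- `∫₀ˢ e^{-ua - (s-u)b} du`. -/
def simplexOne (s a b : ℝ) : ℝ := ∫ u in (0 : ℝ)..s, Real.exp (-u * a) * Real.exp (-(s - u) * b)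

lemma dyson_one (t : ℝ) (p q : Idx d N) :
    dyson g B 1 t p q = B p q * (simplexOne t (energy g p) (energy g q) : ℂ) := by
  change volterra (energy g) B (fun s r => freeKernel g s p r) t q = _
  simp only [volterra, rowMul_freeKernel]
  rw [simplexOne, ← intervalIntegral.integral_ofReal, ← intervalIntegral.integral_const_mul]
  refine intervalIntegral.integral_congr fun s _ => ?_
  push_cast; ring

lemma dyson_one_diag (t : ℝ) (p : Idx d N) :
    dyson g B 1 t p p = t * (Real.exp (-t * energy g p) : ℂ) * B p p := by
  have h : simplexOne t (energy g p) (energy g p) = t * Real.exp (-t * energy g p) := by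
    have e : ∀ u : ℝ, Real.exp (-u * energy g p) * Real.exp (-(t - u) * energy g p) =
        Real.exp (-t * energy g p) := fun u => by rw [← Real.exp_add]; congr 1; ring
    simp only [simplexOne, e, intervalIntegral.integral_const, sub_zero, smul_eq_mul]
  rw [dyson_one, h]; push_cast; ring

/-- `∫₀ᵗ ∫₀ˢ e^{-(t-s+u)a - (s-u)b} du ds`. -/
def simplexTwo (t a b : ℝ) : ℝ := ∫ s in (0 : ℝ)..t, simplexOne s a b * Real.exp (-(t - s) * a)

lemma simplexTwo_eq (t a b : ℝ) : simplexTwo t a b =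
    ∫ w in (0 : ℝ)..t, (t - w) * (Real.exp (-(t - w) * a) * Real.exp (-w * b)) := by
  set φ : ℝ → ℝ := fun w => Real.exp (-(t - w) * a) * Real.exp (-w * b) with hφ
  have hφc : Continuous φ := by fun_prop
  have h1 : ∀ s, simplexOne s a b * Real.exp (-(t - s) * a) = ∫ w in (0 : ℝ)..s, φ w := by
    intro s
    have h := intervalIntegral.integral_comp_sub_left (a := 0) (b := s) φ s
    simp only [sub_self, sub_zero] at h
    rw [← h, simplexOne, ← intervalIntegral.integral_mul_const]
    refine intervalIntegral.integral_congr fun u _ => ?_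
    simp only [hφ, ← Real.exp_add]
    congr 1; ring
  have h2 : simplexTwo t a b = ∫ s in (0 : ℝ)..t, ∫ w in (0 : ℝ)..s, φ w :=
    intervalIntegral.integral_congr fun s _ => h1 s
  have h3 := intervalIntegral.integral_mul_deriv_eq_deriv_mul (a := 0) (b := t)
    (u := fun s => ∫ w in (0 : ℝ)..s, φ w) (v := fun s => s - t) (u' := φ) (v' := fun _ => 1)
    (fun s _ => intervalIntegral.integral_hasDerivAt_right (hφc.intervalIntegrable _ _)
      (hφc.stronglyMeasurableAtFilter _ _) hφc.continuousAt)
    (fun s _ => (hasDerivAt_id s).sub_const t) (hφc.intervalIntegrable _ _)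
    intervalIntegrable_const
  simp only [mul_one, sub_self, mul_zero, intervalIntegral.integral_same, zero_mul, zero_sub] at h3
  rw [h2, h3, ← intervalIntegral.integral_neg]
  refine intervalIntegral.integral_congr fun w _ => ?_
  simp only [hφ]; ring

lemma simplexOne_nonneg {s : ℝ} (hs : 0 ≤ s) (a b : ℝ) : 0 ≤ simplexOne s a b :=
  intervalIntegral.integral_nonneg hs fun _ _ => by positivity

lemma simplexTwo_nonneg {t : ℝ} (ht : 0 ≤ t) (a b : ℝ) : 0 ≤ simplexTwo t a b :=
  intervalIntegral.integral_nonneg ht fun _ hs => mul_nonneg (simplexOne_nonneg hs.1 a b)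
    (Real.exp_pos _).le

/-- Symmetrising the integral over the simplex in the two energies removes one of the two time
integrations. -/
lemma simplexTwo_add_swap (t a b : ℝ) : simplexTwo t a b + simplexTwo t b a =
    t ^ 2 * ∫ ξ in (0 : ℝ)..1, Real.exp (-t * (ξ * b + (1 - ξ) * a)) := by
  have h1 : simplexTwo t b a = ∫ w in (0 : ℝ)..t, w * (Real.exp (-(t - w) * a) * Real.exp (-w * b)) := by
    have h := intervalIntegral.integral_comp_sub_left (a := 0) (b := t)
      (fun w => (t - w) * (Real.exp (-(t - w) * b) * Real.exp (-w * a))) t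
    simp only [sub_self, sub_zero] at h
    rw [simplexTwo_eq, ← h]
    refine intervalIntegral.integral_congr fun w _ => ?_
    simp only [sub_sub_cancel]
    ring
  have h2 := intervalIntegral.smul_integral_comp_mul_left (a := 0) (b := 1)
    (fun w => Real.exp (-(t - w) * a) * Real.exp (-w * b)) t
  simp only [mul_zero, mul_one, smul_eq_mul] at h2
  rw [h1, simplexTwo_eq, ← intervalIntegral.integral_add
    (Continuous.intervalIntegrable (by fun_prop) _ _)
    (Continuous.intervalIntegrable (by fun_prop) _ _)]
  have h3 : ∀ w, (t - w) * (Real.exp (-(t - w) * a) * Real.exp (-w * b)) +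
      w * (Real.exp (-(t - w) * a) * Real.exp (-w * b)) =
      t * (Real.exp (-(t - w) * a) * Real.exp (-w * b)) := fun w => by ring
  simp only [h3]
  rw [intervalIntegral.integral_const_mul, ← h2, pow_two, mul_assoc]
  congr 2
  refine intervalIntegral.integral_congr fun ξ _ => ?_
  simp only [← Real.exp_add]
  congr 1; ring

lemma pairWeight_sub (t : ℝ) (p r : Fin d → ℤ) : pairWeight g t (r - p) p =
    ∫ ξ in (0 : ℝ)..1, Real.exp (-t * (ξ * normSq g r + (1 - ξ) * normSq g p)) := by
  simp only [pairWeight, expWeight, add_sub_cancel]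

lemma simplexTwo_add_energy (t : ℝ) (p r : Idx d N) :
    simplexTwo t (energy g p) (energy g r) + simplexTwo t (energy g r) (energy g p) =
      t ^ 2 * pairWeight g t (r.1 - p.1) p.1 := by
  rw [simplexTwo_add_swap, pairWeight_sub]; rfl

lemma norm_mul_le_gam (hB : IsPert B) : ∃ C : ℝ, 0 < C ∧ ∀ p r : Idx d N,
    ‖B p r * B r p‖ ≤ C * (gam (2 * d) p r * vel p ^ 2) := by
  obtain ⟨C, hC, h⟩ := hB (2 * d + 1)
  refine ⟨C * C, by positivity, fun p r => ?_⟩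
  have hv : vel r ≤ jb (p.1 - r.1) * vel p := by
    have := jb_add_le_mul (r.1 - p.1) p.1
    rw [sub_add_cancel, jb_sub_comm] at this
    exact this
  have hj := jb_pos (p.1 - r.1)
  have h1 := gam_nonneg (2 * d) p r
  have h2 := gam_le_one (2 * d + 1) p r
  have h3 := gam_nonneg (2 * d + 1) p r
  have h4 := vel_nonneg p
  have h5 := vel_nonneg r
  have e : gam (2 * d + 1) p r * jb (p.1 - r.1) = gam (2 * d) p r := by
    unfold gam; rw [pow_succ]; field_simp
  rw [norm_mul]
  calc _ ≤ (C * gam (2 * d + 1) p r * vel r) * (C * gam (2 * d + 1) r p * vel p) := by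
        gcongr
        · exact h p r
        · exact h r p
    _ = C * C * (gam (2 * d + 1) p r * gam (2 * d + 1) p r * vel r * vel p) := by
        rw [gam_comm _ r p]; ring
    _ ≤ C * C * (1 * gam (2 * d + 1) p r * (jb (p.1 - r.1) * vel p) * vel p) := by gcongr
    _ = C * C * ((gam (2 * d + 1) p r * jb (p.1 - r.1)) * vel p ^ 2) := by ring
    _ = _ := by rw [e]

lemma summable_gam_exp (hg : g.PosDef) {t : ℝ} (ht : 0 < t) : Summable fun x : Idx d N × Idx d N =>
    gam (2 * d) x.1 x.2 * vel x.1 ^ 2 * Real.exp (-t * energy g x.1) := by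
  have h0 : ∀ x : Idx d N × Idx d N,
      0 ≤ gam (2 * d) x.1 x.2 * vel x.1 ^ 2 * Real.exp (-t * energy g x.1) := fun x => by
    have := gam_nonneg (2 * d) x.1 x.2
    positivity
  refine (summable_prod_of_nonneg h0).2 ⟨fun p => ?_, ?_⟩
  · have := (summable_gam_right (N := N) le_rfl p).mul_right
      (vel p ^ 2 * Real.exp (-t * energy g p))
    simpa only [← mul_assoc] using this
  · simp only [tsum_mul_right]
    have e : ∀ p : Idx d N, ∑' r : Idx d N, gam (2 * d) p r =
        ∑' r : Idx d N, (jb r.1 ^ (2 * d))⁻¹ := fun p => by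
      simp only [gam_comm _ p]
      exact tsum_gam_left p
    have h1 : Summable fun p : Idx d N => vel p ^ 2 * Real.exp (-t * energy g p) :=
      (hasSum_fst (N := N) (summable_jb_mul_exp hg ht 2)).summable
    simp only [e, mul_assoc]
    exact h1.mul_left _

lemma pairWeight_sub_le (t : ℝ) (p r : Idx d N) : pairWeight g t (r.1 - p.1) p.1 ≤
    Real.exp (-t * energy g r) + Real.exp (-t * energy g p) := by
  have := pairWeight_le (g := g) t (r.1 - p.1) p.1
  rwa [add_sub_cancel] at this

lemma summable_pair (hg : g.PosDef) (hB : IsPert B) {t : ℝ} (ht : 0 < t) :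
    Summable fun x : Idx d N × Idx d N =>
      ‖B x.1 x.2 * B x.2 x.1‖ * pairWeight g t (x.2.1 - x.1.1) x.1.1 := by
  obtain ⟨C, hC, h⟩ := norm_mul_le_gam hB
  have h1 := summable_gam_exp (N := N) hg ht
  have h2 := h1.prod_symm
  refine Summable.of_nonneg_of_le (fun x => mul_nonneg (norm_nonneg _) (pairWeight_nonneg _ _ _))
    (fun x => ?_) ((h1.add h2).mul_left C)
  have h3 := h x.1 x.2
  have h4 := h x.2 x.1
  rw [mul_comm (B x.2 x.1)] at h4
  have h5 := norm_nonneg (B x.1 x.2 * B x.2 x.1)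
  simp only [Prod.fst_swap, Prod.snd_swap]
  calc _ ≤ ‖B x.1 x.2 * B x.2 x.1‖ * (Real.exp (-t * energy g x.2) + Real.exp (-t * energy g x.1)) := by
        gcongr
        exact pairWeight_sub_le t x.1 x.2
    _ = ‖B x.1 x.2 * B x.2 x.1‖ * Real.exp (-t * energy g x.2) +
        ‖B x.1 x.2 * B x.2 x.1‖ * Real.exp (-t * energy g x.1) := mul_add _ _ _
    _ ≤ C * (gam (2 * d) x.2 x.1 * vel x.2 ^ 2) * Real.exp (-t * energy g x.2) +
        C * (gam (2 * d) x.1 x.2 * vel x.1 ^ 2) * Real.exp (-t * energy g x.1) := by gcongr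
    _ = _ := by ring

/-- The diagonal of the second Dyson term as a sum over the intermediate mode. -/
lemma hasSum_dyson_two (hg : g.PosDef) (hB : IsPert B) {t : ℝ} (ht : 0 < t) (p : Idx d N) :
    HasSum (fun r => B p r * B r p * (simplexTwo t (energy g p) (energy g r) : ℂ))
      (dyson g B 2 t p p) := by
  obtain ⟨C, hC, h⟩ := norm_mul_le_gam hB
  have hs : Summable fun r : Idx d N => C * (gam (2 * d) p r * vel p ^ 2) * t :=
    (((summable_gam_right le_rfl p).mul_right _).mul_left C).mul_right t
  have hS : ∀ s ∈ Icc 0 t, ∀ r : Idx d N, ‖(simplexOne s (energy g p) (energy g r) : ℂ)‖ ≤ t := by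
    intro s hs r
    rw [Complex.norm_real]
    refine (intervalIntegral.norm_integral_le_of_norm_le_const (C := 1) fun u hu => ?_).trans ?_
    · rw [uIoc_of_le hs.1] at hu
      rw [Real.norm_of_nonneg (by positivity), ← Real.exp_add, Real.exp_le_one_iff]
      have h1 := mul_nonneg hu.1.le (energy_nonneg hg p)
      have h2 := mul_nonneg (sub_nonneg.2 hu.2) (energy_nonneg hg r)
      linarith
    · rw [sub_zero, one_mul, abs_of_nonneg hs.1]; exact hs.2
  have hbd : ∀ s ∈ Icc 0 t, ∀ r, ‖B p r * B r p * (simplexOne s (energy g p) (energy g r) : ℂ)‖ ≤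
      C * (gam (2 * d) p r * vel p ^ 2) * t := fun s hs r => by
    rw [norm_mul]
    exact mul_le_mul (h p r) (hS s hs r) (norm_nonneg _) ((norm_nonneg _).trans (h p r))
  have hc : ∀ r : Idx d N, Continuous fun s => (simplexOne s (energy g p) (energy g r) : ℂ) := by
    intro r
    have e : ∀ s, simplexOne s (energy g p) (energy g r) = Real.exp (-s * energy g r) *
        ∫ u in (0 : ℝ)..s, Real.exp (-u * energy g p) * Real.exp (u * energy g r) := by
      intro s
      rw [simplexOne, ← intervalIntegral.integral_const_mul]
      refine intervalIntegral.integral_congr fun u _ => ?_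
      simp only [← Real.exp_add]
      congr 1; ring
    simp only [e]
    refine Complex.continuous_ofReal.comp (Continuous.mul (by fun_prop) ?_)
    exact intervalIntegral.continuous_primitive
      (fun a b => Continuous.intervalIntegrable (by fun_prop) _ _) 0
  have e1 : ∀ r, B p r * B r p * (simplexTwo t (energy g p) (energy g r) : ℂ) =
      ∫ s in (0 : ℝ)..t, B p r * B r p * (simplexOne s (energy g p) (energy g r) : ℂ) *
        (Real.exp (-(t - s) * energy g p) : ℂ) := by
    intro r
    rw [simplexTwo, ← intervalIntegral.integral_ofReal, ← intervalIntegral.integral_const_mul]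
    refine intervalIntegral.integral_congr fun s _ => ?_
    push_cast; ring
  have e2 : dyson g B 2 t p p = ∫ s in (0 : ℝ)..t, (∑' r, B p r * B r p *
      (simplexOne s (energy g p) (energy g r) : ℂ)) * (Real.exp (-(t - s) * energy g p) : ℂ) := by
    change volterra (energy g) B (fun s r => dyson g B 1 s p r) t p = _
    refine intervalIntegral.integral_congr fun s _ => ?_
    simp only [rowMul, dyson_one]
    congr 1
    exact tsum_congr fun r => by ring
  simp only [e1, e2]
  refine intervalIntegral.hasSum_integral_of_dominated_convergence
    (fun r _ => C * (gam (2 * d) p r * vel p ^ 2) * t)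
    (fun r => Continuous.aestronglyMeasurable ?_)
    (fun r => Eventually.of_forall fun s hs' => ?_) (Eventually.of_forall fun _ _ => hs)
    intervalIntegrable_const (Eventually.of_forall fun s hs' => ?_)
  · exact (continuous_const.mul (hc r)).mul (by fun_prop)
  · rw [uIoc_of_le ht.le] at hs'
    rw [norm_mul, Complex.norm_real, Real.norm_of_nonneg (Real.exp_pos _).le]
    have h1 := hbd s ⟨hs'.1.le, hs'.2⟩ r
    refine (mul_le_of_le_one_right (norm_nonneg _) ?_).trans h1
    rw [Real.exp_le_one_iff]
    have := mul_nonneg (sub_nonneg.2 hs'.2) (energy_nonneg hg p)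
    linarith
  · rw [uIoc_of_le ht.le] at hs'
    exact (Summable.of_norm_bounded hs (hbd s ⟨hs'.1.le, hs'.2⟩)).hasSum.mul_right _

/-- The trace of the second order term of the Dyson series, as a sum over pairs of modes. -/
lemma hasSum_dyson_two_diag (hg : g.PosDef) (hB : IsPert B) {t : ℝ} (ht : 0 < t) :
    HasSum (fun p => dyson g B 2 t p p) ((t : ℂ) ^ 2 / 2 * ∑' x : Idx d N × Idx d N,
      B x.1 x.2 * B x.2 x.1 * (pairWeight g t (x.2.1 - x.1.1) x.1.1 : ℂ)) := by
  set f : Idx d N × Idx d N → ℂ := fun x =>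
    B x.1 x.2 * B x.2 x.1 * (simplexTwo t (energy g x.1) (energy g x.2) : ℂ) with hf
  have hadd : ∀ x, f x + f x.swap = (t : ℂ) ^ 2 * (B x.1 x.2 * B x.2 x.1 *
      (pairWeight g t (x.2.1 - x.1.1) x.1.1 : ℂ)) := by
    intro x
    have := congrArg (fun y : ℝ => (y : ℂ)) (simplexTwo_add_energy (g := g) t x.1 x.2)
    simp only [Complex.ofReal_add, Complex.ofReal_mul, Complex.ofReal_pow] at this
    simp only [hf, Prod.fst_swap, Prod.snd_swap]
    linear_combination (B x.1 x.2 * B x.2 x.1) * this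
  have hfs : Summable f := by
    refine Summable.of_norm_bounded ((summable_pair hg hB ht).mul_left (t ^ 2)) fun x => ?_
    have h1 := simplexTwo_add_energy (g := g) t x.1 x.2
    have h2 := simplexTwo_nonneg ht.le (energy g x.1) (energy g x.2)
    have h3 := simplexTwo_nonneg ht.le (energy g x.2) (energy g x.1)
    simp only [hf]
    rw [norm_mul, Complex.norm_real, Real.norm_of_nonneg h2, mul_left_comm]
    exact mul_le_mul_of_nonneg_left (by linarith) (norm_nonneg _)
  have h1 : HasSum (fun p => dyson g B 2 t p p) (∑' x, f x) :=
    hfs.hasSum.prod_fiberwise fun p => hasSum_dyson_two hg hB ht p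
  have h2 : ∑' x, f x = (t : ℂ) ^ 2 / 2 * ∑' x : Idx d N × Idx d N,
      B x.1 x.2 * B x.2 x.1 * (pairWeight g t (x.2.1 - x.1.1) x.1.1 : ℂ) := by
    have h3 := hfs.tsum_add hfs.prod_symm
    have h4 : ∑' x : Idx d N × Idx d N, f x.swap = ∑' x, f x :=
      (Equiv.prodComm (Idx d N) (Idx d N)).tsum_eq f
    simp only [hadd, tsum_mul_left, h4] at h3
    linear_combination -(1 / 2 : ℂ) * h3
  rw [← h2]; exact h1

end DysonTrace

/-! ### The heat trace to second order -/

section SecondOrder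

open Set

variable {d N : ℕ} {g : Matrix (Fin d) (Fin d) ℝ} {E : MatField d N} {ω : Fin d → MatField d N}

lemma raise_add (g : Matrix (Fin d) (Fin d) ℝ) (k l : Fin d → ℤ) (μ : Fin d) :
    raise g (k + l) μ = raise g k μ + raise g l μ := by
  simp only [raise, ← Finset.sum_add_distrib]
  exact Finset.sum_congr rfl fun ν _ => by simp; ring

lemma raise_neg (g : Matrix (Fin d) (Fin d) ℝ) (k : Fin d → ℤ) (μ : Fin d) :
    raise g (-k) μ = -raise g k μ := by
  simp only [raise, ← Finset.sum_neg_distrib]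
  exact Finset.sum_congr rfl fun ν _ => by simp

/-- The matrix-valued symbol `i p^μ ω̂_μ(k) + Ê(k)` of the part of `-L` of first order in `E` and
`ω`: here `k` is the momentum transfer and `p` is the sum of the incoming and outgoing momenta. -/
def symb (g : Matrix (Fin d) (Fin d) ℝ) (E : MatField d N) (ω : Fin d → MatField d N)
    (p k : Fin d → ℤ) : Matrix (Fin N) (Fin N) ℂ :=
  Complex.I • (∑ μ, (raise g p μ : ℂ) • fCoeff (ω μ) k) + fCoeff E k

lemma pert1_eq_symb (hg : g.PosDef) (p q : Idx d N) :
    pert1 g E ω p q = (fnorm d : ℂ) * symb g E ω (p.1 + q.1) (p.1 - q.1) p.2 q.2 := by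
  have h1 : ∑ μ, ∑ ν, (g⁻¹ μ ν : ℂ) *
      (Complex.I * (p.1 μ : ℂ) * fCoeff (ω ν) (p.1 - q.1) p.2 q.2) =
      ∑ μ, ∑ ν, (g⁻¹ μ ν : ℂ) *
      (Complex.I * (p.1 ν : ℂ) * fCoeff (ω μ) (p.1 - q.1) p.2 q.2) := by
    rw [Finset.sum_comm]
    exact Finset.sum_congr rfl fun μ _ => Finset.sum_congr rfl fun ν _ => by
      rw [inv_symm hg ν μ]
  rw [pert1, symb]
  simp only [mul_add, Finset.sum_add_distrib, h1]
  simp only [Matrix.add_apply, Matrix.smul_apply, Matrix.sum_apply, smul_eq_mul, raise, Pi.add_apply]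
  push_cast
  simp only [mul_add, Finset.mul_sum, Finset.sum_mul, add_mul, Finset.sum_add_distrib]
  congr 2 <;> exact Finset.sum_congr rfl fun μ _ => Finset.sum_congr rfl fun ν _ => by ring

lemma sum_pert1_mul_pert1 (hg : g.PosDef) (k q : Fin d → ℤ) :
    ∑ x : Fin N × Fin N, pert1 g E ω (q, x.1) (q + k, x.2) * pert1 g E ω (q + k, x.2) (q, x.1) =
      (fnorm d : ℂ) ^ 2 *
        Matrix.trace (symb g E ω (q + (q + k)) (-k) * symb g E ω (q + (q + k)) k) := by
  have e1 : q - (q + k) = -k := by abel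
  have e2 : q + k - q = k := by abel
  have e3 : q + k + q = q + (q + k) := by abel
  simp only [pert1_eq_symb hg, e1, e2, e3, Fintype.sum_prod_type, Matrix.trace, Matrix.diag_apply,
    Matrix.mul_apply, Finset.mul_sum]
  exact Finset.sum_congr rfl fun a _ => Finset.sum_congr rfl fun b _ => by ring

lemma trace_symb_mul_symb (p k : Fin d → ℤ) :
    Matrix.trace (symb g E ω p (-k) * symb g E ω p k) =
      -(∑ μ, ∑ ν, (raise g p μ * raise g p ν : ℂ) *
        Matrix.trace (fCoeff (ω μ) (-k) * fCoeff (ω ν) k)) +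
      Complex.I * ∑ μ, (raise g p μ : ℂ) * (Matrix.trace (fCoeff (ω μ) (-k) * fCoeff E k) +
        Matrix.trace (fCoeff E (-k) * fCoeff (ω μ) k)) +
      Matrix.trace (fCoeff E (-k) * fCoeff E k) := by
  have hI : Complex.I * Complex.I = -1 := Complex.I_mul_I
  have h1 : Matrix.trace ((∑ μ, (raise g p μ : ℂ) • fCoeff (ω μ) (-k)) *
      ∑ ν, (raise g p ν : ℂ) • fCoeff (ω ν) k) = ∑ μ, ∑ ν, (raise g p μ * raise g p ν : ℂ) *
        Matrix.trace (fCoeff (ω μ) (-k) * fCoeff (ω ν) k) := by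
    simp only [Matrix.sum_mul, Matrix.trace_sum, Matrix.smul_mul, Matrix.mul_smul,
      Matrix.trace_smul, smul_eq_mul, Finset.mul_sum]
    rw [Finset.sum_comm]
    exact Finset.sum_congr rfl fun μ _ => Finset.sum_congr rfl fun ν _ => by ring
  have h2 : Matrix.trace ((∑ μ, (raise g p μ : ℂ) • fCoeff (ω μ) (-k)) * fCoeff E k) =
      ∑ μ, (raise g p μ : ℂ) * Matrix.trace (fCoeff (ω μ) (-k) * fCoeff E k) := by
    simp only [Matrix.sum_mul, Matrix.trace_sum, Matrix.smul_mul, Matrix.trace_smul, smul_eq_mul]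
  have h3 : Matrix.trace (fCoeff E (-k) * ∑ μ, (raise g p μ : ℂ) • fCoeff (ω μ) k) =
      ∑ μ, (raise g p μ : ℂ) * Matrix.trace (fCoeff E (-k) * fCoeff (ω μ) k) := by
    simp only [Matrix.mul_sum, Matrix.trace_sum, Matrix.mul_smul, Matrix.trace_smul, smul_eq_mul]
  simp only [symb, add_mul, mul_add, Matrix.smul_mul, Matrix.mul_smul, Matrix.trace_add,
    Matrix.trace_smul, smul_eq_mul, h1, h2, h3, Finset.sum_add_distrib]
  linear_combination (∑ μ, ∑ ν, (raise g p μ * raise g p ν : ℂ) *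
        Matrix.trace (fCoeff (ω μ) (-k) * fCoeff (ω ν) k)) * hI

/-- A sum whose terms change sign under `q ↦ -(q + k)` vanishes. -/
lemma hasSum_zero_of_odd {f : (Fin d → ℤ) → ℂ} (hf : Summable f) (k : Fin d → ℤ)
    (h : ∀ q, f (-(q + k)) = -f q) : HasSum f 0 := by
  have h1 : ∑' q, f (-(q + k)) = ∑' q, f q :=
    ((Equiv.addRight k).trans (Equiv.neg _)).tsum_eq f
  simp only [h, tsum_neg] at h1
  have h2 : ∑' q, f q = 0 := by linear_combination -(1 / 2 : ℂ) * h1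
  rw [← h2]; exact hf.hasSum

/-- The summand in the part of `modeTerm` of second order. -/
def quadTerm (g : Matrix (Fin d) (Fin d) ℝ) (E : MatField d N) (ω : Fin d → MatField d N) (t : ℝ)
    (k : Fin d → ℤ) : ℂ :=
  (v2 g k t : ℂ) * Matrix.trace (fCoeff E (-k) * fCoeff E k) +
    ∑ μ, ∑ ν, (v3 g μ ν k t : ℂ) * Matrix.trace (fCoeff (ω μ) (-k) * fCoeff (ω ν) k)

lemma modeTerm_eq (t : ℝ) (k : Fin d → ℤ) : modeTerm g E ω t k =
    (v1 g k t : ℂ) * Matrix.trace (fCoeff E k) + quadTerm g E ω t k := by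
  simp only [modeTerm, quadTerm, Matrix.trace_add, Matrix.trace_smul, Matrix.trace_sum, smul_eq_mul,
    add_assoc]

/-- The terms of the trace that are odd under the exchange `q ↔ -(q + k)` of the momenta drop out;
the others are the form factors. -/
lemma hasSum_quadTerm (hg : g.PosDef) {t : ℝ} (ht : 0 < t) (k : Fin d → ℤ)
    (hs : Summable fun q => (fnorm d : ℂ) ^ 2 * Matrix.trace (symb g E ω (q + (q + k)) (-k) *
      symb g E ω (q + (q + k)) k) * (pairWeight g t k q : ℂ)) :
    (t : ℂ) ^ 2 / 2 * ∑' q, (fnorm d : ℂ) ^ 2 * Matrix.trace (symb g E ω (q + (q + k)) (-k) *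
      symb g E ω (q + (q + k)) k) * (pairWeight g t k q : ℂ) +
      (t : ℂ) * theta g t * ((fnorm d : ℂ) ^ 2 * ∑ μ, ∑ ν, (g⁻¹ μ ν : ℂ) *
        Matrix.trace (fCoeff (ω μ) (-k) * fCoeff (ω ν) k)) = quadTerm g E ω t k := by
  set τ : Fin d → Fin d → ℂ := fun μ ν => Matrix.trace (fCoeff (ω μ) (-k) * fCoeff (ω ν) k) with hτ
  set η := Matrix.trace (fCoeff E (-k) * fCoeff E k) with hη
  set κ : ℝ := t ^ 2 / (2 * (2 * Real.pi) ^ d) with hκ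
  have hκ' : (κ : ℂ) = (t : ℂ) ^ 2 / 2 * (fnorm d : ℂ) ^ 2 := by
    rw [← Complex.ofReal_pow (fnorm d), fnorm_sq, hκ]
    push_cast
    field_simp
  have ht' : (t : ℂ) ≠ 0 := Complex.ofReal_ne_zero.2 ht.ne'
  have h1 := hs.hasSum.mul_left ((t : ℂ) ^ 2 / 2)
  have h2 := ((Complex.hasSum_ofReal.2 (summable_exp_normSq hg ht).hasSum).mul_left
    (t : ℂ)).mul_right ((fnorm d : ℂ) ^ 2 * ∑ μ, ∑ ν, (g⁻¹ μ ν : ℂ) * τ μ ν)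
  have h3 := ((Complex.hasSum_ofReal.2 (hasSum_v2 hg ht k)).mul_right η).add
    (hasSum_sum (s := Finset.univ) fun μ _ => hasSum_sum (s := Finset.univ) fun ν _ =>
      (Complex.hasSum_ofReal.2 (hasSum_v3 hg ht k μ ν)).mul_right (τ μ ν))
  have h4 := (h1.add h2).sub h3
  set α : Fin d → ℂ := fun μ => Matrix.trace (fCoeff (ω μ) (-k) * fCoeff E k) +
        Matrix.trace (fCoeff E (-k) * fCoeff (ω μ) k) with hα
  -- with `p = 2q + k` one has `k^μ k^ν - 4 q^μ q^ν = -p^μ p^ν + p^μ k^ν + k^μ p^ν`; what remains after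
  -- subtracting the form factors is linear in `p`, hence odd
  have e : ∀ q, (t : ℂ) ^ 2 / 2 * ((fnorm d : ℂ) ^ 2 * Matrix.trace (symb g E ω (q + (q + k)) (-k) *
      symb g E ω (q + (q + k)) k) * (pairWeight g t k q : ℂ)) +
      (t : ℂ) * (Real.exp (-t * normSq g q) : ℂ) *
        ((fnorm d : ℂ) ^ 2 * ∑ μ, ∑ ν, (g⁻¹ μ ν : ℂ) * τ μ ν) -
      (((κ * pairWeight g t k q : ℝ) : ℂ) * η + ∑ μ, ∑ ν, ((κ *
      ((raise g k μ * raise g k ν - 4 * raise g q μ * raise g q ν) * pairWeight g t k q +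
        2 / t * g⁻¹ μ ν * Real.exp (-t * normSq g q)) : ℝ) : ℂ) * τ μ ν) =
      (κ : ℂ) * (pairWeight g t k q : ℂ) * (Complex.I * ∑ μ, (raise g (q + (q + k)) μ : ℂ) * α μ -
        ∑ μ, ∑ ν, ((raise g (q + (q + k)) μ : ℂ) * raise g k ν +
          raise g k μ * raise g (q + (q + k)) ν) * τ μ ν) := by
    intro q
    have e1 : ∑ μ, ∑ ν, ((κ *
      ((raise g k μ * raise g k ν - 4 * raise g q μ * raise g q ν) * pairWeight g t k q +
        2 / t * g⁻¹ μ ν * Real.exp (-t * normSq g q)) : ℝ) : ℂ) * τ μ ν =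
        (κ : ℂ) * (pairWeight g t k q : ℂ) * (∑ μ, ∑ ν, ((raise g (q + (q + k)) μ : ℂ) * raise g k ν +
          raise g k μ * raise g (q + (q + k)) ν) * τ μ ν) -
        (κ : ℂ) * (pairWeight g t k q : ℂ) * (∑ μ, ∑ ν, ((raise g (q + (q + k)) μ : ℂ) *
          raise g (q + (q + k)) ν) * τ μ ν) +
        (t : ℂ) * (Real.exp (-t * normSq g q) : ℂ) *
          ((fnorm d : ℂ) ^ 2 * ∑ μ, ∑ ν, (g⁻¹ μ ν : ℂ) * τ μ ν) := by
      simp only [Finset.mul_sum, ← Finset.sum_sub_distrib, ← Finset.sum_add_distrib]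
      refine Finset.sum_congr rfl fun μ _ => Finset.sum_congr rfl fun ν _ => ?_
      simp only [raise_add]
      push_cast
      rw [hκ']
      field_simp
      ring
    rw [e1, trace_symb_mul_symb, Complex.ofReal_mul, hκ']
    ring
  have h4' := h4.congr_fun fun q => (e q).symm
  have h5 := hasSum_zero_of_odd (f := fun q => (κ : ℂ) * (pairWeight g t k q : ℂ) *
    (Complex.I * ∑ μ, (raise g (q + (q + k)) μ : ℂ) * α μ -
        ∑ μ, ∑ ν, ((raise g (q + (q + k)) μ : ℂ) * raise g k ν +
          raise g k μ * raise g (q + (q + k)) ν) * τ μ ν)) h4'.summable k fun q => by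
    have e1 : ∀ μ, raise g (-(q + k) + (-(q + k) + k)) μ = -raise g (q + (q + k)) μ := fun μ => by
      rw [← raise_neg]; congr 1; abel
    simp only [e1, pairWeight_swap, Complex.ofReal_neg, neg_mul, mul_neg, Finset.sum_neg_distrib,
      ← neg_add]
    ring
  have h6 := h4'.unique h5
  rw [sub_eq_zero] at h6
  rw [quadTerm, ← h6]
  rfl

end SecondOrder

section HeatTrace

open Set

variable {d N : ℕ} {g : Matrix (Fin d) (Fin d) ℝ} {E : MatField d N} {ω : Fin d → MatField d N}

/-- Pairs of modes, parametrised by the momentum transfer `k`, the momentum `q` and the two matrix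
indices. -/
def pairEquiv (d N : ℕ) :
    ((Fin d → ℤ) × (Fin d → ℤ)) × (Fin N × Fin N) ≃ Idx d N × Idx d N where
  toFun y := ((y.1.2, y.2.1), (y.1.2 + y.1.1, y.2.2))
  invFun x := ((x.2.1 - x.1.1, x.1.1), (x.1.2, x.2.2))
  left_inv y := by simp
  right_inv x := by simp

lemma isPert_pert1 (g : Matrix (Fin d) (Fin d) ℝ) (hE : IsSmoothMat E)
    (hω : ∀ μ, IsSmoothMat (ω μ)) : IsPert (pert1 g E ω) := fun L => pert1_bound g hE hω L

lemma isPert_pert2 (g : Matrix (Fin d) (Fin d) ℝ)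
    (hω : ∀ μ, IsSmoothMat (ω μ)) : IsPert (pert2 g ω) := fun L => pert2_bound g hω L

/-- The sum over pairs of modes, organised by the momentum transfer. -/
lemma hasSum_pairs (hg : g.PosDef) (hE : IsSmoothMat E) (hω : ∀ μ, IsSmoothMat (ω μ)) {t : ℝ}
    (ht : 0 < t) :
    (∀ k, Summable fun q => (fnorm d : ℂ) ^ 2 * Matrix.trace (symb g E ω (q + (q + k)) (-k) *
      symb g E ω (q + (q + k)) k) * (pairWeight g t k q : ℂ)) ∧
    HasSum (fun k => ∑' q, (fnorm d : ℂ) ^ 2 * Matrix.trace (symb g E ω (q + (q + k)) (-k) *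
      symb g E ω (q + (q + k)) k) * (pairWeight g t k q : ℂ))
      (∑' x : Idx d N × Idx d N, pert1 g E ω x.1 x.2 * pert1 g E ω x.2 x.1 *
        (pairWeight g t (x.2.1 - x.1.1) x.1.1 : ℂ)) := by
  set F : Idx d N × Idx d N → ℂ := fun x => pert1 g E ω x.1 x.2 * pert1 g E ω x.2 x.1 *
        (pairWeight g t (x.2.1 - x.1.1) x.1.1 : ℂ) with hF
  have hFs : Summable F := by
    refine Summable.of_norm ?_
    refine (summable_pair hg (isPert_pert1 g hE hω) ht).congr fun x => ?_
    simp only [hF]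
    rw [norm_mul (_ * _) (_ : ℂ), Complex.norm_real, Real.norm_of_nonneg (pairWeight_nonneg _ _ _)]
  have h1 : HasSum (F ∘ pairEquiv d N) (∑' x, F x) := (pairEquiv d N).hasSum_iff.2 hFs.hasSum
  have h2 : HasSum (fun y : (Fin d → ℤ) × (Fin d → ℤ) => (fnorm d : ℂ) ^ 2 *
      Matrix.trace (symb g E ω (y.2 + (y.2 + y.1)) (-y.1) * symb g E ω (y.2 + (y.2 + y.1)) y.1) *
      (pairWeight g t y.1 y.2 : ℂ)) (∑' x, F x) := by
    refine h1.prod_fiberwise fun y => ?_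
    rw [← sum_pert1_mul_pert1 hg, Finset.sum_mul]
    have h3 := hasSum_fintype fun x : Fin N × Fin N => (F ∘ pairEquiv d N) (y, x)
    simpa [hF, pairEquiv] using h3
  refine ⟨fun k => h2.summable.prod_factor k, ?_⟩
  exact h2.prod_fiberwise fun k => (h2.summable.prod_factor k).hasSum

/-- The trace of the first order term of the Dyson series for the part of `-L` that is linear in `E`
and `ω`. -/
lemma hasSum_dyson_one_pert1 (hg : g.PosDef) {t : ℝ} (ht : 0 < t) :
    HasSum (fun p => dyson g (pert1 g E ω) 1 t p p)
      ((v1 g 0 t : ℂ) * Matrix.trace (fCoeff E 0)) := by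
  have hw := Complex.hasSum_ofReal.2 (summable_exp_normSq hg ht).hasSum
  obtain ⟨C, hC, hr⟩ := abs_raise_le g
  have hodd : ∀ μ, HasSum (fun q : Fin d → ℤ =>
      (raise g (q + q) μ : ℂ) * (Real.exp (-t * normSq g q) : ℂ)) 0 := by
    intro μ
    refine hasSum_zero_of_odd ?_ 0 fun q => ?_
    · refine Summable.of_norm_bounded ((summable_jb_mul_exp hg ht 1).mul_left (2 * C)) fun q => ?_
      rw [norm_mul, Complex.norm_real, Complex.norm_real, Real.norm_of_nonneg (Real.exp_pos _).le,
        Real.norm_eq_abs, raise_add, pow_one, ← mul_assoc]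
      gcongr
      have := hr q μ
      rw [← two_mul, abs_mul, abs_two]
      linarith
    · rw [add_zero, normSq_neg, ← neg_add, raise_neg]
      push_cast; ring
  have h : ∀ a : Fin N, HasSum (fun q => dyson g (pert1 g E ω) 1 t (q, a) (q, a))
      ((v1 g 0 t : ℂ) * fCoeff E 0 a a) := by
    intro a
    have h1 := ((hasSum_sum (s := Finset.univ) fun μ _ => (hodd μ).mul_right
      (fCoeff (ω μ) 0 a a)).mul_left Complex.I).add (hw.mul_right (fCoeff E 0 a a))
    have h2 := h1.mul_left ((t : ℂ) * (fnorm d : ℂ))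
    have e : (v1 g 0 t : ℂ) * fCoeff E 0 a a = (t : ℂ) * (fnorm d : ℂ) *
        (Complex.I * ∑ μ, 0 * fCoeff (ω μ) 0 a a + (theta g t : ℂ) * fCoeff E 0 a a) := by
      have e1 : v1 g 0 t = t * fnorm d * theta g t := if_pos rfl
      rw [e1]
      push_cast
      simp only [zero_mul, Finset.sum_const_zero, mul_zero, zero_add]
      ring
    rw [e]
    refine h2.congr_fun fun q => ?_
    have e2 : dyson g (pert1 g E ω) 1 t (q, a) (q, a) = t * (Real.exp (-t * normSq g q) : ℂ) *
        ((fnorm d : ℂ) * symb g E ω (q + q) (q - q) a a) := by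
      rw [dyson_one_diag, pert1_eq_symb hg]; rfl
    rw [e2, sub_self]
    simp only [symb, Matrix.add_apply, Matrix.smul_apply, Matrix.sum_apply, smul_eq_mul,
      Finset.mul_sum, mul_add]
    congr 1
    · exact Finset.sum_congr rfl fun μ _ => by ring
    · ring
  have := hasSum_idx (f := fun p => dyson g (pert1 g E ω) 1 t p p) h
  rwa [← Finset.mul_sum] at this

/-- The trace of the first order term of the Dyson series for the part of `-L` that is quadratic
in `ω`. -/
lemma hasSum_dyson_one_pert2 (hg : g.PosDef) (hω : ∀ μ, IsSmoothMat (ω μ)) {t : ℝ} (ht : 0 < t) :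
    ∃ s, HasSum (fun p => dyson g (pert2 g ω) 1 t p p) s ∧
      HasSum (fun k => (t : ℂ) * theta g t * ((fnorm d : ℂ) ^ 2 * ∑ μ, ∑ ν, (g⁻¹ μ ν : ℂ) *
        Matrix.trace (fCoeff (ω μ) (-k) * fCoeff (ω ν) k))) s := by
  have hw := Complex.hasSum_ofReal.2 (summable_exp_normSq hg ht).hasSum
  refine ⟨(t : ℂ) * (theta g t : ℂ) * ((fnorm d : ℂ) * ∑ μ, ∑ ν, (g⁻¹ μ ν : ℂ) *
    ∑ a, fCoeff (fun x => ω μ x * ω ν x) 0 a a), ?_, ?_⟩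
  · have h1 : ∀ a : Fin N, HasSum (fun q => dyson g (pert2 g ω) 1 t (q, a) (q, a))
        ((t : ℂ) * (theta g t : ℂ) * ((fnorm d : ℂ) * ∑ μ, ∑ ν, (g⁻¹ μ ν : ℂ) *
          fCoeff (fun x => ω μ x * ω ν x) 0 a a)) := by
      intro a
      refine ((hw.mul_left (t : ℂ)).mul_right _).congr_fun fun q => ?_
      rw [dyson_one_diag, pert2]
      simp only [sub_self, energy]
    have h2 := hasSum_idx (f := fun p => dyson g (pert2 g ω) 1 t p p) h1
    rw [← Finset.mul_sum, ← Finset.mul_sum] at h2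
    have e : ∑ a, ∑ μ, ∑ ν, (g⁻¹ μ ν : ℂ) * fCoeff (fun x => ω μ x * ω ν x) 0 a a =
        ∑ μ, ∑ ν, (g⁻¹ μ ν : ℂ) * ∑ a, fCoeff (fun x => ω μ x * ω ν x) 0 a a := by
      rw [Finset.sum_comm]
      refine Finset.sum_congr rfl fun μ _ => ?_
      rw [Finset.sum_comm]
      exact Finset.sum_congr rfl fun ν _ => (Finset.mul_sum _ _ _).symm
    rwa [e] at h2
  · have hc : ∀ μ ν a, HasSum (fun k => (fnorm d : ℂ) * (fCoeff (ω μ) (-k) * fCoeff (ω ν) k) a a)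
        (fCoeff (fun x => ω μ x * ω ν x) 0 a a) := by
      intro μ ν a
      have h1 := hasSum_sum (s := Finset.univ) fun (b : Fin N) _ => hasSum_sc_mul
        (hω μ a b).continuous (hω ν b a).continuous (hω ν b a).summable_sc 0
      have h2 : fCoeff (fun x => ω μ x * ω ν x) 0 a a = ∑ b, sc (fun x => ω μ x a b * ω ν x b a) 0 := by
        rw [fCoeff_apply]
        simp only [Matrix.mul_apply]
        exact sc_sum (fun b _ => ((hω μ a b).mul (hω ν b a)).continuous) _
      rw [h2]
      refine h1.congr_fun fun k => ?_
      simp only [Matrix.mul_apply, Finset.mul_sum, fCoeff_apply, zero_sub]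
      exact Finset.sum_congr rfl fun b _ => by ring
    have h3 := (((hasSum_sum (s := Finset.univ) fun μ _ => hasSum_sum (s := Finset.univ) fun ν _ =>
      (hasSum_sum (s := Finset.univ) fun (a : Fin N) _ => hc μ ν a).mul_left
        (g⁻¹ μ ν : ℂ)).mul_left (fnorm d : ℂ)).mul_left ((t : ℂ) * (theta g t : ℂ)))
    refine h3.congr_fun fun k => ?_
    simp only [Matrix.trace, Matrix.diag_apply, Finset.mul_sum]
    exact Finset.sum_congr rfl fun μ _ => Finset.sum_congr rfl fun ν _ =>
      Finset.sum_congr rfl fun a _ => by ring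

lemma hasSum_dyson_zero (hg : g.PosDef) (B : Idx d N → Idx d N → ℂ) {t : ℝ} (ht : 0 < t) :
    HasSum (fun p => dyson g B 0 t p p) ((N : ℂ) * (theta g t : ℂ)) := by
  have h := Complex.hasSum_ofReal.2 (hasSum_fst (N := N) (summable_exp_normSq hg ht))
  rw [Complex.ofReal_mul, Complex.ofReal_natCast] at h
  refine h.congr_fun fun p => ?_
  simp [dyson, freeKernel, energy]

lemma fCoeff_smul (c : ℂ) (u : MatField d N) (k : Fin d → ℤ) :
    fCoeff (c • u) k = c • fCoeff u k := by
  ext a b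
  rw [Matrix.smul_apply, fCoeff_apply, fCoeff_apply, smul_eq_mul, ← sc_const_mul]
  rfl

lemma pert_smul (ε : ℂ) (p q : Idx d N) :
    pert g (ε • E) (ε • ω) p q = ε * pert1 g E ω p q + ε ^ 2 * pert2 g ω p q := by
  have h1 : ∀ μ ν, fCoeff (fun x => (ε • ω) μ x * (ε • ω) ν x) (p.1 - q.1) =
      ε ^ 2 • fCoeff (fun x => ω μ x * ω ν x) (p.1 - q.1) := by
    intro μ ν
    rw [← fCoeff_smul]
    congr 1
    funext x
    simp only [Pi.smul_apply, Matrix.smul_mul, Matrix.mul_smul, smul_smul, pow_two]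
  simp only [pert, pert1, pert2, h1]
  simp only [Pi.smul_apply, fCoeff_smul, Matrix.smul_apply, smul_eq_mul, mul_add,
    Finset.mul_sum, Finset.sum_add_distrib]
  congr 2
  · congr 1 <;> exact Finset.sum_congr rfl fun μ _ => Finset.sum_congr rfl fun ν _ => by ring_nf
  · ring
  · exact funext fun μ => Finset.sum_congr rfl fun ν _ => by ring

lemma quadTerm_smul (ε : ℂ) (t : ℝ) (k : Fin d → ℤ) :
    quadTerm g (ε • E) (ε • ω) t k = ε ^ 2 * quadTerm g E ω t k := by
  simp only [quadTerm, Pi.smul_apply, fCoeff_smul, Matrix.smul_mul, Matrix.mul_smul,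
    Matrix.trace_smul, smul_eq_mul, mul_add, Finset.mul_sum]
  congr 1
  · ring
  · exact Finset.sum_congr rfl fun μ _ => Finset.sum_congr rfl fun ν _ => by ring

lemma hasSum_v1 (t : ℝ) : HasSum (fun k => (v1 g k t : ℂ) * Matrix.trace (fCoeff E k))
    ((v1 g 0 t : ℂ) * Matrix.trace (fCoeff E 0)) :=
  hasSum_single 0 fun k hk => by simp [v1, hk]

lemma IsSmoothMat.smul {u : MatField d N} (hu : IsSmoothMat u) (c : ℂ) : IsSmoothMat (c • u) :=
  fun a b => (hu a b).const_mul c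

/-- The sum over the modes of the quadratic terms is the trace of the second order part of the
Dyson series. -/
lemma exists_hasSum_quadTerm (hg : g.PosDef) (hE : IsSmoothMat E) (hω : ∀ μ, IsSmoothMat (ω μ))
    {t : ℝ} (ht : 0 < t) : ∃ s₁ s₂, HasSum (fun p => dyson g (pert2 g ω) 1 t p p) s₁ ∧
      HasSum (fun p => dyson g (pert1 g E ω) 2 t p p) s₂ ∧
      HasSum (fun k => quadTerm g E ω t k) (s₁ + s₂) := by
  obtain ⟨s₁, h1, h2⟩ := hasSum_dyson_one_pert2 hg hω ht
  obtain ⟨h3, h4⟩ := hasSum_pairs hg hE hω ht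
  refine ⟨s₁, _, h1, hasSum_dyson_two_diag hg (isPert_pert1 g hE hω) ht, ?_⟩
  rw [add_comm]
  exact ((h4.mul_left ((t : ℂ) ^ 2 / 2)).add h2).congr_fun fun k =>
    (hasSum_quadTerm hg ht k (h3 k)).symm

theorem summable_modeTerm (hg : g.PosDef) (hE : IsSmoothMat E) (hω : ∀ μ, IsSmoothMat (ω μ))
    {t : ℝ} (ht : 0 < t) : Summable fun k => modeTerm g E ω t k := by
  obtain ⟨s₁, s₂, -, -, h⟩ := exists_hasSum_quadTerm hg hE hω ht
  simp only [modeTerm_eq]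
  exact (hasSum_v1 t).summable.add h.summable

lemma secondOrder_smul (hg : g.PosDef) (hE : IsSmoothMat E) (hω : ∀ μ, IsSmoothMat (ω μ))
    {t : ℝ} (ht : 0 < t) (ε : ℂ) : secondOrder g (ε • E) (ε • ω) t =
      ε * ((v1 g 0 t : ℂ) * Matrix.trace (fCoeff E 0)) + ε ^ 2 * ∑' k, quadTerm g E ω t k := by
  obtain ⟨s₁, s₂, -, -, h⟩ := exists_hasSum_quadTerm hg hE hω ht
  have h1 := ((hasSum_v1 (g := g) (E := E) t).mul_left ε).add (h.summable.hasSum.mul_left (ε ^ 2))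
  rw [← h1.tsum_eq, secondOrder]
  refine tsum_congr fun k => ?_
  rw [modeTerm_eq, quadTerm_smul, fCoeff_smul, Matrix.trace_smul, smul_eq_mul]
  ring

theorem heatTrace_expansion (hg : g.PosDef) (hE : IsSmoothMat E) (hω : ∀ μ, IsSmoothMat (ω μ))
    {t : ℝ≥0} (ht : 0 < t) :
    (fun ε : ℝ => heatTrace g ((ε : ℂ) • E) ((ε : ℂ) • ω) t
            - ((N : ℂ) * (theta g t : ℂ) + secondOrder g ((ε : ℂ) • E) ((ε : ℂ) • ω) t))
          =O[𝓝 0] fun ε : ℝ => ε ^ 3 := by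
  have ht' : 0 < (t : ℝ) := NNReal.coe_pos.2 ht
  obtain ⟨s₁, s₂, h1, h2, h3⟩ := exists_hasSum_quadTerm hg hE hω ht'
  obtain ⟨A, hA, h⟩ := heatKernel_expansion hg (isPert_pert1 g hE hω) (isPert_pert2 g hω) d ht'.le
  obtain ⟨W, hW, hw⟩ := wt_le_jb (N := N) hg d ht'
  have hws : Summable fun q : Idx d N => wt d (t : ℝ) (energy g q) :=
    Summable.of_nonneg_of_le (fun q => (wt_pos ht'.le (energy_nonneg hg q)).le) hw
      ((summable_jb_idx le_rfl).mul_left W)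
  refine IsBigO.of_bound (A * ∑' q : Idx d N, wt d (t : ℝ) (energy g q)) ?_
  have hnear : ∀ᶠ ε : ℝ in 𝓝 0, |ε| ≤ 1 / 2 := by
    filter_upwards [Metric.closedBall_mem_nhds (0 : ℝ) (by norm_num : (0 : ℝ) < 1 / 2)] with ε hε
    simpa using hε
  filter_upwards [hnear] with ε hε
  have hEε := hE.smul (ε : ℂ)
  have hωε : ∀ μ, IsSmoothMat (((ε : ℂ) • ω) μ) := fun μ => (hω μ).smul (ε : ℂ)
  have hK : ∀ p q, pert g ((ε : ℂ) • E) ((ε : ℂ) • ω) p q =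
      ε * pert1 g E ω p q + (ε : ℂ) ^ 2 * pert2 g ω p q := pert_smul (ε : ℂ)
  have hT : Summable fun p : Idx d N => heatKernel g (fun r q => ε * pert1 g E ω r q +
      (ε : ℂ) ^ 2 * pert2 g ω r q) t p p := by
    have h5 := summable_heatKernel hg (isPert_pert g hEε hωε) ht'
    have h6 : Function.Injective fun p : Idx d N => (p, p) := fun p q h => (Prod.ext_iff.1 h).1
    have h7 := (h5.comp_injective h6).of_norm
    have e : pert g ((ε : ℂ) • E) ((ε : ℂ) • ω) = fun r q => ε * pert1 g E ω r q +
      (ε : ℂ) ^ 2 * pert2 g ω r q := funext fun r => funext fun q => hK r q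
    rw [e] at h7
    exact h7
  have h5 := hT.hasSum.sub (((hasSum_dyson_zero hg (pert1 g E ω) ht').add
    (((hasSum_dyson_one_pert1 (E := E) (ω := ω) hg ht').mul_left (ε : ℂ)).add
      (h1.mul_left ((ε : ℂ) ^ 2)))).add (h2.mul_left ((ε : ℂ) ^ 2)))
  have h6 := tsum_of_norm_bounded (hws.hasSum.mul_left (A * |ε| ^ 3)) fun p => h ε hε p p
  rw [h5.tsum_eq] at h6
  rw [heatTrace_eq_tsum hg hEε hωε ht, secondOrder_smul hg hE hω ht', h3.tsum_eq]
  have e : pert g ((ε : ℂ) • E) ((ε : ℂ) • ω) = fun r q => ε * pert1 g E ω r q +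
      (ε : ℂ) ^ 2 * pert2 g ω r q := funext fun r => funext fun q => hK r q
  rw [e, Real.norm_eq_abs, abs_pow]
  refine le_trans (le_of_eq ?_) (h6.trans (le_of_eq ?_))
  · congr 1; ring
  · ring

end HeatTrace

/-! ### Quadratic functionals in Fourier space -/

section Functionals

open Set

variable {d N : ℕ} {g : Matrix (Fin d) (Fin d) ℝ} {E : MatField d N} {ω : Fin d → MatField d N}

lemma IsSmoothMat.add {u v : MatField d N} (hu : IsSmoothMat u) (hv : IsSmoothMat v) :
    IsSmoothMat fun x => u x + v x := fun a b => IsSmooth.add (hu a b) (hv a b)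

lemma IsSmoothMat.sub {u v : MatField d N} (hu : IsSmoothMat u) (hv : IsSmoothMat v) :
    IsSmoothMat fun x => u x - v x := fun a b => IsSmooth.sub (hu a b) (hv a b)

lemma IsSmoothMat.pdMat {u : MatField d N} (hu : IsSmoothMat u) (μ : Fin d) :
    IsSmoothMat (pdMat μ u) := fun a b => (hu a b).pd μ

lemma isSmoothMat_sum {κ : Type*} {s : Finset κ} {u : κ → MatField d N}
    (hu : ∀ i ∈ s, IsSmoothMat (u i)) : IsSmoothMat fun x => ∑ i ∈ s, u i x := fun a b => by
  simp only [Matrix.sum_apply]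
  exact IsSmooth.sum fun i hi => hu i hi a b

lemma fCoeff_add {u v : MatField d N} (hu : IsSmoothMat u) (hv : IsSmoothMat v) (k : Fin d → ℤ) :
    fCoeff (fun x => u x + v x) k = fCoeff u k + fCoeff v k := by
  ext a b
  exact sc_add (hu a b).continuous (hv a b).continuous k

lemma fCoeff_sub {u v : MatField d N} (hu : IsSmoothMat u) (hv : IsSmoothMat v) (k : Fin d → ℤ) :
    fCoeff (fun x => u x - v x) k = fCoeff u k - fCoeff v k := by
  have h := fCoeff_add (hu.sub hv) hv k
  simp only [sub_add_cancel] at h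
  exact eq_sub_of_add_eq h.symm

lemma fCoeff_sum {κ : Type*} {s : Finset κ} {u : κ → MatField d N}
    (hu : ∀ i ∈ s, IsSmoothMat (u i)) (k : Fin d → ℤ) :
    fCoeff (fun x => ∑ i ∈ s, u i x) k = ∑ i ∈ s, fCoeff (u i) k := by
  ext a b
  rw [Matrix.sum_apply, fCoeff_apply]
  simp only [Matrix.sum_apply]
  exact sc_sum (fun i hi => (hu i hi a b).continuous) k

lemma fCoeff_pdMat {u : MatField d N} (hu : IsSmoothMat u) (μ : Fin d) (k : Fin d → ℤ) :
    fCoeff (pdMat μ u) k = (Complex.I * (k μ : ℂ)) • fCoeff u k := by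
  ext a b
  exact sc_pd (hu a b) μ k

/-- Boundedness of the Fourier multiplier `m(k²)`. -/
def BoundedSymbol (g : Matrix (Fin d) (Fin d) ℝ) (m : ℝ → ℝ) : Prop :=
  ∃ C : ℝ, ∀ k, |m (normSq g k)| ≤ C

lemma BoundedSymbol.summable {m : ℝ → ℝ} (hm : BoundedSymbol g m) {c : (Fin d → ℤ) → ℂ}
    (hc : Summable fun k => ‖c k‖) : Summable fun k => ‖(m (normSq g k) : ℂ) * c k‖ := by
  obtain ⟨C, hC⟩ := hm
  refine Summable.of_nonneg_of_le (fun k => norm_nonneg _) (fun k => ?_) (hc.mul_left C)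
  rw [norm_mul, Complex.norm_real]
  exact mul_le_mul_of_nonneg_right (hC k) (norm_nonneg _)

lemma funcLap_apply {m : ℝ → ℝ} (hm : BoundedSymbol g m) {u : MatField d N} (hu : IsSmoothMat u)
    (x : Torus d) (a b : Fin N) :
    funcLap g m u x a b = fseries (fun k => (m (normSq g k) : ℂ) * fCoeff u k a b) x := by
  have hs : ∀ a b, Summable fun k => ((m (normSq g k) : ℂ) * planeWave k x) * fCoeff u k a b := by
    intro a b
    have h := summable_mul_planeWave (hm.summable (hu a b).summable_sc) x
    refine h.congr fun k => ?_
    rw [fCoeff_apply]; ring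
  have hM : Summable fun k => ((m (normSq g k) : ℂ) * planeWave k x) • fCoeff u k :=
    Pi.summable.2 fun a => Pi.summable.2 fun b => hs a b
  have h1 : (∑' k, ((m (normSq g k) : ℂ) * planeWave k x) • fCoeff u k) a b =
      ∑' k, ((m (normSq g k) : ℂ) * planeWave k x) * fCoeff u k a b :=
    ((Pi.hasSum.1 ((Pi.hasSum.1 hM.hasSum) a)) b).tsum_eq.symm
  rw [funcLap, Matrix.smul_apply, h1, fseries, smul_eq_mul]
  congr 1
  exact tsum_congr fun k => by ring

lemma continuous_funcLap {m : ℝ → ℝ} (hm : BoundedSymbol g m) {u : MatField d N}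
    (hu : IsSmoothMat u) (a b : Fin N) : Continuous fun x => funcLap g m u x a b := by
  simp only [funcLap_apply hm hu]
  exact continuous_fseries (hm.summable (hu a b).summable_sc)

lemma continuous_trace_mul_funcLap {m : ℝ → ℝ} (hm : BoundedSymbol g m) {u v : MatField d N}
    (hu : IsSmoothMat u) (hv : IsSmoothMat v) :
    Continuous fun x => Matrix.trace (u x * funcLap g m v x) := by
  simp only [Matrix.trace, Matrix.diag_apply, Matrix.mul_apply]
  exact continuous_finsetSum _ fun a _ => continuous_finsetSum _ fun b _ =>
    (hu a b).continuous.mul (continuous_funcLap hm hv b a)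

/-- Parseval's identity for `∫ tr u m(-∂²) v`. -/
lemma hasSum_integral_trace_mul_funcLap {m : ℝ → ℝ} (hm : BoundedSymbol g m) {u v : MatField d N}
    (hu : IsSmoothMat u) (hv : IsSmoothMat v) :
    HasSum (fun k => (m (normSq g k) : ℂ) * Matrix.trace (fCoeff u (-k) * fCoeff v k))
      (∫ x, Matrix.trace (u x * funcLap g m v x)) := by
  have h1 : ∫ x, Matrix.trace (u x * funcLap g m v x) =
      ∑ a, ∑ b, ∫ x, u x a b * fseries (fun k => (m (normSq g k) : ℂ) * fCoeff v k b a) x := by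
    simp only [Matrix.trace, Matrix.diag_apply, Matrix.mul_apply, funcLap_apply hm hv]
    have hc : ∀ a b, Integrable fun x =>
        u x a b * fseries (fun k => (m (normSq g k) : ℂ) * fCoeff v k b a) x := fun a b =>
      integrable_of_continuous ((hu a b).continuous.mul
        (continuous_fseries (hm.summable (hv b a).summable_sc)))
    rw [integral_finsetSum _ fun a _ => integrable_finsetSum _ fun b _ => hc a b]
    exact Finset.sum_congr rfl fun a _ => integral_finsetSum _ fun b _ => hc a b
  rw [h1]
  have h2 := hasSum_sum (s := Finset.univ) fun (a : Fin N) _ => hasSum_sum (s := Finset.univ)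
    fun (b : Fin N) _ => hasSum_integral_mul_fseries (hm.summable (hv b a).summable_sc)
      (hu a b).continuous
  refine h2.congr_fun fun k => ?_
  simp only [Matrix.trace, Matrix.diag_apply, Matrix.mul_apply, Finset.mul_sum, fCoeff_apply]
  exact Finset.sum_congr rfl fun a _ => Finset.sum_congr rfl fun b _ => by ring

lemma integral_trace_eq {u : MatField d N} (hu : IsSmoothMat u) :
    ∫ x, Matrix.trace (u x) = (fnorm d : ℂ)⁻¹ * Matrix.trace (fCoeff u 0) := by
  have h2 : (fnorm d : ℂ) ≠ 0 := Complex.ofReal_ne_zero.2 fnorm_pos.ne'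
  simp only [Matrix.trace, Matrix.diag_apply, fCoeff_apply, sc, neg_zero, planeWave_zero, mul_one,
    Finset.mul_sum]
  rw [integral_finsetSum _ fun a _ => integrable_of_continuous (hu a a).continuous]
  exact Finset.sum_congr rfl fun a _ => by rw [← mul_assoc, inv_mul_cancel₀ h2, one_mul]

lemma IsSmoothMat.raiseCurv {Om : Fin d → Fin d → MatField d N} (h : ∀ μ ν, IsSmoothMat (Om μ ν))
    (μ ν : Fin d) : IsSmoothMat (raiseCurv g Om μ ν) :=
  isSmoothMat_sum fun ρ _ => isSmoothMat_sum fun σ _ => (h ρ σ).smul _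

/-- The contraction `Ω̂_{μν}(-k) Ω̂'^{μν}(k)`. -/
def curvPair (g : Matrix (Fin d) (Fin d) ℝ) (Om Om' : Fin d → Fin d → MatField d N)
    (k : Fin d → ℤ) : ℂ :=
  ∑ μ, ∑ ν, Matrix.trace (fCoeff (Om μ ν) (-k) * fCoeff (raiseCurv g Om' μ ν) k)

lemma hasSum_curvPair {m : ℝ → ℝ} (hm : BoundedSymbol g m) {Om Om' : Fin d → Fin d → MatField d N}
    (h : ∀ μ ν, IsSmoothMat (Om μ ν)) (h' : ∀ μ ν, IsSmoothMat (Om' μ ν)) :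
    HasSum (fun k => (m (normSq g k) : ℂ) * curvPair g Om Om' k)
      (∑ μ, ∑ ν, ∫ x, Matrix.trace (Om μ ν x * funcLap g m (raiseCurv g Om' μ ν) x)) := by
  have h1 := hasSum_sum (s := Finset.univ) fun μ _ => hasSum_sum (s := Finset.univ) fun ν _ =>
    hasSum_integral_trace_mul_funcLap hm (h μ ν) (IsSmoothMat.raiseCurv (g := g) h' μ ν)
  refine h1.congr_fun fun k => ?_
  simp only [curvPair, Finset.mul_sum]

lemma integral_quadratic {m m' : ℝ → ℝ} (hm : BoundedSymbol g m) (hm' : BoundedSymbol g m')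
    (hE : IsSmoothMat E) {Om : Fin d → Fin d → MatField d N} (h : ∀ μ ν, IsSmoothMat (Om μ ν))
    (r x y z : ℂ) :
    ∫ p : Torus d, r * Matrix.trace (x • E p + y • (E p * funcLap g m E p) + z •
      ∑ μ, ∑ ν, Om μ ν p * funcLap g m' (raiseCurv g Om μ ν) p) =
    r * (x * ((fnorm d : ℂ)⁻¹ * Matrix.trace (fCoeff E 0)) +
      y * ∑' k, (m (normSq g k) : ℂ) * Matrix.trace (fCoeff E (-k) * fCoeff E k) +
      z * ∑' k, (m' (normSq g k) : ℂ) * curvPair g Om Om k) := by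
  have hr := fun μ ν => IsSmoothMat.raiseCurv (g := g) h μ ν
  have i1 : Integrable fun p => x * Matrix.trace (E p) := by
    refine integrable_of_continuous (continuous_const.mul ?_)
    exact continuous_finsetSum _ fun a _ => (hE a a).continuous
  have i2 : Integrable fun p => y * Matrix.trace (E p * funcLap g m E p) :=
    integrable_of_continuous (continuous_const.mul (continuous_trace_mul_funcLap hm hE hE))
  have i3 : ∀ μ ν, Integrable fun p => Matrix.trace (Om μ ν p * funcLap g m' (raiseCurv g Om μ ν) p) :=
    fun μ ν => integrable_of_continuous (continuous_trace_mul_funcLap hm' (h μ ν) (hr μ ν))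
  have i12 : Integrable fun p => x * Matrix.trace (E p) + y * Matrix.trace (E p * funcLap g m E p) :=
    i1.add i2
  have i4 : Integrable fun p => z * ∑ μ, ∑ ν,
      Matrix.trace (Om μ ν p * funcLap g m' (raiseCurv g Om μ ν) p) :=
    (integrable_finsetSum _ fun μ _ => integrable_finsetSum _ fun ν _ => i3 μ ν).const_mul z
  rw [integral_const_mul, (hasSum_integral_trace_mul_funcLap hm hE hE).tsum_eq,
    (hasSum_curvPair hm' h h).tsum_eq, ← integral_trace_eq hE]
  simp only [Matrix.trace_add, Matrix.trace_smul, Matrix.trace_sum, smul_eq_mul]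
  rw [integral_add i12 i4, integral_add i1 i2, integral_const_mul, integral_const_mul,
    integral_const_mul, integral_finsetSum _ fun μ _ => integrable_finsetSum _ fun ν _ => i3 μ ν]
  congr 4
  exact funext fun μ => integral_finsetSum _ fun ν _ => i3 μ ν

lemma bvH_nonneg (z : ℝ) : 0 ≤ bvH z :=
  intervalIntegral.integral_nonneg zero_le_one fun _ _ => (Real.exp_pos _).le

lemma bvH_le_one {z : ℝ} (hz : 0 ≤ z) : bvH z ≤ 1 := by
  have h := intervalIntegral.integral_mono_on (μ := volume) (zero_le_one' ℝ)
    (Continuous.intervalIntegrable (by fun_prop) _ _)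
    (intervalIntegrable_const (c := (1 : ℝ)))
    (f := fun α => Real.exp (-(α * (1 - α)) * z)) fun α hα => by
      rw [Real.exp_le_one_iff]
      have := mul_nonneg (mul_nonneg hα.1 (sub_nonneg.2 hα.2)) hz
      linarith
  simpa [bvH] using h

lemma one_sub_le_bvH {z : ℝ} (hz : 0 ≤ z) : 1 - z ≤ bvH z := by
  have h := intervalIntegral.integral_mono_on (μ := volume) (zero_le_one' ℝ)
    (intervalIntegrable_const (c := 1 - z))
    (Continuous.intervalIntegrable (by fun_prop) _ _)
    (g := fun α => Real.exp (-(α * (1 - α)) * z)) fun α hα => by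
      have h1 := Real.add_one_le_exp (-(α * (1 - α)) * z)
      have h2 : α * (1 - α) ≤ 1 := by nlinarith [hα.1, hα.2]
      nlinarith
  simpa [bvH] using h

lemma abs_bvQ_le {z : ℝ} (hz : 0 ≤ z) : |bvQ z| ≤ 1 := by
  unfold bvQ
  split_ifs with h
  · norm_num [abs_of_pos]
  · have hz' : 0 < z := lt_of_le_of_ne hz (Ne.symm h)
    have h1 := bvH_le_one hz
    have h2 := one_sub_le_bvH hz
    rw [abs_mul, abs_div, abs_of_pos hz', abs_of_nonpos (by linarith : bvH z - 1 ≤ 0)]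
    have h3 : -(bvH z - 1) / z ≤ 1 := by rw [div_le_one hz']; linarith
    have h4 : 0 ≤ -(bvH z - 1) / z := div_nonneg (by linarith) hz
    rw [abs_neg, abs_of_pos (by norm_num : (0 : ℝ) < 1 / 2)]
    linarith

lemma boundedSymbol_bvH (hg : g.PosDef) {t : ℝ} (ht : 0 ≤ t) :
    BoundedSymbol g fun z => 1 / 2 * bvH (t * z) := by
  refine ⟨1, fun k => ?_⟩
  have hz := mul_nonneg ht (normSq_nonneg hg k)
  have h1 := bvH_le_one hz
  have h2 := bvH_nonneg (t * normSq g k)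
  rw [abs_of_nonneg (by positivity)]
  linarith

lemma boundedSymbol_bvQ (hg : g.PosDef) {t : ℝ} (ht : 0 ≤ t) :
    BoundedSymbol g fun z => bvQ (t * z) :=
  ⟨1, fun k => abs_bvQ_le (mul_nonneg ht (normSq_nonneg hg k))⟩

lemma boundedSymbol_inv (hg : g.PosDef) : BoundedSymbol g fun z => z⁻¹ := by
  obtain ⟨c, hc, -, -, h⟩ := exists_lower_normSq hg
  refine ⟨c⁻¹, fun k => ?_⟩
  rw [abs_of_nonneg (inv_nonneg.2 (normSq_nonneg hg k))]
  rcases eq_or_ne k 0 with rfl | hk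
  · rw [normSq_zero, inv_zero]; positivity
  · refine inv_anti₀ hc ((le_mul_of_one_le_right hc.le ?_).trans (h k hk))
    exact one_le_pow₀ (one_le_jb k)

lemma smallT_eq (hg : g.PosDef) (hE : IsSmoothMat E) {Om : Fin d → Fin d → MatField d N}
    (h : ∀ μ ν, IsSmoothMat (Om μ ν)) {t : ℝ} (ht : 0 ≤ t) : smallT g E Om t =
    (((4 * Real.pi * t) ^ (-(d : ℝ) / 2) : ℝ) : ℂ) * ((Real.sqrt g.det : ℂ) *
      ((t : ℂ) * ((fnorm d : ℂ)⁻¹ * Matrix.trace (fCoeff E 0)) +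
      (t ^ 2 : ℂ) * ∑' k, ((1 / 2 * bvH (t * normSq g k) : ℝ) : ℂ) *
        Matrix.trace (fCoeff E (-k) * fCoeff E k) +
      (t ^ 2 : ℂ) * ∑' k, (bvQ (t * normSq g k) : ℂ) * curvPair g Om Om k)) :=
  congrArg _ (integral_quadratic (boundedSymbol_bvH hg ht) (boundedSymbol_bvQ hg ht) hE h _ _ _ _)

lemma largeT_eq (hg : g.PosDef) (hE : IsSmoothMat E) {Om : Fin d → Fin d → MatField d N}
    (h : ∀ μ ν, IsSmoothMat (Om μ ν)) (t : ℝ) : largeT g E Om t =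
    ((t / (2 * Real.pi) ^ d : ℝ) : ℂ) * ((fnorm d : ℂ)⁻¹ * Matrix.trace (fCoeff E 0) +
      ∑' k, (((normSq g k)⁻¹ : ℝ) : ℂ) * Matrix.trace (fCoeff E (-k) * fCoeff E k) +
      (1 / 2 : ℂ) * ∑' k, (((normSq g k)⁻¹ : ℝ) : ℂ) * curvPair g Om Om k) := by
  have h1 := integral_quadratic (boundedSymbol_inv hg) (boundedSymbol_inv hg) hE h 1 1 1 (1 / 2)
  simp only [one_mul, one_smul] at h1
  rw [largeT]
  exact congrArg _ h1

/-! ### The gauge-covariant curvature -/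

/-- The commutator term of the curvature. -/
def commCurv (ω : Fin d → MatField d N) (μ ν : Fin d) : MatField d N :=
  fun x => ω μ x * ω ν x - ω ν x * ω μ x

lemma isSmoothMat_linCurv (hω : ∀ μ, IsSmoothMat (ω μ)) (μ ν : Fin d) :
    IsSmoothMat (linCurv ω μ ν) := ((hω ν).pdMat μ).sub ((hω μ).pdMat ν)

lemma isSmoothMat_commCurv (hω : ∀ μ, IsSmoothMat (ω μ)) (μ ν : Fin d) :
    IsSmoothMat (commCurv ω μ ν) := ((hω μ).mul (hω ν)).sub ((hω ν).mul (hω μ))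

lemma isSmoothMat_fullCurv (hω : ∀ μ, IsSmoothMat (ω μ)) (μ ν : Fin d) :
    IsSmoothMat (fullCurv ω μ ν) := (isSmoothMat_linCurv hω μ ν).add (isSmoothMat_commCurv hω μ ν)

lemma fCoeff_linCurv (hω : ∀ μ, IsSmoothMat (ω μ)) (μ ν : Fin d) (k : Fin d → ℤ) :
    fCoeff (linCurv ω μ ν) k =
      (Complex.I * (k μ : ℂ)) • fCoeff (ω ν) k - (Complex.I * (k ν : ℂ)) • fCoeff (ω μ) k := by
  rw [← fCoeff_pdMat (hω ν), ← fCoeff_pdMat (hω μ)]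
  exact fCoeff_sub ((hω ν).pdMat μ) ((hω μ).pdMat ν) k

lemma fCoeff_raiseCurv {Om : Fin d → Fin d → MatField d N} (h : ∀ μ ν, IsSmoothMat (Om μ ν))
    (μ ν : Fin d) (k : Fin d → ℤ) : fCoeff (raiseCurv g Om μ ν) k =
      ∑ ρ, ∑ σ, ((g⁻¹ μ ρ * g⁻¹ ν σ : ℝ) : ℂ) • fCoeff (Om ρ σ) k := by
  have h1 : fCoeff (raiseCurv g Om μ ν) k = ∑ ρ, fCoeff (fun x => ∑ σ,
      ((g⁻¹ μ ρ * g⁻¹ ν σ : ℝ) : ℂ) • Om ρ σ x) k :=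
    fCoeff_sum (fun ρ _ => isSmoothMat_sum fun σ _ => (h ρ σ).smul _) k
  rw [h1]
  refine Finset.sum_congr rfl fun ρ _ => ?_
  rw [fCoeff_sum (u := fun σ x => ((g⁻¹ μ ρ * g⁻¹ ν σ : ℝ) : ℂ) • Om ρ σ x)
    fun σ _ => (h ρ σ).smul _]
  exact Finset.sum_congr rfl fun σ _ => fCoeff_smul _ _ _

lemma fCoeff_linCurv_smul (hω : ∀ μ, IsSmoothMat (ω μ)) (ε : ℂ) (μ ν : Fin d) (k : Fin d → ℤ) :
    fCoeff (linCurv (ε • ω) μ ν) k = ε • fCoeff (linCurv ω μ ν) k := by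
  have hω' : ∀ μ, IsSmoothMat ((ε • ω) μ) := fun μ => (hω μ).smul ε
  rw [fCoeff_linCurv hω, fCoeff_linCurv hω']
  simp only [Pi.smul_apply, fCoeff_smul, smul_sub, smul_smul]
  congr 2 <;> ring

lemma fCoeff_fullCurv_smul (hω : ∀ μ, IsSmoothMat (ω μ)) (ε : ℂ) (μ ν : Fin d) (k : Fin d → ℤ) :
    fCoeff (fullCurv (ε • ω) μ ν) k =
      ε • fCoeff (linCurv ω μ ν) k + ε ^ 2 • fCoeff (commCurv ω μ ν) k := by
  have hω' : ∀ μ, IsSmoothMat ((ε • ω) μ) := fun μ => (hω μ).smul ε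
  have h1 : fCoeff (fullCurv (ε • ω) μ ν) k =
      fCoeff (linCurv (ε • ω) μ ν) k + fCoeff (commCurv (ε • ω) μ ν) k :=
    fCoeff_add (isSmoothMat_linCurv hω' μ ν) (isSmoothMat_commCurv hω' μ ν) k
  have h2 : commCurv (ε • ω) μ ν = ε ^ 2 • commCurv ω μ ν := by
    funext x
    simp only [commCurv, Pi.smul_apply, Matrix.smul_mul, Matrix.mul_smul, smul_smul, smul_sub,
      pow_two]
  rw [h1, fCoeff_linCurv_smul hω, h2, fCoeff_smul]

lemma curvPair_eq {Om Om' : Fin d → Fin d → MatField d N}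
    (h' : ∀ μ ν, IsSmoothMat (Om' μ ν)) (k : Fin d → ℤ) :
    curvPair g Om Om' k = ∑ μ, ∑ ν, ∑ ρ, ∑ σ, ((g⁻¹ μ ρ * g⁻¹ ν σ : ℝ) : ℂ) *
      Matrix.trace (fCoeff (Om μ ν) (-k) * fCoeff (Om' ρ σ) k) := by
  simp only [curvPair, fCoeff_raiseCurv h', Matrix.mul_sum, Matrix.mul_smul, Matrix.trace_sum,
    Matrix.trace_smul, smul_eq_mul]

lemma curvPair_linCurv_smul (hω : ∀ μ, IsSmoothMat (ω μ)) (ε : ℂ) (k : Fin d → ℤ) :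
    curvPair g (linCurv (ε • ω)) (linCurv (ε • ω)) k =
      ε ^ 2 * curvPair g (linCurv ω) (linCurv ω) k := by
  have h1 := isSmoothMat_linCurv hω
  have h2 := isSmoothMat_linCurv (ω := ε • ω) fun μ => (hω μ).smul ε
  rw [curvPair_eq h1, curvPair_eq h2]
  simp only [fCoeff_linCurv_smul hω, Matrix.smul_mul, Matrix.mul_smul, Matrix.trace_smul,
    smul_eq_mul, Finset.mul_sum]
  exact Finset.sum_congr rfl fun μ _ => Finset.sum_congr rfl fun ν _ =>
    Finset.sum_congr rfl fun ρ _ => Finset.sum_congr rfl fun σ _ => by ring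

lemma curvPair_fullCurv_smul (hω : ∀ μ, IsSmoothMat (ω μ)) (ε : ℂ) (k : Fin d → ℤ) :
    curvPair g (fullCurv (ε • ω)) (fullCurv (ε • ω)) k =
      ε ^ 2 * curvPair g (linCurv ω) (linCurv ω) k +
      (ε ^ 3 * (curvPair g (linCurv ω) (commCurv ω) k + curvPair g (commCurv ω) (linCurv ω) k) +
      ε ^ 4 * curvPair g (commCurv ω) (commCurv ω) k) := by
  have h1 := isSmoothMat_linCurv hω
  have h2 := isSmoothMat_fullCurv (ω := ε • ω) fun μ => (hω μ).smul ε
  have h3 := isSmoothMat_commCurv hω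
  rw [curvPair_eq h1, curvPair_eq h2, curvPair_eq h3, curvPair_eq h1, curvPair_eq h3]
  simp only [fCoeff_fullCurv_smul hω, Matrix.smul_mul, Matrix.mul_smul, Matrix.trace_smul,
    smul_eq_mul, Finset.mul_sum, Matrix.add_mul, Matrix.mul_add, Matrix.trace_add,
    ← Finset.sum_add_distrib]
  exact Finset.sum_congr rfl fun μ _ => Finset.sum_congr rfl fun ν _ =>
    Finset.sum_congr rfl fun ρ _ => Finset.sum_congr rfl fun σ _ => by ring

/-- Passing from the linearised to the full curvature changes the quadratic functional by terms of
third and fourth order in the connection. -/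
lemma exists_tsum_curvPair_sub {m : ℝ → ℝ} (hm : BoundedSymbol g m) (hω : ∀ μ, IsSmoothMat (ω μ)) :
    ∃ X Y : ℂ, ∀ ε : ℂ,
      ∑' k, (m (normSq g k) : ℂ) * curvPair g (fullCurv (ε • ω)) (fullCurv (ε • ω)) k -
      ∑' k, (m (normSq g k) : ℂ) * curvPair g (linCurv (ε • ω)) (linCurv (ε • ω)) k =
        ε ^ 3 * (X + ε * Y) := by
  have h1 := isSmoothMat_linCurv hω
  have h3 := isSmoothMat_commCurv hω
  obtain ⟨S, hS⟩ : ∃ S, HasSum (fun k => (m (normSq g k) : ℂ) *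
      curvPair g (linCurv ω) (linCurv ω) k) S := ⟨_, hasSum_curvPair hm h1 h1⟩
  obtain ⟨X, hX⟩ : ∃ X, HasSum (fun k => (m (normSq g k) : ℂ) * curvPair g (linCurv ω) (commCurv ω) k +
      (m (normSq g k) : ℂ) * curvPair g (commCurv ω) (linCurv ω) k) X :=
    ⟨_, (hasSum_curvPair hm h1 h3).add (hasSum_curvPair hm h3 h1)⟩
  obtain ⟨Y, hY⟩ : ∃ Y, HasSum (fun k => (m (normSq g k) : ℂ) *
      curvPair g (commCurv ω) (commCurv ω) k) Y := ⟨_, hasSum_curvPair hm h3 h3⟩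
  refine ⟨X, Y, fun ε => ?_⟩
  have h4 := (hS.mul_left (ε ^ 2)).add ((hX.mul_left (ε ^ 3)).add (hY.mul_left (ε ^ 4)))
  have e1 : ∑' k, (m (normSq g k) : ℂ) * curvPair g (fullCurv (ε • ω)) (fullCurv (ε • ω)) k =
      ε ^ 2 * S + (ε ^ 3 * X + ε ^ 4 * Y) := by
    rw [← h4.tsum_eq]
    exact tsum_congr fun k => by rw [curvPair_fullCurv_smul hω]; ring
  have e2 : ∑' k, (m (normSq g k) : ℂ) * curvPair g (linCurv (ε • ω)) (linCurv (ε • ω)) k =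
      ε ^ 2 * S := by
    rw [← (hS.mul_left (ε ^ 2)).tsum_eq]
    exact tsum_congr fun k => by rw [curvPair_linCurv_smul hω]; ring
  rw [e1, e2]
  ring

lemma isBigO_cube (X Y : ℂ) (c : ℂ) {f : ℝ → ℂ}
    (h : ∀ ε : ℝ, f ε = c * ((ε : ℂ) ^ 3 * (X + ε * Y))) : f =O[𝓝 0] fun ε : ℝ => ε ^ 3 := by
  refine IsBigO.of_bound (‖c‖ * (‖X‖ + ‖Y‖)) ?_
  filter_upwards [Metric.closedBall_mem_nhds (0 : ℝ) one_pos] with ε hε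
  have hε' : |ε| ≤ 1 := by simpa using hε
  rw [h, norm_mul, norm_mul, norm_pow, Complex.norm_real, norm_pow, Real.norm_eq_abs]
  have h1 : ‖X + ε * Y‖ ≤ ‖X‖ + ‖Y‖ := by
    refine (norm_add_le _ _).trans (add_le_add le_rfl ?_)
    rw [norm_mul, Complex.norm_real, Real.norm_eq_abs]
    exact mul_le_of_le_one_left (norm_nonneg _) hε'
  calc _ ≤ ‖c‖ * (|ε| ^ 3 * (‖X‖ + ‖Y‖)) := by gcongr
    _ = _ := by ring

theorem smallT_fullCurv_sub (hg : g.PosDef) (hE : IsSmoothMat E) (hω : ∀ μ, IsSmoothMat (ω μ))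
    {t : ℝ} (ht : 0 < t) :
    (fun ε : ℝ => smallT g ((ε : ℂ) • E) (fullCurv ((ε : ℂ) • ω)) t
            - smallT g ((ε : ℂ) • E) (linCurv ((ε : ℂ) • ω)) t) =O[𝓝 0] (fun ε : ℝ => ε ^ 3) := by
  obtain ⟨X, Y, h⟩ := exists_tsum_curvPair_sub (boundedSymbol_bvQ hg ht.le) hω
  refine isBigO_cube X Y ((((4 * Real.pi * t) ^ (-(d : ℝ) / 2) : ℝ) : ℂ) * ((Real.sqrt g.det : ℂ) *
    (t ^ 2 : ℂ))) fun ε => ?_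
  have hω' : ∀ μ, IsSmoothMat (((ε : ℂ) • ω) μ) := fun μ => (hω μ).smul _
  rw [smallT_eq hg (hE.smul _) (isSmoothMat_fullCurv hω') ht.le,
    smallT_eq hg (hE.smul _) (isSmoothMat_linCurv hω') ht.le, ← h]
  ring

theorem largeT_fullCurv_sub (hg : g.PosDef) (hE : IsSmoothMat E) (hω : ∀ μ, IsSmoothMat (ω μ))
    (t : ℝ) :
    (fun ε : ℝ => largeT g ((ε : ℂ) • E) (fullCurv ((ε : ℂ) • ω)) t
            - largeT g ((ε : ℂ) • E) (linCurv ((ε : ℂ) • ω)) t) =O[𝓝 0] (fun ε : ℝ => ε ^ 3) := by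
  obtain ⟨X, Y, h⟩ := exists_tsum_curvPair_sub (boundedSymbol_inv hg) hω
  refine isBigO_cube X Y (((t / (2 * Real.pi) ^ d : ℝ) : ℂ) * (1 / 2 : ℂ)) fun ε => ?_
  have hω' : ∀ μ, IsSmoothMat (((ε : ℂ) • ω) μ) := fun μ => (hω μ).smul _
  rw [largeT_eq hg (hE.smul _) (isSmoothMat_fullCurv hω'),
    largeT_eq hg (hE.smul _) (isSmoothMat_linCurv hω'), ← h]
  ring

end Functionals

/-! ### Comparison of form factors -/

section Comparison

open Set

variable {d N : ℕ} {g : Matrix (Fin d) (Fin d) ℝ} {E : MatField d N} {ω : Fin d → MatField d N}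

/-- The transversal tensor `k² g^{μν} - k^μ k^ν`. -/
def transv (g : Matrix (Fin d) (Fin d) ℝ) (k : Fin d → ℤ) (μ ν : Fin d) : ℝ :=
  normSq g k * g⁻¹ μ ν - raise g k μ * raise g k ν

lemma raise_eq_left (hg : g.PosDef) (k : Fin d → ℤ) (ν : Fin d) :
    raise g k ν = ∑ μ, g⁻¹ μ ν * (k μ : ℝ) :=
  Finset.sum_congr rfl fun μ _ => by rw [inv_symm hg]

/-- In Fourier space the square of the linearised curvature is the transversal part of `ω`. -/
lemma curvPair_linCurv (hg : g.PosDef) (hω : ∀ μ, IsSmoothMat (ω μ)) (k : Fin d → ℤ) :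
    curvPair g (linCurv ω) (linCurv ω) k = 2 * ∑ μ, ∑ ν, (transv g k μ ν : ℂ) *
      Matrix.trace (fCoeff (ω μ) (-k) * fCoeff (ω ν) k) := by
  set τ : Fin d → Fin d → ℂ := fun μ ν => Matrix.trace (fCoeff (ω μ) (-k) * fCoeff (ω ν) k) with hτ
  set G : Fin d → Fin d → ℂ := fun μ ν => (g⁻¹ μ ν : ℂ) with hG
  set K : Fin d → ℂ := fun μ => (k μ : ℂ) with hK
  set R : Fin d → ℂ := fun μ => (raise g k μ : ℂ) with hR
  have hR1 : ∀ μ, R μ = ∑ ν, G μ ν * K ν := fun μ => by simp [hR, raise, hG, hK]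
  have hR2 : ∀ ν, R ν = ∑ μ, G μ ν * K μ := fun ν => by simp [hR, raise_eq_left hg, hG, hK]
  have hn : (normSq g k : ℂ) = ∑ μ, ∑ ν, G μ ν * K μ * K ν := by simp [normSq, hG, hK]
  have hI : Complex.I * Complex.I = -1 := Complex.I_mul_I
  have h1 : curvPair g (linCurv ω) (linCurv ω) k = ∑ μ, ∑ ν, ∑ ρ, ∑ σ,
      ((G μ ρ * K μ * K ρ) * (G ν σ * τ ν σ) - (G μ ρ * K μ) * (G ν σ * K σ) * τ ν ρ -
        (G μ ρ * K ρ) * (G ν σ * K ν) * τ μ σ + (G ν σ * K ν * K σ) * (G μ ρ * τ μ ρ)) := by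
    rw [curvPair_eq (isSmoothMat_linCurv hω)]
    refine Finset.sum_congr rfl fun μ _ => Finset.sum_congr rfl fun ν _ =>
      Finset.sum_congr rfl fun ρ _ => Finset.sum_congr rfl fun σ _ => ?_
    simp only [fCoeff_linCurv hω, Matrix.sub_mul, Matrix.mul_sub, Matrix.smul_mul, Matrix.mul_smul,
      Matrix.trace_sub, Matrix.trace_smul, smul_eq_mul, Pi.neg_apply, Int.cast_neg,
      Complex.ofReal_mul, hG, hK, hτ]
    linear_combination (-(g⁻¹ μ ρ * g⁻¹ ν σ : ℂ) *
      ((k μ : ℂ) * k ρ * τ ν σ - k μ * k σ * τ ν ρ - k ν * k ρ * τ μ σ + k ν * k σ * τ μ ρ)) * hI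
  have a1 : ∑ μ, ∑ ν, ∑ ρ, ∑ σ, (G μ ρ * K μ * K ρ) * (G ν σ * τ ν σ) =
      (normSq g k : ℂ) * ∑ μ, ∑ ν, G μ ν * τ μ ν := by
    rw [hn, Finset.sum_mul]
    refine Finset.sum_congr rfl fun μ _ => ?_
    rw [Finset.sum_comm, Finset.sum_mul]
    refine Finset.sum_congr rfl fun ρ _ => ?_
    simp only [Finset.mul_sum]
  have a2 : ∑ μ, ∑ ν, ∑ ρ, ∑ σ, (G μ ρ * K μ) * (G ν σ * K σ) * τ ν ρ =
      ∑ μ, ∑ ν, R μ * R ν * τ μ ν := by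
    rw [Finset.sum_comm]
    refine Finset.sum_congr rfl fun ν _ => ?_
    rw [Finset.sum_comm]
    refine Finset.sum_congr rfl fun ρ _ => ?_
    rw [hR1 ν, hR2 ρ, mul_comm (∑ i, G ν i * K i)]
    simp only [Finset.mul_sum, Finset.sum_mul]
    exact Finset.sum_comm
  have a3 : ∑ μ, ∑ ν, ∑ ρ, ∑ σ, (G μ ρ * K ρ) * (G ν σ * K ν) * τ μ σ =
      ∑ μ, ∑ ν, R μ * R ν * τ μ ν := by
    refine Finset.sum_congr rfl fun μ _ => ?_
    have e : ∀ ν, ∑ ρ, ∑ σ, (G μ ρ * K ρ) * (G ν σ * K ν) * τ μ σ =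
        ∑ σ, ∑ ρ, (G μ ρ * K ρ) * (G ν σ * K ν) * τ μ σ := fun ν => Finset.sum_comm
    simp only [e]
    rw [Finset.sum_comm]
    refine Finset.sum_congr rfl fun σ _ => ?_
    rw [hR1 μ, hR2 σ, mul_comm (∑ i, G μ i * K i)]
    simp only [Finset.mul_sum, Finset.sum_mul]
    rw [Finset.sum_comm]
    exact Finset.sum_congr rfl fun _ _ => Finset.sum_congr rfl fun _ _ => by ring
  have a4 : ∑ μ, ∑ ν, ∑ ρ, ∑ σ, (G ν σ * K ν * K σ) * (G μ ρ * τ μ ρ) =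
      (normSq g k : ℂ) * ∑ μ, ∑ ν, G μ ν * τ μ ν := by
    rw [← a1, Finset.sum_comm]
    refine Finset.sum_congr rfl fun ν _ => Finset.sum_congr rfl fun μ _ => ?_
    rw [Finset.sum_comm]
  have h2 : ∑ μ, ∑ ν, (transv g k μ ν : ℂ) * τ μ ν = (normSq g k : ℂ) * ∑ μ, ∑ ν, G μ ν * τ μ ν -
      ∑ μ, ∑ ν, R μ * R ν * τ μ ν := by
    simp only [Finset.mul_sum, ← Finset.sum_sub_distrib, transv, hG, hR]
    refine Finset.sum_congr rfl fun μ _ => Finset.sum_congr rfl fun ν _ => ?_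
    push_cast; ring
  rw [h1, h2]
  simp only [Finset.sum_add_distrib, Finset.sum_sub_distrib]
  rw [a1, a2, a3, a4]
  ring

/-- Two sets of form factors that are close to each other lead to close quadratic functionals: the
Fourier coefficients absorb any power of the momentum. -/
lemma norm_secondOrder_sub_le (hg : g.PosDef) (hE : IsSmoothMat E) (hω : ∀ μ, IsSmoothMat (ω μ))
    (n : ℕ) : ∃ K : ℝ, ∀ (t δ : ℝ) (a₁ : ℝ) (a₂ : (Fin d → ℤ) → ℝ)
      (a₃ : Fin d → Fin d → (Fin d → ℤ) → ℝ), 0 < t → 0 ≤ δ → |v1 g 0 t - a₁| ≤ δ →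
      (∀ k, |v2 g k t - a₂ k| ≤ δ * jb k ^ n) → (∀ μ ν k, |v3 g μ ν k t - a₃ μ ν k| ≤ δ * jb k ^ n) →
      ‖secondOrder g E ω t - ((a₁ : ℂ) * Matrix.trace (fCoeff E 0) +
        ∑' k, ((a₂ k : ℂ) * Matrix.trace (fCoeff E (-k) * fCoeff E k) +
          ∑ μ, ∑ ν, (a₃ μ ν k : ℂ) * Matrix.trace (fCoeff (ω μ) (-k) * fCoeff (ω ν) k)))‖ ≤ K * δ := by
  have hτ : ∀ {u v : MatField d N}, IsSmoothMat u → IsSmoothMat v →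
      Summable fun k => jb k ^ n * ‖Matrix.trace (fCoeff u (-k) * fCoeff v k)‖ := by
    intro u v hu hv
    obtain ⟨C, hC, h⟩ := hu.fCoeff_decay 0
    obtain ⟨D, hD, h'⟩ := hv.fCoeff_decay (n + 2 * d)
    refine Summable.of_nonneg_of_le (fun k => ?_) (fun k => ?_)
      ((summable_jb (d := d) le_rfl).mul_left (∑ _a : Fin N, ∑ _b : Fin N, C * D))
    · have := jb_pos k; positivity
    · have hj := jb_pos k
      have h1 : ‖Matrix.trace (fCoeff u (-k) * fCoeff v k)‖ ≤
          ∑ _a : Fin N, ∑ _b : Fin N, C * (D * (jb k ^ (n + 2 * d))⁻¹) := by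
        simp only [Matrix.trace, Matrix.diag_apply, Matrix.mul_apply]
        refine norm_sum_le_of_le _ fun a _ => norm_sum_le_of_le _ fun b _ => ?_
        rw [norm_mul]
        have h2 := h (-k) a b
        simp only [pow_zero, inv_one, mul_one] at h2
        exact mul_le_mul h2 (h' k b a) (norm_nonneg _) hC.le
      calc _ ≤ jb k ^ n * ∑ _a : Fin N, ∑ _b : Fin N, C * (D * (jb k ^ (n + 2 * d))⁻¹) := by gcongr
        _ = _ := by
          simp only [Finset.sum_const, nsmul_eq_mul]
          rw [pow_add]
          field_simp
  have hs := (hτ hE hE).add (summable_sum (s := Finset.univ) fun μ _ =>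
    summable_sum (s := Finset.univ) fun ν _ => hτ (hω μ) (hω ν))
  refine ⟨‖Matrix.trace (fCoeff E 0)‖ + ∑' k, (jb k ^ n * ‖Matrix.trace (fCoeff E (-k) * fCoeff E k)‖ +
    ∑ μ, ∑ ν, jb k ^ n * ‖Matrix.trace (fCoeff (ω μ) (-k) * fCoeff (ω ν) k)‖),
    fun t δ a₁ a₂ a₃ ht hδ h1 h2 h3 => ?_⟩
  obtain ⟨s₁, s₂, -, -, hQ⟩ := exists_hasSum_quadTerm hg hE hω ht
  set A : (Fin d → ℤ) → ℂ := fun k => (a₂ k : ℂ) * Matrix.trace (fCoeff E (-k) * fCoeff E k) +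
          ∑ μ, ∑ ν, (a₃ μ ν k : ℂ) * Matrix.trace (fCoeff (ω μ) (-k) * fCoeff (ω ν) k) with hA
  have hb : ∀ k, ‖quadTerm g E ω t k - A k‖ ≤ δ * (jb k ^ n *
      ‖Matrix.trace (fCoeff E (-k) * fCoeff E k)‖ +
      ∑ μ, ∑ ν, jb k ^ n * ‖Matrix.trace (fCoeff (ω μ) (-k) * fCoeff (ω ν) k)‖) := by
    intro k
    have e : quadTerm g E ω t k - A k =
        ((v2 g k t - a₂ k : ℝ) : ℂ) * Matrix.trace (fCoeff E (-k) * fCoeff E k) +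
        ∑ μ, ∑ ν, ((v3 g μ ν k t - a₃ μ ν k : ℝ) : ℂ) *
          Matrix.trace (fCoeff (ω μ) (-k) * fCoeff (ω ν) k) := by
      simp only [quadTerm, hA, Complex.ofReal_sub, sub_mul, Finset.sum_sub_distrib]
      ring
    rw [e, mul_add]
    refine (norm_add_le _ _).trans (add_le_add ?_ ?_)
    · rw [norm_mul, Complex.norm_real, Real.norm_eq_abs, ← mul_assoc]
      exact mul_le_mul_of_nonneg_right (h2 k) (norm_nonneg _)
    · simp only [Finset.mul_sum]
      refine norm_sum_le_of_le _ fun μ _ => norm_sum_le_of_le _ fun ν _ => ?_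
      rw [norm_mul, Complex.norm_real, Real.norm_eq_abs, ← mul_assoc]
      exact mul_le_mul_of_nonneg_right (h3 μ ν k) (norm_nonneg _)
  have hds : Summable fun k => quadTerm g E ω t k - A k :=
    Summable.of_norm_bounded (hs.mul_left δ) hb
  have hAs : Summable A := (hQ.summable.sub hds).congr fun k => by ring
  have hbd := tsum_of_norm_bounded (hs.hasSum.mul_left δ) hb
  have e : secondOrder g E ω t - ((a₁ : ℂ) * Matrix.trace (fCoeff E 0) + ∑' k, A k) =
      ((v1 g 0 t - a₁ : ℝ) : ℂ) * Matrix.trace (fCoeff E 0) + ∑' k, (quadTerm g E ω t k - A k) := by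
    have h4 := (hasSum_v1 (g := g) (E := E) t).add hQ.summable.hasSum
    have h5 : secondOrder g E ω t = (v1 g 0 t : ℂ) * Matrix.trace (fCoeff E 0) +
        ∑' k, quadTerm g E ω t k := by
      rw [← h4.tsum_eq, secondOrder]
      exact tsum_congr fun k => modeTerm_eq t k
    rw [h5, hQ.summable.tsum_sub hAs]
    push_cast; ring
  rw [e, add_mul]
  refine (norm_add_le _ _).trans (add_le_add ?_ (hbd.trans (le_of_eq (mul_comm _ _))))
  rw [norm_mul, Complex.norm_real, Real.norm_eq_abs, mul_comm]
  exact mul_le_mul_of_nonneg_left h1 (norm_nonneg _)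

/-- The quadratic functional of `E` and of the linearised curvature with multipliers `m` and `m'`, as
a sum over the modes of `E` and `ω`. -/
lemma hasSum_lin_form {m m' : ℝ → ℝ} (hg : g.PosDef) (hm : BoundedSymbol g m)
    (hm' : BoundedSymbol g m') (hE : IsSmoothMat E) (hω : ∀ μ, IsSmoothMat (ω μ)) (y z : ℂ) :
    HasSum (fun k => y * (m (normSq g k) : ℂ) * Matrix.trace (fCoeff E (-k) * fCoeff E k) +
      ∑ μ, ∑ ν, (z * (m' (normSq g k) : ℂ) * 2 * (transv g k μ ν : ℂ)) *
        Matrix.trace (fCoeff (ω μ) (-k) * fCoeff (ω ν) k))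
      (y * ∑' k, (m (normSq g k) : ℂ) * Matrix.trace (fCoeff E (-k) * fCoeff E k) +
        z * ∑' k, (m' (normSq g k) : ℂ) * curvPair g (linCurv ω) (linCurv ω) k) := by
  have h := isSmoothMat_linCurv hω
  have h1 := (hasSum_integral_trace_mul_funcLap hm hE hE).summable.hasSum.mul_left y
  have h2 := (hasSum_curvPair hm' h h).summable.hasSum.mul_left z
  refine (h1.add h2).congr_fun fun k => ?_
  rw [curvPair_linCurv hg hω, mul_assoc]
  congr 1
  simp only [Finset.mul_sum]
  exact Finset.sum_congr rfl fun μ _ => Finset.sum_congr rfl fun ν _ => by ring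

end Comparison

/-! ### Large times -/

section LargeTime

open Set

variable {d N : ℕ} {g : Matrix (Fin d) (Fin d) ℝ} {E : MatField d N} {ω : Fin d → MatField d N}

lemma pairWeight_zero_left (t : ℝ) (q : Fin d → ℤ) :
    pairWeight g t 0 q = Real.exp (-t * normSq g q) := by
  have h : ∀ ξ : ℝ, expWeight g 0 t ξ q = Real.exp (-t * normSq g q) := fun ξ => by
    rw [expWeight, add_zero]; congr 1; ring
  simp [pairWeight, h]

lemma pairWeight_zero_right {t : ℝ} (ht : 0 < t) {k : Fin d → ℤ}
    (hk : 0 < normSq g k) :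
    pairWeight g t k 0 = (1 - Real.exp (-t * normSq g k)) * (t * normSq g k)⁻¹ := by
  have h : ∀ ξ : ℝ, expWeight g k t ξ 0 = Real.exp (-t * normSq g k * ξ) := fun ξ => by
    rw [expWeight, zero_add, normSq_zero]; congr 1; ring
  have h0 : -t * normSq g k ≠ 0 := by have := mul_pos ht hk; linarith
  simp only [pairWeight, h]
  rw [intervalIntegral.integral_comp_mul_left _ h0, integral_exp]
  simp only [mul_zero, mul_one, Real.exp_zero, smul_eq_mul]
  field_simp
  ring

/-- Off the two momenta `q = 0` and `q = -k` the pair weight decays exponentially in time. -/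
lemma pairWeight_le_of_ne {c t : ℝ} (hc : ∀ k : Fin d → ℤ, k ≠ 0 → c ≤ normSq g k) (ht : 1 ≤ t)
    {k q : Fin d → ℤ} (hq : q ≠ 0) (hqk : q + k ≠ 0) :
    pairWeight g t k q ≤ Real.exp c * Real.exp (-c * t) *
      (Real.exp (-1 * normSq g (q + k)) + Real.exp (-1 * normSq g q)) := by
  have h : ∀ p : Fin d → ℤ, p ≠ 0 → Real.exp (-t * normSq g p) ≤
      Real.exp c * Real.exp (-c * t) * Real.exp (-1 * normSq g p) := fun p hp => by
    rw [← Real.exp_add, ← Real.exp_add]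
    refine Real.exp_le_exp.2 ?_
    nlinarith [hc p hp]
  refine (pairWeight_le t k q).trans ?_
  rw [mul_add]
  exact add_le_add (h _ hqk) (h _ hq)

/-- A momentum sum against the pair weight is dominated at large times by the two momenta at which
one of the two propagators carries a zero mode. -/
lemma exists_hasSum_pairWeight_largeT (hg : g.PosDef) {c : ℝ} (hc0 : 0 < c)
    (hc : ∀ k : Fin d → ℤ, k ≠ 0 → c ≤ normSq g k) (n : ℕ) :
    ∃ K : ℝ, 0 < K ∧ ∀ (t A S : ℝ) (k : Fin d → ℤ) (f : (Fin d → ℤ) → ℝ), 1 ≤ t → 0 ≤ A →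
      (∀ q, |f q| ≤ A * jb q ^ n) → HasSum (fun q => f q * pairWeight g t k q) S →
      |S - ((f 0 + f (-k)) * (t * normSq g k)⁻¹ + if k = 0 then f 0 else 0)| ≤
        A * jb k ^ n * K * Real.exp (-c * t) := by
  have hs := summable_jb_mul_exp hg one_pos n
  set K₀ := ∑' q : Fin d → ℤ, jb q ^ n * Real.exp (-1 * normSq g q) with hK₀
  have hK₀0 : 0 ≤ K₀ := tsum_nonneg fun q => by have := jb_pos q; positivity
  refine ⟨2 * Real.exp c * K₀ + 2 * c⁻¹, by positivity, fun t A S k f ht hA hf hS => ?_⟩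
  have ht0 : 0 < t := by linarith
  have hjk := one_le_jb k
  have hjn : 1 ≤ jb k ^ n := one_le_pow₀ hjk
  set e := Real.exp (-c * t) with he
  have he0 : 0 < e := Real.exp_pos _
  -- the shifted Gaussian sum
  have hs' : HasSum (fun q : Fin d → ℤ => jb (q + k) ^ n * Real.exp (-1 * normSq g (q + k))) K₀ :=
    (Equiv.addRight k).hasSum_iff.2 hs.hasSum
  have hb : HasSum (fun q : Fin d → ℤ => A * Real.exp c * e *
      (jb k ^ n * (jb (q + k) ^ n * Real.exp (-1 * normSq g (q + k))) +
        jb q ^ n * Real.exp (-1 * normSq g q))) (A * Real.exp c * e * (jb k ^ n * K₀ + K₀)) :=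
    ((hs'.mul_left _).add hs.hasSum).mul_left _
  set s : Finset (Fin d → ℤ) := {0, -k} with hsdef
  have hfin : HasSum (fun q => if q ∈ s then f q * pairWeight g t k q else 0)
      (∑ q ∈ s, f q * pairWeight g t k q) := by
    rw [← Finset.sum_congr rfl fun q hq => if_pos (c := q ∈ s) (e := (0 : ℝ)) hq]
    exact hasSum_sum_of_ne_finset_zero fun q hq => if_neg hq
  have htail : |S - ∑ q ∈ s, f q * pairWeight g t k q| ≤
      A * Real.exp c * e * (jb k ^ n * K₀ + K₀) := by
    have hd := hS.sub hfin
    rw [← hd.tsum_eq, ← Real.norm_eq_abs]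
    refine tsum_of_norm_bounded hb fun q => ?_
    have hjq := jb_pos q
    have hjqk := jb_pos (q + k)
    by_cases hq : q ∈ s
    · simp only [if_pos hq, sub_self, norm_zero]
      have := jb_pos k; positivity
    · have hq' : q ≠ 0 ∧ q ≠ -k := by simpa [hsdef] using hq
      have h1 := pairWeight_le_of_ne hc ht hq'.1 (fun h => hq'.2 (eq_neg_of_add_eq_zero_left h))
      have h2 : jb q ≤ jb k * jb (q + k) := by
        have := jb_add_le_mul (-k) (q + k)
        simpa using this
      simp only [if_neg hq, sub_zero]
      rw [Real.norm_eq_abs, abs_mul, abs_of_nonneg (pairWeight_nonneg _ _ _)]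
      calc |f q| * pairWeight g t k q ≤ A * jb q ^ n * (Real.exp c * e *
            (Real.exp (-1 * normSq g (q + k)) + Real.exp (-1 * normSq g q))) :=
            mul_le_mul (hf q) h1 (pairWeight_nonneg _ _ _) (by positivity)
        _ = A * Real.exp c * e * (jb q ^ n * Real.exp (-1 * normSq g (q + k)) +
            jb q ^ n * Real.exp (-1 * normSq g q)) := by ring
        _ ≤ A * Real.exp c * e * ((jb k * jb (q + k)) ^ n * Real.exp (-1 * normSq g (q + k)) +
            jb q ^ n * Real.exp (-1 * normSq g q)) := by gcongr
        _ = _ := by rw [mul_pow]; ring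
  have htail' : |S - ∑ q ∈ s, f q * pairWeight g t k q| ≤
      A * jb k ^ n * (2 * Real.exp c * K₀) * e := by
    refine htail.trans ?_
    calc A * Real.exp c * e * (jb k ^ n * K₀ + K₀) ≤
          A * Real.exp c * e * (jb k ^ n * K₀ + jb k ^ n * K₀) := by
          gcongr; exact le_mul_of_one_le_left hK₀0 hjn
      _ = _ := by ring
  -- for `k = 0` the two momenta `0` and `-k` coincide and carry weight one; the inverse, which is then
  -- `0⁻¹ = 0`, does not contribute
  have hmain : |(∑ q ∈ s, f q * pairWeight g t k q) -
      ((f 0 + f (-k)) * (t * normSq g k)⁻¹ + if k = 0 then f 0 else 0)| ≤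
      A * jb k ^ n * (2 * c⁻¹) * e := by
    rcases eq_or_ne k 0 with rfl | hk
    · simp only [hsdef, neg_zero, Finset.mem_singleton, Finset.insert_eq_of_mem,
        Finset.sum_singleton, normSq_zero, mul_zero, inv_zero, pairWeight_zero_left, Real.exp_zero,
        if_true, mul_one, zero_add, sub_self, abs_zero]
      positivity
    · have hn := hc k hk
      have hn0 : 0 < normSq g k := hc0.trans_le hn
      have hw : pairWeight g t k (-k) = pairWeight g t k 0 := by
        simpa using pairWeight_swap (g := g) t k 0
      have hne : (0 : Fin d → ℤ) ∉ ({-k} : Finset (Fin d → ℤ)) := by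
        simpa using hk
      rw [hsdef, Finset.sum_insert hne, Finset.sum_singleton, hw, pairWeight_zero_right ht0 hn0,
        if_neg hk, add_zero]
      have e1 : f 0 * ((1 - Real.exp (-t * normSq g k)) * (t * normSq g k)⁻¹) +
          f (-k) * ((1 - Real.exp (-t * normSq g k)) * (t * normSq g k)⁻¹) -
          (f 0 + f (-k)) * (t * normSq g k)⁻¹ =
          -((f 0 + f (-k)) * (t * normSq g k)⁻¹ * Real.exp (-t * normSq g k)) := by ring
      rw [e1, abs_neg, abs_mul, abs_mul, abs_of_pos (Real.exp_pos _),
        abs_of_pos (inv_pos.2 (mul_pos ht0 hn0))]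
      have h1 : |f 0 + f (-k)| ≤ A * jb k ^ n * 2 := by
        have h2 := hf 0
        have h3 := hf (-k)
        have h4 : jb (0 : Fin d → ℤ) = 1 := by simp [jb]
        rw [h4, one_pow] at h2
        rw [jb_neg] at h3
        have h5 : A * 1 ≤ A * jb k ^ n := by gcongr
        linarith [abs_add_le (f 0) (f (-k))]
      have h2 : (t * normSq g k)⁻¹ ≤ c⁻¹ := by
        refine inv_anti₀ hc0 ?_
        nlinarith
      have h3 : Real.exp (-t * normSq g k) ≤ e := Real.exp_le_exp.2 (by nlinarith)
      have := jb_pos k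
      calc _ ≤ A * jb k ^ n * 2 * c⁻¹ * e := by gcongr
        _ = _ := by ring
  calc _ ≤ _ := abs_sub_le _ (∑ q ∈ s, f q * pairWeight g t k q) _
    _ ≤ A * jb k ^ n * (2 * Real.exp c * K₀) * e + A * jb k ^ n * (2 * c⁻¹) * e :=
        add_le_add htail' hmain
    _ = _ := by ring

/-- A bound of the prefactor in the form factor `v₃` that is uniform in both momenta. -/
lemma exists_abs_prefactor_le_mul (g : Matrix (Fin d) (Fin d) ℝ) :
    ∃ C : ℝ, 0 < C ∧ ∀ (μ ν : Fin d) (k q : Fin d → ℤ),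
      |raise g k μ * raise g k ν - 4 * raise g q μ * raise g q ν| ≤ C * jb k ^ 2 * jb q ^ 2 := by
  obtain ⟨C, hC, h⟩ := abs_raise_le g
  refine ⟨5 * C ^ 2, by positivity, fun μ ν k q => ?_⟩
  have h1 : ∀ p : Fin d → ℤ, |raise g p μ * raise g p ν| ≤ C ^ 2 * jb p ^ 2 := fun p => by
    rw [abs_mul, ← mul_pow, pow_two]
    exact mul_le_mul (h p μ) (h p ν) (abs_nonneg _) ((abs_nonneg _).trans (h p μ))
  have hk : 1 ≤ jb k ^ 2 := one_le_pow₀ (one_le_jb k)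
  have hq : 1 ≤ jb q ^ 2 := one_le_pow₀ (one_le_jb q)
  have h2 : jb k ^ 2 ≤ jb k ^ 2 * jb q ^ 2 := le_mul_of_one_le_right (by positivity) hq
  have h3 : jb q ^ 2 ≤ jb k ^ 2 * jb q ^ 2 := le_mul_of_one_le_left (by positivity) hk
  rw [mul_assoc 4]
  refine (abs_sub _ _).trans ?_
  rw [abs_mul 4, abs_of_pos (by norm_num : (0 : ℝ) < 4)]
  have h4 := mul_le_mul_of_nonneg_left h2 (sq_nonneg C)
  have h5 := mul_le_mul_of_nonneg_left h3 (sq_nonneg C)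
  linarith [h1 k, h1 q]

/-- The limit at large times of the form factor `v₂`. -/
def v2Large (g : Matrix (Fin d) (Fin d) ℝ) (t : ℝ) (k : Fin d → ℤ) : ℝ :=
  t / (2 * Real.pi) ^ d * (normSq g k)⁻¹ + if k = 0 then t ^ 2 / (2 * (2 * Real.pi) ^ d) else 0

/-- The limit at large times of the form factor `v₃`. -/
def v3Large (g : Matrix (Fin d) (Fin d) ℝ) (t : ℝ) (μ ν : Fin d) (k : Fin d → ℤ) : ℝ :=
  t / (2 * Real.pi) ^ d * ((normSq g k)⁻¹ * transv g k μ ν) +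
    if k = 0 then t / (2 * Real.pi) ^ d * g⁻¹ μ ν else 0

/-- The form factors reach their limits at large times exponentially fast, with at most polynomial
growth in the mode. -/
lemma exists_formFactors_largeT (hg : g.PosDef) {c : ℝ} (hc0 : 0 < c)
    (hc : ∀ k : Fin d → ℤ, k ≠ 0 → c ≤ normSq g k) :
    ∃ K : ℝ, 0 < K ∧ ∀ t : ℝ, 1 ≤ t →
      |v1 g 0 t - t * fnorm d| ≤ K * (t ^ 2 * Real.exp (-c * t)) ∧
      (∀ k, |v2 g k t - v2Large g t k| ≤ K * (t ^ 2 * Real.exp (-c * t)) * jb k ^ 4) ∧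
      ∀ μ ν k, |v3 g μ ν k t - v3Large g t μ ν k| ≤
        K * (t ^ 2 * Real.exp (-c * t)) * jb k ^ 4 := by
  obtain ⟨K₀, hK₀, h0⟩ := exists_hasSum_pairWeight_largeT hg hc0 hc 0
  obtain ⟨K₂, hK₂, h2⟩ := exists_hasSum_pairWeight_largeT hg hc0 hc 2
  obtain ⟨C, hC, hpre⟩ := exists_abs_prefactor_le_mul g
  set P := 1 / (2 * (2 * Real.pi) ^ d) with hP
  have hP0 : 0 < P := by positivity
  set G := ∑ μ, ∑ ν, |g⁻¹ μ ν| with hG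
  have hG0 : 0 ≤ G := by positivity
  have hGle : ∀ μ ν, |g⁻¹ μ ν| ≤ G := fun μ ν =>
    (Finset.single_le_sum (f := fun ν => |g⁻¹ μ ν|) (fun _ _ => abs_nonneg _)
      (Finset.mem_univ ν)).trans (Finset.single_le_sum (f := fun μ => ∑ ν, |g⁻¹ μ ν|)
      (fun _ _ => Finset.sum_nonneg fun _ _ => abs_nonneg _) (Finset.mem_univ μ))
  have hf0 := fnorm_pos (d := d)
  refine ⟨fnorm d * K₀ + P * K₀ + P * (C * K₂ + 2 * G * K₀), by positivity, fun t ht => ?_⟩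
  have ht0 : 0 < t := by linarith
  set e := Real.exp (-c * t) with he
  have he0 : 0 < e := Real.exp_pos _
  have ht2 : t ≤ t ^ 2 := by nlinarith
  have htheta : |theta g t - 1| ≤ K₀ * e := by
    have h := h0 t 1 (theta g t) 0 (fun _ => 1) ht zero_le_one (by simp)
      ((summable_exp_normSq hg ht0).hasSum.congr_fun fun q => by
        rw [pairWeight_zero_left, one_mul])
    simpa [he] using h
  have hcan : ∀ x, (t ^ 2 * P)⁻¹ * (t ^ 2 / (2 * (2 * Real.pi) ^ d) * x) = x := fun x => by
    rw [hP]; field_simp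
  have hj : ∀ k : Fin d → ℤ, 1 ≤ jb k ^ 4 := fun k => one_le_pow₀ (one_le_jb k)
  refine ⟨?_, fun k => ?_, fun μ ν k => ?_⟩
  · have e1 : v1 g 0 t - t * fnorm d = t * fnorm d * (theta g t - 1) := by
      rw [v1, if_pos rfl, fnorm]; ring
    rw [e1, abs_mul, abs_of_pos (mul_pos ht0 hf0)]
    calc t * fnorm d * |theta g t - 1| ≤ t ^ 2 * fnorm d * (K₀ * e) := by gcongr
      _ = fnorm d * K₀ * (t ^ 2 * e) := by ring
      _ ≤ _ := by
        refine mul_le_mul_of_nonneg_right ?_ (by positivity)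
        have : 0 ≤ P * K₀ + P * (C * K₂ + 2 * G * K₀) := by positivity
        linarith
  · have hs := (hasSum_v2 hg ht0 k).mul_left (t ^ 2 * P)⁻¹
    have h := h0 t 1 _ k (fun _ => 1) ht zero_le_one (by simp) (hs.congr_fun fun q => by
      rw [hP]; field_simp)
    have e1 : v2 g k t - v2Large g t k = t ^ 2 * P * ((t ^ 2 * P)⁻¹ * v2 g k t -
        ((1 + 1) * (t * normSq g k)⁻¹ + if k = 0 then 1 else 0)) := by
      rw [mul_sub, mul_inv_cancel_left₀ (by positivity), v2Large, mul_inv, hP]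
      split_ifs <;> field_simp <;> ring
    rw [e1, abs_mul, abs_of_pos (by positivity)]
    calc t ^ 2 * P * _ ≤ t ^ 2 * P * (1 * jb k ^ 0 * K₀ * e) := by gcongr
      _ = P * K₀ * (t ^ 2 * e) * 1 := by ring
      _ ≤ _ := by
        refine mul_le_mul (mul_le_mul_of_nonneg_right ?_ (by positivity)) (hj k) zero_le_one
          (by positivity)
        have h6 : 0 ≤ fnorm d * K₀ := by positivity
        have h7 : 0 ≤ P * (C * K₂ + 2 * G * K₀) := by positivity
        linarith
  · set f : (Fin d → ℤ) → ℝ := fun q => raise g k μ * raise g k ν - 4 * raise g q μ * raise g q ν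
      with hf
    set T := 2 / t * g⁻¹ μ ν with hT
    have hs := (hasSum_v3 hg ht0 k μ ν).mul_left (t ^ 2 * P)⁻¹
    have hθ := (summable_exp_normSq hg ht0).hasSum.mul_left T
    have h := h2 t (C * jb k ^ 2) _ k f ht (by have := jb_pos k; positivity) (fun q => hpre μ ν k q)
      ((hs.sub hθ).congr_fun fun q => by rw [hcan]; ring)
    have e1 : v3 g μ ν k t - v3Large g t μ ν k = t ^ 2 * P * (((t ^ 2 * P)⁻¹ * v3 g μ ν k t -
        T * theta g t - ((f 0 + f (-k)) * (t * normSq g k)⁻¹ + if k = 0 then f 0 else 0)) +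
        T * (theta g t - 1)) := by
      have h1 : f 0 = raise g k μ * raise g k ν := by simp [hf, raise]
      have h3 : f (-k) = -3 * (raise g k μ * raise g k ν) := by simp only [hf, raise_neg]; ring
      have h4 : t ^ 2 * P * T = t / (2 * Real.pi) ^ d * g⁻¹ μ ν := by
        rw [hP, hT]; field_simp
      have h5 : t ^ 2 * P * ((f 0 + f (-k)) * (t * normSq g k)⁻¹ + if k = 0 then f 0 else 0) =
          -(t / (2 * Real.pi) ^ d * (raise g k μ * raise g k ν) * (normSq g k)⁻¹) := by
        rcases eq_or_ne k 0 with rfl | hk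
        · simp [h1, raise]
        · rw [if_neg hk, h1, h3, hP, mul_inv]; field_simp; ring
      have h6 : v3Large g t μ ν k = t / (2 * Real.pi) ^ d * g⁻¹ μ ν -
          t / (2 * Real.pi) ^ d * (raise g k μ * raise g k ν) * (normSq g k)⁻¹ := by
        rcases eq_or_ne k 0 with rfl | hk
        · simp [v3Large]
        · have := (hc0.trans_le (hc k hk)).ne'
          rw [v3Large, if_neg hk, transv]; field_simp; ring
      rw [mul_add, mul_sub, mul_sub, mul_inv_cancel_left₀ (by positivity), h5, h6]
      linear_combination (1 : ℝ) * h4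
    have hTle : |T| ≤ 2 * G := by
      rw [hT, abs_mul, abs_of_pos (by positivity)]
      refine mul_le_mul ?_ (hGle μ ν) (abs_nonneg _) zero_le_two
      rw [div_le_iff₀ ht0]; linarith
    rw [e1, abs_mul, abs_of_pos (by positivity)]
    have hj4 : jb k ^ 2 * jb k ^ 2 = jb k ^ 4 := by ring
    calc _ ≤ t ^ 2 * P * (C * jb k ^ 2 * jb k ^ 2 * K₂ * e + 2 * G * (K₀ * e)) := by
          gcongr
          refine (abs_add_le _ _).trans (add_le_add h ?_)
          rw [abs_mul]
          gcongr
      _ ≤ t ^ 2 * P * (C * jb k ^ 2 * jb k ^ 2 * K₂ * e + 2 * G * (K₀ * e) * jb k ^ 4) := by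
          refine mul_le_mul_of_nonneg_left (add_le_add le_rfl ?_) (by positivity)
          exact le_mul_of_one_le_right (by positivity) (hj k)
      _ = P * (C * K₂ + 2 * G * K₀) * (t ^ 2 * e) * jb k ^ 4 := by rw [← hj4]; ring
      _ ≤ _ := by
        have := jb_pos k
        gcongr
        have h6 : 0 ≤ fnorm d * K₀ + P * K₀ := by positivity
        linarith

/-- The quadratic functional with the limiting form factors. -/
lemma largeT_add_zeroModeT_eq (hg : g.PosDef) (hE : IsSmoothMat E) (hω : ∀ μ, IsSmoothMat (ω μ))
    (t : ℝ) : largeT g E (linCurv ω) t + zeroModeT g E ω t =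
      ((t * fnorm d : ℝ) : ℂ) * Matrix.trace (fCoeff E 0) +
        ∑' k, ((v2Large g t k : ℂ) * Matrix.trace (fCoeff E (-k) * fCoeff E k) +
          ∑ μ, ∑ ν, (v3Large g t μ ν k : ℂ) *
            Matrix.trace (fCoeff (ω μ) (-k) * fCoeff (ω ν) k)) := by
  set y : ℂ := ((t / (2 * Real.pi) ^ d : ℝ) : ℂ) with hy
  have h1 := hasSum_lin_form hg (boundedSymbol_inv hg) (boundedSymbol_inv hg) hE hω y (y * (1 / 2))
  have h2 : HasSum (fun k : Fin d → ℤ => if k = 0 then zeroModeT g E ω t else 0) (zeroModeT g E ω t) :=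
    hasSum_ite_eq 0 _
  have h3 : y * (fnorm d : ℂ)⁻¹ = ((t * fnorm d : ℝ) : ℂ) := by
    have hf := fnorm_pos (d := d)
    rw [hy, ← Complex.ofReal_inv, ← Complex.ofReal_mul]
    congr 1
    rw [div_eq_mul_inv, ← fnorm_sq]
    field_simp
  have h4 := (h1.add h2).congr_fun (g := fun k =>
      ((v2Large g t k : ℂ) * Matrix.trace (fCoeff E (-k) * fCoeff E k) +
          ∑ μ, ∑ ν, (v3Large g t μ ν k : ℂ) *
            Matrix.trace (fCoeff (ω μ) (-k) * fCoeff (ω ν) k))) fun k => by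
    rcases eq_or_ne k 0 with rfl | hk
    · simp only [v2Large, v3Large, zeroModeT, if_true, normSq_zero, inv_zero, mul_zero, zero_mul,
        zero_add, Complex.ofReal_zero, neg_zero, Finset.sum_const_zero, ← hy, Complex.ofReal_mul,
        Finset.mul_sum, mul_assoc]
    · simp only [v2Large, v3Large, if_neg hk, add_zero, Complex.ofReal_mul, ← hy]
      congr 1
      exact Finset.sum_congr rfl fun μ _ => Finset.sum_congr rfl fun ν _ => by ring
  rw [h4.tsum_eq, largeT_eq hg hE (isSmoothMat_linCurv hω), ← h3, ← hy]
  ring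

/-- Halving the rate absorbs the power of `t`. -/
lemma sq_mul_exp_isBigO {c : ℝ} (hc : 0 < c) :
    (fun t : ℝ => t ^ 2 * Real.exp (-c * t)) =O[atTop] fun t : ℝ => Real.exp (-(c / 2) * t) := by
  have h := (isLittleO_pow_exp_pos_mul_atTop 2 (half_pos hc)).isBigO
  refine (h.mul (isBigO_refl (fun t : ℝ => Real.exp (-c * t)) atTop)).congr_right fun t => ?_
  rw [← Real.exp_add]
  congr 1; ring

theorem exists_secondOrder_largeT (hg : g.PosDef) : ∃ c : ℝ, 0 < c ∧
    ∀ (E : MatField d N) (ω : Fin d → MatField d N), IsSmoothMat E → (∀ μ, IsSmoothMat (ω μ)) →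
        (fun t : ℝ => secondOrder g E ω t - (largeT g E (linCurv ω) t + zeroModeT g E ω t))
          =O[atTop] fun t : ℝ => Real.exp (-c * t) := by
  obtain ⟨c, hc0, -, -, hc⟩ := exists_lower_normSq hg
  have hc' : ∀ k : Fin d → ℤ, k ≠ 0 → c ≤ normSq g k := fun k hk => by
    have := one_le_pow₀ (n := 2) (one_le_jb k)
    nlinarith [hc k hk]
  obtain ⟨K, hK, h⟩ := exists_formFactors_largeT hg hc0 hc'
  refine ⟨c / 2, half_pos hc0, fun E ω hE hω => ?_⟩
  obtain ⟨M, hM⟩ := norm_secondOrder_sub_le hg hE hω 4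
  refine IsBigO.trans (IsBigO.of_bound (M * K) ?_) (sq_mul_exp_isBigO hc0)
  filter_upwards [eventually_ge_atTop 1] with t ht
  obtain ⟨h1, h2, h3⟩ := h t ht
  rw [largeT_add_zeroModeT_eq hg hE hω, Real.norm_of_nonneg (by positivity), mul_assoc]
  exact hM t _ _ _ _ (by linarith) (by positivity) h1 h2 h3

end LargeTime

/-! ### Gaussian integrals and Poisson summation -/

section Poisson

open Set

variable {d : ℕ} {g : Matrix (Fin d) (Fin d) ℝ}

open scoped MatrixOrder in
/-- The symmetric square root of a metric. -/
lemma exists_sqrt_matrix (hg : g.PosDef) : ∃ S : Matrix (Fin d) (Fin d) ℝ, S.transpose = S ∧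
    S * S = g ∧ S.det ≠ 0 ∧ |S.det| = Real.sqrt g.det := by
  have h0 : 0 ≤ g := Matrix.nonneg_iff_posSemidef.2 hg.posSemidef
  have h1 : CFC.sqrt g * CFC.sqrt g = g := CFC.sqrt_mul_sqrt_self g h0
  have h2 : (CFC.sqrt g).IsHermitian :=
    (Matrix.nonneg_iff_posSemidef.1 (CFC.sqrt_nonneg g)).isHermitian
  have h3 : (CFC.sqrt g).det * (CFC.sqrt g).det = g.det := by rw [← Matrix.det_mul, h1]
  refine ⟨CFC.sqrt g, by simpa using h2.eq, h1, fun h => ?_, ?_⟩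
  · rw [h] at h3; simp [hg.det_pos.ne] at h3
  · rw [← h3, Real.sqrt_mul_self_eq_abs]

/-- The character `e^{2πi n·y}`. -/
def chr (n : Fin d → ℤ) (y : Fin d → ℝ) : ℂ :=
  Complex.exp (2 * Real.pi * Complex.I * ∑ i, (n i : ℂ) * (y i : ℂ))

/-- The Gaussian `e^{-t g^{μν} y_μ y_ν}`. -/
def gauss (g : Matrix (Fin d) (Fin d) ℝ) (t : ℝ) (y : Fin d → ℝ) : ℝ :=
  Real.exp (-t * bform g y y)

/-- The real point underlying a lattice point. -/
def latt (q : Fin d → ℤ) : Fin d → ℝ := fun i => q i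

lemma gauss_pos (t : ℝ) (y : Fin d → ℝ) : 0 < gauss g t y := Real.exp_pos _

lemma continuous_gauss (t : ℝ) : Continuous (gauss g t) := by
  have := (continuous_bform (g := g)).comp (continuous_id.prodMk continuous_id)
  exact Real.continuous_exp.comp (continuous_const.mul this)

lemma continuous_chr (n : Fin d → ℤ) : Continuous (chr n) := by unfold chr; fun_prop

lemma norm_chr (n : Fin d → ℤ) (y : Fin d → ℝ) : ‖chr n y‖ = 1 := by
  have e : 2 * Real.pi * Complex.I * ∑ i, (n i : ℂ) * (y i : ℂ) =
      ((2 * Real.pi * ∑ i, (n i : ℝ) * y i : ℝ) : ℂ) * Complex.I := by push_cast; ring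
  rw [chr, e, Complex.norm_exp_ofReal_mul_I]

lemma chr_add (n : Fin d → ℤ) (x y : Fin d → ℝ) : chr n (x + y) = chr n x * chr n y := by
  rw [chr, chr, chr, ← Complex.exp_add, ← mul_add, ← Finset.sum_add_distrib]
  congr 2
  refine Finset.sum_congr rfl fun i _ => ?_
  simp only [Pi.add_apply, Complex.ofReal_add]; ring

lemma chr_latt (n q : Fin d → ℤ) : chr n (latt q) = 1 := by
  rw [chr, Complex.exp_eq_one_iff]
  refine ⟨∑ i, n i * q i, ?_⟩
  simp only [latt, Complex.ofReal_intCast]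
  push_cast; ring

/-- The Fourier transform of a Gaussian is a Gaussian for the inverse quadratic form. -/
lemma integral_chr_mul_gauss (hg : g.PosDef) {t : ℝ} (ht : 0 < t) (n : Fin d → ℤ) :
    ∫ x, chr (-n) x * (gauss g t x : ℂ) = (((Real.pi / t) ^ ((d : ℝ) / 2) * Real.sqrt g.det *
      Real.exp (-(Real.pi ^ 2 / t) * normSq g⁻¹ n) : ℝ) : ℂ) := by
  obtain ⟨S, hST, hSS, hS0, hdet⟩ := exists_sqrt_matrix hg
  have hSu : IsUnit S.det := isUnit_iff_ne_zero.2 hS0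
  have hinv : g⁻¹ = S⁻¹ * S⁻¹ := by rw [← hSS, Matrix.mul_inv_rev]
  have hB : ∀ z : Fin d → ℝ, bform g (S.mulVec z) (S.mulVec z) = ∑ i, z i ^ 2 := by
    intro z
    rw [bform_eq_dotProduct, Matrix.mulVec_mulVec, hinv, mul_assoc, Matrix.nonsing_inv_mul S hSu,
      mul_one, ← Matrix.vecMul_transpose, hST, ← Matrix.dotProduct_mulVec, Matrix.mulVec_mulVec,
      Matrix.mul_nonsing_inv S hSu, Matrix.one_mulVec]
    simp [dotProduct, pow_two]
  set m : Fin d → ℝ := S.mulVec (latt n) with hm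
  have hmm : ∑ i, m i ^ 2 = normSq g⁻¹ n := by
    have e : normSq g⁻¹ n = latt n ⬝ᵥ (g.mulVec (latt n)) := by
      rw [normSq_eq_bform, bform_eq_dotProduct, Matrix.nonsing_inv_nonsing_inv]
      · rfl
      · exact isUnit_iff_ne_zero.2 hg.det_pos.ne'
    rw [e, ← hSS, ← Matrix.mulVec_mulVec, Matrix.dotProduct_mulVec, ← Matrix.mulVec_transpose, hST]
    simp [dotProduct, pow_two, hm]
  have hnS : ∀ z : Fin d → ℝ, ∑ i, (n i : ℝ) * S.mulVec z i = ∑ i, m i * z i := by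
    intro z
    have := Matrix.dotProduct_mulVec (latt n) S z
    rw [← Matrix.mulVec_transpose, hST] at this
    exact this
  have hmap := Real.map_matrix_volume_pi_eq_smul_volume_pi hS0
  have hcont : Continuous fun x : Fin d → ℝ => chr (-n) x * (gauss g t x : ℂ) :=
    (continuous_chr _).mul (Complex.continuous_ofReal.comp (continuous_gauss t))
  have hlin : Continuous (Matrix.toLin' S) := LinearMap.continuous_of_finiteDimensional _
  have h1 : ∫ x, chr (-n) x * (gauss g t x : ℂ) = ((|S.det| : ℝ) : ℂ) *
      ∫ z : Fin d → ℝ, chr (-n) (S.mulVec z) * (gauss g t (S.mulVec z) : ℂ) := by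
    have h2 := integral_map (μ := (volume : Measure (Fin d → ℝ))) hlin.measurable.aemeasurable
      (hcont.aestronglyMeasurable (μ := Measure.map (Matrix.toLin' S) volume))
    rw [hmap, integral_smul_measure] at h2
    simp only [Matrix.toLin'_apply] at h2
    rw [← h2, ENNReal.toReal_ofReal (abs_nonneg _), Complex.real_smul, ← mul_assoc,
      ← Complex.ofReal_mul, abs_inv, mul_inv_cancel₀ (abs_ne_zero.2 hS0), Complex.ofReal_one, one_mul]
  have h2 : ∀ z : Fin d → ℝ, chr (-n) (S.mulVec z) * (gauss g t (S.mulVec z) : ℂ) =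
      Complex.exp (-(t : ℂ) * ∑ i, (z i : ℂ) ^ 2 +
        ∑ i, (-(2 * Real.pi * Complex.I) * (m i : ℂ)) * z i) := by
    intro z
    have e : ∑ i, (n i : ℂ) * (S.mulVec z i : ℂ) = ∑ i, (m i : ℂ) * z i := by
      exact_mod_cast hnS z
    rw [gauss, hB, chr, Complex.ofReal_exp, ← Complex.exp_add]
    congr 1
    simp only [Pi.neg_apply, Int.cast_neg, neg_mul, Finset.sum_neg_distrib, e]
    push_cast
    simp only [mul_assoc, ← Finset.mul_sum]
    ring
  rw [h1]
  simp only [h2]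
  rw [GaussianFourier.integral_cexp_neg_mul_sum_add (by simpa using ht), hdet]
  have h3 : ∑ i, (-(2 * Real.pi * Complex.I) * (m i : ℂ)) ^ 2 / 1 =
      -(4 * Real.pi ^ 2) * (normSq g⁻¹ n : ℂ) := by
    rw [← hmm]
    push_cast
    rw [Finset.mul_sum]
    refine Finset.sum_congr rfl fun i _ => ?_
    linear_combination (4 * Real.pi ^ 2 * (m i : ℂ) ^ 2) * Complex.I_sq
  simp only [div_one] at h3
  rw [h3, Complex.ofReal_mul, Complex.ofReal_mul, Complex.ofReal_exp,
    Complex.ofReal_cpow (by positivity)]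
  have ht' : (t : ℂ) ≠ 0 := Complex.ofReal_ne_zero.2 ht.ne'
  have e1 : -(4 * (Real.pi : ℂ) ^ 2) * (normSq g⁻¹ n : ℂ) / (4 * t) =
      ((-(Real.pi ^ 2 / t) * normSq g⁻¹ n : ℝ) : ℂ) := by push_cast; field_simp
  rw [e1, Fintype.card_fin]
  push_cast
  ring

/-- The half-open unit box with corner `q`. -/
def unitBox (q : Fin d → ℤ) : Set (Fin d → ℝ) := {x | ∀ i, x i ∈ Ioc (q i : ℝ) (q i + 1)}

lemma measurableSet_unitBox (q : Fin d → ℤ) : MeasurableSet (unitBox q) :=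
  MeasurableSet.univ_pi' fun _ => measurableSet_Ioc

/-- An integral over `ℝ^d` is the sum of the integrals over the translates of the unit box. -/
lemma hasSum_integral_unitBox {h : (Fin d → ℝ) → ℂ} (hh : Integrable h) :
    HasSum (fun q : Fin d → ℤ => ∫ x in unitBox 0, h (latt q + x)) (∫ x, h x) := by
  have hU : (⋃ q : Fin d → ℤ, unitBox q) = univ := by
    refine eq_univ_of_forall fun x => mem_iUnion.2 ⟨fun i => ⌈x i⌉ - 1, fun i => ⟨?_, ?_⟩⟩
    · push_cast; linarith [Int.ceil_lt_add_one (x i)]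
    · push_cast; linarith [Int.le_ceil (x i)]
  have hd : Pairwise (Function.onFun Disjoint (unitBox (d := d))) := by
    intro p q hpq
    refine Set.disjoint_left.2 fun x hp hq => hpq (funext fun i => ?_)
    have h1 := hp i
    have h2 := hq i
    have e1 : (p i : ℝ) < q i + 1 := h1.1.trans_le h2.2
    have e2 : (q i : ℝ) < p i + 1 := h2.1.trans_le h1.2
    have e3 : p i < q i + 1 := by exact_mod_cast e1
    have e4 : q i < p i + 1 := by exact_mod_cast e2
    omega
  have h1 := hasSum_integral_iUnion (μ := volume) measurableSet_unitBox hd (f := h) (by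
    rw [hU]; exact hh.integrableOn)
  rw [hU, setIntegral_univ] at h1
  refine h1.congr_fun fun q => ?_
  have h2 := (measurePreserving_add_left (volume : Measure (Fin d → ℝ)) (latt q)).setIntegral_preimage_emb
    (measurableEmbedding_addLeft _) h (unitBox q)
  rw [← h2]
  congr 2
  ext x
  simp only [unitBox, latt, mem_preimage, mem_ofPred_eq, Pi.add_apply, Pi.zero_apply, Int.cast_zero,
    mem_Ioc]
  refine forall_congr' fun i => ?_
  constructor <;> rintro ⟨_, _⟩ <;> constructor <;> linarith

lemma bform_self_le (g : Matrix (Fin d) (Fin d) ℝ) (y : Fin d → ℝ) :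
    bform g y y ≤ (∑ μ, ∑ ν, |g⁻¹ μ ν|) * ‖y‖ ^ 2 := by
  simp only [bform, Finset.sum_mul]
  refine Finset.sum_le_sum fun μ _ => Finset.sum_le_sum fun ν _ => ?_
  calc g⁻¹ μ ν * y μ * y ν ≤ |g⁻¹ μ ν * y μ * y ν| := le_abs_self _
    _ = |g⁻¹ μ ν| * (|y μ| * |y ν|) := by rw [abs_mul, abs_mul, mul_assoc]
    _ ≤ |g⁻¹ μ ν| * ‖y‖ ^ 2 := by
      rw [pow_two]
      gcongr <;> exact norm_le_pi_norm y _

/-- Bounded shifts of a Gaussian on the lattice are dominated by a wider Gaussian. -/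
lemma gauss_shift_le (hg : g.PosDef) {t : ℝ} (ht : 0 < t) (R : ℝ) : ∃ K : ℝ, 0 < K ∧
    ∀ (q : Fin d → ℤ) (y : Fin d → ℝ), ‖y‖ ≤ R →
      gauss g t (latt q + y) ≤ K * Real.exp (-(t / 2) * normSq g q) := by
  refine ⟨Real.exp (t * ((∑ μ, ∑ ν, |g⁻¹ μ ν|) * R ^ 2)), Real.exp_pos _, fun q y hy => ?_⟩
  rw [gauss, ← Real.exp_add]
  refine Real.exp_le_exp.2 ?_
  have h1 := bform_add_self_le hg (latt q + y) ((-1 : ℝ) • y)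
  have e : latt q + y + (-1 : ℝ) • y = latt q := by simp
  rw [e, bform_smul_left, bform_smul_right] at h1
  have h2 : bform g (latt q) (latt q) = normSq g q := rfl
  have h3 := bform_self_le g y
  have h4 : (∑ μ, ∑ ν, |g⁻¹ μ ν|) * ‖y‖ ^ 2 ≤ (∑ μ, ∑ ν, |g⁻¹ μ ν|) * R ^ 2 := by gcongr
  have h5 : normSq g q ≤ 2 * bform g (latt q + y) (latt q + y) +
      2 * ((∑ μ, ∑ ν, |g⁻¹ μ ν|) * R ^ 2) := by linarith
  nlinarith

lemma integrable_gauss (hg : g.PosDef) {t : ℝ} (ht : 0 < t) : Integrable (gauss g t) := by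
  obtain ⟨c, hc, h⟩ := exists_lower_bform hg
  have h1 : Integrable fun x : Fin d → ℝ => ∏ i, Real.exp (-(t * c / (d + 1)) * x i ^ 2) :=
    Integrable.fintype_prod (f := fun _ (x : ℝ) => Real.exp (-(t * c / (d + 1)) * x ^ 2)) fun _ =>
      integrable_exp_neg_mul_sq (by positivity)
  refine h1.mono' (continuous_gauss t).aestronglyMeasurable (Eventually.of_forall fun x => ?_)
  rw [gauss, Real.norm_of_nonneg (Real.exp_pos _).le, ← Real.exp_sum, ← Finset.mul_sum]
  refine Real.exp_le_exp.2 ?_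
  have h2 : ∑ i, x i ^ 2 ≤ (d + 1) * ‖x‖ ^ 2 := by
    calc ∑ i, x i ^ 2 ≤ ∑ _i : Fin d, ‖x‖ ^ 2 := by
          refine Finset.sum_le_sum fun i _ => ?_
          rw [← sq_abs]
          exact pow_le_pow_left₀ (abs_nonneg _) (norm_le_pi_norm x i) 2
      _ = d * ‖x‖ ^ 2 := by simp
      _ ≤ _ := by gcongr; linarith
  have h3 : t * c / (d + 1) * ∑ i, x i ^ 2 ≤ t * (c * ‖x‖ ^ 2) := by
    calc t * c / (d + 1) * ∑ i, x i ^ 2 ≤ t * c / (d + 1) * ((d + 1) * ‖x‖ ^ 2) := by gcongr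
      _ = _ := by field_simp
  have h4 := mul_le_mul_of_nonneg_left (h x) ht.le
  linarith

lemma summable_gauss_shift (hg : g.PosDef) {t : ℝ} (ht : 0 < t) (y : Fin d → ℝ) :
    Summable fun q : Fin d → ℤ => gauss g t (latt q + y) := by
  obtain ⟨K, hK, h⟩ := gauss_shift_le hg ht ‖y‖
  exact Summable.of_nonneg_of_le (fun q => (Real.exp_pos _).le) (fun q => h q y le_rfl)
    ((summable_exp_normSq hg (half_pos ht)).mul_left K)

lemma latt_add (p q : Fin d → ℤ) : latt (p + q) = latt p + latt q := by
  ext i; simp [latt]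

/-- Poisson summation for Gaussians. -/
theorem hasSum_poisson (hg : g.PosDef) {t : ℝ} (ht : 0 < t) (y : Fin d → ℝ) :
    HasSum (fun n : Fin d → ℤ => (((Real.pi / t) ^ ((d : ℝ) / 2) * Real.sqrt g.det *
      Real.exp (-(Real.pi ^ 2 / t) * normSq g⁻¹ n) : ℝ) : ℂ) * chr n y)
      ((∑' q : Fin d → ℤ, gauss g t (latt q + y) : ℝ) : ℂ) := by
  set Φ : (Fin d → ℝ) → ℂ := fun y => ((∑' q : Fin d → ℤ, gauss g t (latt q + y) : ℝ) : ℂ) with hΦ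
  have hΦc : Continuous Φ := by
    refine Complex.continuous_ofReal.comp (continuous_iff_continuousAt.2 fun y => ?_)
    obtain ⟨K, hK, h⟩ := gauss_shift_le hg ht (‖y‖ + 1)
    have h1 : ContinuousOn (fun y => ∑' q : Fin d → ℤ, gauss g t (latt q + y))
        (Metric.closedBall 0 (‖y‖ + 1)) := by
      refine continuousOn_tsum (fun q => ((continuous_gauss t).comp
        (continuous_const.add continuous_id)).continuousOn)
        ((summable_exp_normSq hg (half_pos ht)).mul_left K) fun q z hz => ?_
      rw [Real.norm_of_nonneg (gauss_pos _ _).le]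
      exact h q z (by simpa using hz)
    refine h1.continuousAt (Metric.closedBall_mem_nhds_of_mem ?_)
    simp
  have hper : ∀ (m : Fin d → ℤ) y, Φ (latt m + y) = Φ y := by
    intro m y
    simp only [hΦ]
    congr 1
    have := (Equiv.addRight m).tsum_eq fun q : Fin d → ℤ => gauss g t (latt q + y)
    rw [← this]
    refine tsum_congr fun q => ?_
    rw [Equiv.coe_addRight, latt_add, add_assoc]
  -- the periodic function descends to the torus
  set π : (Fin d → ℝ) → UnitAddTorus (Fin d) := fun y i => (y i : UnitAddCircle) with hπ
  have hq : IsOpenQuotientMap π := IsOpenQuotientMap.piMap fun _ => QuotientAddGroup.isOpenQuotientMap_mk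
  have hsec : ∀ y, Φ (Function.surjInv hq.surjective (π y)) = Φ y := by
    intro y
    have h1 := Function.surjInv_eq hq.surjective (π y)
    have h2 : ∀ i, ∃ m : ℤ, Function.surjInv hq.surjective (π y) i = m + y i := by
      intro i
      have h3 : ((Function.surjInv hq.surjective (π y) i - y i : ℝ) : UnitAddCircle) = 0 := by
        rw [AddCircle.coe_sub, sub_eq_zero]
        exact congrFun h1 i
      obtain ⟨m, hm⟩ := (AddCircle.coe_eq_zero_iff 1).1 h3
      refine ⟨m, ?_⟩
      rw [zsmul_eq_mul, mul_one] at hm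
      linarith
    choose m hm using h2
    rw [show Function.surjInv hq.surjective (π y) = latt m + y from funext hm, hper]
  let F : C(UnitAddTorus (Fin d), ℂ) := ⟨fun x => Φ (Function.surjInv hq.surjective x),
    hq.isQuotientMap.continuous_iff.2 (hΦc.congr fun y => (hsec y).symm)⟩
  have hF : ∀ y, F (π y) = Φ y := hsec
  have hchr : ∀ (n : Fin d → ℤ) y, UnitAddTorus.mFourier n (π y) = chr n y := by
    intro n y
    simp only [UnitAddTorus.mFourier, ContinuousMap.coe_mk, hπ, fourier_coe_apply, chr]
    rw [← Complex.exp_sum, Finset.mul_sum]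
    congr 1
    exact Finset.sum_congr rfl fun i _ => by push_cast; ring
  have hint : ∀ n : Fin d → ℤ, Integrable fun x : Fin d → ℝ => chr (-n) x * (gauss g t x : ℂ) :=
    fun n => (integrable_gauss hg ht).ofReal.bdd_mul (continuous_chr _).aestronglyMeasurable
      (Eventually.of_forall fun x => (norm_chr _ x).le)
  have hbox : ∀ x ∈ unitBox (0 : Fin d → ℤ), ‖x‖ ≤ 1 := by
    intro x hx
    refine (pi_norm_le_iff_of_nonneg zero_le_one).2 fun i => ?_
    have := hx i
    simp only [Pi.zero_apply, Int.cast_zero, zero_add, mem_Ioc] at this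
    rw [Real.norm_of_nonneg this.1.le]; exact this.2
  -- unfolding: integrating the periodised Gaussian over a period box gives the integral over `ℝ^d`
  have hcoef : ∀ n : Fin d → ℤ, UnitAddTorus.mFourierCoeff F n =
      (((Real.pi / t) ^ ((d : ℝ) / 2) * Real.sqrt g.det *
        Real.exp (-(Real.pi ^ 2 / t) * normSq g⁻¹ n) : ℝ) : ℂ) := by
    intro n
    rw [← integral_chr_mul_gauss hg ht, UnitAddTorus.mFourierCoeff_eq_integral F n 0,
      ← (hasSum_integral_unitBox (hint n)).tsum_eq]
    have e0 : {x : Fin d → ℝ | ∀ i, x i ∈ Ioc ((0 : Fin d → ℝ) i) ((0 : Fin d → ℝ) i + 1)} =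
        unitBox (0 : Fin d → ℤ) := by
      ext x; simp [unitBox]
    rw [e0]
    obtain ⟨K, hK, h⟩ := gauss_shift_le hg ht 1
    have hfin : IsFiniteMeasure (volume.restrict (unitBox (0 : Fin d → ℤ))) := by
      refine ⟨?_⟩
      rw [Measure.restrict_apply_univ]
      refine (measure_mono (t := Metric.closedBall 0 1) fun x hx => ?_).trans_lt
        (isCompact_closedBall _ _).measure_lt_top
      simpa using hbox x hx
    have hs := hasSum_integral_of_dominated_convergence
      (μ := volume.restrict (unitBox (0 : Fin d → ℤ)))
      (F := fun (q : Fin d → ℤ) x => chr (-n) (latt q + x) * (gauss g t (latt q + x) : ℂ))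
      (f := fun x => chr (-n) x * Φ x)
      (fun q _ => K * Real.exp (-(t / 2) * normSq g q))
      (fun q => (((continuous_chr _).mul (Complex.continuous_ofReal.comp (continuous_gauss t))).comp
        (continuous_const.add continuous_id)).aestronglyMeasurable)
      (fun q => (ae_restrict_iff' (measurableSet_unitBox 0)).2 (Eventually.of_forall fun x hx => by
        rw [norm_mul, norm_chr, one_mul, Complex.norm_real, Real.norm_of_nonneg (gauss_pos _ _).le]
        exact h q x (hbox x hx)))
      (Eventually.of_forall fun _ => (summable_exp_normSq hg (half_pos ht)).mul_left K)
      (integrable_const _)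
      (Eventually.of_forall fun x => by
        have := (Complex.hasSum_ofReal.2 (summable_gauss_shift hg ht x).hasSum).mul_left (chr (-n) x)
        refine this.congr_fun fun q => ?_
        rw [chr_add, chr_latt, one_mul])
    rw [hs.tsum_eq]
    refine integral_congr_ae (Eventually.of_forall fun x => ?_)
    change UnitAddTorus.mFourier (-n) (π x) • F (π x) = _
    rw [hchr, hF, smul_eq_mul]
  have hgi : (g⁻¹).PosDef := hg.inv
  have hsum : Summable (UnitAddTorus.mFourierCoeff F) := by
    have := (summable_exp_normSq hgi (t := Real.pi ^ 2 / t) (by positivity)).mul_left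
      ((Real.pi / t) ^ ((d : ℝ) / 2) * Real.sqrt g.det)
    exact (Complex.summable_ofReal.2 this).congr fun n => (hcoef n).symm
  have := UnitAddTorus.hasSum_mFourier_series_apply_of_summable hsum (π y)
  rw [hF] at this
  refine this.congr_fun fun n => ?_
  rw [hcoef, hchr, smul_eq_mul]

end Poisson

/-! ### Moments of Gaussians on the lattice -/

section Moments

open Set

variable {d : ℕ} {g : Matrix (Fin d) (Fin d) ℝ}

lemma abs_bform_le (g : Matrix (Fin d) (Fin d) ℝ) (y z : Fin d → ℝ) :
    |bform g y z| ≤ (∑ μ, ∑ ν, |g⁻¹ μ ν|) * (‖y‖ * ‖z‖) := by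
  simp only [bform, Finset.sum_mul]
  refine (Finset.abs_sum_le_sum_abs _ _).trans (Finset.sum_le_sum fun μ _ =>
    (Finset.abs_sum_le_sum_abs _ _).trans (Finset.sum_le_sum fun ν _ => ?_))
  rw [abs_mul, abs_mul, mul_assoc]
  gcongr
  · exact norm_le_pi_norm y _
  · exact norm_le_pi_norm z _

lemma norm_latt_le (q : Fin d → ℤ) : ‖latt q‖ ≤ jb q :=
  (pi_norm_le_iff_of_nonneg (jb_pos q).le).2 fun i => abs_le_jb q i

lemma abs_bform_shift_le (g : Matrix (Fin d) (Fin d) ℝ) (v : Fin d → ℝ) (R : ℝ) :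
    ∃ A : ℝ, 0 ≤ A ∧ ∀ (q : Fin d → ℤ) (y : Fin d → ℝ), ‖y‖ ≤ R →
      |bform g (latt q + y) v| ≤ A * jb q := by
  refine ⟨(∑ μ, ∑ ν, |g⁻¹ μ ν|) * ((1 + |R|) * ‖v‖), by positivity, fun q y hy => ?_⟩
  have h1 : ‖latt q + y‖ ≤ (1 + |R|) * jb q := by
    have := norm_add_le (latt q) y
    have h2 := norm_latt_le q
    have h3 := one_le_jb q
    have h4 := le_abs_self R
    nlinarith [abs_nonneg R]
  refine (abs_bform_le g _ v).trans ?_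
  calc _ ≤ (∑ μ, ∑ ν, |g⁻¹ μ ν|) * ((1 + |R|) * jb q * ‖v‖) := by gcongr
    _ = _ := by ring

lemma norm_line_le {y v : Fin d → ℝ} {s : ℝ} (hs : s ∈ Ioo (-1 : ℝ) 1) :
    ‖y + s • v‖ ≤ ‖y‖ + ‖v‖ := by
  refine (norm_add_le _ _).trans (add_le_add le_rfl ?_)
  rw [norm_smul]
  exact mul_le_of_le_one_left (norm_nonneg _) (abs_le.2 ⟨hs.1.le, hs.2.le⟩)

lemma hasDerivAt_bform_line (x y v w : Fin d → ℝ) (s : ℝ) :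
    HasDerivAt (fun s : ℝ => bform g (x + (y + s • w)) v) (bform g w v) s := by
  have h : HasDerivAt (fun s : ℝ => s * bform g w v + bform g (x + y) v) (bform g w v) s := by
    simpa using ((hasDerivAt_id s).mul_const (bform g w v)).add_const (bform g (x + y) v)
  refine h.congr_of_eventuallyEq (Eventually.of_forall fun r => ?_)
  simp only [bform_add_left, bform_smul_left]; ring

lemma hasDerivAt_gauss_line (hg : g.PosDef) (t : ℝ) (x y v : Fin d → ℝ) (s : ℝ) :
    HasDerivAt (fun s : ℝ => gauss g t (x + (y + s • v)))
      (-2 * t * bform g (x + (y + s • v)) v * gauss g t (x + (y + s • v))) s := by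
  have h : HasDerivAt (fun s : ℝ => -t * (bform g (x + y) (x + y) + s * (2 * bform g (x + y) v) +
      s ^ 2 * bform g v v)) (-t * (2 * bform g (x + y) v + 2 * s * bform g v v)) s := by
    have h1 := ((hasDerivAt_id s).mul_const (2 * bform g (x + y) v)).const_add
      (bform g (x + y) (x + y))
    have h2 := (hasDerivAt_pow 2 s).mul_const (bform g v v)
    simpa using (h1.add h2).const_mul (-t)
  have e : ∀ r : ℝ, -t * bform g (x + (y + r • v)) (x + (y + r • v)) =
      -t * (bform g (x + y) (x + y) + r * (2 * bform g (x + y) v) + r ^ 2 * bform g v v) := fun r => by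
    rw [← add_assoc]
    simp only [bform_add_left _ (x + y), bform_add_right _ _ (x + y), bform_smul_left, bform_smul_right,
      bform_comm hg v (x + y)]
    ring
  have h3 := h.exp
  refine (h3.congr_of_eventuallyEq (Eventually.of_forall fun r => ?_)).congr_deriv ?_
  · simp only [gauss, e]
  · simp only [gauss, e]
    rw [← add_assoc, bform_add_left _ (x + y), bform_smul_left]
    ring

/-- Term-by-term differentiation of a Gaussian lattice sum. -/
lemma hasDerivAt_tsum_gauss (hg : g.PosDef) {t : ℝ} (ht : 0 < t) (y v : Fin d → ℝ) :
    HasDerivAt (fun s : ℝ => ∑' q : Fin d → ℤ, gauss g t (latt q + (y + s • v)))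
      (∑' q : Fin d → ℤ, -2 * t * bform g (latt q + y) v * gauss g t (latt q + y)) 0 := by
  obtain ⟨K, hK, h⟩ := gauss_shift_le hg ht (‖y‖ + ‖v‖)
  obtain ⟨A, hA, h'⟩ := abs_bform_shift_le g v (‖y‖ + ‖v‖)
  have h0 : (0 : ℝ) ∈ Ioo (-1 : ℝ) 1 := by norm_num
  have := hasDerivAt_tsum_of_isPreconnected (y := (0 : ℝ)) (y₀ := 0)
    ((summable_jb_mul_exp hg (half_pos ht) 1).mul_left (2 * t * A * K)) isOpen_Ioo isPreconnected_Ioo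
    (fun q s _ => hasDerivAt_gauss_line hg t (latt q) y v s) (fun q s hs => ?_) h0
    (by simpa using summable_gauss_shift hg ht y) h0
  · simpa using this
  · rw [norm_mul, norm_mul, Real.norm_of_nonneg (gauss_pos _ _).le, Real.norm_eq_abs,
      Real.norm_eq_abs, abs_mul, abs_of_pos ht, abs_neg, abs_two]
    have hj := jb_pos q
    have hG := (gauss_pos (g := g) t (latt q + (y + s • v))).le
    calc _ ≤ 2 * t * (A * jb q) * (K * Real.exp (-(t / 2) * normSq g q)) := by
          gcongr
          · exact h' q _ (norm_line_le hs)
          · exact h q _ (norm_line_le hs)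
      _ = _ := by ring

lemma summable_bform_mul_gauss (hg : g.PosDef) {t : ℝ} (ht : 0 < t) (y v : Fin d → ℝ) :
    Summable fun q : Fin d → ℤ => bform g (latt q + y) v * gauss g t (latt q + y) := by
  obtain ⟨K, hK, h⟩ := gauss_shift_le hg ht ‖y‖
  obtain ⟨A, hA, h'⟩ := abs_bform_shift_le g v ‖y‖
  refine Summable.of_norm_bounded ((summable_jb_mul_exp hg (half_pos ht) 1).mul_left (A * K))
    fun q => ?_
  rw [norm_mul, Real.norm_of_nonneg (gauss_pos _ _).le, Real.norm_eq_abs]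
  have hj := jb_pos q
  have hG := (gauss_pos (g := g) t (latt q + y)).le
  calc _ ≤ (A * jb q) * (K * Real.exp (-(t / 2) * normSq g q)) := by
        gcongr
        · exact h' q _ le_rfl
        · exact h q _ le_rfl
    _ = _ := by ring

lemma summable_bform_mul_bform_mul_gauss (hg : g.PosDef) {t : ℝ} (ht : 0 < t) (y v w : Fin d → ℝ) :
    Summable fun q : Fin d → ℤ =>
      bform g (latt q + y) v * bform g (latt q + y) w * gauss g t (latt q + y) := by
  obtain ⟨K, hK, h⟩ := gauss_shift_le hg ht ‖y‖
  obtain ⟨A, hA, h'⟩ := abs_bform_shift_le g v ‖y‖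
  obtain ⟨B, hB, h''⟩ := abs_bform_shift_le g w ‖y‖
  refine Summable.of_norm_bounded ((summable_jb_mul_exp hg (half_pos ht) 2).mul_left (A * B * K))
    fun q => ?_
  rw [norm_mul, norm_mul, Real.norm_of_nonneg (gauss_pos _ _).le, Real.norm_eq_abs, Real.norm_eq_abs]
  have hj := jb_pos q
  have hG := (gauss_pos (g := g) t (latt q + y)).le
  calc _ ≤ (A * jb q) * (B * jb q) * (K * Real.exp (-(t / 2) * normSq g q)) := by
        gcongr
        · exact h' q _ le_rfl
        · exact h'' q _ le_rfl
        · exact h q _ le_rfl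
    _ = _ := by ring

/-- The second derivative of a Gaussian sum over a shifted lattice, differentiated term by term. -/
lemma hasDerivAt_tsum_bform_mul_gauss (hg : g.PosDef) {t : ℝ} (ht : 0 < t) (y v w : Fin d → ℝ) :
    HasDerivAt (fun s : ℝ => ∑' q : Fin d → ℤ,
        -2 * t * bform g (latt q + (y + s • w)) v * gauss g t (latt q + (y + s • w)))
      (∑' q : Fin d → ℤ, (4 * t ^ 2 * (bform g (latt q + y) v * bform g (latt q + y) w) -
        2 * t * bform g w v) * gauss g t (latt q + y)) 0 := by
  obtain ⟨K, hK, h⟩ := gauss_shift_le hg ht (‖y‖ + ‖w‖)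
  obtain ⟨A, hA, h'⟩ := abs_bform_shift_le g v (‖y‖ + ‖w‖)
  obtain ⟨B, hB, h''⟩ := abs_bform_shift_le g w (‖y‖ + ‖w‖)
  have h0 : (0 : ℝ) ∈ Ioo (-1 : ℝ) 1 := by norm_num
  have hd : ∀ (q : Fin d → ℤ) (s : ℝ), s ∈ Ioo (-1 : ℝ) 1 → HasDerivAt
      (fun s : ℝ => -2 * t * bform g (latt q + (y + s • w)) v * gauss g t (latt q + (y + s • w)))
      ((4 * t ^ 2 * (bform g (latt q + (y + s • w)) v * bform g (latt q + (y + s • w)) w) -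
        2 * t * bform g w v) * gauss g t (latt q + (y + s • w))) s := by
    intro q s _
    have h1 := ((hasDerivAt_bform_line (g := g) (latt q) y v w s).const_mul (-2 * t)).mul
      (hasDerivAt_gauss_line hg t (latt q) y w s)
    refine h1.congr_deriv ?_
    ring
  have := hasDerivAt_tsum_of_isPreconnected (y := (0 : ℝ)) (y₀ := 0)
    ((summable_jb_mul_exp hg (half_pos ht) 2).mul_left
      ((4 * t ^ 2 * (A * B) + |2 * t * bform g w v|) * K)) isOpen_Ioo isPreconnected_Ioo
    hd (fun q s hs => ?_) h0 ?_ h0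
  · simpa using this
  · rw [norm_mul, Real.norm_of_nonneg (gauss_pos _ _).le, Real.norm_eq_abs]
    have hj := one_le_jb q
    have hj2 : 1 ≤ jb q ^ 2 := one_le_pow₀ hj
    have h1 : |4 * t ^ 2 * (bform g (latt q + (y + s • w)) v * bform g (latt q + (y + s • w)) w) -
        2 * t * bform g w v| ≤ (4 * t ^ 2 * (A * B) + |2 * t * bform g w v|) * jb q ^ 2 := by
      refine (abs_sub _ _).trans ?_
      rw [abs_mul, abs_mul (bform g _ v), abs_of_pos (by positivity : 0 < 4 * t ^ 2)]
      have h2 : |bform g (latt q + (y + s • w)) v| * |bform g (latt q + (y + s • w)) w| ≤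
          (A * jb q) * (B * jb q) :=
        mul_le_mul (h' q _ (norm_line_le hs)) (h'' q _ (norm_line_le hs)) (abs_nonneg _)
          (by positivity)
      have h3 : |2 * t * bform g w v| ≤ |2 * t * bform g w v| * jb q ^ 2 :=
        le_mul_of_one_le_right (abs_nonneg _) hj2
      have h4 := mul_le_mul_of_nonneg_left h2 (by positivity : (0 : ℝ) ≤ 4 * t ^ 2)
      linarith
    have hG := (gauss_pos (g := g) t (latt q + (y + s • w))).le
    calc _ ≤ (4 * t ^ 2 * (A * B) + |2 * t * bform g w v|) * jb q ^ 2 *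
          (K * Real.exp (-(t / 2) * normSq g q)) := by
          gcongr
          exact h q _ (norm_line_le hs)
      _ = _ := by ring
  · refine ((summable_bform_mul_gauss hg ht y v).mul_left (-2 * t)).congr fun q => ?_
    simp only [zero_smul, add_zero]; ring

/-- The pairing of a lattice point with a vector. -/
def lpair (n : Fin d → ℤ) (v : Fin d → ℝ) : ℝ := ∑ i, (n i : ℝ) * v i

lemma abs_lpair_le (n : Fin d → ℤ) (v : Fin d → ℝ) : |lpair n v| ≤ jb n * ‖v‖ := by
  refine (Finset.abs_sum_le_sum_abs _ _).trans ?_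
  calc ∑ i, |(n i : ℝ) * v i| ≤ ∑ i, |(n i : ℝ)| * ‖v‖ :=
        Finset.sum_le_sum fun i _ => by rw [abs_mul]; gcongr; exact norm_le_pi_norm v i
    _ = (∑ i, |(n i : ℝ)|) * ‖v‖ := by rw [Finset.sum_mul]
    _ ≤ _ := by gcongr; unfold jb; linarith

lemma hasDerivAt_chr_line (n : Fin d → ℤ) (y v : Fin d → ℝ) (s : ℝ) :
    HasDerivAt (fun s : ℝ => chr n (y + s • v))
      (2 * Real.pi * Complex.I * (lpair n v : ℂ) * chr n (y + s • v)) s := by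
  have e : ∀ r : ℝ, chr n (y + r • v) = chr n y *
      Complex.exp ((r : ℂ) * (2 * Real.pi * Complex.I * (lpair n v : ℂ))) := fun r => by
    rw [chr_add, chr, chr]
    congr 2
    simp only [lpair, Pi.smul_apply, smul_eq_mul, Complex.ofReal_mul, Complex.ofReal_sum,
      Complex.ofReal_intCast, Finset.mul_sum]
    exact Finset.sum_congr rfl fun i _ => by ring
  have h1 : HasDerivAt (fun r : ℝ => (r : ℂ) * (2 * Real.pi * Complex.I * (lpair n v : ℂ)))
      (2 * Real.pi * Complex.I * (lpair n v : ℂ)) s := by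
    simpa using (Complex.ofRealCLM.hasDerivAt (x := s)).mul_const
      (2 * Real.pi * Complex.I * (lpair n v : ℂ))
  refine ((h1.cexp.const_mul (chr n y)).congr_of_eventuallyEq
    (Eventually.of_forall fun r => e r)).congr_deriv ?_
  rw [e]; ring

lemma hasDerivAt_tsum_chr {a : (Fin d → ℤ) → ℂ} (ha : Summable fun n => jb n * ‖a n‖)
    (y v : Fin d → ℝ) : HasDerivAt (fun s : ℝ => ∑' n, a n * chr n (y + s • v))
      (∑' n, (a n * (2 * Real.pi * Complex.I * (lpair n v : ℂ))) * chr n y) 0 := by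
  have h0 : (0 : ℝ) ∈ (univ : Set ℝ) := mem_univ _
  have hp : ‖(2 * Real.pi * Complex.I : ℂ)‖ = 2 * Real.pi := by
    simp [abs_of_pos Real.pi_pos]
  have := hasDerivAt_tsum_of_isPreconnected (y := (0 : ℝ)) (y₀ := 0)
    (ha.mul_left (2 * Real.pi * ‖v‖)) isOpen_univ isPreconnected_univ
    (fun n s _ => (hasDerivAt_chr_line n y v s).const_mul (a n)) (fun n s _ => ?_) h0 ?_ h0
  · simpa [mul_assoc] using this
  · rw [norm_mul, norm_mul, norm_mul, norm_chr, hp, mul_one, Complex.norm_real, Real.norm_eq_abs]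
    calc _ ≤ ‖a n‖ * (2 * Real.pi * (jb n * ‖v‖)) := by gcongr; exact abs_lpair_le n v
      _ = _ := by ring
  · refine Summable.of_norm_bounded ha fun n => ?_
    rw [norm_mul, norm_chr, mul_one]
    exact le_mul_of_one_le_left (norm_nonneg _) (one_le_jb n)

/-- The continuum value `∫ e^{-t g^{μν} x_μ x_ν} dx` of the Gaussian lattice sums. -/
def gaussVol (g : Matrix (Fin d) (Fin d) ℝ) (t : ℝ) : ℝ :=
  (Real.pi / t) ^ ((d : ℝ) / 2) * Real.sqrt g.det

lemma gaussVol_nonneg {t : ℝ} (ht : 0 < t) : 0 ≤ gaussVol g t := by unfold gaussVol; positivity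

/-- The coefficients of the dual lattice sum. -/
def dualCoeff (g : Matrix (Fin d) (Fin d) ℝ) (t : ℝ) (n : Fin d → ℤ) : ℝ :=
  gaussVol g t * Real.exp (-(Real.pi ^ 2 / t) * normSq g⁻¹ n)

lemma dualCoeff_nonneg {t : ℝ} (ht : 0 < t) (n : Fin d → ℤ) : 0 ≤ dualCoeff g t n :=
  mul_nonneg (gaussVol_nonneg ht) (Real.exp_pos _).le

lemma summable_jb_mul_dualCoeff (hg : g.PosDef) {t : ℝ} (ht : 0 < t) (m : ℕ) :
    Summable fun n => jb n ^ m * dualCoeff g t n := by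
  refine ((summable_jb_mul_exp hg.inv (t := Real.pi ^ 2 / t) (by positivity) m).mul_left
    (gaussVol g t)).congr fun n => ?_
  rw [dualCoeff]; ring

lemma tsum_gauss_eq (hg : g.PosDef) {t : ℝ} (ht : 0 < t) (y : Fin d → ℝ) :
    ((∑' q : Fin d → ℤ, gauss g t (latt q + y) : ℝ) : ℂ) =
      ∑' n, (dualCoeff g t n : ℂ) * chr n y := (hasSum_poisson hg ht y).tsum_eq.symm

/-- Poisson summation for the first moments. -/
lemma tsum_bform_mul_gauss_eq (hg : g.PosDef) {t : ℝ} (ht : 0 < t) (y v : Fin d → ℝ) :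
    ((∑' q : Fin d → ℤ, -2 * t * bform g (latt q + y) v * gauss g t (latt q + y) : ℝ) : ℂ) =
      ∑' n, ((dualCoeff g t n : ℂ) * (2 * Real.pi * Complex.I * (lpair n v : ℂ))) * chr n y := by
  have h1 := (hasDerivAt_tsum_gauss hg ht y v).ofReal_comp
  have h2 := hasDerivAt_tsum_chr (a := fun n => (dualCoeff g t n : ℂ))
    ((summable_jb_mul_dualCoeff hg ht 1).congr fun n => by
      rw [pow_one, Complex.norm_real, Real.norm_of_nonneg (dualCoeff_nonneg ht n)]) y v
  simp only [tsum_gauss_eq hg ht] at h1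
  exact h1.unique h2

/-- Poisson summation for the second moments. -/
lemma tsum_bform_mul_bform_mul_gauss_eq (hg : g.PosDef) {t : ℝ} (ht : 0 < t) (y v w : Fin d → ℝ) :
    ((∑' q : Fin d → ℤ, (4 * t ^ 2 * (bform g (latt q + y) v * bform g (latt q + y) w) -
        2 * t * bform g w v) * gauss g t (latt q + y) : ℝ) : ℂ) =
      ∑' n, ((dualCoeff g t n : ℂ) * (2 * Real.pi * Complex.I * (lpair n v : ℂ)) *
        (2 * Real.pi * Complex.I * (lpair n w : ℂ))) * chr n y := by
  have h1 := (hasDerivAt_tsum_bform_mul_gauss hg ht y v w).ofReal_comp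
  have h2 := hasDerivAt_tsum_chr
    (a := fun n => (dualCoeff g t n : ℂ) * (2 * Real.pi * Complex.I * (lpair n v : ℂ)))
    (Summable.of_nonneg_of_le (fun n => mul_nonneg (jb_pos n).le (norm_nonneg _)) (fun n => ?_)
      ((summable_jb_mul_dualCoeff hg ht 2).mul_left (2 * Real.pi * ‖v‖))) y w
  · simp only [tsum_bform_mul_gauss_eq hg ht] at h1
    exact h1.unique h2
  · have hp : ‖(2 * Real.pi * Complex.I : ℂ)‖ = 2 * Real.pi := by
      simp [abs_of_pos Real.pi_pos]
    have hj := jb_pos n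
    have hc := dualCoeff_nonneg (g := g) ht n
    rw [norm_mul, norm_mul, hp, Complex.norm_real, Complex.norm_real, Real.norm_of_nonneg hc,
      Real.norm_eq_abs]
    calc _ ≤ jb n * (dualCoeff g t n * (2 * Real.pi * (jb n * ‖v‖))) := by
          gcongr; exact abs_lpair_le n v
      _ = _ := by ring

/-- A dual lattice sum is dominated at small times by its zero mode. -/
lemma exists_dualSum_sub_le (hg : g.PosDef) : ∃ c K : ℝ, 0 < c ∧ 0 < K ∧ ∀ (t A : ℝ)
    (X : (Fin d → ℤ) → ℂ), 0 < t → t ≤ 1 → 0 ≤ A → (∀ n, ‖X n‖ ≤ A * jb n ^ 2) →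
      ‖(∑' n, (dualCoeff g t n : ℂ) * X n) - (gaussVol g t : ℂ) * X 0‖ ≤
        A * gaussVol g t * (K * Real.exp (-c / t)) := by
  obtain ⟨c, hc0, -, -, hc⟩ := exists_lower_normSq hg.inv
  have hs := summable_jb_mul_exp hg.inv (t := Real.pi ^ 2) (by positivity) 2
  set K := ∑' n : Fin d → ℤ, jb n ^ 2 * Real.exp (-Real.pi ^ 2 * normSq g⁻¹ n) with hK
  have hK0 : 0 ≤ K := tsum_nonneg fun n => by have := jb_pos n; positivity
  refine ⟨Real.pi ^ 2 * c, (K + 1) * Real.exp (Real.pi ^ 2 * c), by positivity, by positivity,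
    fun t A X ht ht1 hA hX => ?_⟩
  have hV := gaussVol_nonneg (g := g) ht
  have hsum : Summable fun n => (dualCoeff g t n : ℂ) * X n := by
    refine Summable.of_norm_bounded ((summable_jb_mul_dualCoeff hg ht 2).mul_left A) fun n => ?_
    have hd := dualCoeff_nonneg (g := g) ht n
    rw [norm_mul, Complex.norm_real, Real.norm_of_nonneg hd]
    calc _ ≤ dualCoeff g t n * (A * jb n ^ 2) := by gcongr; exact hX n
      _ = _ := by ring
  have h1 := hsum.hasSum.sub (hasSum_ite_eq (0 : Fin d → ℤ) ((dualCoeff g t 0 : ℂ) * X 0))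
  have h2 : dualCoeff g t 0 = gaussVol g t := by simp [dualCoeff]
  rw [← h2, ← h1.tsum_eq]
  have hb := hs.hasSum.mul_left (A * gaussVol g t *
    (Real.exp (Real.pi ^ 2 * c) * Real.exp (-(Real.pi ^ 2 * c) / t)))
  refine (tsum_of_norm_bounded hb fun n => ?_).trans ?_
  · have hj := jb_pos n
    rcases eq_or_ne n 0 with rfl | hn
    · simp only [if_true, sub_self, norm_zero]
      positivity
    · rw [if_neg hn, sub_zero, norm_mul, Complex.norm_real,
        Real.norm_of_nonneg (dualCoeff_nonneg ht n), dualCoeff]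
      have h3 : Real.exp (-(Real.pi ^ 2 / t) * normSq g⁻¹ n) ≤ Real.exp (Real.pi ^ 2 * c) *
          Real.exp (-(Real.pi ^ 2 * c) / t) * Real.exp (-Real.pi ^ 2 * normSq g⁻¹ n) := by
        rw [← Real.exp_add, ← Real.exp_add]
        refine Real.exp_le_exp.2 ?_
        have h4 : c ≤ normSq g⁻¹ n := by
          have := one_le_pow₀ (n := 2) (one_le_jb n)
          nlinarith [hc n hn]
        have h5 : 0 ≤ Real.pi ^ 2 * (1 / t - 1) := by
          have : 1 ≤ 1 / t := by rwa [le_div_iff₀ ht, one_mul]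
          have h6 : 0 ≤ 1 / t - 1 := by linarith
          positivity
        have h6 := mul_le_mul_of_nonneg_left h4 h5
        have e1 : -(Real.pi ^ 2 / t) * normSq g⁻¹ n =
          -(Real.pi ^ 2 * (1 / t - 1) * normSq g⁻¹ n) - Real.pi ^ 2 * normSq g⁻¹ n := by ring
        have e2 : Real.pi ^ 2 * c + -(Real.pi ^ 2 * c) / t + -Real.pi ^ 2 * normSq g⁻¹ n =
          -(Real.pi ^ 2 * (1 / t - 1) * c) - Real.pi ^ 2 * normSq g⁻¹ n := by ring
        rw [e1, e2]; linarith
      calc _ ≤ gaussVol g t * (Real.exp (Real.pi ^ 2 * c) *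
          Real.exp (-(Real.pi ^ 2 * c) / t) * Real.exp (-Real.pi ^ 2 * normSq g⁻¹ n)) *
            (A * jb n ^ 2) := by gcongr; exact hX n
        _ = _ := by ring
  · rw [← hK, h2]
    calc _ = A * gaussVol g t * (K * Real.exp (Real.pi ^ 2 * c) *
            Real.exp (-(Real.pi ^ 2 * c) / t)) := by ring
      _ ≤ _ := by gcongr; linarith

/-- At small times the Gaussian lattice sum and its first two moments agree, up to exponentially
small errors, with the Gaussian integrals. -/
lemma exists_moments_sub_le (hg : g.PosDef) : ∃ c K : ℝ, 0 < c ∧ 0 < K ∧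
    ∀ (t : ℝ), 0 < t → t ≤ 1 → ∀ y : Fin d → ℝ,
      |(∑' q : Fin d → ℤ, gauss g t (latt q + y)) - gaussVol g t| ≤
        gaussVol g t * (K * Real.exp (-c / t)) ∧
      (∀ μ, |∑' q : Fin d → ℤ, -2 * t * bform g (latt q + y) (Pi.single μ 1) *
        gauss g t (latt q + y)| ≤ gaussVol g t * (K * Real.exp (-c / t))) ∧
      ∀ μ ν, |∑' q : Fin d → ℤ, (4 * t ^ 2 * (bform g (latt q + y) (Pi.single μ 1) *
          bform g (latt q + y) (Pi.single ν 1)) -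
        2 * t * bform g (Pi.single ν 1) (Pi.single μ 1)) * gauss g t (latt q + y)| ≤
          gaussVol g t * (K * Real.exp (-c / t)) := by
  obtain ⟨c, K, hc, hK, h⟩ := exists_dualSum_sub_le hg
  have hp : ‖(2 * Real.pi * Complex.I : ℂ)‖ = 2 * Real.pi := by
    simp [abs_of_pos Real.pi_pos]
  have hpi : 1 ≤ 2 * Real.pi := by linarith [Real.pi_gt_three]
  have hpi2 : 2 * Real.pi ≤ (2 * Real.pi) ^ 2 := by nlinarith
  refine ⟨c, (2 * Real.pi) ^ 2 * K, hc, by positivity, fun t ht ht1 y => ?_⟩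
  have hV := gaussVol_nonneg (g := g) ht
  have hl : ∀ (n : Fin d → ℤ) (μ : Fin d), ‖(2 * Real.pi * Complex.I *
      (lpair n (Pi.single μ 1) : ℂ))‖ ≤ 2 * Real.pi * jb n := fun n μ => by
    rw [norm_mul, hp, Complex.norm_real, Real.norm_eq_abs]
    have := abs_lpair_le n (Pi.single μ 1)
    rw [Pi.norm_single, norm_one, mul_one] at this
    gcongr
  have hz : ∀ v : Fin d → ℝ, lpair 0 v = 0 := fun v => by simp [lpair]
  refine ⟨?_, fun μ => ?_, fun μ ν => ?_⟩
  · have h1 := h t ((2 * Real.pi) ^ 2) (fun n => chr n y) ht ht1 (by positivity) fun n => by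
      rw [norm_chr]
      have := one_le_pow₀ (n := 2) (one_le_jb n)
      nlinarith
    rw [← tsum_gauss_eq hg ht, show chr 0 y = 1 by simp [chr], mul_one, ← Complex.ofReal_sub,
      Complex.norm_real, Real.norm_eq_abs] at h1
    refine h1.trans (le_of_eq (by ring))
  · have h1 := h t ((2 * Real.pi) ^ 2) (fun n => (2 * Real.pi * Complex.I *
      (lpair n (Pi.single μ 1) : ℂ)) * chr n y) ht ht1 (by positivity) fun n => by
      rw [norm_mul, norm_chr, mul_one]
      have hj := one_le_jb n
      refine (hl n μ).trans (mul_le_mul hpi2 ?_ (jb_pos n).le (by positivity))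
      nlinarith
    simp only [← mul_assoc] at h1
    rw [hz] at h1
    have h2 := tsum_bform_mul_gauss_eq hg ht y (Pi.single μ 1)
    simp only [← mul_assoc] at h2
    rw [← h2] at h1
    simp only [Complex.ofReal_zero, mul_zero, zero_mul, sub_zero, Complex.norm_real,
      Real.norm_eq_abs] at h1
    refine h1.trans (le_of_eq (by ring))
  · have h1 := h t ((2 * Real.pi) ^ 2) (fun n => (2 * Real.pi * Complex.I *
      (lpair n (Pi.single μ 1) : ℂ)) * (2 * Real.pi * Complex.I *
      (lpair n (Pi.single ν 1) : ℂ)) * chr n y) ht ht1 (by positivity) fun n => by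
      rw [norm_mul, norm_mul, norm_chr, mul_one]
      have hj := jb_pos n
      calc _ ≤ (2 * Real.pi * jb n) * (2 * Real.pi * jb n) :=
            mul_le_mul (hl n μ) (hl n ν) (norm_nonneg _) (by positivity)
        _ = _ := by ring
    simp only [← mul_assoc] at h1
    rw [hz] at h1
    have h2 := tsum_bform_mul_bform_mul_gauss_eq hg ht y (Pi.single μ 1) (Pi.single ν 1)
    simp only [← mul_assoc] at h2
    rw [← h2] at h1
    simp only [Complex.ofReal_zero, mul_zero, zero_mul, sub_zero, Complex.norm_real,
      Real.norm_eq_abs] at h1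
    simp only [← mul_assoc]
    refine h1.trans (le_of_eq (by ring))

end Moments

/-! ### Small times -/

section SmallTime

open Set

variable {d N : ℕ} {g : Matrix (Fin d) (Fin d) ℝ} {E : MatField d N} {ω : Fin d → MatField d N}

/-- Completing the square in the exponent of the weight. -/
lemma expWeight_eq (hg : g.PosDef) (k : Fin d → ℤ) (t ξ : ℝ) (q : Fin d → ℤ) :
    expWeight g k t ξ q =
      Real.exp (-(ξ * (1 - ξ)) * (t * normSq g k)) * gauss g t (latt q + ξ • latt k) := by
  rw [expWeight, gauss, ← Real.exp_add]
  congr 1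
  have h1 : normSq g (q + k) = normSq g q + 2 * bform g (latt q) (latt k) + normSq g k := by
    have e : normSq g (q + k) = bform g (latt q + latt k) (latt q + latt k) := by
      rw [← latt_add]; rfl
    rw [e, bform_add_left, bform_add_right, bform_add_right, bform_comm hg (latt k) (latt q)]
    change normSq g q + _ + (_ + normSq g k) = _
    ring
  have h2 : bform g (latt q + ξ • latt k) (latt q + ξ • latt k) =
      normSq g q + 2 * ξ * bform g (latt q) (latt k) + ξ ^ 2 * normSq g k := by
    rw [bform_add_left, bform_add_right, bform_add_right, bform_smul_left, bform_smul_left,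
      bform_smul_right, bform_smul_right, bform_comm hg (latt k) (latt q)]
    change normSq g q + _ + (_ + ξ * (ξ * normSq g k)) = _
    ring
  rw [h1, h2]; ring

lemma bform_latt_single (hg : g.PosDef) (q : Fin d → ℤ) (μ : Fin d) :
    bform g (latt q) (Pi.single μ 1) = raise g q μ := by
  rw [raise_eq_left hg, bform]
  refine Finset.sum_congr rfl fun a _ => ?_
  rw [Finset.sum_eq_single μ (fun b _ hb => by simp [hb]) (by simp)]
  simp [latt]

lemma bform_single_single (μ ν : Fin d) :
    bform g (Pi.single ν 1) (Pi.single μ 1) = g⁻¹ ν μ := by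
  rw [bform, Finset.sum_eq_single ν (fun b _ hb => by simp [hb]) (by simp),
    Finset.sum_eq_single μ (fun b _ hb => by simp [hb]) (by simp)]
  simp

/-- The summands of `v₃` in terms of the derivatives of a Gaussian centred at `-ξ k`. -/
lemma tsum_v3Term_eq (hg : g.PosDef) {t : ℝ} (ht : 0 < t) (k : Fin d → ℤ) (μ ν : Fin d) (ξ : ℝ) :
    ∑' q, v3Term g μ ν k t ξ q = Real.exp (-(ξ * (1 - ξ)) * (t * normSq g k)) *
      (((1 - 4 * ξ ^ 2) * (raise g k μ * raise g k ν) - 2 / t * g⁻¹ μ ν) *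
          (∑' q : Fin d → ℤ, gauss g t (latt q + ξ • latt k)) -
        1 / t ^ 2 * (∑' q : Fin d → ℤ, (4 * t ^ 2 * (bform g (latt q + ξ • latt k) (Pi.single μ 1) *
          bform g (latt q + ξ • latt k) (Pi.single ν 1)) -
          2 * t * bform g (Pi.single ν 1) (Pi.single μ 1)) * gauss g t (latt q + ξ • latt k)) -
        2 * ξ / t * (raise g k μ * (∑' q : Fin d → ℤ, -2 * t *
            bform g (latt q + ξ • latt k) (Pi.single ν 1) * gauss g t (latt q + ξ • latt k)) +
          raise g k ν * ∑' q : Fin d → ℤ, -2 * t *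
            bform g (latt q + ξ • latt k) (Pi.single μ 1) * gauss g t (latt q + ξ • latt k))) +
      2 / t * g⁻¹ μ ν * ∑' q : Fin d → ℤ, gauss g t (latt q + 0) := by
  set y := ξ • latt k with hy
  have h0 := (summable_gauss_shift hg ht y).hasSum
  have h1 : ∀ μ : Fin d, HasSum _ (∑' q : Fin d → ℤ, -2 * t * bform g (latt q + y) (Pi.single μ 1) *
      gauss g t (latt q + y)) := fun μ =>
    (((summable_bform_mul_gauss hg ht y (Pi.single μ 1)).mul_left (-2 * t)).congr fun q => by
      ring).hasSum
  have h2 : HasSum _ (∑' q : Fin d → ℤ, (4 * t ^ 2 * (bform g (latt q + y) (Pi.single μ 1) *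
          bform g (latt q + y) (Pi.single ν 1)) -
          2 * t * bform g (Pi.single ν 1) (Pi.single μ 1)) * gauss g t (latt q + y)) :=
    ((((summable_bform_mul_bform_mul_gauss hg ht y (Pi.single μ 1) (Pi.single ν 1)).mul_left
      (4 * t ^ 2)).sub ((summable_gauss_shift hg ht y).mul_left
      (2 * t * bform g (Pi.single ν 1) (Pi.single μ 1)))).congr fun q => by ring).hasSum
  have h3 := (summable_gauss_shift hg ht 0).hasSum
  refine HasSum.tsum_eq (HasSum.congr_fun ((((h0.mul_left ((1 - 4 * ξ ^ 2) *
    (raise g k μ * raise g k ν) - 2 / t * g⁻¹ μ ν)).sub (h2.mul_left (1 / t ^ 2))).sub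
    ((((h1 ν).mul_left (raise g k μ)).add ((h1 μ).mul_left (raise g k ν))).mul_left
      (2 * ξ / t))).mul_left (Real.exp (-(ξ * (1 - ξ)) * (t * normSq g k))) |>.add
    (h3.mul_left (2 / t * g⁻¹ μ ν))) fun q => ?_)
  have e1 : ∀ μ : Fin d, bform g (latt q + y) (Pi.single μ 1) = raise g q μ + ξ * raise g k μ :=
    fun μ => by
      rw [bform_add_left, hy, bform_smul_left, bform_latt_single hg, bform_latt_single hg]
  have e2 : gauss g t (latt q + 0) = Real.exp (-t * normSq g q) := by rw [add_zero]; rfl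
  rw [v3Term, expWeight_eq hg, e1, e1, e2, bform_single_single, inv_symm hg ν μ, ← hy]
  field_simp
  ring

lemma abs_sub_mul_add_le {a b c r s u v x y : ℝ} (h1 : |a| ≤ b) (h2 : |r| ≤ s) (h3 : |u| ≤ v)
    (h4 : |x| ≤ y) (c' : |c| ≤ 1) : |c * (a - r - u) + x| ≤ b + s + v + y := by
  refine (abs_add_le _ _).trans (add_le_add ?_ h4)
  rw [abs_mul]
  have h5 : |a - r - u| ≤ b + s + v :=
    (abs_sub _ _).trans (add_le_add ((abs_sub _ _).trans (add_le_add h1 h2)) h3)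
  exact (mul_le_of_le_one_left (abs_nonneg _) c').trans h5

lemma abs_exp_neg_le_one (hg : g.PosDef) {t ξ : ℝ} (ht : 0 < t) (hξ : ξ ∈ Icc (0 : ℝ) 1)
    (k : Fin d → ℤ) : |Real.exp (-(ξ * (1 - ξ)) * (t * normSq g k))| ≤ 1 := by
  rw [abs_of_pos (Real.exp_pos _), Real.exp_le_one_iff]
  have h1 := mul_nonneg hξ.1 (sub_nonneg.2 hξ.2)
  have h2 := mul_nonneg h1 (mul_nonneg ht.le (normSq_nonneg hg k))
  linarith

/-- At small times the momentum sums in `v₂` and `v₃` are given by Gaussian integrals. -/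
lemma exists_momentumSums_sub_le (hg : g.PosDef) : ∃ c K : ℝ, 0 < c ∧ 0 < K ∧
    ∀ (t : ℝ), 0 < t → t ≤ 1 →
      |theta g t - gaussVol g t| ≤ K * (gaussVol g t * Real.exp (-c / t)) ∧
      ∀ (k : Fin d → ℤ) (ξ : ℝ), ξ ∈ Icc (0 : ℝ) 1 →
        |(∑' q, expWeight g k t ξ q) -
          gaussVol g t * Real.exp (-(ξ * (1 - ξ)) * (t * normSq g k))| ≤
          K * (gaussVol g t * Real.exp (-c / t)) ∧
        ∀ μ ν, |(∑' q, v3Term g μ ν k t ξ q) -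
          gaussVol g t * (Real.exp (-(ξ * (1 - ξ)) * (t * normSq g k)) *
            ((1 - 4 * ξ ^ 2) * (raise g k μ * raise g k ν) - 2 / t * g⁻¹ μ ν) +
              2 / t * g⁻¹ μ ν)| ≤
          K * (gaussVol g t * Real.exp (-c / t)) * jb k ^ 2 / t ^ 2 := by
  obtain ⟨c, K, hc, hK, h⟩ := exists_moments_sub_le hg
  obtain ⟨C, hC, hr⟩ := abs_raise_le g
  set G := ∑ μ, ∑ ν, |g⁻¹ μ ν| with hG
  have hG0 : 0 ≤ G := by positivity
  have hGle : ∀ μ ν, |g⁻¹ μ ν| ≤ G := fun μ ν =>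
    (Finset.single_le_sum (f := fun ν => |g⁻¹ μ ν|) (fun _ _ => abs_nonneg _)
      (Finset.mem_univ ν)).trans (Finset.single_le_sum (f := fun μ => ∑ ν, |g⁻¹ μ ν|)
      (fun _ _ => Finset.sum_nonneg fun _ _ => abs_nonneg _) (Finset.mem_univ μ))
  refine ⟨c, K * (1 + (3 * C ^ 2 + 4 * G + 4 * C)), hc, by positivity, fun t ht ht1 => ?_⟩
  have hV := gaussVol_nonneg (g := g) ht
  set e := gaussVol g t * (K * Real.exp (-c / t)) with he
  have he0 : 0 ≤ e := by positivity
  have heK : e ≤ K * (1 + (3 * C ^ 2 + 4 * G + 4 * C)) * (gaussVol g t * Real.exp (-c / t)) := by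
    have h1 : 0 ≤ 3 * C ^ 2 + 4 * G + 4 * C := by positivity
    calc e = K * (gaussVol g t * Real.exp (-c / t)) := by rw [he]; ring
      _ ≤ _ := by gcongr; exact le_mul_of_one_le_right hK.le (by linarith)
  have hθ : |(∑' q : Fin d → ℤ, gauss g t (latt q + 0)) - gaussVol g t| ≤ e := (h t ht ht1 0).1
  refine ⟨?_, fun k ξ hξ => ⟨?_, fun μ ν => ?_⟩⟩
  · simp only [add_zero] at hθ
    exact hθ.trans heK
  · simp only [expWeight_eq hg, tsum_mul_left]
    rw [mul_comm (gaussVol g t), ← mul_sub, abs_mul]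
    exact ((mul_le_of_le_one_left (abs_nonneg _) (abs_exp_neg_le_one hg ht hξ k)).trans
      (h t ht ht1 (ξ • latt k)).1).trans heK
  · obtain ⟨m0, m1, m2⟩ := h t ht ht1 (ξ • latt k)
    rw [tsum_v3Term_eq hg ht]
    set S0 := ∑' q : Fin d → ℤ, gauss g t (latt q + ξ • latt k)
    set D2 := ∑' q : Fin d → ℤ, (4 * t ^ 2 * (bform g (latt q + ξ • latt k) (Pi.single μ 1) *
          bform g (latt q + ξ • latt k) (Pi.single ν 1)) -
          2 * t * bform g (Pi.single ν 1) (Pi.single μ 1)) * gauss g t (latt q + ξ • latt k)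
    set D1 := ∑' q : Fin d → ℤ, -2 * t *
            bform g (latt q + ξ • latt k) (Pi.single ν 1) * gauss g t (latt q + ξ • latt k)
    set D1' := ∑' q : Fin d → ℤ, -2 * t *
            bform g (latt q + ξ • latt k) (Pi.single μ 1) * gauss g t (latt q + ξ • latt k)
    set S := ∑' q : Fin d → ℤ, gauss g t (latt q + 0)
    set W := Real.exp (-(ξ * (1 - ξ)) * (t * normSq g k))
    set kk := raise g k μ * raise g k ν
    have hj := one_le_jb k
    have hj2 : jb k ≤ jb k ^ 2 := by nlinarith
    have hj1 : 1 ≤ jb k ^ 2 := hj.trans hj2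
    have ht2 : t ^ 2 ≤ t := by nlinarith
    have ht21 : t ^ 2 ≤ 1 := ht2.trans ht1
    have hkk : |kk| ≤ C ^ 2 * jb k ^ 2 := by
      rw [abs_mul, ← mul_pow, pow_two]
      exact mul_le_mul (hr k μ) (hr k ν) (abs_nonneg _) ((abs_nonneg _).trans (hr k μ))
    set J := jb k ^ 2 / t ^ 2 with hJ
    have hJ1 : jb k ^ 2 ≤ J := by
      rw [hJ, le_div_iff₀ (by positivity)]
      exact mul_le_of_le_one_right (by positivity) ht21
    have hJ0 : 0 ≤ J := by positivity
    have htJ : jb k / t ≤ J := by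
      rw [hJ, div_le_div_iff₀ ht (by positivity)]
      have := mul_le_mul hj2 ht2 (by positivity) (by positivity)
      linarith
    have htJ' : 1 / t ≤ J := (div_le_div_of_nonneg_right hj ht.le).trans htJ
    have htJ2 : 1 / t ^ 2 ≤ J := div_le_div_of_nonneg_right hj1 (by positivity)
    have hgt : |2 / t * g⁻¹ μ ν| ≤ 2 * G * J := by
      rw [abs_mul, abs_of_pos (by positivity)]
      calc 2 / t * |g⁻¹ μ ν| = 2 * |g⁻¹ μ ν| * (1 / t) := by ring
        _ ≤ 2 * G * J := by gcongr; exact hGle μ ν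
    have hξ2 : |1 - 4 * ξ ^ 2| ≤ 3 := by
      have h1 : ξ ^ 2 ≤ 1 := by nlinarith [hξ.1, hξ.2]
      rw [abs_le]; constructor <;> nlinarith [sq_nonneg ξ]
    have b1 : |((1 - 4 * ξ ^ 2) * kk - 2 / t * g⁻¹ μ ν) * (S0 - gaussVol g t)| ≤
        (3 * C ^ 2 + 2 * G) * J * e := by
      rw [abs_mul]
      refine mul_le_mul ?_ m0 (abs_nonneg _) (by positivity)
      refine (abs_sub _ _).trans ?_
      rw [abs_mul]
      calc |1 - 4 * ξ ^ 2| * |kk| + |2 / t * g⁻¹ μ ν| ≤ 3 * (C ^ 2 * J) + 2 * G * J := by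
            refine add_le_add (mul_le_mul hξ2 (hkk.trans ?_) (abs_nonneg _) (by norm_num)) hgt
            gcongr
        _ = _ := by ring
    have b2 : |1 / t ^ 2 * D2| ≤ J * e := by
      rw [abs_mul, abs_of_pos (by positivity)]
      exact mul_le_mul htJ2 (m2 μ ν) (abs_nonneg _) hJ0
    have b3 : |2 * ξ / t * (raise g k μ * D1 + raise g k ν * D1')| ≤ 4 * C * J * e := by
      rw [abs_mul, abs_of_nonneg (by have := hξ.1; positivity)]
      have h1 : |raise g k μ * D1 + raise g k ν * D1'| ≤ 2 * C * jb k * e := by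
        refine (abs_add_le _ _).trans ?_
        rw [abs_mul, abs_mul]
        have h2 := mul_le_mul (hr k μ) (m1 ν) (abs_nonneg _) (by positivity)
        have h3 := mul_le_mul (hr k ν) (m1 μ) (abs_nonneg _) (by positivity)
        linarith
      calc 2 * ξ / t * |raise g k μ * D1 + raise g k ν * D1'| ≤
            2 * 1 / t * (2 * C * jb k * e) := by
              have := hξ.1
              gcongr; exact hξ.2
        _ = 4 * C * e * (jb k / t) := by ring
        _ ≤ 4 * C * e * J := by gcongr
        _ = _ := by ring
    have b4 : |2 / t * g⁻¹ μ ν * (S - gaussVol g t)| ≤ 2 * G * J * e := by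
      rw [abs_mul]
      exact mul_le_mul hgt hθ (abs_nonneg _) (by positivity)
    have hfin := abs_sub_mul_add_le b1 b2 b3 b4 (abs_exp_neg_le_one hg ht hξ k)
    have e1 : W * (((1 - 4 * ξ ^ 2) * kk - 2 / t * g⁻¹ μ ν) * S0 - 1 / t ^ 2 * D2 -
        2 * ξ / t * (raise g k μ * D1 + raise g k ν * D1')) + 2 / t * g⁻¹ μ ν * S -
        gaussVol g t * (W * ((1 - 4 * ξ ^ 2) * kk - 2 / t * g⁻¹ μ ν) + 2 / t * g⁻¹ μ ν) =
        W * (((1 - 4 * ξ ^ 2) * kk - 2 / t * g⁻¹ μ ν) * (S0 - gaussVol g t) - 1 / t ^ 2 * D2 -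
          2 * ξ / t * (raise g k μ * D1 + raise g k ν * D1')) +
          2 / t * g⁻¹ μ ν * (S - gaussVol g t) := by ring
    rw [e1]
    refine hfin.trans (le_of_eq ?_)
    rw [he, hJ]; ring

/-- Integration by parts for the function `h`. -/
lemma mul_integral_exp_eq (z : ℝ) :
    z * ∫ ξ in (0 : ℝ)..1, (1 - 4 * ξ ^ 2) * Real.exp (-(ξ * (1 - ξ)) * z) = 2 * (bvH z - 1) := by
  have hd : ∀ ξ : ℝ, HasDerivAt (fun ξ : ℝ => (1 + 2 * ξ) * Real.exp (-(ξ * (1 - ξ)) * z))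
      (2 * Real.exp (-(ξ * (1 - ξ)) * z) -
        z * ((1 - 4 * ξ ^ 2) * Real.exp (-(ξ * (1 - ξ)) * z))) ξ := by
    intro ξ
    have h1 : HasDerivAt (fun ξ : ℝ => -(ξ * (1 - ξ)) * z) (-(1 - 2 * ξ) * z) ξ := by
      have := (((hasDerivAt_id ξ).mul ((hasDerivAt_id ξ).const_sub 1)).neg).mul_const z
      refine this.congr_deriv ?_
      simp only [id]; ring
    have h2 : HasDerivAt (fun ξ : ℝ => 1 + 2 * ξ) 2 ξ := by
      simpa using ((hasDerivAt_id ξ).const_mul 2).const_add 1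
    refine (h2.mul h1.exp).congr_deriv ?_
    ring
  have c1 : Continuous fun ξ : ℝ => 2 * Real.exp (-(ξ * (1 - ξ)) * z) := by fun_prop
  have c2 : Continuous fun ξ : ℝ => z * ((1 - 4 * ξ ^ 2) * Real.exp (-(ξ * (1 - ξ)) * z)) := by
    fun_prop
  have h := intervalIntegral.integral_eq_sub_of_hasDerivAt (a := 0) (b := 1) (fun ξ _ => hd ξ)
    ((c1.sub c2).intervalIntegrable _ _)
  rw [intervalIntegral.integral_sub (c1.intervalIntegrable _ _) (c2.intervalIntegrable _ _),
    intervalIntegral.integral_const_mul, intervalIntegral.integral_const_mul] at h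
  have e : ∫ ξ in (0 : ℝ)..1, Real.exp (-(ξ * (1 - ξ)) * z) = bvH z := rfl
  rw [e] at h
  simp only [mul_one, mul_zero, add_zero, sub_self, neg_zero, zero_mul, Real.exp_zero] at h
  linarith

/-- The Gaussian approximation of the integral over `ξ` in `v₃` is transversal, with form factor
`bvQ`: integration by parts trades the longitudinal part for the metric. -/
lemma integral_v3Main_eq (hg : g.PosDef) {t : ℝ} (ht : 0 < t) (k : Fin d → ℤ) (μ ν : Fin d) :
    ∫ ξ in (0 : ℝ)..1, (Real.exp (-(ξ * (1 - ξ)) * (t * normSq g k)) *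
      ((1 - 4 * ξ ^ 2) * (raise g k μ * raise g k ν) - 2 / t * g⁻¹ μ ν) + 2 / t * g⁻¹ μ ν) =
      4 * bvQ (t * normSq g k) * transv g k μ ν := by
  set z := t * normSq g k with hz
  set kk := raise g k μ * raise g k ν with hkk
  set G := g⁻¹ μ ν with hG
  have c1 : Continuous fun ξ : ℝ => kk * ((1 - 4 * ξ ^ 2) * Real.exp (-(ξ * (1 - ξ)) * z)) := by
    fun_prop
  have c2 : Continuous fun ξ : ℝ => 2 / t * G * Real.exp (-(ξ * (1 - ξ)) * z) := by fun_prop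
  have e1 : ∀ ξ : ℝ, Real.exp (-(ξ * (1 - ξ)) * z) * ((1 - 4 * ξ ^ 2) * kk - 2 / t * G) + 2 / t * G =
      kk * ((1 - 4 * ξ ^ 2) * Real.exp (-(ξ * (1 - ξ)) * z)) -
        2 / t * G * Real.exp (-(ξ * (1 - ξ)) * z) + 2 / t * G := fun ξ => by ring
  have i12 : IntervalIntegrable (fun ξ : ℝ => kk * ((1 - 4 * ξ ^ 2) *
      Real.exp (-(ξ * (1 - ξ)) * z)) - 2 / t * G * Real.exp (-(ξ * (1 - ξ)) * z)) volume 0 1 :=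
    (c1.sub c2).intervalIntegrable _ _
  simp only [e1]
  rw [intervalIntegral.integral_add i12 intervalIntegrable_const,
    intervalIntegral.integral_sub (c1.intervalIntegrable _ _) (c2.intervalIntegrable _ _),
    intervalIntegral.integral_const_mul, intervalIntegral.integral_const_mul]
  have e : ∫ ξ in (0 : ℝ)..1, Real.exp (-(ξ * (1 - ξ)) * z) = bvH z := rfl
  have h := mul_integral_exp_eq z
  rw [e]
  simp only [intervalIntegral.integral_const, sub_zero, one_smul]
  rcases eq_or_ne k 0 with rfl | hk
  · have h1 : z = 0 := by simp [hz]
    have h2 : bvH 0 = 1 := by simp [bvH]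
    have h3 : kk = 0 := by simp [hkk, raise]
    have h4 : transv g 0 μ ν = 0 := by simp [transv, raise]
    rw [h1, h2, h3, h4]; ring
  · have hn : 0 < normSq g k := by
      obtain ⟨c, hc0, -, -, hc⟩ := exists_lower_normSq hg
      have := jb_pos k
      exact lt_of_lt_of_le (by positivity) (hc k hk)
    have hz0 : z ≠ 0 := (mul_pos ht hn).ne'
    have h1 : ∫ ξ in (0 : ℝ)..1, (1 - 4 * ξ ^ 2) * Real.exp (-(ξ * (1 - ξ)) * z) =
        2 * (bvH z - 1) / z := by rw [eq_div_iff hz0, mul_comm, h]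
    rw [h1, bvQ, if_neg hz0, transv, ← hkk, ← hG]
    have hn' := hn.ne'
    rw [hz]
    field_simp
    ring

lemma prefactor_eq {t : ℝ} (ht : 0 < t) : (4 * Real.pi * t) ^ (-(d : ℝ) / 2) * Real.sqrt g.det =
    gaussVol g t * fnorm d ^ 2 := by
  have h1 : 4 * Real.pi * t = (2 * Real.pi) * (2 * Real.pi) * (Real.pi / t)⁻¹ := by
    field_simp; ring
  have h2 : ((Real.pi / t)⁻¹) ^ (-(d : ℝ) / 2) = (Real.pi / t) ^ ((d : ℝ) / 2) := by
    rw [neg_div, Real.rpow_neg (by positivity), Real.inv_rpow (by positivity), inv_inv]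
  rw [h1, Real.mul_rpow (by positivity) (by positivity), Real.mul_rpow (by positivity) (by positivity),
    h2, gaussVol, fnorm]
  ring

lemma abs_integral_sub_le {F f : ℝ → ℝ} {C : ℝ} (hF : IntervalIntegrable F volume 0 1)
    (hf : Continuous f) (h : ∀ ξ ∈ Icc (0 : ℝ) 1, |F ξ - f ξ| ≤ C) :
    |(∫ ξ in (0 : ℝ)..1, F ξ) - ∫ ξ in (0 : ℝ)..1, f ξ| ≤ C := by
  rw [← intervalIntegral.integral_sub hF (hf.intervalIntegrable _ _)]
  have := intervalIntegral.norm_integral_le_of_norm_le_const (a := 0) (b := 1) (C := C)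
    (f := fun ξ => F ξ - f ξ) fun ξ hξ => by
      rw [uIoc_of_le zero_le_one] at hξ
      exact h ξ (Ioc_subset_Icc_self hξ)
  simpa using this

/-- The form factors agree at small times with the heat kernel form factors `bvH` and `bvQ`, up to
exponentially small terms of at most polynomial growth in the mode. -/
lemma exists_formFactors_smallT (hg : g.PosDef) : ∃ c K : ℝ, 0 < c ∧ 0 < K ∧
    ∀ t : ℝ, 0 < t → t ≤ 1 →
      |v1 g 0 t - gaussVol g t * fnorm d ^ 2 * (t * (fnorm d)⁻¹)| ≤
        K * (gaussVol g t * Real.exp (-c / t)) ∧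
      (∀ k, |v2 g k t - gaussVol g t * fnorm d ^ 2 * t ^ 2 * (1 / 2 * bvH (t * normSq g k))| ≤
        K * (gaussVol g t * Real.exp (-c / t)) * jb k ^ 2) ∧
      ∀ μ ν k, |v3 g μ ν k t - gaussVol g t * fnorm d ^ 2 * t ^ 2 * bvQ (t * normSq g k) * 2 *
        transv g k μ ν| ≤ K * (gaussVol g t * Real.exp (-c / t)) * jb k ^ 2 := by
  obtain ⟨c, K, hc, hK, h⟩ := exists_momentumSums_sub_le hg
  have hf0 := fnorm_pos (d := d)
  have hP : ∀ t : ℝ, t ^ 2 / (2 * (2 * Real.pi) ^ d) = t ^ 2 * (fnorm d ^ 2 / 2) := fun t => by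
    rw [fnorm_sq]; field_simp
  refine ⟨c, K * (fnorm d + fnorm d ^ 2 / 2), hc, by positivity, fun t ht ht1 => ?_⟩
  obtain ⟨h1, h2⟩ := h t ht ht1
  obtain ⟨-, hi⟩ := formFactors_converge hg ht
  have hV := gaussVol_nonneg (g := g) ht
  set e := gaussVol g t * Real.exp (-c / t) with he
  have he0 : 0 ≤ e := by positivity
  have ht2 : t ^ 2 ≤ 1 := by nlinarith
  refine ⟨?_, fun k => ?_, fun μ ν k => ?_⟩
  · have e1 : v1 g 0 t - gaussVol g t * fnorm d ^ 2 * (t * (fnorm d)⁻¹) =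
        t * fnorm d * (theta g t - gaussVol g t) := by
      rw [v1, if_pos rfl, show (2 * Real.pi) ^ (-(d : ℝ) / 2) = fnorm d from rfl]
      field_simp
    rw [e1, abs_mul, abs_of_pos (by positivity)]
    calc t * fnorm d * |theta g t - gaussVol g t| ≤ 1 * fnorm d * (K * e) := by gcongr
      _ = K * fnorm d * e := by ring
      _ ≤ _ := by
        gcongr
        have : 0 ≤ fnorm d ^ 2 / 2 := by positivity
        linarith
  · have h3 := abs_integral_sub_le (hi k).2.1 (f := fun ξ => gaussVol g t *
      Real.exp (-(ξ * (1 - ξ)) * (t * normSq g k))) (by fun_prop) fun ξ hξ => (h2 k ξ hξ).1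
    rw [intervalIntegral.integral_const_mul] at h3
    have e0 : ∫ ξ in (0 : ℝ)..1, Real.exp (-(ξ * (1 - ξ)) * (t * normSq g k)) =
      bvH (t * normSq g k) := rfl
    rw [e0] at h3
    have e1 : v2 g k t - gaussVol g t * fnorm d ^ 2 * t ^ 2 * (1 / 2 * bvH (t * normSq g k)) =
        t ^ 2 * (fnorm d ^ 2 / 2) * ((∫ ξ in (0 : ℝ)..1, ∑' q, expWeight g k t ξ q) -
          gaussVol g t * bvH (t * normSq g k)) := by
      rw [v2, hP]; ring
    rw [e1, abs_mul, abs_of_pos (by positivity)]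
    have hj : 1 ≤ jb k ^ 2 := one_le_pow₀ (one_le_jb k)
    calc _ ≤ 1 * (fnorm d ^ 2 / 2) * (K * e) := by gcongr
      _ = K * (fnorm d ^ 2 / 2) * e * 1 := by ring
      _ ≤ _ := by gcongr; linarith
  · have h3 := abs_integral_sub_le ((hi k).2.2 μ ν).2 (f := fun ξ => gaussVol g t *
      (Real.exp (-(ξ * (1 - ξ)) * (t * normSq g k)) *
            ((1 - 4 * ξ ^ 2) * (raise g k μ * raise g k ν) - 2 / t * g⁻¹ μ ν) +
              2 / t * g⁻¹ μ ν)) (by fun_prop) fun ξ hξ => (h2 k ξ hξ).2 μ ν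
    rw [intervalIntegral.integral_const_mul, integral_v3Main_eq hg ht] at h3
    have e1 : v3 g μ ν k t - gaussVol g t * fnorm d ^ 2 * t ^ 2 * bvQ (t * normSq g k) * 2 *
        transv g k μ ν = t ^ 2 * (fnorm d ^ 2 / 2) *
          ((∫ ξ in (0 : ℝ)..1, ∑' q, v3Term g μ ν k t ξ q) -
          gaussVol g t * (4 * bvQ (t * normSq g k) * transv g k μ ν)) := by
      rw [v3, hP]; ring
    rw [e1, abs_mul, abs_of_pos (by positivity)]
    have hj := jb_pos k
    calc _ ≤ t ^ 2 * (fnorm d ^ 2 / 2) * (K * e * jb k ^ 2 / t ^ 2) := by gcongr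
      _ = K * (fnorm d ^ 2 / 2) * e * jb k ^ 2 := by field_simp
      _ ≤ _ := by gcongr; linarith

/-- The covariant expression at small times in terms of its form factors. -/
lemma smallT_linCurv_eq (hg : g.PosDef) (hE : IsSmoothMat E) (hω : ∀ μ, IsSmoothMat (ω μ))
    {t : ℝ} (ht : 0 < t) : smallT g E (linCurv ω) t =
      ((gaussVol g t * fnorm d ^ 2 * (t * (fnorm d)⁻¹) : ℝ) : ℂ) * Matrix.trace (fCoeff E 0) +
        ∑' k, (((gaussVol g t * fnorm d ^ 2 * t ^ 2 * (1 / 2 * bvH (t * normSq g k)) : ℝ) : ℂ) *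
            Matrix.trace (fCoeff E (-k) * fCoeff E k) +
          ∑ μ, ∑ ν, ((gaussVol g t * fnorm d ^ 2 * t ^ 2 * bvQ (t * normSq g k) * 2 *
            transv g k μ ν : ℝ) : ℂ) * Matrix.trace (fCoeff (ω μ) (-k) * fCoeff (ω ν) k)) := by
  set W := gaussVol g t * fnorm d ^ 2 with hW
  have h1 := hasSum_lin_form hg (boundedSymbol_bvH hg ht.le) (boundedSymbol_bvQ hg ht.le) hE hω
    ((W * t ^ 2 : ℝ) : ℂ) ((W * t ^ 2 : ℝ) : ℂ)
  have h2 := h1.tsum_eq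
  rw [smallT_eq hg hE (isSmoothMat_linCurv hω) ht.le, ← mul_assoc, ← Complex.ofReal_mul,
    prefactor_eq ht, ← hW]
  have h3 : ∑' k, (((W * t ^ 2 * (1 / 2 * bvH (t * normSq g k)) : ℝ) : ℂ) *
            Matrix.trace (fCoeff E (-k) * fCoeff E k) +
          ∑ μ, ∑ ν, ((W * t ^ 2 * bvQ (t * normSq g k) * 2 *
            transv g k μ ν : ℝ) : ℂ) * Matrix.trace (fCoeff (ω μ) (-k) * fCoeff (ω ν) k)) =
      ((W * t ^ 2 : ℝ) : ℂ) * ∑' k, ((1 / 2 * bvH (t * normSq g k) : ℝ) : ℂ) *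
        Matrix.trace (fCoeff E (-k) * fCoeff E k) +
      ((W * t ^ 2 : ℝ) : ℂ) * ∑' k, (bvQ (t * normSq g k) : ℂ) *
        curvPair g (linCurv ω) (linCurv ω) k := by
    rw [← h2]
    refine tsum_congr fun k => ?_
    simp only [Complex.ofReal_mul, Complex.ofReal_ofNat]
  rw [h3]
  push_cast
  ring

/-- Halving the rate absorbs the power `t ^ (-d / 2)`. -/
lemma gaussVol_mul_exp_isBigO (g : Matrix (Fin d) (Fin d) ℝ) {c : ℝ} (hc : 0 < c) :
    (fun t : ℝ => gaussVol g t * Real.exp (-c / t)) =O[𝓝[>] 0]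
      fun t : ℝ => Real.exp (-(c / 2) / t) := by
  have h := ((isLittleO_rpow_exp_pos_mul_atTop ((d : ℝ) / 2) (half_pos hc)).isBigO.comp_tendsto
    tendsto_inv_nhdsGT_zero).mul (isBigO_refl (fun t : ℝ => Real.exp (-c / t)) (𝓝[>] 0))
  have h2 := h.const_mul_left (Real.pi ^ ((d : ℝ) / 2) * Real.sqrt g.det)
  refine (h2.congr' ?_ (Eventually.of_forall fun t => ?_))
  · filter_upwards [self_mem_nhdsWithin] with t ht
    have ht' : 0 < t := ht
    simp only [Function.comp_apply, gaussVol]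
    rw [div_eq_mul_inv Real.pi t, Real.mul_rpow Real.pi_pos.le (inv_nonneg.2 ht'.le)]
    ring
  · simp only [Function.comp_apply]
    rw [← Real.exp_add]
    congr 1; ring

theorem exists_secondOrder_smallT (hg : g.PosDef) : ∃ c : ℝ, 0 < c ∧
    ∀ (E : MatField d N) (ω : Fin d → MatField d N), IsSmoothMat E → (∀ μ, IsSmoothMat (ω μ)) →
        (fun t : ℝ => secondOrder g E ω t - smallT g E (linCurv ω) t)
          =O[𝓝[>] 0] fun t : ℝ => Real.exp (-c / t) := by
  obtain ⟨c, K, hc0, hK, h⟩ := exists_formFactors_smallT hg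
  refine ⟨c / 2, half_pos hc0, fun E ω hE hω => ?_⟩
  obtain ⟨M, hM⟩ := norm_secondOrder_sub_le hg hE hω 2
  refine IsBigO.trans (IsBigO.of_bound (M * K) ?_) (gaussVol_mul_exp_isBigO g hc0)
  filter_upwards [Ioc_mem_nhdsGT one_pos] with t ht
  obtain ⟨h1, h2, h3⟩ := h t ht.1 ht.2
  have hV := gaussVol_nonneg (g := g) ht.1
  rw [smallT_linCurv_eq hg hE hω ht.1, Real.norm_of_nonneg (by positivity), mul_assoc M K]
  exact hM t _ _ _ _ ht.1 (by positivity) h1 h2 h3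

end SmallTime

end TorusHeat

end

theorem mainTheorem2 (d N : ℕ) (g : Matrix (Fin d) (Fin d) ℝ) (hg : g.PosDef) :
    -- the heat semigroup exists, is unique, and is of trace class for `t > 0`
    (∀ (E : MatField d N) (ω : Fin d → MatField d N), IsSmoothMat E → (∀ μ, IsSmoothMat (ω μ)) →
      (∃! G : ℝ≥0 → L2 d N →L[ℂ] L2 d N, IsHeatSemigroup g E ω G) ∧
      ∀ t : ℝ≥0, 0 < t → HasTrace (heatSemigroup g E ω t) (heatTrace g E ω t)) ∧
    -- the form factors and the Fourier series involved converge
    (∀ t : ℝ, 0 < t →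
      (Summable fun q : Fin d → ℤ => Real.exp (-t * normSq g q)) ∧
      ∀ k : Fin d → ℤ,
        (∀ ξ ∈ Set.Icc (0 : ℝ) 1, Summable fun q => expWeight g k t ξ q) ∧
        IntervalIntegrable (fun ξ => ∑' q, expWeight g k t ξ q) volume 0 1 ∧
        ∀ μ ν : Fin d,
          (∀ ξ ∈ Set.Icc (0 : ℝ) 1, Summable fun q => v3Term g μ ν k t ξ q) ∧
          IntervalIntegrable (fun ξ => ∑' q, v3Term g μ ν k t ξ q) volume 0 1) ∧
    (∀ u : MatField d N, IsSmoothMat u → ∀ a b, Summable fun k => ‖fCoeff u k a b‖) ∧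
    -- the heat trace up to second order in `E` and `ω`
    (∀ (E : MatField d N) (ω : Fin d → MatField d N), IsSmoothMat E → (∀ μ, IsSmoothMat (ω μ)) →
      ∀ t : ℝ≥0, 0 < t →
        (Summable fun k => modeTerm g E ω t k) ∧
        (fun ε : ℝ => heatTrace g ((ε : ℂ) • E) ((ε : ℂ) • ω) t
            - ((N : ℂ) * (theta g t : ℂ) + secondOrder g ((ε : ℂ) • E) ((ε : ℂ) • ω) t))
          =O[𝓝 0] fun ε : ℝ => ε ^ 3) ∧
    -- small `t`
    (∃ c : ℝ, 0 < c ∧ ∀ (E : MatField d N) (ω : Fin d → MatField d N),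
      IsSmoothMat E → (∀ μ, IsSmoothMat (ω μ)) →
        (fun t : ℝ => secondOrder g E ω t - smallT g E (linCurv ω) t)
          =O[𝓝[>] 0] fun t : ℝ => Real.exp (-c / t)) ∧
    -- large `t`
    (∃ c : ℝ, 0 < c ∧ ∀ (E : MatField d N) (ω : Fin d → MatField d N),
      IsSmoothMat E → (∀ μ, IsSmoothMat (ω μ)) →
        (fun t : ℝ => secondOrder g E ω t - (largeT g E (linCurv ω) t + zeroModeT g E ω t))
          =O[atTop] fun t : ℝ => Real.exp (-c * t)) ∧
    -- the gauge-covariant curvature differs from its linear part by higher order terms only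
    (∀ (E : MatField d N) (ω : Fin d → MatField d N), IsSmoothMat E → (∀ μ, IsSmoothMat (ω μ)) →
      ∀ t : ℝ, 0 < t →
        (fun ε : ℝ => smallT g ((ε : ℂ) • E) (fullCurv ((ε : ℂ) • ω)) t
            - smallT g ((ε : ℂ) • E) (linCurv ((ε : ℂ) • ω)) t)
          =O[𝓝 0] (fun ε : ℝ => ε ^ 3) ∧
        (fun ε : ℝ => largeT g ((ε : ℂ) • E) (fullCurv ((ε : ℂ) • ω)) t
            - largeT g ((ε : ℂ) • E) (linCurv ((ε : ℂ) • ω)) t)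
          =O[𝓝 0] (fun ε : ℝ => ε ^ 3)) := by
  exact ⟨fun E ω hE hω => ⟨existsUnique_isHeatSemigroup hg hE hω,
      fun t ht => hasTrace_heatSemigroup hg hE hω ht⟩,
    fun t ht => formFactors_converge hg ht, fun u hu a b => (hu a b).summable_sc,
    fun E ω hE hω t ht => ⟨summable_modeTerm hg hE hω (NNReal.coe_pos.2 ht),
      heatTrace_expansion hg hE hω ht⟩,
    exists_secondOrder_smallT hg, exists_secondOrder_largeT hg,
    fun E ω hE hω t ht => ⟨smallT_fullCurv_sub hg hE hω ht, largeT_fullCurv_sub hg hE hω t⟩⟩
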